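/- **The Traffic Crossing Problem.** A traffic crossing $C=(V,\delta_{\max})$ consists of $n$ vehicles $v_1,\dots,v_n$ in $\mathbb R^2$ and a speed limit $\delta_{\max}\ge 0$. Vehicle $v_i$ has a length $l_i>0$, a start $p_i^{\vdash}$ and a goal $p_i^{\dashv}\neq p_i^{\vdash}$ on a common horizontal or vertical line, a start time $t_i^{\vdash}\ge 0$ and a deadline $t_i^{\dashv}$; let $d_i$ be the unit vector from $p_i^{\vdash}$ to $p_i^{\dashv}$. Under a set $D=(\delta_i)$ of measurable speed profiles, the leading point of $v_i$ at time $t$ is $p_i(t)=p_i^{\vdash}+d_i\int_0^t\delta_i$, and $v_i$ inhabits the open segment $\sigma_i(t)$ between $p_i(t)$ and its rear end $p_i(t)-l_id_i$. $D$ is *valid* if $\delta_i(t)\in[0,\delta_{\max}]$ for $t\in[t_i^{\vdash},t_i^{\dashv}]$ and $\delta_i(t)=0$ for all other $t$, if $\sigma_i(t)\cap\sigma_j(t)=\emptyset$ for all $t$ and $i\ne j$, and if $p_i(t_i^{\dashv})=p_i^{\dashv}$. $C$ is *solvable* if it has a valid $D$. The *path* of $v_i$ is the open segment from $p_i^{\vdash}-l_id_i$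 to $p_i^{\dashv}$. If the paths of two orthogonal vehicles meet, their common point $\chi$ is their *intersection*. A vehicle *enters* $\chi$ at the infimum of the times at which its leading point is beyond $\chi$, and *leaves* $\chi$ (has passed it) at the first time at which its rear end is at or beyond $\chi$ (these times are $-\infty$ or $+\infty$ if the condition has always held, or never holds). A *certificate* $P$ consists of one bit for each pair of vehicles, which says which of the two has priority. $P$ *agrees* with $D$ if, for each pair of orthogonal vehicles with an intersection, the vehicle that enters it first under $D$ has priority. The *full-speed profiles* for $P$ are the right-continuous speed profiles under which, at every time, each $v_i$ has speed $\delta_{\max}$, except that it has speed $0$ if (i) its start time has not come, or (ii) it is at its goal, or (iii) its leading point is at an intersection with a vehicle that has priority over it and has not yet passed the intersection, or (iv) its leading point touches the rear end of a stopped vehicle with the same direction in the same lane. **Lemma.** 1. For each $C$ and $P$ the full-speed profiles $D_{full}$ exist and are unique. 2. If $D$ is valid for $C$, then some certificate agrees with $D$; and for each certificate that agrees with $D$, $D_{full}$ is valid, every vehicle enters and leaves each of its intersections under $D_{full}$ no later than under $D$, and it arrives at its goal no later than under $D$. 3. Consequently $C$ is solvable if and only if $D_{full}$ is valid for some certificate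 $P$; and certificates have size $O(n^2)$. 4. Let the numbers of $C$ be given in fixed precision (as integral multiples of $1/q$, with $q$ and the integers involved having at most $b$ bits), and let $n\ge1$. Given $C$ and any $P$, one program of a random access machine with logarithmic cost (additions, subtractions, multiplications, comparisons and memory accesses, each charged the total bit length of its operands and addresses) simulates $D_{full}$ in time $O(n^4(b+\log n))$: it decides whether $D_{full}$ is valid and, if no two vehicles overlap initially, it outputs all entry, exit and arrival times under $D_{full}$. 5. The Traffic Crossing Problem (given a crossing in this encoding, is it solvable?) is in $\mathrm{NP}$, that is, on these machines membership can be verified in polynomial time with certificates of polynomial size. -/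

import Mathlib

open MeasureTheory

noncomputable section

namespace Traffic

/-! ## Traffic crossings -/

/-- Points of the Euclidean plane. -/
abbrev Pt := EuclideanSpace ℝ (Fin 2)

/-- A vehicle: an axis-parallel segment, located by its leading point. It moves from `start`
to `goal`, not before `startTime`, and has to arrive by `deadline`. -/
structure Vehicle where
  length : ℝ
  start : Pt
  goal : Pt
  startTime : ℝ
  deadline : ℝ
  length_pos : 0 < length
  start_ne_goal : start ≠ goal
  axis_parallel : start 0 = goal 0 ∨ start 1 = goal 1
  startTime_nonneg : 0 ≤ startTime

/-- The unit vector pointing from the start of the vehicle to its goal. -/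
def Vehicle.dir (v : Vehicle) : Pt := ‖v.goal - v.start‖⁻¹ • (v.goal - v.start)

/-- A traffic crossing with `n` vehicles and a global speed limit. -/
structure Crossing (n : ℕ) where
  vehicle : Fin n → Vehicle
  maxSpeed : ℝ
  maxSpeed_nonneg : 0 ≤ maxSpeed

/-- A set of speed profiles: the speed of every vehicle at every time. -/
abbrev Profile (n : ℕ) := Fin n → ℝ → ℝ

/-- Distance covered by vehicle `i` up to time `t`. -/
def travelled {n : ℕ} (D : Profile n) (i : Fin n) (t : ℝ) : ℝ := ∫ s in (0 : ℝ)..t, D i s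

namespace Crossing

variable {n : ℕ}

/-- Leading point of vehicle `i` at time `t`. -/
def front (C : Crossing n) (D : Profile n) (i : Fin n) (t : ℝ) : Pt :=
  (C.vehicle i).start + travelled D i t • (C.vehicle i).dir

/-- Rear end of vehicle `i` at time `t`. -/
def rear (C : Crossing n) (D : Profile n) (i : Fin n) (t : ℝ) : Pt :=
  C.front D i t - (C.vehicle i).length • (C.vehicle i).dir

/-- The open segment inhabited by vehicle `i` at time `t`. -/
def body (C : Crossing n) (D : Profile n) (i : Fin n) (t : ℝ) : Set Pt :=
  openSegment ℝ (C.front D i t) (C.rear D i t)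

/-- Validity of a set of (measurable) speed profiles. -/
structure Valid (C : Crossing n) (D : Profile n) : Prop where
  measurable : ∀ i, AEMeasurable (D i) volume
  outside : ∀ i, ∀ t ∉ Set.Icc (C.vehicle i).startTime (C.vehicle i).deadline, D i t = 0
  inside : ∀ i, ∀ t ∈ Set.Icc (C.vehicle i).startTime (C.vehicle i).deadline,
    D i t ∈ Set.Icc 0 C.maxSpeed
  no_collision : ∀ t, ∀ i j, i ≠ j → Disjoint (C.body D i t) (C.body D j t)
  reach_goal : ∀ i, C.front D i (C.vehicle i).deadline = (C.vehicle i).goal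

/-- A traffic crossing is solvable if it has a valid set of speed profiles. -/
def Solvable (C : Crossing n) : Prop := ∃ D, C.Valid D

/-- No two vehicles overlap in the initial configuration. -/
def InitiallyDisjoint (C : Crossing n) : Prop :=
  ∀ i j, i ≠ j → Disjoint (C.body 0 i 0) (C.body 0 j 0)

/-! ## Intersections, events and priorities -/

/-- The path of vehicle `i`: all points that its body sweeps on the way from start to goal. -/
def path (C : Crossing n) (i : Fin n) : Set Pt :=
  openSegment ℝ ((C.vehicle i).start - (C.vehicle i).length • (C.vehicle i).dir)
    (C.vehicle i).goal

/-- The paths of the orthogonal vehicles `i` and `j` cross at the intersection `χ`. -/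
def CrossAt (C : Crossing n) (i j : Fin n) (χ : Pt) : Prop :=
  inner ℝ (C.vehicle i).dir (C.vehicle j).dir = 0 ∧ χ ∈ C.path i ∧ χ ∈ C.path j

/-- Signed distance from the starting position of vehicle `i` to the point `χ` of its lane, in the
direction of travel. -/
def offset (C : Crossing n) (i : Fin n) (χ : Pt) : ℝ :=
  inner ℝ (C.vehicle i).dir (χ - (C.vehicle i).start)

/-- At time `t`, the leading point of vehicle `i` is beyond `χ`. -/
def Entered (C : Crossing n) (D : Profile n) (i : Fin n) (χ : Pt) (t : ℝ) : Prop :=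
  C.offset i χ < travelled D i t

/-- At time `t`, vehicle `i` has passed `χ` completely. -/
def Passed (C : Crossing n) (D : Profile n) (i : Fin n) (χ : Pt) (t : ℝ) : Prop :=
  C.offset i χ + (C.vehicle i).length ≤ travelled D i t

/-- The first time at which `p` holds: `⊤` if it never holds, `⊥` if it has always held. -/
def firstTime (p : ℝ → Prop) : EReal := sInf ((fun t : ℝ => (t : EReal)) '' {t | p t})

/-- The time at which vehicle `i` enters the intersection `χ`. -/
def entryTime (C : Crossing n) (D : Profile n) (i : Fin n) (χ : Pt) : EReal :=
  firstTime (C.Entered D i χ)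

/-- The time at which vehicle `i` leaves the intersection `χ`. -/
def exitTime (C : Crossing n) (D : Profile n) (i : Fin n) (χ : Pt) : EReal :=
  firstTime (C.Passed D i χ)

/-- The time at which vehicle `i` arrives at its goal. -/
def arrivalTime (C : Crossing n) (D : Profile n) (i : Fin n) : EReal :=
  firstTime fun t => C.front D i t = (C.vehicle i).goal

end Crossing

/-- A certificate: one bit for each pair of vehicles. For `i < j` the bit `P i j` says whether `i`
has priority over `j`; the other bits are not used. -/
abbrev Priorities (n : ℕ) := Fin n → Fin n → Bool

/-- Vehicle `i` has priority over vehicle `j`. -/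
def Before {n : ℕ} (P : Priorities n) (i j : Fin n) : Prop :=
  (i < j ∧ P i j = true) ∨ (j < i ∧ P j i = false)

namespace Crossing

variable {n : ℕ}

/-- `P` is a certificate associated with `D`: whenever the paths of two orthogonal vehicles
cross, the one that enters the intersection first under `D` has priority. -/
def Agrees (C : Crossing n) (P : Priorities n) (D : Profile n) : Prop :=
  ∀ i j χ, C.CrossAt i j χ → (Before P i j ↔ C.entryTime D i χ < C.entryTime D j χ)

/-- Vehicle `i` has arrived at an intersection that a vehicle with priority over `i` has not yet
passed. -/
def Waits (C : Crossing n) (P : Priorities n) (D : Profile n) (i : Fin n) (t : ℝ) : Prop :=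
  ∃ k χ, C.CrossAt i k χ ∧ C.front D i t = χ ∧ Before P k i ∧ ¬ C.Passed D k χ t

/-- Vehicle `i` touches the rear end of a stopped vehicle in the same lane. -/
def Blocked (C : Crossing n) (D : Profile n) (i : Fin n) (t : ℝ) : Prop :=
  ∃ k, (C.vehicle k).dir = (C.vehicle i).dir ∧ C.front D i t = C.rear D k t ∧ D k t = 0

/-- The reasons for which a vehicle stands still under the full-speed policy. -/
def Halted (C : Crossing n) (P : Priorities n) (D : Profile n) (i : Fin n) (t : ℝ) : Prop :=
  t < (C.vehicle i).startTime ∨ C.front D i t = (C.vehicle i).goal ∨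
    C.Waits P D i t ∨ C.Blocked D i t

/-- `D` is the set of full-speed profiles for the priorities `P`: at every time each vehicle
moves at full speed unless it has a reason to stand still. Right-continuity expresses that such
a decision is in force from the moment at which it is taken. -/
structure IsFullSpeed (C : Crossing n) (P : Priorities n) (D : Profile n) : Prop where
  right_continuous : ∀ i t, ContinuousWithinAt (D i) (Set.Ici t) t
  halted : ∀ i t, C.Halted P D i t → D i t = 0
  moving : ∀ i t, ¬ C.Halted P D i t → D i t = C.maxSpeed

end Crossing

/-! ## Random access machines with logarithmic cost -/

/-- The length of an integer in binary, with one further bit for the sign. -/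
def bitLen (z : ℤ) : ℕ := z.natAbs.size + 1

/-- Structured programs of a random access machine over the integers. The machine has registers,
and memory banks whose cells are addressed indirectly through registers. -/
inductive Prog where
  /-- `x := c` -/
  | const (x : ℕ) (c : ℤ)
  /-- `x := y + z` -/
  | add (x y z : ℕ)
  /-- `x := y - z` -/
  | sub (x y z : ℕ)
  /-- `x := y * z` -/
  | mul (x y z : ℕ)
  /-- `x := a[y]` -/
  | load (x a y : ℕ)
  /-- `a[y] := x` -/
  | store (a y x : ℕ)
  /-- `p; q` -/
  | seq (p q : Prog)
  /-- `if 0 < x then p else q` -/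
  | branch (x : ℕ) (p q : Prog)
  /-- `while 0 < x do p` -/
  | loop (x : ℕ) (p : Prog)

/-- Contents of the registers and of the memory banks. -/
structure State where
  reg : ℕ → ℤ
  bank : ℕ → ℕ → ℤ

def State.setReg (s : State) (x : ℕ) (z : ℤ) : State :=
  { s with reg := Function.update s.reg x z }

def State.setCell (s : State) (a k : ℕ) (z : ℤ) : State :=
  { s with bank := Function.update s.bank a (Function.update (s.bank a) k z) }

/-- `p.Run s s' c`: started in state `s`, the program `p` halts in state `s'`, at cost `c` under
the logarithmic cost criterion, where an instruction costs the total length of the integers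
(operands and addresses) that it handles. -/
inductive Prog.Run : Prog → State → State → ℕ → Prop
  | const (s : State) (x : ℕ) (c : ℤ) : Run (.const x c) s (s.setReg x c) (bitLen c)
  | add (s : State) (x y z : ℕ) :
      Run (.add x y z) s (s.setReg x (s.reg y + s.reg z)) (bitLen (s.reg y) + bitLen (s.reg z))
  | sub (s : State) (x y z : ℕ) :
      Run (.sub x y z) s (s.setReg x (s.reg y - s.reg z)) (bitLen (s.reg y) + bitLen (s.reg z))
  | mul (s : State) (x y z : ℕ) :
      Run (.mul x y z) s (s.setReg x (s.reg y * s.reg z)) (bitLen (s.reg y) + bitLen (s.reg z))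
  | load (s : State) (x a y : ℕ) :
      Run (.load x a y) s (s.setReg x (s.bank a (s.reg y).toNat))
        (bitLen (s.reg y) + bitLen (s.bank a (s.reg y).toNat))
  | store (s : State) (a y x : ℕ) :
      Run (.store a y x) s (s.setCell a (s.reg y).toNat (s.reg x))
        (bitLen (s.reg y) + bitLen (s.reg x))
  | seq {p q : Prog} {s s' s'' : State} {c d : ℕ} :
      Run p s s' c → Run q s' s'' d → Run (.seq p q) s s'' (c + d)
  | branch_pos {x : ℕ} {p q : Prog} {s s' : State} {c : ℕ} :
      0 < s.reg x → Run p s s' c → Run (.branch x p q) s s' (bitLen (s.reg x) + c)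
  | branch_neg {x : ℕ} {p q : Prog} {s s' : State} {c : ℕ} :
      ¬ 0 < s.reg x → Run q s s' c → Run (.branch x p q) s s' (bitLen (s.reg x) + c)
  | loop_done {x : ℕ} {p : Prog} {s : State} :
      ¬ 0 < s.reg x → Run (.loop x p) s s (bitLen (s.reg x))
  | loop_step {x : ℕ} {p : Prog} {s s' s'' : State} {c d : ℕ} :
      0 < s.reg x → Run p s s' c → Run (.loop x p) s' s'' d →
        Run (.loop x p) s s'' (bitLen (s.reg x) + c + d)

/-- Initial state for the input `w` and the certificate `u`: the words are in banks 0 and 1 and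
their numbers of entries in registers 0 and 1; everything else is 0. -/
def initState (w u : List ℤ) : State where
  reg x := if x = 0 then w.length else if x = 1 then u.length else 0
  bank a k := if a = 0 then w.getD k 0 else if a = 1 then u.getD k 0 else 0

/-- The size of a word of integers in bits. -/
def wordSize (w : List ℤ) : ℕ := (w.map bitLen).sum

/-- The program `V` accepts the input `w` with the certificate `u`. -/
def Accepts (V : Prog) (w u : List ℤ) : Prop :=
  ∃ s c, V.Run (initState w u) s c ∧ s.reg 0 = 1

/-- The class NP, for languages of words of integers written in binary: membership can be verified
in polynomial time with a certificate of polynomial size. -/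
def InNP (L : Set (List ℤ)) : Prop :=
  ∃ (V : Prog) (p q : Polynomial ℕ),
    (∀ w u, ∃ s c, V.Run (initState w u) s c ∧ c ≤ p.eval (wordSize w + wordSize u)) ∧
    ∀ w, w ∈ L ↔ ∃ u, wordSize u ≤ q.eval (wordSize w) ∧ Accepts V w u

/-! ## Instances as inputs of a machine -/

/-- A vehicle all of whose numbers are integers, in units of the precision of the instance. -/
structure IntVehicle where
  length : ℕ
  startX : ℤ
  startY : ℤ
  goalX : ℤ
  goalY : ℤ
  startTime : ℕ
  deadline : ℤ
  length_pos : 0 < length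
  start_ne_goal : ¬ (startX = goalX ∧ startY = goalY)
  axis_parallel : startX = goalX ∨ startY = goalY

/-- An instance of the Traffic Crossing Problem with `n` vehicles in fixed precision: all numbers
are integral multiples of `1 / den`. -/
structure Instance (n : ℕ) where
  den : ℕ
  den_pos : 0 < den
  maxSpeed : ℕ
  vehicle : Fin n → IntVehicle

/-- The vehicle in the plane described by integers in units of `1 / q`. -/
def IntVehicle.toVehicle (v : IntVehicle) (q : ℕ) (hq : 0 < q) : Vehicle where
  length := v.length / q
  start := !₂[(v.startX : ℝ) / q, (v.startY : ℝ) / q]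
  goal := !₂[(v.goalX : ℝ) / q, (v.goalY : ℝ) / q]
  startTime := v.startTime / q
  deadline := v.deadline / q
  length_pos := by
    have := v.length_pos
    positivity
  start_ne_goal := by
    intro h
    have hq' : (q : ℝ) ≠ 0 := by positivity
    have h0 := congrArg (fun p : Pt => p 0) h
    have h1 := congrArg (fun p : Pt => p 1) h
    simp [div_left_inj' hq'] at h0 h1
    exact v.start_ne_goal ⟨h0, h1⟩
  axis_parallel := by
    rcases v.axis_parallel with h | h
    · left; simp [h]
    · right; simp [h]
  startTime_nonneg := by positivity

namespace Instance

variable {n : ℕ}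

/-- The traffic crossing described by an instance. -/
def toCrossing (I : Instance n) : Crossing n where
  vehicle i := (I.vehicle i).toVehicle I.den I.den_pos
  maxSpeed := I.maxSpeed / I.den
  maxSpeed_nonneg := by positivity

/-- All numeric values of an instance. -/
def values (I : Instance n) : List ℤ :=
  (I.den : ℤ) :: (I.maxSpeed : ℤ) :: (List.finRange n).flatMap fun i =>
    [((I.vehicle i).length : ℤ), (I.vehicle i).startX, (I.vehicle i).startY, (I.vehicle i).goalX,
      (I.vehicle i).goalY, ((I.vehicle i).startTime : ℤ), (I.vehicle i).deadline]

/-- The numeric values of the instance have at most `b` bits. -/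
def HasBits (I : Instance n) (b : ℕ) : Prop := ∀ z ∈ I.values, z.natAbs < 2 ^ b

/-- The word that encodes an instance: the number of vehicles and the numeric values. -/
def encode (I : Instance n) : List ℤ := (n : ℤ) :: I.values

/-- Times in the output of a machine: `-1` and `-2` stand for `⊥` and `⊤`, and any other integer
`z` for the time `z / (den * maxSpeed)`. -/
def decodeTime (I : Instance n) (z : ℤ) : EReal :=
  if z = -1 then ⊥ else if z = -2 then ⊤ else (((z : ℝ) / (I.den * I.maxSpeed) : ℝ) : EReal)

end Instance

/-- The word that encodes a certificate: the matrix of its bits, row by row. -/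
def Priorities.encode {n : ℕ} (P : Priorities n) : List ℤ :=
  (List.finRange n).flatMap fun i => (List.finRange n).map fun j => if P i j then 1 else 0

/-- The Traffic Crossing Problem: the encodings of the solvable instances. -/
def TrafficCrossingProblem : Set (List ℤ) :=
  {w | ∃ (n : ℕ) (I : Instance n), w = I.encode ∧ I.toCrossing.Solvable}

/-- The final state `s` of a machine reports the course of the speed profiles `F`: the time at
which vehicle `i` enters (leaves) its intersection with vehicle `j` is in cell `i * n + j` of
bank 2 (bank 3), and the arrival time of vehicle `i` is in cell `i` of bank 4. -/
def Reports {n : ℕ} (I : Instance n) (F : Profile n) (s : State) : Prop :=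
  (∀ (i j : Fin n) (χ : Pt), I.toCrossing.CrossAt i j χ →
    I.decodeTime (s.bank 2 (i * n + j)) = I.toCrossing.entryTime F i χ ∧
    I.decodeTime (s.bank 3 (i * n + j)) = I.toCrossing.exitTime F i χ) ∧
  ∀ i : Fin n, I.decodeTime (s.bank 4 i) = I.toCrossing.arrivalTime F i

end Traffic

end

/-!
# Full-speed profiles, and the Traffic Crossing Problem is in NP

Since vehicles move on axis-parallel lines, everything is expressed by the distances `pos D t i`
that they have covered: intersections, contacts and collisions become linear relations between these
distances and the constants `dist`, `len` and `off` of the crossing (`disjoint_body_iff`,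
`crossAt_iff`, `waits_iff`, `blocked_iff`).

*Existence and uniqueness.* The condition on a vehicle that touches a stopped vehicle refers to
speeds at the same time, but only to those of vehicles further ahead in the lane. Hence the vehicles
that stand still are determined by the time and the distances covered (`Stop`), and full-speed
profiles are the solutions of an equation for the speeds in terms of the distances (`Solves`). If
all vehicles keep the speeds of a time `T`, then for a short time the same vehicles have a reason to
stand still (`eventually_halt_iff`). This yields local existence and uniqueness, and solutions are
glued.

*Comparison.* No valid profiles `D` overtake the full-speed profiles for priorities that agree with
`D` (`Valid.pos_le_pos`). This is shown by continuous induction: at a time at which `D` has not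
overtaken, a vehicle that moves at full speed is not overtaken for a short time, and for a vehicle
that stands still, each of the possible reasons also keeps `D` from moving beyond the same point. In
particular all events are no later than under `D`, and the vehicles arrive in time. The full-speed
profiles have no collisions, because vehicles keep their order in a lane (`SolvesAll.order`),
because vehicles that approach each other in a lane have goals that do not overlap
(`Valid.opp_dist_le`), and because at an intersection a vehicle without priority waits
(`SolvesAll.priority`).

*Simulation.* The events are the start times and the times at which a vehicle comes to an
intersection, has passed it, or arrives. Between two consecutive events the vehicles with a reason
of their own to stand still remain the same; they determine how far each vehicle can go (`IsReach`),
taking into account the lengths of the vehicles in between, and each vehicle moves at full speed up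
to that point (`SolvesAll.pos_add`). If distances are measured in units of `1 / den ^ 2` and times
in units of `1 / (den * maxSpeed)`, all quantities are integers and one unit of distance takes one
unit of time at full speed. There are at most `2 * n ^ 2 + 2 * n` events, as each of them occurs
only once (`pending`); each takes a step of two nested loops over the vehicles, on numbers of `O(b +
log n)` bits. Validity can be decided from the times of the events (`SolvesAll.valid_iff`).

*Machines.* Programs are written in a small language of terms and commands with bounded loops,
`Term` and `Cmd`, whose compilation into programs of the machine is proved correct with explicit
bounds for the cost and for the lengths of numbers (`Term.evaluates`, `Cmd.exists_runs`). The
verifier checks that the word encodes an instance and then simulates the full-speed profiles for the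
given certificate. It accepts if and only if these are valid, and by comparison an instance is
solvable if and only if they are valid for some certificate.
-/

noncomputable section

namespace Traffic

/-! ### Crossings in scalar terms -/

namespace Crossing
variable {n : ℕ}

/-- The distance from the start of vehicle `i` to its goal. -/
def dist (C : Crossing n) (i : Fin n) : ℝ := ‖(C.vehicle i).goal - (C.vehicle i).start‖

/-- The length of vehicle `i`. -/
def len (C : Crossing n) (i : Fin n) : ℝ := (C.vehicle i).length

/-- The signed distance, in the direction of vehicle `i`, from its start to the start of `j`. For
orthogonal vehicles this locates the crossing point on the lane of `i`, and for vehicles in a common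
lane it is their initial displacement. -/
def off (C : Crossing n) (i j : Fin n) : ℝ :=
  inner ℝ (C.vehicle i).dir ((C.vehicle j).start - (C.vehicle i).start)

/-- The paths of the orthogonal vehicles `i` and `j` meet, in scalar terms. -/
def Cross (C : Crossing n) (i j : Fin n) : Prop :=
  inner ℝ (C.vehicle i).dir (C.vehicle j).dir = 0 ∧ -C.len i < C.off i j ∧ C.off i j < C.dist i ∧
    -C.len j < C.off j i ∧ C.off j i < C.dist j

/-- The start of vehicle `j` is on the line along which vehicle `i` moves. -/
def Lane (C : Crossing n) (i j : Fin n) : Prop :=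
  (C.vehicle j).start - (C.vehicle i).start = C.off i j • (C.vehicle i).dir

/-- The vehicles `i` and `j` have a common lane and direction. -/
def Same (C : Crossing n) (i j : Fin n) : Prop :=
  (C.vehicle j).dir = (C.vehicle i).dir ∧ C.Lane i j

/-- The vehicles `i` and `j` have a common lane and opposite directions. -/
def Opp (C : Crossing n) (i j : Fin n) : Prop :=
  (C.vehicle j).dir = -(C.vehicle i).dir ∧ C.Lane i j

/-- The bodies of `i` and `j` are disjoint when these vehicles have covered the distances `a` and
`b`, in scalar terms. -/
def Clear (C : Crossing n) (i j : Fin n) (a b : ℝ) : Prop :=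
  (inner ℝ (C.vehicle i).dir (C.vehicle j).dir = 0 →
    ¬ (a - C.len i < C.off i j ∧ C.off i j < a ∧ b - C.len j < C.off j i ∧ C.off j i < b)) ∧
  (C.Same i j → C.off i j + b ≤ a - C.len i ∨ a ≤ C.off i j + b - C.len j) ∧
  (C.Opp i j → a ≤ C.off i j - b ∨ C.off i j - b + C.len j ≤ a - C.len i)

end Crossing

theorem Vehicle.dist_pos (v : Vehicle) : 0 < ‖v.goal - v.start‖ :=
  norm_pos_iff.2 (sub_ne_zero.2 v.start_ne_goal.symm)

theorem Vehicle.norm_dir (v : Vehicle) : ‖v.dir‖ = 1 := by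
  have := v.dist_pos
  rw [Vehicle.dir, norm_smul, norm_inv, norm_norm, inv_mul_cancel₀ this.ne']

theorem Vehicle.inner_dir_self (v : Vehicle) : inner ℝ v.dir v.dir = 1 := by
  rw [real_inner_self_eq_norm_sq, v.norm_dir, one_pow]

theorem Vehicle.goal_eq (v : Vehicle) : v.goal = v.start + ‖v.goal - v.start‖ • v.dir := by
  have := v.dist_pos
  rw [Vehicle.dir, smul_smul, mul_inv_cancel₀ this.ne', one_smul]; abel

theorem Pt.inner_eq (a b : Pt) : inner ℝ a b = a 0 * b 0 + a 1 * b 1 := by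
  simp [PiLp.inner_apply, Fin.sum_univ_two, mul_comm]

theorem Pt.ext' {a b : Pt} (h0 : a 0 = b 0) (h1 : a 1 = b 1) : a = b := by
  ext k; fin_cases k <;> assumption

theorem Vehicle.dir_cases (v : Vehicle) :
    (v.dir 0 = 0 ∧ (v.dir 1 = 1 ∨ v.dir 1 = -1)) ∨ (v.dir 1 = 0 ∧ (v.dir 0 = 1 ∨ v.dir 0 = -1)) := by
  have h := v.inner_dir_self
  rw [Pt.inner_eq] at h
  rcases v.axis_parallel with h0 | h0
  · left
    have : v.dir 0 = 0 := by simp [Vehicle.dir, h0]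
    refine ⟨this, ?_⟩
    rw [this] at h
    exact mul_self_eq_one_iff.1 (by linarith)
  · right
    have : v.dir 1 = 0 := by simp [Vehicle.dir, h0]
    refine ⟨this, ?_⟩
    rw [this] at h
    exact mul_self_eq_one_iff.1 (by linarith)

/-- Two axis-parallel directions are orthogonal, equal, or opposite. -/
theorem Vehicle.dir_rel (v w : Vehicle) :
    inner ℝ v.dir w.dir = 0 ∨ w.dir = v.dir ∨ w.dir = -v.dir := by
  rw [Pt.inner_eq]
  rcases v.dir_cases with ⟨a, b | b⟩ | ⟨a, b | b⟩ <;> rcases w.dir_cases with ⟨c, d | d⟩ | ⟨c, d | d⟩ <;>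
    solve
      | (left; simp [a, b, c, d])
      | (right; left; apply Pt.ext' <;> simp [a, b, c, d])
      | (right; right; apply Pt.ext' <;> simp [a, b, c, d])

/-- The directions of two orthogonal vehicles are an orthonormal basis of the plane. -/
theorem Vehicle.expand (v w : Vehicle) (h : inner ℝ v.dir w.dir = 0) (z : Pt) :
    z = inner ℝ v.dir z • v.dir + inner ℝ w.dir z • w.dir := by
  simp only [Pt.inner_eq] at *
  rcases v.dir_cases with ⟨a, b | b⟩ | ⟨a, b | b⟩ <;> rcases w.dir_cases with ⟨c, d | d⟩ | ⟨c, d | d⟩ <;>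
    simp [a, b, c, d] at h <;> (apply Pt.ext' <;> simp [a, b, c, d])

/-- The points of an open segment on a line, in terms of a coordinate of the line. -/
theorem mem_openSegment_line {s d : Pt} {a b : ℝ} (hab : a < b) (z : Pt) :
    z ∈ openSegment ℝ (s + a • d) (s + b • d) ↔ ∃ c, a < c ∧ c < b ∧ z = s + c • d := by
  rw [openSegment_eq_image']
  have hb : 0 < b - a := sub_pos.2 hab
  constructor
  · rintro ⟨θ, ⟨h0, h1⟩, rfl⟩
    refine ⟨a + θ * (b - a), by nlinarith, by nlinarith, ?_⟩
    module
  · rintro ⟨c, h0, h1, rfl⟩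
    refine ⟨(c - a) / (b - a), ⟨div_pos (by linarith) hb, (div_lt_one hb).2 (by linarith)⟩, ?_⟩
    have : ((c - a) / (b - a)) * (b - a) = c - a := div_mul_cancel₀ _ hb.ne'
    have h2 : s + b • d - (s + a • d) = (b - a) • d := by module
    simp only [h2, smul_smul, this]
    module

namespace Crossing
variable {n : ℕ} (C : Crossing n)

theorem dist_pos (i : Fin n) : 0 < C.dist i := (C.vehicle i).dist_pos
theorem len_pos (i : Fin n) : 0 < C.len i := (C.vehicle i).length_pos

theorem goal_eq (i : Fin n) :
    (C.vehicle i).goal = (C.vehicle i).start + C.dist i • (C.vehicle i).dir := (C.vehicle i).goal_eq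

theorem line_inj (i : Fin n) {a b : ℝ}
    (h : (C.vehicle i).start + a • (C.vehicle i).dir = (C.vehicle i).start + b • (C.vehicle i).dir) :
    a = b := by
  have h1 := congrArg (fun z => inner ℝ (C.vehicle i).dir (z - (C.vehicle i).start)) h
  simpa [inner_smul_right, Vehicle.norm_dir] using h1

theorem mem_body (D : Profile n) (i : Fin n) (t : ℝ) (z : Pt) :
    z ∈ C.body D i t ↔ ∃ c, travelled D i t - C.len i < c ∧ c < travelled D i t ∧
      z = (C.vehicle i).start + c • (C.vehicle i).dir := by
  have h : C.rear D i t = (C.vehicle i).start + (travelled D i t - C.len i) • (C.vehicle i).dir := by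
    simp only [rear, front, len]; module
  rw [body, openSegment_symm, h, front]
  exact mem_openSegment_line (by linarith [C.len_pos i]) z

theorem mem_path (i : Fin n) (z : Pt) :
    z ∈ C.path i ↔ ∃ c, -C.len i < c ∧ c < C.dist i ∧
      z = (C.vehicle i).start + c • (C.vehicle i).dir := by
  have h : (C.vehicle i).start - (C.vehicle i).length • (C.vehicle i).dir
      = (C.vehicle i).start + (-C.len i) • (C.vehicle i).dir := by
    simp only [len]; module
  rw [path, h, C.goal_eq]
  exact mem_openSegment_line (by linarith [C.len_pos i, C.dist_pos i]) z

/-- The lines of two orthogonal vehicles meet in one point, given by the offsets. -/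
theorem meet_iff {i j : Fin n} (h : inner ℝ (C.vehicle i).dir (C.vehicle j).dir = 0) (a b : ℝ) :
    (C.vehicle i).start + a • (C.vehicle i).dir = (C.vehicle j).start + b • (C.vehicle j).dir ↔
      a = C.off i j ∧ b = C.off j i := by
  have h' : inner ℝ (C.vehicle j).dir (C.vehicle i).dir = 0 := by rw [real_inner_comm]; exact h
  constructor
  · intro e
    have e1 : (C.vehicle j).start - (C.vehicle i).start
      = a • (C.vehicle i).dir - b • (C.vehicle j).dir := by
      linear_combination (norm := module) -e
    have e2 : (C.vehicle i).start - (C.vehicle j).start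
      = b • (C.vehicle j).dir - a • (C.vehicle i).dir := by
      rw [← neg_sub, e1]; abel
    rw [off, off, e1, e2]
    simp [inner_sub_right, inner_smul_right, h, h', Vehicle.norm_dir]
  · rintro ⟨rfl, rfl⟩
    have e := Vehicle.expand _ _ h ((C.vehicle j).start - (C.vehicle i).start)
    have e2 : inner ℝ (C.vehicle j).dir ((C.vehicle j).start - (C.vehicle i).start)
        = - C.off j i := by
      rw [off, ← inner_neg_right, neg_sub]
    rw [e2] at e
    change _ = C.off i j • (C.vehicle i).dir + _ at e
    linear_combination (norm := module) -e

theorem Cross.symm {C : Crossing n} {i j : Fin n} (h : C.Cross i j) : C.Cross j i :=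
  ⟨by rw [real_inner_comm]; exact h.1, h.2.2.2.1, h.2.2.2.2, h.2.1, h.2.2.1⟩

theorem Cross.ne {C : Crossing n} {i j : Fin n} (h : C.Cross i j) : i ≠ j := by
  rintro rfl
  have := h.1
  rw [Vehicle.inner_dir_self] at this
  exact one_ne_zero this

/-- The paths of two orthogonal vehicles have at most one common point, which lies on the lane of
`i` at the distance `off i j` from the start. -/
theorem crossAt_iff (i j : Fin n) (χ : Pt) :
    C.CrossAt i j χ ↔ C.Cross i j ∧ χ = (C.vehicle i).start + C.off i j • (C.vehicle i).dir := by
  constructor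
  · rintro ⟨h, hi, hj⟩
    obtain ⟨a, ha, ha', rfl⟩ := (C.mem_path i χ).1 hi
    obtain ⟨b, hb, hb', e⟩ := (C.mem_path j _).1 hj
    obtain ⟨rfl, rfl⟩ := (C.meet_iff h a b).1 e
    exact ⟨⟨h, ha, ha', hb, hb'⟩, rfl⟩
  · rintro ⟨h, rfl⟩
    refine ⟨h.1, (C.mem_path i _).2 ⟨_, h.2.1, h.2.2.1, rfl⟩, (C.mem_path j _).2
      ⟨_, h.2.2.2.1, h.2.2.2.2, ?_⟩⟩
    exact (C.meet_iff h.1 _ _).2 ⟨rfl, rfl⟩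

theorem CrossAt.symm {C : Crossing n} {i j : Fin n} {χ : Pt} (h : C.CrossAt i j χ) :
    C.CrossAt j i χ := ⟨by rw [real_inner_comm]; exact h.1, h.2.2, h.2.1⟩

theorem CrossAt.cross {C : Crossing n} {i j : Fin n} {χ : Pt} (h : C.CrossAt i j χ) : C.Cross i j :=
  ((C.crossAt_iff i j χ).1 h).1

theorem CrossAt.offset_left {C : Crossing n} {i j : Fin n} {χ : Pt} (h : C.CrossAt i j χ) :
    C.offset i χ = C.off i j := by
  rw [((C.crossAt_iff i j χ).1 h).2, offset]
  simp [inner_smul_right, Vehicle.norm_dir]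

theorem CrossAt.offset_right {C : Crossing n} {i j : Fin n} {χ : Pt} (h : C.CrossAt i j χ) :
    C.offset j χ = C.off j i := h.symm.offset_left

theorem Cross.crossAt {C : Crossing n} {i j : Fin n} (h : C.Cross i j) :
    ∃ χ, C.CrossAt i j χ := ⟨_, (C.crossAt_iff i j _).2 ⟨h, rfl⟩⟩

/-! ### Vehicles in a common lane -/

theorem Same.off_symm {C : Crossing n} {i j : Fin n} (h : C.Same i j) : C.off j i = -C.off i j := by
  rw [off, off, h.1, ← inner_neg_right, neg_sub]

theorem Same.symm {C : Crossing n} {i j : Fin n} (h : C.Same i j) : C.Same j i := by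
  refine ⟨h.1.symm, ?_⟩
  rw [Lane, h.off_symm, h.1, neg_smul, ← h.2, neg_sub]

theorem Same.off_add {C : Crossing n} {i j k : Fin n} (h : C.Same i j) :
    C.off i k = C.off i j + C.off j k := by
  rw [off, off, off, h.1, ← inner_add_right]
  congr 1; abel

theorem Same.trans {C : Crossing n} {i j k : Fin n} (h : C.Same i j) (h' : C.Same j k) :
    C.Same i k := by
  refine ⟨h'.1.trans h.1, ?_⟩
  have e1 := h.2
  have e2 := h'.2
  rw [Lane] at e1 e2 ⊢
  rw [h.off_add, add_smul, ← e1]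
  rw [h.1] at e2
  rw [← e2]; abel

theorem off_self (i : Fin n) : C.off i i = 0 := by simp [off]

theorem lane_of_eq {i j : Fin n} {c : ℝ}
    (h : (C.vehicle j).start - (C.vehicle i).start = c • (C.vehicle i).dir) :
    C.Lane i j ∧ C.off i j = c := by
  have : C.off i j = c := by
    rw [off, h, inner_smul_right, Vehicle.inner_dir_self, mul_one]
  exact ⟨by rw [Lane, this, h], this⟩

theorem inner_same {i j : Fin n} (h : (C.vehicle j).dir = (C.vehicle i).dir) :
    inner ℝ (C.vehicle i).dir (C.vehicle j).dir = 1 := by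
  rw [h, Vehicle.inner_dir_self]

theorem inner_opp {i j : Fin n} (h : (C.vehicle j).dir = -(C.vehicle i).dir) :
    inner ℝ (C.vehicle i).dir (C.vehicle j).dir = -1 := by
  rw [h, inner_neg_right, Vehicle.inner_dir_self]

theorem exists_Ioo_inter {a b c d : ℝ} (h : a < b) (h' : c < d) (h1 : a < d) (h2 : c < b) :
    ∃ x, a < x ∧ x < b ∧ c < x ∧ x < d := by
  obtain ⟨x, hx, hx'⟩ := exists_between (max_lt (lt_min h h1) (lt_min h2 h'))
  exact ⟨x, (le_max_left _ _).trans_lt hx, hx'.trans_le (min_le_left _ _),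
    (le_max_right _ _).trans_lt hx, hx'.trans_le (min_le_right _ _)⟩

/-- Collisions in scalar terms. The bodies are open segments, so vehicles that touch do not collide.
-/
theorem disjoint_body_iff (D : Profile n) (i j : Fin n) (t : ℝ) :
    Disjoint (C.body D i t) (C.body D j t) ↔ C.Clear i j (travelled D i t) (travelled D j t) := by
  have key : Disjoint (C.body D i t) (C.body D j t) ↔ ∀ a b,
      (travelled D i t - C.len i < a ∧ a < travelled D i t) →
      (travelled D j t - C.len j < b ∧ b < travelled D j t) →
      (C.vehicle i).start + a • (C.vehicle i).dir
        ≠ (C.vehicle j).start + b • (C.vehicle j).dir := by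
    rw [Set.disjoint_left]
    constructor
    · intro h a b ha hb e
      exact h ((C.mem_body D i t _).2 ⟨a, ha.1, ha.2, rfl⟩) ((C.mem_body D j t _).2
        ⟨b, hb.1, hb.2, e⟩)
    · intro h z hi hj
      obtain ⟨a, ha, ha', rfl⟩ := (C.mem_body D i t _).1 hi
      obtain ⟨b, hb, hb', e⟩ := (C.mem_body D j t _).1 hj
      exact h a b ⟨ha, ha'⟩ ⟨hb, hb'⟩ e
  rw [key]
  have hli := C.len_pos i
  have hlj := C.len_pos j
  generalize travelled D i t = x, travelled D j t = y
  rcases Vehicle.dir_rel (C.vehicle i) (C.vehicle j) with h | h | h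
  · constructor
    · intro H
      refine ⟨fun _ hc => ?_, fun hs => ?_, fun hs => ?_⟩
      · exact H _ _ ⟨hc.1, hc.2.1⟩ ⟨hc.2.2.1, hc.2.2.2⟩ ((C.meet_iff h _ _).2 ⟨rfl, rfl⟩)
      · rw [C.inner_same hs.1] at h; norm_num at h
      · rw [C.inner_opp hs.1] at h; norm_num at h
    · rintro ⟨H, -, -⟩ a b ha hb e
      obtain ⟨rfl, rfl⟩ := (C.meet_iff h _ _).1 e
      exact H h ⟨ha.1, ha.2, hb.1, hb.2⟩
  · have h1 := C.inner_same h
    constructor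
    · intro H
      refine ⟨fun h0 => by rw [h1] at h0; norm_num at h0, fun hs => ?_, fun hs => ?_⟩
      · by_contra hc
        push Not at hc
        obtain ⟨c, c1, c2, c3, c4⟩ := exists_Ioo_inter (a := x - C.len i) (b := x)
          (c := C.off i j + y - C.len j) (d := C.off i j + y) (by linarith) (by linarith)
          hc.1 hc.2
        refine H c (c - C.off i j) ⟨c1, c2⟩ ⟨by linarith, by linarith⟩ ?_
        have := hs.2
        rw [Lane] at this
        rw [h]
        linear_combination (norm := module) -this
      · have := C.inner_opp hs.1
        rw [h1] at this; norm_num at this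
    · rintro ⟨-, H, -⟩ a b ha hb e
      rw [h] at e
      obtain ⟨l1, l2⟩ := C.lane_of_eq (i := i) (j := j) (c := a - b)
        (by linear_combination (norm := module) -e)
      rcases H ⟨h, l1⟩ with H | H <;> rw [l2] at H <;> linarith
  · have h1 := C.inner_opp h
    constructor
    · intro H
      refine ⟨fun h0 => by rw [h1] at h0; norm_num at h0, fun hs => ?_, fun hs => ?_⟩
      · have := C.inner_same hs.1
        rw [h1] at this; norm_num at this
      · by_contra hc
        push Not at hc
        obtain ⟨c, c1, c2, c3, c4⟩ := exists_Ioo_inter (a := x - C.len i) (b := x)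
          (c := C.off i j - y) (d := C.off i j - y + C.len j) (by linarith) (by linarith)
          hc.2 hc.1
        refine H c (C.off i j - c) ⟨c1, c2⟩ ⟨by linarith, by linarith⟩ ?_
        have := hs.2
        rw [Lane] at this
        rw [h]
        linear_combination (norm := module) -this
    · rintro ⟨-, -, H⟩ a b ha hb e
      rw [h] at e
      obtain ⟨l1, l2⟩ := C.lane_of_eq (i := i) (j := j) (c := a + b)
        (by linear_combination (norm := module) -e)
      rcases H ⟨h, l1⟩ with H | H <;> rw [l2] at H <;> linarith

/-! ### The conditions on leading points and rear ends in scalar terms -/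

theorem front_eq_goal (D : Profile n) (i : Fin n) (t : ℝ) :
    C.front D i t = (C.vehicle i).goal ↔ travelled D i t = C.dist i := by
  rw [front, C.goal_eq]
  exact ⟨C.line_inj i, fun h => by rw [h]⟩

theorem CrossAt.front_eq {C : Crossing n} {i j : Fin n} {χ : Pt} (h : C.CrossAt i j χ)
    (D : Profile n) (t : ℝ) : C.front D i t = χ ↔ travelled D i t = C.off i j := by
  rw [((C.crossAt_iff i j χ).1 h).2, front]
  exact ⟨C.line_inj i, fun h => by rw [h]⟩

theorem front_eq_rear (D : Profile n) {i k : Fin n} (t : ℝ)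
    (h : (C.vehicle k).dir = (C.vehicle i).dir) :
    C.front D i t = C.rear D k t ↔
      C.Same i k ∧ travelled D i t = C.off i k + travelled D k t - C.len k := by
  rw [rear, front, front, h]
  change _ = _ - C.len k • _ ↔ _
  constructor
  · intro e
    obtain ⟨l1, l2⟩ := C.lane_of_eq (i := i) (j := k)
      (c := travelled D i t - travelled D k t + C.len k)
      (by linear_combination (norm := module) -e)
    exact ⟨⟨h, l1⟩, by rw [l2]; ring⟩
  · rintro ⟨hs, e⟩
    have := hs.2
    rw [Lane] at this
    rw [e]
    linear_combination (norm := module) -this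

theorem waits_iff (P : Priorities n) (D : Profile n) (i : Fin n) (t : ℝ) :
    C.Waits P D i t ↔ ∃ k, C.Cross i k ∧ travelled D i t = C.off i k ∧ Before P k i ∧
      travelled D k t < C.off k i + C.len k := by
  constructor
  · rintro ⟨k, χ, hc, hf, hb, hp⟩
    refine ⟨k, hc.cross, (hc.front_eq D t).1 hf, hb, ?_⟩
    rw [Passed, hc.offset_right, not_le] at hp
    exact hp
  · rintro ⟨k, hc, hf, hb, hp⟩
    obtain ⟨χ, hχ⟩ := hc.crossAt
    refine ⟨k, χ, hχ, (hχ.front_eq D t).2 hf, hb, ?_⟩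
    rw [Passed, hχ.offset_right, not_le]
    exact hp

theorem blocked_iff (D : Profile n) (i : Fin n) (t : ℝ) :
    C.Blocked D i t ↔ ∃ k, C.Same i k ∧
      travelled D i t = C.off i k + travelled D k t - C.len k ∧ D k t = 0 := by
  constructor
  · rintro ⟨k, hd, hf, h0⟩
    obtain ⟨h1, h2⟩ := (C.front_eq_rear D t hd).1 hf
    exact ⟨k, h1, h2, h0⟩
  · rintro ⟨k, hs, hf, h0⟩
    exact ⟨k, hs.1, (C.front_eq_rear D t hs.1).2 ⟨hs, hf⟩, h0⟩

end Crossing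
end Traffic

namespace Traffic

/-! ### Distances covered under bounded speeds -/

open Filter Topology

/-- A function that is locally constant to the right of every point is measurable: it is the
pointwise limit of step functions which take its values at points of finer and finer grids to the
right. -/
theorem measurable_of_eventually_eq_right {f : ℝ → ℝ} (h : ∀ t, ∀ᶠ s in 𝓝[>] t, f s = f t) :
    Measurable f := by
  have hu : ∀ t : ℝ, Tendsto (fun k : ℕ => ((⌊t * ((k : ℝ) + 1)⌋ : ℝ) + 1) / ((k : ℝ) + 1)) atTop (𝓝[>] t) := by
    intro t
    rw [tendsto_nhdsWithin_iff]
    have hpos : ∀ k : ℕ, (0 : ℝ) < k + 1 := fun k => by positivity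
    have hgt : ∀ k : ℕ, t < ((⌊t * ((k : ℝ) + 1)⌋ : ℝ) + 1) / ((k : ℝ) + 1) := fun k => by
      rw [lt_div_iff₀ (hpos k)]; exact Int.lt_floor_add_one (t * ((k : ℝ) + 1))
    refine ⟨?_, Eventually.of_forall hgt⟩
    have h1 : Tendsto (fun k : ℕ => t + 1 / ((k : ℝ) + 1)) atTop (𝓝 (t + 0)) :=
      tendsto_const_nhds.add (tendsto_one_div_add_atTop_nhds_zero_nat (𝕜 := ℝ))
    rw [add_zero] at h1
    refine tendsto_of_tendsto_of_tendsto_of_le_of_le tendsto_const_nhds h1 (fun k => (hgt k).le) ?_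
    intro k
    have := Int.floor_le (t * ((k : ℝ) + 1))
    have hk := hpos k
    rw [div_le_iff₀ hk, add_mul, one_div, inv_mul_cancel₀ hk.ne']
    linarith
  refine measurable_of_tendsto_metrizable (f := fun (k : ℕ) t => f (((⌊t * ((k : ℝ) + 1)⌋ : ℝ) + 1) / ((k : ℝ) + 1)))
    (fun k => ?_) ?_
  · have : Measurable fun z : ℤ => f (((z : ℝ) + 1) / (k + 1)) := Measurable.of_discrete
    exact this.comp (Int.measurable_floor.comp (measurable_id.mul_const _))
  · rw [tendsto_pi_nhds]
    intro t
    exact tendsto_const_nhds.congr' (((hu t).eventually (h t)).mono fun _ e => e.symm)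

/-- Continuous induction on `[0, ∞)`. -/
theorem forall_of_isClosed {S : Set ℝ} (hc : IsClosed S) (h0 : (0 : ℝ) ∈ S)
    (hr : ∀ t, 0 ≤ t → t ∈ S → ∀ᶠ s in 𝓝[>] t, s ∈ S) {t : ℝ} (ht : 0 ≤ t) : t ∈ S :=
  (hc.inter isClosed_Icc).Icc_subset_of_forall_mem_nhdsWithin h0
    (fun x hx => hr x hx.2.1 hx.1) ⟨ht, le_rfl⟩

/-- A speed profile of one vehicle that respects the speed limit `v` and is at rest before time
`0`. -/
structure IsSpeed (v : ℝ) (f : ℝ → ℝ) : Prop where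
  aem : AEMeasurable f volume
  mem : ∀ t, f t ∈ Set.Icc 0 v
  neg : ∀ t < 0, f t = 0

namespace IsSpeed
variable {v : ℝ} {f g : ℝ → ℝ}

theorem intervalIntegrable (h : IsSpeed v f) (a b : ℝ) : IntervalIntegrable f volume a b := by
  refine (intervalIntegrable_const (c := v)).mono_fun (h.aem.aestronglyMeasurable.restrict) ?_
  refine Eventually.of_forall fun t => ?_
  have := h.mem t
  change ‖f t‖ ≤ ‖v‖
  rw [Real.norm_of_nonneg this.1, Real.norm_of_nonneg (this.1.trans this.2)]
  exact this.2

theorem integral_sub (h : IsSpeed v f) (s t : ℝ) :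
    (∫ r in (0:ℝ)..t, f r) - ∫ r in (0:ℝ)..s, f r = ∫ r in s..t, f r :=
  intervalIntegral.integral_interval_sub_left (h.intervalIntegrable _ _) (h.intervalIntegrable _ _)

theorem mono (h : IsSpeed v f) {s t : ℝ} (hst : s ≤ t) :
    ∫ r in (0:ℝ)..s, f r ≤ ∫ r in (0:ℝ)..t, f r := by
  have := h.integral_sub s t
  have h2 : 0 ≤ ∫ r in s..t, f r := intervalIntegral.integral_nonneg hst fun r _ => (h.mem r).1
  linarith

theorem le_add (h : IsSpeed v f) {s t : ℝ} (hst : s ≤ t) :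
    ∫ r in (0:ℝ)..t, f r ≤ (∫ r in (0:ℝ)..s, f r) + v * (t - s) := by
  have := h.integral_sub s t
  have h2 : ∫ r in s..t, f r ≤ ∫ r in s..t, v :=
    intervalIntegral.integral_mono_on hst (h.intervalIntegrable _ _) intervalIntegrable_const
      fun r _ => (h.mem r).2
  rw [intervalIntegral.integral_const, smul_eq_mul, mul_comm] at h2
  linarith

theorem eq_zero (h : IsSpeed v f) {t : ℝ} (ht : t ≤ 0) : ∫ r in (0:ℝ)..t, f r = 0 := by
  rw [intervalIntegral.integral_symm, neg_eq_zero]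
  have : ∀ᵐ r ∂(volume : Measure ℝ), r ≠ 0 := by simp [ae_iff]
  rw [intervalIntegral.integral_congr_ae (g := fun _ => (0:ℝ))]
  · simp
  · filter_upwards [this] with r hr hr'
    rw [Set.uIoc_of_le ht] at hr'
    exact h.neg r (lt_of_le_of_ne hr'.2 hr)

theorem nonneg (h : IsSpeed v f) (t : ℝ) : 0 ≤ ∫ r in (0:ℝ)..t, f r := by
  rcases le_total t 0 with ht | ht
  · rw [h.eq_zero ht]
  · have := h.mono ht
    rwa [intervalIntegral.integral_same] at this

theorem continuous (h : IsSpeed v f) : Continuous fun t => ∫ r in (0:ℝ)..t, f r :=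
  intervalIntegral.continuous_primitive (fun a b => h.intervalIntegrable a b) 0

/-- Where the speed is constant on `[a, b)`, the distance is affine on `[a, b]`. -/
theorem eq_add (h : IsSpeed v f) {a b c : ℝ} (hc : ∀ s, a < s → s < b → f s = c) {t : ℝ}
    (h1 : a ≤ t) (h2 : t ≤ b) :
    ∫ r in (0:ℝ)..t, f r = (∫ r in (0:ℝ)..a, f r) + c * (t - a) := by
  have := h.integral_sub a t
  have h3 : ∫ r in a..t, f r = ∫ r in a..t, c := by
    have hb : ∀ᵐ r ∂(volume : Measure ℝ), r ≠ b := by simp [ae_iff]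
    refine intervalIntegral.integral_congr_ae ?_
    filter_upwards [hb] with r hr hr'
    rw [Set.uIoc_of_le h1] at hr'
    exact hc r hr'.1 (lt_of_le_of_ne (hr'.2.trans h2) hr)
  rw [intervalIntegral.integral_const, smul_eq_mul, mul_comm] at h3
  linarith

/-- If the speed is constant for a short time after `t`, then the distance is affine for this time.
-/
theorem eventually_eq (h : IsSpeed v f) {t : ℝ} (hr : ∀ᶠ s in 𝓝[>] t, f s = f t) :
    ∀ᶠ s in 𝓝[>] t, ∫ r in (0:ℝ)..s, f r = (∫ r in (0:ℝ)..t, f r) + f t * (s - t) := by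
  obtain ⟨b, hb, hs⟩ := mem_nhdsGT_iff_exists_Ioo_subset.1 hr
  filter_upwards [Ioo_mem_nhdsGT hb] with s hs'
  exact h.eq_add (fun r h1 h2 => hs ⟨h1, h2⟩) hs'.1.le hs'.2.le

/-- The distances up to time `T` do not depend on the speeds from time `T` on. -/
theorem congr_of_lt {T : ℝ} (hfg : ∀ t < T, f t = g t) (h0 : 0 ≤ T) {t : ℝ} (ht : t ≤ T) :
    ∫ r in (0:ℝ)..t, f r = ∫ r in (0:ℝ)..t, g r := by
  have hb : ∀ᵐ r ∂(volume : Measure ℝ), r ≠ T := by simp [ae_iff]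
  refine intervalIntegral.integral_congr_ae ?_
  filter_upwards [hb] with r hr hr'
  exact hfg r (lt_of_le_of_ne (hr'.2.trans (max_le h0 ht)) hr)

end IsSpeed

namespace Crossing
variable {n : ℕ} (C : Crossing n) (P : Priorities n)

/-- The distances covered by the vehicles at time `t`. -/
def pos (D : Profile n) (t : ℝ) (i : Fin n) : ℝ := travelled D i t

/-- Vehicle `i` has a reason of its own to stand still at time `t`, when the vehicles have covered
the distances `p`: its start time has not come, or it is at its goal, or it waits at an
intersection. -/
def Root (t : ℝ) (p : Fin n → ℝ) (i : Fin n) : Prop :=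
  t < (C.vehicle i).startTime ∨ p i = C.dist i ∨
    ∃ k, C.Cross i k ∧ p i = C.off i k ∧ Before P k i ∧ p k < C.off k i + C.len k

/-- The vehicles that stand still at time `t` when the distances `p` have been covered: those with
a reason of their own, and those in a queue behind them. -/
inductive Stop (t : ℝ) (p : Fin n → ℝ) : Fin n → Prop
  | root {i : Fin n} : C.Root P t p i → Stop t p i
  | behind {i k : Fin n} : C.Same i k → p i = C.off i k + p k - C.len k → Stop t p k → Stop t p i

open Classical in
/-- The speeds under the full-speed policy at time `t` when the distances `p` have been covered. -/
def speed (t : ℝ) (p : Fin n → ℝ) (i : Fin n) : ℝ := if C.Stop P t p i then 0 else C.maxSpeed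

/-- `D` obeys the full-speed policy up to time `T`. -/
structure Solves (T : ℝ) (D : Profile n) : Prop where
  eq : ∀ t < T, ∀ i, D i t = C.speed P t (pos D t) i
  mem : ∀ i t, D i t = 0 ∨ D i t = C.maxSpeed
  neg : ∀ i, ∀ t < 0, D i t = 0
  right : ∀ i t, ∀ᶠ s in 𝓝[>] t, D i s = D i t

variable {C P}

theorem Solves.isSpeed {T : ℝ} {D : Profile n} (h : C.Solves P T D) (i : Fin n) :
    IsSpeed C.maxSpeed (D i) := by
  refine ⟨(measurable_of_eventually_eq_right (h.right i)).aemeasurable, fun t => ?_, h.neg i⟩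
  rcases h.mem i t with e | e <;> rw [e]
  · exact ⟨le_rfl, C.maxSpeed_nonneg⟩
  · exact ⟨C.maxSpeed_nonneg, le_rfl⟩

theorem Solves.mono {T T' : ℝ} {D : Profile n} (h : C.Solves P T D) (hT : T' ≤ T) :
    C.Solves P T' D :=
  ⟨fun t ht => h.eq t (ht.trans_le hT), h.mem, h.neg, h.right⟩

/-- Vehicle `k` is further ahead than `i` in their common lane: a well-founded relation. -/
theorem wellFounded_ahead (C : Crossing n) (p : Fin n → ℝ) :
    WellFounded fun k i : Fin n => C.Same i k ∧ p i < C.off i k + p k := by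
  have : IsTrans (Fin n) fun k i : Fin n => C.Same i k ∧ p i < C.off i k + p k := by
    constructor
    rintro a b c ⟨h1, h2⟩ ⟨h3, h4⟩
    refine ⟨h3.trans h1, ?_⟩
    rw [h3.off_add (k := a)]
    linarith
  have : Std.Irrefl fun k i : Fin n => C.Same i k ∧ p i < C.off i k + p k := by
    constructor
    rintro a ⟨-, h⟩
    rw [C.off_self] at h
    linarith
  exact Finite.wellFounded_of_trans_of_irrefl _

/-- Under full-speed profiles, exactly the vehicles in `Stop` stand still. The condition on the
vehicle ahead refers to its speed at the same time; this recursion ends, because it proceeds to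
vehicles that are further ahead. -/
theorem IsFullSpeed.eq_zero_iff {D : Profile n} (hv : 0 < C.maxSpeed) (h : C.IsFullSpeed P D)
    (i : Fin n) (t : ℝ) : D i t = 0 ↔ C.Stop P t (pos D t) i := by
  constructor
  · refine (wellFounded_ahead C (pos D t)).induction
      (C := fun i => D i t = 0 → C.Stop P t (pos D t) i) i ?_
    intro i ih h0
    have hh : C.Halted P D i t := by
      by_contra hc
      rw [h.moving i t hc] at h0
      exact hv.ne' h0
    rcases hh with hh | hh | hh | hh
    · exact .root (Or.inl hh)
    · exact .root (Or.inr (Or.inl ((C.front_eq_goal D i t).1 hh)))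
    · exact .root (Or.inr (Or.inr ((C.waits_iff P D i t).1 hh)))
    · obtain ⟨k, hs, he, hk⟩ := (C.blocked_iff D i t).1 hh
      refine .behind hs he (ih k ⟨hs, ?_⟩ hk)
      have := C.len_pos k
      simp only [pos]
      linarith
  · intro hs
    induction hs with
    | root hr =>
      refine h.halted _ t ?_
      rcases hr with hr | hr | hr
      · exact Or.inl hr
      · exact Or.inr (Or.inl ((C.front_eq_goal D _ t).2 hr))
      · exact Or.inr (Or.inr (Or.inl ((C.waits_iff P D _ t).2 hr)))
    | behind hs he _ ih =>
      exact h.halted _ t (Or.inr (Or.inr (Or.inr ((C.blocked_iff D _ t).2 ⟨_, hs, he, ih⟩))))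

theorem IsFullSpeed.mem {D : Profile n} (h : C.IsFullSpeed P D) (i : Fin n) (t : ℝ) :
    D i t = 0 ∨ D i t = C.maxSpeed := by
  by_cases hh : C.Halted P D i t
  · exact Or.inl (h.halted i t hh)
  · exact Or.inr (h.moving i t hh)

/-- Full-speed profiles are determined at each time by the distances covered so far. -/
theorem IsFullSpeed.solves {D : Profile n} (hv : 0 < C.maxSpeed) (h : C.IsFullSpeed P D) (T : ℝ) :
    C.Solves P T D := by
  refine ⟨fun t _ i => ?_, h.mem, fun i t ht => ?_, fun i t => ?_⟩
  · rw [speed]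
    split_ifs with hs
    · exact (h.eq_zero_iff hv i t).2 hs
    · exact (h.mem i t).resolve_left fun h0 => hs ((h.eq_zero_iff hv i t).1 h0)
  · exact h.halted i t (Or.inl (ht.trans_le (C.vehicle i).startTime_nonneg))
  · have hc := (h.right_continuous i t).mono_left (nhdsWithin_mono t Set.Ioi_subset_Ici_self)
    rcases h.mem i t with e | e
    · filter_upwards [hc.eventually_lt_const (u := C.maxSpeed) (by rw [e]; exact hv)] with s hs
      rw [e]
      exact (h.mem i s).resolve_right hs.ne
    · filter_upwards [hc.eventually_const_lt (u := 0) (by rw [e]; exact hv)] with s hs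
      rw [e]
      exact (h.mem i s).resolve_left hs.ne'

theorem Solves.isFullSpeed {D : Profile n} (hv : 0 < C.maxSpeed) (h : ∀ T, C.Solves P T D) :
    C.IsFullSpeed P D := by
  have key : ∀ i t, D i t = 0 ↔ C.Stop P t (pos D t) i := by
    intro i t
    rw [(h (t + 1)).eq t (by linarith) i, speed]
    split_ifs with hs
    · simp [hs]
    · simp [hs, hv.ne']
  have key2 : ∀ i t, C.Halted P D i t ↔ C.Stop P t (pos D t) i := by
    intro i t
    rw [Halted, C.front_eq_goal, C.waits_iff, C.blocked_iff]
    constructor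
    · rintro (hr | hr | hr | ⟨k, hs, he, hk⟩)
      · exact .root (Or.inl hr)
      · exact .root (Or.inr (Or.inl hr))
      · exact .root (Or.inr (Or.inr hr))
      · exact .behind hs he ((key k t).1 hk)
    · rintro (hr | ⟨hs, he, hk⟩)
      · rcases hr with hr | hr | hr
        · exact Or.inl hr
        · exact Or.inr (Or.inl hr)
        · exact Or.inr (Or.inr (Or.inl hr))
      · exact Or.inr (Or.inr (Or.inr ⟨_, hs, he, (key _ t).2 hk⟩))
  refine ⟨fun i t => ?_, fun i t ht => (key i t).2 ((key2 i t).1 ht), fun i t ht => ?_⟩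
  · refine continuousWithinAt_Ioi_iff_Ici.1 ?_
    exact (tendsto_congr' ((h 0).right i t)).2 tendsto_const_nhds
  · rw [key2, ← key] at ht
    exact ((h 0).mem i t).resolve_left ht

theorem Solves.pos_eventually {T : ℝ} {D : Profile n} (h : C.Solves P T D) (i : Fin n) (t : ℝ) :
    ∀ᶠ s in 𝓝[>] t, pos D s i = pos D t i + D i t * (s - t) :=
  (h.isSpeed i).eventually_eq (h.right i t)

/-- Profiles that obey the full-speed policy up to time `T` coincide up to time `T`. -/
theorem Solves.unique {T : ℝ} {D E : Profile n} (hD : C.Solves P T D) (hE : C.Solves P T E)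
    (i : Fin n) {t : ℝ} (ht : t < T) : D i t = E i t := by
  have key : ∀ t, 0 ≤ t → t ∈ {t | T ≤ t ∨ pos D t = pos E t} := by
    intro t h0
    -- The distances coincide on `[0, T]`: where they do, the speeds do, and these remain constant
    -- for a short time.
    refine forall_of_isClosed ?_ (Or.inr ?_) ?_ h0
    · refine isClosed_Ici.union (isClosed_eq ?_ ?_)
      · exact continuous_pi fun i => (hD.isSpeed i).continuous
      · exact continuous_pi fun i => (hE.isSpeed i).continuous
    · funext i
      exact ((hD.isSpeed i).eq_zero le_rfl).trans ((hE.isSpeed i).eq_zero le_rfl).symm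
    · rintro t - (ht | ht)
      · filter_upwards [self_mem_nhdsWithin] with s hs
        exact Or.inl (ht.trans (le_of_lt hs))
      · rcases le_or_gt T t with h1 | h1
        · filter_upwards [self_mem_nhdsWithin] with s hs
          exact Or.inl (h1.trans (le_of_lt hs))
        · have : ∀ i, ∀ᶠ s in 𝓝[>] t, pos D s i = pos E s i := by
            intro i
            filter_upwards [hD.pos_eventually i t, hE.pos_eventually i t] with s h2 h3
            rw [h2, h3, hD.eq t h1, hE.eq t h1, ht]
          filter_upwards [eventually_all.2 this] with s hs
          exact Or.inr (funext hs)
  rcases lt_or_ge t 0 with h0 | h0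
  · rw [hD.neg i t h0, hE.neg i t h0]
  · have := (key t h0).resolve_left (not_le.2 ht)
    rw [hD.eq t ht, hE.eq t ht, this]

/-- As long as the vehicles keep their speeds, the policy does not change them for a short time. -/
theorem eventually_halt_iff (C : Crossing n) (P : Priorities n) (T : ℝ) (p : Fin n → ℝ) :
    ∀ᶠ t in 𝓝[>] T, ∀ i,
      C.Stop P t (fun i => p i + C.speed P T p i * (t - T)) i ↔ C.Stop P T p i := by
  set q : ℝ → Fin n → ℝ := fun t i => p i + C.speed P T p i * (t - T) with hq
  have hqc : ∀ i, Tendsto (fun t => q t i) (𝓝[>] T) (𝓝 (p i)) := by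
    intro i
    have : Continuous fun t => q t i := by simp only [hq]; fun_prop
    have h := this.tendsto T
    simp only [hq, sub_self, mul_zero, add_zero] at h
    exact h.mono_left nhdsWithin_le_nhds
  have hqm : ∀ t, T < t → ∀ i, p i ≤ q t i := by
    intro t ht i
    have : 0 ≤ C.speed P T p i := by
      rw [speed]; split_ifs
      exacts [le_rfl, C.maxSpeed_nonneg]
    have := mul_nonneg this (sub_nonneg.2 ht.le)
    simp only [hq]; linarith
  have hq0 : ∀ t i, C.Stop P T p i → q t i = p i := by
    intro t i h
    simp [hq, speed, h]
  -- In each of the conditions, an inequality that holds at time `T` holds for a short time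
  -- afterwards, and an equation that does not hold at time `T` does not hold for a short time
  -- afterwards.
  have e1 : ∀ᶠ t in 𝓝[>] T, ∀ i, T < (C.vehicle i).startTime → t < (C.vehicle i).startTime := by
    refine eventually_all.2 fun i => ?_
    by_cases h : T < (C.vehicle i).startTime
    · filter_upwards [(eventually_lt_nhds h).filter_mono nhdsWithin_le_nhds] with t ht _ using ht
    · exact Eventually.of_forall fun t h' => absurd h' h
  have e2 : ∀ᶠ t in 𝓝[>] T, ∀ i, q t i = C.dist i → p i = C.dist i := by
    refine eventually_all.2 fun i => ?_
    by_cases h : p i = C.dist i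
    · exact Eventually.of_forall fun t _ => h
    · filter_upwards [(hqc i).eventually_ne h] with t ht h' using absurd h' ht
  have e3 : ∀ᶠ t in 𝓝[>] T, ∀ i k, q t i = C.off i k → p i = C.off i k := by
    refine eventually_all.2 fun i => eventually_all.2 fun k => ?_
    by_cases h : p i = C.off i k
    · exact Eventually.of_forall fun t _ => h
    · filter_upwards [(hqc i).eventually_ne h] with t ht h' using absurd h' ht
  have e4 : ∀ᶠ t in 𝓝[>] T, ∀ i k, p k < C.off k i + C.len k → q t k < C.off k i + C.len k := by
    refine eventually_all.2 fun i => eventually_all.2 fun k => ?_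
    by_cases h : p k < C.off k i + C.len k
    · filter_upwards [(hqc k).eventually_lt_const h] with t ht _ using ht
    · exact Eventually.of_forall fun t h' => absurd h' h
  have e5 : ∀ᶠ t in 𝓝[>] T, ∀ i k, q t i = C.off i k + q t k - C.len k →
      p i = C.off i k + p k - C.len k := by
    refine eventually_all.2 fun i => eventually_all.2 fun k => ?_
    by_cases h : p i = C.off i k + p k - C.len k
    · exact Eventually.of_forall fun t _ => h
    · have h1 : Tendsto (fun t => q t i - (C.off i k + q t k - C.len k)) (𝓝[>] T)
          (𝓝 (p i - (C.off i k + p k - C.len k))) :=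
        (hqc i).sub (((hqc k).const_add _).sub_const _)
      filter_upwards [h1.eventually_ne (sub_ne_zero.2 h)] with t ht h'
      exact absurd (sub_eq_zero.2 h') ht
  filter_upwards [e1, e2, e3, e4, e5, self_mem_nhdsWithin] with t h1 h2 h3 h4 h5 hT i
  constructor
  · intro h
    induction h with
    | root hr =>
      rcases hr with hr | hr | ⟨k, hc, he, hb, hp⟩
      · exact .root (Or.inl (lt_trans hT hr))
      · exact .root (Or.inr (Or.inl (h2 _ hr)))
      · exact .root (Or.inr (Or.inr ⟨k, hc, h3 _ _ he, hb, (hqm t hT k).trans_lt hp⟩))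
    | behind hs he _ ih => exact .behind hs (h5 _ _ he) ih
  -- The distances of the vehicles that stand still at time `T` have not changed.
  · intro h
    have hS := h
    induction h with
    | root hr =>
      have e := hq0 t _ hS
      rcases hr with hr | hr | ⟨k, hc, he, hb, hp⟩
      · exact .root (Or.inl (h1 _ hr))
      · exact .root (Or.inr (Or.inl (e.trans hr)))
      · exact .root (Or.inr (Or.inr ⟨k, hc, e.trans he, hb, h4 _ _ hp⟩))
    | behind hs he hk ih =>
      refine .behind hs ?_ (ih hk)
      change q t _ = _ + q t _ - _
      rw [hq0 t _ hS, hq0 t _ hk, he]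

/-- A solution can be continued. -/
theorem Solves.extend {T : ℝ} (hT : 0 ≤ T) {D : Profile n} (h : C.Solves P T D) :
    ∃ T' > T, ∃ E, C.Solves P T' E := by
  obtain ⟨T', hT', hs⟩ := mem_nhdsGT_iff_exists_Ioo_subset.1 (eventually_halt_iff C P T (pos D T))
  rw [Set.mem_Ioi] at hT'
  set u := C.speed P T (pos D T) with hu
  have hum : ∀ i, u i = 0 ∨ u i = C.maxSpeed := by
    intro i
    rw [hu, speed]; split_ifs <;> simp
  -- After time `T`, the vehicles keep the speeds of time `T` as long as the policy does not change
  -- them.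
  let E : Profile n := fun i t => if t < T then D i t else if t < T' then u i else 0
  have E1 : ∀ i, ∀ t < T, E i t = D i t := fun i t ht => if_pos ht
  have E2 : ∀ i t, T ≤ t → t < T' → E i t = u i := fun i t ht ht' => by
    simp only [E]; rw [if_neg (not_lt.2 ht), if_pos ht']
  have E3 : ∀ i t, T' ≤ t → E i t = 0 := fun i t ht => by
    simp only [E]; rw [if_neg (not_lt.2 (hT'.le.trans ht)), if_neg (not_lt.2 ht)]
  have hmem : ∀ i t, E i t = 0 ∨ E i t = C.maxSpeed := by
    intro i t
    rcases lt_or_ge t T with h1 | h1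
    · rw [E1 i t h1]; exact h.mem i t
    · rcases lt_or_ge t T' with h2 | h2
      · rw [E2 i t h1 h2]; exact hum i
      · exact Or.inl (E3 i t h2)
  have hneg : ∀ i, ∀ t < 0, E i t = 0 := fun i t ht => by
    rw [E1 i t (ht.trans_le hT)]; exact h.neg i t ht
  have hright : ∀ i t, ∀ᶠ s in 𝓝[>] t, E i s = E i t := by
    intro i t
    rcases lt_or_ge t T with h1 | h1
    · filter_upwards [h.right i t, Ioo_mem_nhdsGT h1] with s h2 h3
      rw [E1 i t h1, E1 i s h3.2, h2]
    · rcases lt_or_ge t T' with h2 | h2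
      · filter_upwards [Ioo_mem_nhdsGT h2] with s h3
        rw [E2 i t h1 h2, E2 i s (h1.trans h3.1.le) h3.2]
      · filter_upwards [self_mem_nhdsWithin] with s h3
        rw [E3 i t h2, E3 i s (h2.trans (le_of_lt h3))]
  -- Before time 0 nothing happens; this gives access to the facts about distances under `E`.
  have hE : C.Solves P (-1) E :=
    ⟨fun t ht i => by
      rw [hneg i t (by linarith), speed, if_pos]
      exact .root (Or.inl (lt_of_lt_of_le (by linarith) (C.vehicle i).startTime_nonneg)),
      hmem, hneg, hright⟩
  have hpos : ∀ t ≤ T, pos E t = pos D t := fun t ht => funext fun i =>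
    IsSpeed.congr_of_lt (E1 i) hT ht
  refine ⟨T', hT', E, fun t ht i => ?_, hmem, hneg, hright⟩
  rcases lt_or_ge t T with h1 | h1
  · rw [E1 i t h1, h.eq t h1, hpos t h1.le]
  · have hp : pos E t = fun i => pos D T i + u i * (t - T) := by
      funext i
      rw [← hpos T le_rfl]
      exact (hE.isSpeed i).eq_add (fun s h2 h3 => E2 i s h2.le h3) h1 ht.le
    rw [E2 i t h1 ht]
    rcases eq_or_lt_of_le h1 with rfl | h1
    · rw [hpos T le_rfl]
    · have := hs ⟨h1, ht⟩ i
      rw [hp, hu, speed, speed, this]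

/-- The full-speed profiles exist if the speed limit is positive: solutions up to finite times are
glued, and the supremum of these times cannot be finite, as solutions can be continued. -/
theorem exists_solves (C : Crossing n) (P : Priorities n) : ∃ D, ∀ T, C.Solves P T D := by
  classical
  let S : Set ℝ := {T | 0 ≤ T ∧ ∃ D, C.Solves P T D}
  have h0 : (0 : ℝ) ∈ S := by
    refine ⟨le_rfl, 0, fun t ht i => ?_, fun i t => Or.inl rfl, fun i t _ => rfl,
      fun i t => Eventually.of_forall fun s => rfl⟩
    rw [speed, if_pos]
    · rfl
    · exact .root (Or.inl (lt_of_lt_of_le ht (C.vehicle i).startTime_nonneg))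
  choose! E hE using fun T (h : T ∈ S) => h.2
  -- Solutions coincide where they are defined, so that any of them can be chosen at each time.
  let G : Profile n := fun i t => if h : ∃ T ∈ S, t < T then E h.choose i t else 0
  have G1 : ∀ T ∈ S, ∀ t < T, ∀ i, G i t = E T i t := by
    intro T hT t ht i
    have h : ∃ T ∈ S, t < T := ⟨T, hT, ht⟩
    have hs := h.choose_spec
    simp only [G, dif_pos h]
    rcases le_total T h.choose with hl | hl
    · exact ((hE _ hs.1).mono hl).unique (hE T hT) i ht
    · exact (hE _ hs.1).unique ((hE T hT).mono hl) i hs.2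
  have G2 : ∀ t, (¬ ∃ T ∈ S, t < T) → ∀ i, G i t = 0 := fun t h i => dif_neg h
  have hG : ∀ T', (∀ t < T', ∃ T ∈ S, t < T) → C.Solves P T' G := by
    intro T' hT'
    refine ⟨fun t ht i => ?_, fun i t => ?_, fun i t ht => ?_, fun i t => ?_⟩
    · obtain ⟨T, hT, htT⟩ := hT' t ht
      have hp : pos G t = pos (E T) t := funext fun i =>
        IsSpeed.congr_of_lt (fun t ht => G1 T hT t ht i) hT.1 htT.le
      rw [G1 T hT t htT, hp, (hE T hT).eq t htT]
    · by_cases h : ∃ T ∈ S, t < T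
      · obtain ⟨T, hT, htT⟩ := h
        rw [G1 T hT t htT]; exact (hE T hT).mem i t
      · exact Or.inl (G2 t h i)
    · rw [G1 0 h0 t ht]; exact (hE 0 h0).neg i t ht
    · by_cases h : ∃ T ∈ S, t < T
      · obtain ⟨T, hT, htT⟩ := h
        filter_upwards [(hE T hT).right i t, Ioo_mem_nhdsGT htT] with s h1 h2
        rw [G1 T hT t htT, G1 T hT s h2.2, h1]
      · filter_upwards [self_mem_nhdsWithin] with s hs
        rw [G2 t h, G2 s]
        rintro ⟨T, hT, hst⟩
        exact h ⟨T, hT, lt_trans hs hst⟩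
  by_cases hb : BddAbove S
  · exfalso
    have h1 : C.Solves P (sSup S) G := hG _ fun t ht => exists_lt_of_lt_csSup ⟨0, h0⟩ ht
    have h2 : 0 ≤ sSup S := le_csSup hb h0
    obtain ⟨T', hT', D, hD⟩ := h1.extend h2
    exact (not_lt.2 (le_csSup hb ⟨h2.trans hT'.le, D, hD⟩)) hT'
  · refine ⟨G, fun T' => hG T' fun t _ => ?_⟩
    rw [not_bddAbove_iff] at hb
    exact hb t

theorem isFullSpeed_zero (hv : C.maxSpeed = 0) : C.IsFullSpeed P 0 :=
  ⟨fun _ _ => continuousWithinAt_const, fun _ _ _ => rfl, fun _ _ _ => hv.symm⟩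

theorem IsFullSpeed.eq_zero {F : Profile n} (hv : C.maxSpeed = 0) (h : C.IsFullSpeed P F) :
    F = 0 := by
  funext i t
  rcases h.mem i t with e | e
  · exact e
  · exact e.trans hv

/-- The full-speed profiles exist and are unique. -/
theorem existsUnique_isFullSpeed (C : Crossing n) (P : Priorities n) :
    ∃! F, C.IsFullSpeed P F := by
  rcases eq_or_lt_of_le C.maxSpeed_nonneg with hv | hv
  · exact ⟨0, isFullSpeed_zero hv.symm, fun F hF => hF.eq_zero hv.symm⟩
  · obtain ⟨F, hF⟩ := exists_solves C P
    refine ⟨F, Solves.isFullSpeed hv hF, fun E hE => ?_⟩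
    funext i t
    exact (hE.solves hv (t + 1)).unique (hF (t + 1)) i (by linarith)

end Crossing
end Traffic

namespace Traffic
open Filter Topology

namespace Crossing
variable {n : ℕ} {C : Crossing n} {P : Priorities n} {D F : Profile n}

/-! ### Valid profiles -/

theorem Valid.isSpeed (h : C.Valid D) (i : Fin n) : IsSpeed C.maxSpeed (D i) := by
  refine ⟨h.measurable i, fun t => ?_, fun t ht => ?_⟩
  · by_cases ht : t ∈ Set.Icc (C.vehicle i).startTime (C.vehicle i).deadline
    · exact h.inside i t ht
    · rw [h.outside i t ht]; exact ⟨le_rfl, C.maxSpeed_nonneg⟩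
  · exact h.outside i t fun h' => absurd (h'.1.trans_lt ht)
      (not_lt.2 (C.vehicle i).startTime_nonneg)

theorem Valid.pos_deadline (h : C.Valid D) (i : Fin n) :
    pos D (C.vehicle i).deadline i = C.dist i :=
  (C.front_eq_goal D i _).1 (h.reach_goal i)

/-- From its deadline on, a vehicle remains at its goal. -/
theorem Valid.pos_of_deadline_le (h : C.Valid D) (i : Fin n) {t : ℝ}
    (ht : (C.vehicle i).deadline ≤ t) : pos D t i = C.dist i := by
  have := (h.isSpeed i).eq_add (a := (C.vehicle i).deadline) (b := t) (c := 0)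
    (fun s h1 _ => h.outside i s fun h' => absurd h'.2 (not_le.2 h1)) ht le_rfl
  rw [zero_mul, add_zero] at this
  exact this.trans (h.pos_deadline i)

theorem Valid.pos_le (h : C.Valid D) (i : Fin n) (t : ℝ) : pos D t i ≤ C.dist i := by
  rw [← h.pos_of_deadline_le i (le_max_right t _)]
  exact (h.isSpeed i).mono (le_max_left _ _)

theorem Valid.clear (h : C.Valid D) {i j : Fin n} (hij : i ≠ j) (t : ℝ) :
    C.Clear i j (pos D t i) (pos D t j) :=
  (C.disjoint_body_iff D i j t).1 (h.no_collision t i j hij)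

theorem pos_zero {v : ℝ} {i : Fin n} (h : IsSpeed v (D i)) : pos D 0 i = 0 := h.eq_zero le_rfl

/-- Vehicles in a common lane keep their order under valid profiles. -/
theorem Valid.order (h : C.Valid D) {i k : Fin n} (hs : C.Same i k) (ho : C.len k ≤ C.off i k)
    {t : ℝ} (ht : 0 ≤ t) : pos D t i ≤ C.off i k + pos D t k - C.len k := by
  have hik : i ≠ k := by
    rintro rfl
    have := C.len_pos i
    rw [C.off_self] at ho
    linarith
  have ci : Continuous fun t => pos D t i := (h.isSpeed i).continuous
  have ck : Continuous fun t => pos D t k := (h.isSpeed k).continuous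
  refine forall_of_isClosed (S := {t | pos D t i ≤ C.off i k + pos D t k - C.len k})
    (isClosed_le ci ((ck.const_add _).sub continuous_const)) ?_ ?_ ht
  · rw [Set.mem_ofPred_eq, pos_zero (h.isSpeed i), pos_zero (h.isSpeed k)]
    linarith
  · intro t _ h1
    have h2 : pos D t i < C.off i k + pos D t k := by
      have := C.len_pos k
      rw [Set.mem_ofPred_eq] at h1
      linarith
    filter_upwards [(ci.continuousAt.eventually_lt (ck.const_add _).continuousAt h2).filter_mono
      nhdsWithin_le_nhds] with s hs'
    rcases (h.clear hik s).2.1 hs with h3 | h3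
    · have := C.len_pos i
      linarith
    · exact h3

/-! ### Entry and exit times -/

theorem firstTime_le {p : ℝ → Prop} {t : ℝ} (h : p t) : firstTime p ≤ t :=
  sInf_le ⟨t, h, rfl⟩

theorem firstTime_lt {p : ℝ → Prop} {e : EReal} (h : firstTime p < e) : ∃ t : ℝ, p t ∧ (t : EReal) < e := by
  obtain ⟨_, ⟨t, ht, rfl⟩, h'⟩ := sInf_lt_iff.1 h
  exact ⟨t, ht, h'⟩

theorem firstTime_mono {p q : ℝ → Prop} (h : ∀ t, p t → q t) : firstTime q ≤ firstTime p :=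
  sInf_le_sInf (Set.image_mono fun t ht => h t ht)

/-- A vehicle that has entered an intersection remains beyond it. -/
theorem entered_of_lt {v : ℝ} {i : Fin n} {χ : Pt} (h : IsSpeed v (D i)) {t : ℝ}
    (ht : C.entryTime D i χ < t) : C.Entered D i χ t := by
  obtain ⟨s, h1, h2⟩ := firstTime_lt ht
  exact lt_of_lt_of_le h1 (h.mono (EReal.coe_lt_coe_iff.1 h2).le)

/-- Two vehicles do not enter their intersection at the same time under valid profiles, since both
bodies would contain the intersection immediately afterwards. -/
theorem Valid.entryTime_ne (h : C.Valid D) {i j : Fin n} {χ : Pt} (hc : C.CrossAt i j χ) :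
    C.entryTime D i χ ≠ C.entryTime D j χ := by
  intro e
  -- No vehicle has passed immediately after its entry time, so that both would be at the
  -- intersection.
  have coll : ∀ t : ℝ, C.Entered D i χ t → C.Entered D j χ t → pos D t i < C.off i j + C.len i →
      pos D t j < C.off j i + C.len j → False := by
    intro t h1 h2 h3 h4
    rw [Entered, hc.offset_left] at h1
    rw [Entered, hc.offset_right] at h2
    exact (h.clear hc.cross.ne t).1 hc.cross.1 ⟨by linarith, h1, by linarith, h2⟩
  have ent : ∀ t : ℝ, C.entryTime D i χ < t → C.Entered D i χ t ∧ C.Entered D j χ t := fun t ht =>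
    ⟨entered_of_lt (h.isSpeed i) ht, entered_of_lt (h.isSpeed j) (e ▸ ht)⟩
  have hx := hc.cross
  generalize he : C.entryTime D i χ = E at ent
  induction E with
  | bot =>
    obtain ⟨h1, h2⟩ := ent 0 (EReal.bot_lt_coe 0)
    refine coll 0 h1 h2 ?_ ?_
    · rw [pos_zero (h.isSpeed i)]; linarith [hx.2.1]
    · rw [pos_zero (h.isSpeed j)]; linarith [hx.2.2.2.1]
  | top =>
    have : C.Entered D i χ (C.vehicle i).deadline := by
      rw [Entered, hc.offset_left]
      exact lt_of_lt_of_eq hx.2.2.1 (h.pos_deadline i).symm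
    exact absurd (firstTime_le this) (by rw [← entryTime, he]; simp)
  | coe r =>
    have main : ∀ (k l : Fin n), IsSpeed C.maxSpeed (D k) → C.entryTime D k χ = r →
        C.offset k χ = C.off k l → ∀ᶠ t in 𝓝[>] r, pos D t k < C.off k l + C.len k := by
      intro k l hk hr ho
      have ck : Continuous fun t => pos D t k := hk.continuous
      have h1 : pos D r k ≤ C.off k l := by
        have hcl : IsClosed {t | pos D t k ≤ C.off k l} := isClosed_le ck continuous_const
        have hsub : Set.Iio r ⊆ {t | pos D t k ≤ C.off k l} := by
          intro s hs
          rw [Set.mem_ofPred_eq]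
          by_contra hlt
          rw [not_le, ← ho] at hlt
          have := firstTime_le (p := C.Entered D k χ) hlt
          rw [← entryTime, hr] at this
          exact (not_le.2 (EReal.coe_lt_coe_iff.2 hs)) this
        have := closure_minimal hsub hcl
        rw [closure_Iio] at this
        exact this Set.self_mem_Iic
      have hl := C.len_pos k
      filter_upwards [(ck.continuousAt.eventually_lt (continuousAt_const (y := C.off k l + C.len k))
        (by linarith)).filter_mono nhdsWithin_le_nhds] with s hs using hs
    obtain ⟨t, ⟨h1, h2⟩, h3⟩ := (((main i j (h.isSpeed i) he hc.offset_left).and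
      (main j i (h.isSpeed j) (e ▸ he) hc.offset_right)).and self_mem_nhdsWithin).exists
    obtain ⟨h4, h5⟩ := ent t (EReal.coe_lt_coe_iff.2 h3)
    exact coll t h4 h5 h1 h2

theorem CrossAt.unique {i j : Fin n} {χ ψ : Pt} (h : C.CrossAt i j χ) (h' : C.CrossAt i j ψ) :
    χ = ψ := ((C.crossAt_iff i j χ).1 h).2.trans ((C.crossAt_iff i j ψ).1 h').2.symm

/-- The order in which the vehicles enter their intersections is a certificate. -/
theorem Valid.exists_agrees (h : C.Valid D) : ∃ P, C.Agrees P D := by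
  classical
  refine ⟨fun i j => decide (∃ χ, C.CrossAt i j χ ∧ C.entryTime D i χ < C.entryTime D j χ), ?_⟩
  intro i j χ hc
  have key : ∀ {i j : Fin n} {χ : Pt}, C.CrossAt i j χ →
      ((∃ χ, C.CrossAt i j χ ∧ C.entryTime D i χ < C.entryTime D j χ) ↔
        C.entryTime D i χ < C.entryTime D j χ) := by
    intro i j χ hc
    refine ⟨?_, fun h => ⟨χ, hc, h⟩⟩
    rintro ⟨ψ, hψ, h⟩
    rwa [hc.unique hψ]
  simp only [Before, decide_eq_true_eq, decide_eq_false_iff_not]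
  rw [key hc, key hc.symm]
  have hne := h.entryTime_ne hc
  rcases lt_or_gt_of_ne hc.cross.ne with hij | hij
  · simp [hij, hij.le]
  · simp only [hij, hij.not_gt, false_and, true_and, false_or, not_lt]
    exact ⟨fun h' => lt_of_le_of_ne h' hne, le_of_lt⟩

/-! ### Invariants of the full-speed policy -/

theorem before_or {i j : Fin n} (P : Priorities n) (h : i ≠ j) : Before P i j ∨ Before P j i := by
  rcases lt_or_gt_of_ne h with h | h
  · cases hb : P i j
    · exact Or.inr (Or.inr ⟨h, hb⟩)
    · exact Or.inl (Or.inl ⟨h, hb⟩)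
  · cases hb : P j i
    · exact Or.inl (Or.inr ⟨h, hb⟩)
    · exact Or.inr (Or.inl ⟨h, hb⟩)

/-- `F` obeys the full-speed policy at all times. -/
abbrev SolvesAll (C : Crossing n) (P : Priorities n) (F : Profile n) : Prop := ∀ T, C.Solves P T F

namespace SolvesAll

theorem isSpeed (h : C.SolvesAll P F) (i : Fin n) : IsSpeed C.maxSpeed (F i) := (h 0).isSpeed i

theorem continuous (h : C.SolvesAll P F) (i : Fin n) : Continuous fun t => pos F t i :=
  (h.isSpeed i).continuous

theorem eventually_halt (h : C.SolvesAll P F) {i : Fin n} {t : ℝ} (hs : C.Stop P t (pos F t) i) :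
    ∀ᶠ s in 𝓝[>] t, pos F s i = pos F t i := by
  filter_upwards [(h (t + 1)).pos_eventually i t] with s h1
  rw [h1, (h (t + 1)).eq t (by linarith), speed, if_pos hs, zero_mul, add_zero]

theorem eventually_move (h : C.SolvesAll P F) {i : Fin n} {t : ℝ} (hs : ¬ C.Stop P t (pos F t) i) :
    ∀ᶠ s in 𝓝[>] t, pos F s i = pos F t i + C.maxSpeed * (s - t) := by
  filter_upwards [(h (t + 1)).pos_eventually i t] with s h1
  rw [h1, (h (t + 1)).eq t (by linarith), speed, if_neg hs]

theorem pos_le (h : C.SolvesAll P F) (i : Fin n) (t : ℝ) : pos F t i ≤ C.dist i := by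
  rcases lt_or_ge t 0 with ht | ht
  · exact ((h.isSpeed i).eq_zero ht.le).trans_le (C.dist_pos i).le
  refine forall_of_isClosed (S := {t | pos F t i ≤ C.dist i})
    (isClosed_le (h.continuous i) continuous_const) ?_ ?_ ht
  · rw [Set.mem_ofPred_eq, pos_zero (h.isSpeed i)]; exact (C.dist_pos i).le
  · intro t _ h1
    rcases eq_or_lt_of_le (α := ℝ) h1 with h2 | h2
    · filter_upwards [h.eventually_halt (.root (Or.inr (Or.inl h2)))] with s hs
      exact (hs.trans h2).le
    · filter_upwards [((h.continuous i).continuousAt.eventually_lt continuousAt_const h2).filter_mono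
        nhdsWithin_le_nhds] with s hs using hs.le

/-- Vehicles in a common lane keep their order under the full-speed policy. -/
theorem order (h : C.SolvesAll P F) {i k : Fin n} (hs : C.Same i k) (ho : C.len k ≤ C.off i k)
    {t : ℝ} (ht : 0 ≤ t) : pos F t i ≤ C.off i k + pos F t k - C.len k := by
  refine forall_of_isClosed (S := {t | pos F t i ≤ C.off i k + pos F t k - C.len k})
    (isClosed_le (h.continuous i) (((h.continuous k).const_add _).sub continuous_const)) ?_ ?_ ht
  · rw [Set.mem_ofPred_eq, pos_zero (h.isSpeed i), pos_zero (h.isSpeed k)]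
    linarith
  · intro t _ h1
    -- If `i` touches `k`, then it stands still if `k` does, and otherwise `k` moves at full speed.
    rcases eq_or_lt_of_le (α := ℝ) h1 with h2 | h2
    · by_cases hk : C.Stop P t (pos F t) k
      · filter_upwards [h.eventually_halt hk, h.eventually_halt (.behind hs h2 hk)] with s h3 h4
        rw [h3, h4]; exact h1
      · filter_upwards [h.eventually_move hk, self_mem_nhdsWithin] with s h3 h4
        rw [h3]
        have : pos F s i ≤ pos F t i + C.maxSpeed * (s - t) := (h.isSpeed i).le_add (le_of_lt h4)
        linarith
    · filter_upwards [((h.continuous i).continuousAt.eventually_lt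
        (((h.continuous k).const_add _).sub continuous_const).continuousAt h2).filter_mono
        nhdsWithin_le_nhds] with s hs using hs.le

/-- A vehicle that has not entered an intersection initially does not enter it before the vehicle
with priority has passed. -/
theorem priority (h : C.SolvesAll P F) {i k : Fin n} (hc : C.Cross i k) (hb : Before P k i)
    (ho : 0 ≤ C.off i k) {t : ℝ} (ht : 0 ≤ t) :
    pos F t i ≤ C.off i k ∨ C.off k i + C.len k ≤ pos F t k := by
  refine forall_of_isClosed
    (S := {t | pos F t i ≤ C.off i k} ∪ {t | C.off k i + C.len k ≤ pos F t k})
    ((isClosed_le (h.continuous i) continuous_const).union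
      (isClosed_le continuous_const (h.continuous k))) ?_ ?_ ht
  · left
    rw [Set.mem_ofPred_eq, pos_zero (h.isSpeed i)]; exact ho
  · intro t _ h1
    by_cases h2 : C.off k i + C.len k ≤ pos F t k
    · filter_upwards [self_mem_nhdsWithin] with s hs
      exact Or.inr (h2.trans ((h.isSpeed k).mono (le_of_lt hs)))
    · rcases eq_or_lt_of_le (α := ℝ) (h1.resolve_right h2) with h3 | h3
      · filter_upwards [h.eventually_halt
          (.root (Or.inr (Or.inr ⟨k, hc, h3, hb, not_le.1 h2⟩)))] with s hs
        exact Or.inl (hs.trans h3).le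
      · filter_upwards [((h.continuous i).continuousAt.eventually_lt continuousAt_const
          h3).filter_mono nhdsWithin_le_nhds] with s hs using Or.inl hs.le

end SolvesAll

/-- The vehicles do not overlap initially if there are valid profiles. -/
theorem clear_zero (h : C.Valid D) {i j : Fin n} (hij : i ≠ j) : C.Clear i j 0 0 := by
  have := h.clear hij 0
  rwa [pos_zero (h.isSpeed i), pos_zero (h.isSpeed j)] at this

/-- No valid profiles overtake the full-speed profiles for their priorities. A vehicle can be
overtaken only when it stands still under the full-speed policy, and then the reason for this keeps
it from being further ahead under the valid profiles. -/
theorem Valid.pos_le_pos (hD : C.Valid D) (hA : C.Agrees P D) (hF : C.SolvesAll P F) (i : Fin n)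
    (t : ℝ) : pos D t i ≤ pos F t i := by
  rcases lt_or_ge t 0 with ht | ht
  · exact ((hD.isSpeed i).eq_zero ht.le).trans_le ((hF.isSpeed i).eq_zero ht.le).ge
  have cD : ∀ i, Continuous fun t => pos D t i := fun i => (hD.isSpeed i).continuous
  refine forall_of_isClosed (S := {t | ∀ i, pos D t i ≤ pos F t i}) ?_ ?_ ?_ ht i
  · rw [Set.ofPred_forall]
    exact isClosed_iInter fun i => isClosed_le (cD i) (hF.continuous i)
  · intro i
    rw [pos_zero (hD.isSpeed i), pos_zero (hF.isSpeed i)]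
  intro t ht h1
  refine eventually_all.2 fun i => ?_
  by_cases hs : C.Stop P t (pos F t) i
  swap
  · filter_upwards [hF.eventually_move hs, self_mem_nhdsWithin] with s h2 h3
    have : pos D s i ≤ pos D t i + C.maxSpeed * (s - t) := (hD.isSpeed i).le_add (le_of_lt h3)
    linarith [h1 i]
  induction hs with
  | @root i hr =>
    have h2 := hF.eventually_halt (.root hr)
    rcases hr with hr | hr | ⟨k, hc, he, hb, hp⟩
    -- The start time of `i` has not come, and `D` has to respect the start times as well.
    · filter_upwards [h2, Ioo_mem_nhdsGT hr] with s h3 h4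
      rw [h3]
      have := (hD.isSpeed i).eq_add (a := t) (b := s) (c := 0)
        (fun r _ h6 => hD.outside i r fun h7 => absurd h7.1 (not_le.2 (h6.trans h4.2))) h4.1.le le_rfl
      rw [zero_mul, add_zero] at this
      exact this.trans_le (h1 i)
    · filter_upwards [h2] with s h3
      rw [h3, hr]
      exact hD.pos_le i s
    -- Vehicle `i` waits for `k`. Since `k` is not further under `D`, it has not yet passed under
    -- `D` either. If `i` entered, then `k` would have entered before, as it has priority, and the
    -- two would collide.
    · have hk : ∀ᶠ s in 𝓝[>] t, pos D s k < C.off k i + C.len k :=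
        (((cD k).continuousAt.eventually_lt continuousAt_const ((h1 k).trans_lt hp))).filter_mono
          nhdsWithin_le_nhds
      have hi : ∀ᶠ s in 𝓝[>] t, pos D s i < C.off i k + C.len i :=
        (((cD i).continuousAt.eventually_lt continuousAt_const
          (lt_of_le_of_lt ((h1 i).trans he.le) (by linarith [C.len_pos i])))).filter_mono
          nhdsWithin_le_nhds
      filter_upwards [h2, hk, hi] with s h3 h4 h5
      rw [h3, he]
      by_contra hlt
      rw [not_le] at hlt
      obtain ⟨χ, hχ⟩ := hc.crossAt
      have h6 := (hA k i χ hχ.symm).1 hb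
      have h7 : C.entryTime D i χ ≤ s := firstTime_le (by rw [Entered, hχ.offset_left]; exact hlt)
      have h8 := entered_of_lt (hD.isSpeed k) (h6.trans_le h7)
      rw [Entered, hχ.offset_right] at h8
      exact (hD.clear hc.ne s).1 hc.1 ⟨by linarith, hlt, by linarith, h8⟩
  | @behind i k hs he hk ih =>
    have hik : i ≠ k := by
      rintro rfl
      rw [C.off_self] at he
      linarith [C.len_pos i]
    -- Vehicle `i` is behind `k` initially, since it is so at time `t`. Under `D` it remains behind
    -- `k`, which is nowhere further under `D` than under the full-speed policy.
    have ho : C.len k ≤ C.off i k := by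
      rcases (clear_zero hD hik).2.1 hs with h2 | h2
      · exfalso
        have h3 := hF.order hs.symm (by rw [hs.off_symm]; linarith) ht
        rw [hs.off_symm] at h3
        linarith [C.len_pos i, C.len_pos k]
      · linarith
    filter_upwards [ih, hF.eventually_halt hk, hF.eventually_halt (.behind hs he hk),
      self_mem_nhdsWithin] with s h2 h3 h4 h5
    have := hD.order hs ho (ht.trans (le_of_lt h5))
    linarith

theorem Clear.symm' {i j : Fin n} {a b : ℝ} (h : C.Clear i j a b)
    (ho : inner ℝ (C.vehicle i).dir (C.vehicle j).dir = 0) : C.Clear j i b a := by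
  have ho' : inner ℝ (C.vehicle j).dir (C.vehicle i).dir = 0 := by rw [real_inner_comm]; exact ho
  refine ⟨fun _ h' => h.1 ho ⟨h'.2.2.1, h'.2.2.2, h'.1, h'.2.1⟩, fun h' => ?_, fun h' => ?_⟩
  · rw [C.inner_same h'.1] at ho'; norm_num at ho'
  · rw [C.inner_opp h'.1] at ho'; norm_num at ho'

/-- Two vehicles in a common lane do not collide under the full-speed policy if they do not overlap
initially and either move away from each other or have goals that do not overlap. -/
theorem SolvesAll.clear_of_lane (hF : C.SolvesAll P F) {i j : Fin n}
    (h0 : C.Clear i j 0 0) (ho : inner ℝ (C.vehicle i).dir (C.vehicle j).dir ≠ 0)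
    (hopp : C.Opp i j → 0 ≤ C.off i j → C.dist i + C.dist j ≤ C.off i j) {t : ℝ} (ht : 0 ≤ t) :
    C.Clear i j (pos F t i) (pos F t j) := by
  have pi : 0 ≤ pos F t i := (hF.isSpeed i).nonneg t
  have pj : 0 ≤ pos F t j := (hF.isSpeed j).nonneg t
  refine ⟨fun h => absurd h ho, fun h => ?_, fun h => ?_⟩
  · rcases h0.2.1 h with h1 | h1
    · left
      have h3 := hF.order h.symm (by rw [h.off_symm]; linarith) ht
      rw [h.off_symm] at h3
      linarith
    · right
      have h3 := hF.order h (by linarith) ht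
      linarith
  · rcases h0.2.2 h with h1 | h1
    · left
      have := hopp h (by linarith)
      have := hF.pos_le i t
      have := hF.pos_le j t
      linarith
    · right
      linarith

/-- Vehicles that approach each other in a common lane cannot pass each other, so that their goals
do not overlap if there are valid profiles. -/
theorem Valid.opp_dist_le (hD : C.Valid D) {i j : Fin n} (h : C.Opp i j) (h0 : 0 ≤ C.off i j) :
    C.dist i + C.dist j ≤ C.off i j := by
  have hij : i ≠ j := by
    rintro rfl
    have := h.1
    have h2 := C.inner_opp h.1
    rw [Vehicle.inner_dir_self] at h2
    norm_num at h2
  have ci : Continuous fun t => pos D t i := (hD.isSpeed i).continuous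
  have cj : Continuous fun t => pos D t j := (hD.isSpeed j).continuous
  set T := max 0 (max (C.vehicle i).deadline (C.vehicle j).deadline) with hT
  have key : T ∈ {t | pos D t i + pos D t j ≤ C.off i j} := by
    refine forall_of_isClosed (S := {t | pos D t i + pos D t j ≤ C.off i j})
      (isClosed_le (ci.add cj) continuous_const) ?_ ?_ (le_max_left _ _)
    · rw [Set.mem_ofPred_eq, pos_zero (hD.isSpeed i), pos_zero (hD.isSpeed j)]
      linarith
    · intro t _ h1
      rw [Set.mem_ofPred_eq] at h1
      have h2 : pos D t i + pos D t j < C.off i j + (C.len i + C.len j) := by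
        linarith [C.len_pos i, C.len_pos j]
      filter_upwards [((ci.add cj).continuousAt.eventually_lt continuousAt_const h2).filter_mono
        nhdsWithin_le_nhds] with s hs
      change pos D s i + pos D s j < _ at hs
      rcases (hD.clear hij s).2.2 h with h3 | h3
      · exact le_sub_iff_add_le.1 h3
      · linarith
  rw [Set.mem_ofPred_eq, hD.pos_of_deadline_le i ((le_max_left _ _).trans (le_max_right _ _)),
    hD.pos_of_deadline_le j ((le_max_right _ _).trans (le_max_right _ _))] at key
  exact key

theorem clear_of_neg {i j : Fin n} {t : ℝ} (hF : C.SolvesAll P F) (h0 : C.Clear i j 0 0)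
    (ht : t < 0) : C.Clear i j (pos F t i) (pos F t j) := by
  have h1 : pos F t i = 0 := (hF.isSpeed i).eq_zero ht.le
  have h2 : pos F t j = 0 := (hF.isSpeed j).eq_zero ht.le
  rw [h1, h2]; exact h0

/-- Full-speed profiles are valid if they arrive in time and do not collide. -/
theorem SolvesAll.valid (hF : C.SolvesAll P F)
    (harr : ∀ i, pos F (C.vehicle i).deadline i = C.dist i)
    (hcl : ∀ t, 0 ≤ t → ∀ i j, i ≠ j → C.Clear i j (pos F t i) (pos F t j)) : C.Valid F := by
  refine ⟨fun i => (hF.isSpeed i).aem, fun i t ht => ?_, fun i t _ => (hF.isSpeed i).mem t,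
    fun t i j hij => ?_, fun i => (C.front_eq_goal F i _).2 (harr i)⟩
  · rw [(hF (t + 1)).eq t (by linarith), speed, if_pos]
    rw [Set.mem_Icc, not_and_or, not_le, not_le] at ht
    rcases ht with ht | ht
    · exact .root (Or.inl ht)
    · refine .root (Or.inr (Or.inl (le_antisymm (hF.pos_le i t) ?_)))
      rw [← harr i]
      exact (hF.isSpeed i).mono ht.le
  · rw [C.disjoint_body_iff]
    rcases lt_or_ge t 0 with ht | ht
    · refine clear_of_neg hF ?_ ht
      have := hcl 0 le_rfl i j hij
      rwa [pos_zero (hF.isSpeed i), pos_zero (hF.isSpeed j)] at this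
    · exact hcl t ht i j hij

/-- The full-speed profiles for priorities that agree with valid profiles are valid: the vehicles
arrive in time because they are nowhere behind, vehicles in a common lane keep their order, and at
an intersection the vehicle without priority waits until the other one has passed. -/
theorem Valid.full_valid (hD : C.Valid D) (hA : C.Agrees P D) (hF : C.SolvesAll P F) :
    C.Valid F := by
  have hle := hD.pos_le_pos hA hF
  refine hF.valid (fun i => le_antisymm (hF.pos_le i _) ?_) ?_
  · rw [← hD.pos_deadline i]; exact hle i _
  · intro t ht i j hij
    by_cases ho : inner ℝ (C.vehicle i).dir (C.vehicle j).dir = 0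
    swap
    · exact hF.clear_of_lane (clear_zero hD hij) ho hD.opp_dist_le ht
    have key : ∀ {i k : Fin n}, Before P k i →
        inner ℝ (C.vehicle i).dir (C.vehicle k).dir = 0 → C.Clear i k (pos F t i) (pos F t k) := by
      intro i k hb ho
      refine ⟨fun _ h => ?_, fun h => ?_, fun h => ?_⟩
      · obtain ⟨h1, h2, h3, h4⟩ := h
        have pi : 0 ≤ pos F t i := (hF.isSpeed i).nonneg t
        have pk : 0 ≤ pos F t k := (hF.isSpeed k).nonneg t
        have hc : C.Cross i k :=
          ⟨ho, by linarith, h2.trans_le (hF.pos_le i t), by linarith, h4.trans_le (hF.pos_le k t)⟩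
        obtain ⟨χ, hχ⟩ := hc.crossAt
        have h5 := (hA k i χ hχ.symm).1 hb
        -- A vehicle that starts beyond the intersection has entered it at time `⊥`, so that no
        -- vehicle enters it before and has priority.
        have h6 : 0 ≤ C.off i k := by
          by_contra hneg
          obtain ⟨s, -, hs⟩ := firstTime_lt h5
          refine (not_le.2 hs) (firstTime_le ?_)
          rw [Entered, hχ.offset_left]
          exact (not_le.1 hneg).trans_le ((hD.isSpeed i).nonneg s)
        rcases hF.priority hc hb h6 ht with h7 | h7 <;> linarith
      · rw [C.inner_same h.1] at ho; norm_num at ho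
      · rw [C.inner_opp h.1] at ho; norm_num at ho
    rcases before_or P hij with hb | hb
    · have ho' : inner ℝ (C.vehicle j).dir (C.vehicle i).dir = 0 := by
        rw [real_inner_comm]; exact ho
      exact (key hb ho').symm' ho'
    · exact key hb ho

/-- The full-speed profiles for priorities that agree with valid profiles `D` are valid, and no
event is later than under `D`. -/
theorem Valid.full_speed (hD : C.Valid D) (hA : C.Agrees P D) (hF : C.IsFullSpeed P F) :
    C.Valid F ∧
      (∀ i j χ, C.CrossAt i j χ →
        C.entryTime F i χ ≤ C.entryTime D i χ ∧ C.exitTime F i χ ≤ C.exitTime D i χ) ∧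
      ∀ i, C.arrivalTime F i ≤ C.arrivalTime D i := by
  rcases eq_or_lt_of_le C.maxSpeed_nonneg with hv | hv
  · have hD0 : D = 0 := by
      funext i t
      have := (hD.isSpeed i).mem t
      rw [← hv] at this
      exact le_antisymm this.2 this.1
    rw [hF.eq_zero hv.symm, ← hD0]
    exact ⟨hD, fun _ _ _ _ => ⟨le_rfl, le_rfl⟩, fun _ => le_rfl⟩
  · have hF' := hF.solves hv
    have hle := hD.pos_le_pos hA hF'
    refine ⟨hD.full_valid hA hF', fun i j χ _ => ⟨?_, ?_⟩, fun i => ?_⟩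
    · exact firstTime_mono fun t ht => lt_of_lt_of_le ht (hle i t)
    · exact firstTime_mono fun t ht => le_trans ht (hle i t)
    · refine firstTime_mono fun t ht => ?_
      rw [C.front_eq_goal] at ht ⊢
      exact le_antisymm (SolvesAll.pos_le hF' i t) (ht.symm.trans_le (hle i t))

theorem solvable_iff (C : Crossing n) :
    C.Solvable ↔ ∃ (P : Priorities n) (F : Profile n), C.IsFullSpeed P F ∧ C.Valid F := by
  constructor
  · rintro ⟨D, hD⟩
    obtain ⟨P, hP⟩ := hD.exists_agrees
    obtain ⟨F, hF, -⟩ := existsUnique_isFullSpeed C P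
    exact ⟨P, F, hF, (hD.full_speed hP hF).1⟩
  · rintro ⟨P, F, -, hF⟩
    exact ⟨F, hF⟩

end Crossing

/-! ### The size of certificates -/

theorem Priorities.length_encode {n : ℕ} (P : Priorities n) : P.encode.length = n ^ 2 := by
  simp [Priorities.encode, List.length_flatMap, sq]

theorem Priorities.eq_of_mem_encode {n : ℕ} (P : Priorities n) {z : ℤ} (hz : z ∈ P.encode) : z = 0 ∨ z = 1 := by
  simp only [Priorities.encode, List.mem_flatMap, List.mem_map] at hz
  obtain ⟨i, -, j, -, rfl⟩ := hz
  split_ifs <;> simp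

/-- A certificate has `n ^ 2` entries of at most two bits each. -/
theorem wordSize_encode_le (n : ℕ) (P : Priorities n) : wordSize P.encode ≤ 2 * n ^ 2 := by
  have key : ∀ (l : List ℤ), (∀ z ∈ l, z = 0 ∨ z = 1) → wordSize l ≤ 2 * l.length := by
    intro l hl
    induction l with
    | nil => simp [wordSize]
    | cons a l ih =>
      have h1 := ih fun z hz => hl z (List.mem_cons_of_mem _ hz)
      have h2 : bitLen a ≤ 2 := by
        rcases hl a List.mem_cons_self with rfl | rfl <;> simp [bitLen]
      simp only [wordSize, List.map_cons, List.sum_cons, List.length_cons] at h1 ⊢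
      omega
  rw [← P.length_encode]
  exact key _ fun z hz => P.eq_of_mem_encode hz

end Traffic

namespace Traffic
open Filter Topology

namespace Crossing
variable {n : ℕ} {C : Crossing n} {P : Priorities n} {F : Profile n}

/-! ### Queues -/

/-- Vehicle `k` is initially ahead of `i` in their common lane. -/
def Ahead (C : Crossing n) (i k : Fin n) : Prop := C.Same i k ∧ C.len k ≤ C.off i k

open Classical in
/-- The total length of the vehicles that are ahead of `i` up to and including `k`: the least
possible distance between the leading points of `i` and `k`. -/
def queue (C : Crossing n) (i k : Fin n) : ℝ :=
  ∑ m with C.Ahead i m ∧ (m = k ∨ C.Ahead m k), C.len m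

theorem Ahead.trans {i j k : Fin n} (h : C.Ahead i j) (h' : C.Ahead j k) : C.Ahead i k := by
  refine ⟨h.1.trans h'.1, ?_⟩
  rw [h.1.off_add (k := k)]
  linarith [h.2, h'.2, C.len_pos j]

theorem Ahead.off_pos {i k : Fin n} (h : C.Ahead i k) : 0 < C.off i k := (C.len_pos k).trans_le h.2

theorem Ahead.irrefl (i : Fin n) : ¬ C.Ahead i i := fun h => by
  have := h.off_pos
  rw [C.off_self] at this
  exact lt_irrefl _ this

theorem Ahead.asymm {i k : Fin n} (h : C.Ahead i k) (h' : C.Ahead k i) : False :=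
  Ahead.irrefl i (h.trans h')

theorem ahead_total {i k : Fin n} (h0 : C.Clear i k 0 0) (h : C.Same i k) :
    C.Ahead i k ∨ C.Ahead k i := by
  rcases h0.2.1 h with h1 | h1
  · right; exact ⟨h.symm, by rw [h.off_symm]; linarith⟩
  · left; exact ⟨h, by linarith⟩

/-- The vehicles do not overlap initially. -/
abbrev Apart (C : Crossing n) : Prop := ∀ i j, i ≠ j → C.Clear i j 0 0

theorem initiallyDisjoint_iff : C.InitiallyDisjoint ↔ C.Apart := by
  refine forall_congr' fun i => forall_congr' fun j => forall_congr' fun _ => ?_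
  rw [C.disjoint_body_iff]
  simp [travelled]

theorem ahead_trichotomy (h0 : C.Apart) {i k : Fin n} (h : C.Same i k) :
    i = k ∨ C.Ahead i k ∨ C.Ahead k i := by
  by_cases hik : i = k
  · exact Or.inl hik
  · exact Or.inr (ahead_total (h0 i k hik) h)

theorem queue_self (i : Fin n) : C.queue i i = 0 := by
  classical
  refine Finset.sum_eq_zero fun m hm => ?_
  rw [Finset.mem_filter] at hm
  rcases hm.2.2 with rfl | h
  · exact absurd hm.2.1 (Ahead.irrefl _)
  · exact (hm.2.1.asymm h).elim

/-- The next vehicle ahead of `i` on the way to `k`. -/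
theorem exists_next (h0 : C.Apart) {i k : Fin n} (h : C.Ahead i k) :
    ∃ m, C.Ahead i m ∧ (m = k ∨ C.Ahead m k) ∧ C.queue i k = C.len m + C.queue m k ∧
      ∀ m', C.Ahead i m' → (m' = k ∨ C.Ahead m' k) → m' = m ∨ C.Ahead m m' := by
  classical
  obtain ⟨m, hm, hmin⟩ := Finset.exists_min_image
    (Finset.univ.filter fun m => C.Ahead i m ∧ (m = k ∨ C.Ahead m k)) (fun m => C.off i m)
    ⟨k, by simp [h]⟩
  rw [Finset.mem_filter] at hm
  have key : ∀ m', C.Ahead i m' → (m' = k ∨ C.Ahead m' k) → m' = m ∨ C.Ahead m m' := by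
    intro m' h1 h2
    have h3 := hmin m' (by simp [h1, h2])
    rcases ahead_trichotomy h0 (hm.2.1.1.symm.trans h1.1) with h4 | h4 | h4
    · exact Or.inl h4.symm
    · exact Or.inr h4
    · have := h4.off_pos
      rw [h1.1.off_add (k := m)] at h3
      linarith
  refine ⟨m, hm.2.1, hm.2.2, ?_, key⟩
  have hS : (Finset.univ.filter fun m' => C.Ahead i m' ∧ (m' = k ∨ C.Ahead m' k)) =
      insert m (Finset.univ.filter fun m' => C.Ahead m m' ∧ (m' = k ∨ C.Ahead m' k)) := by
    ext m'
    simp only [Finset.mem_filter, Finset.mem_univ, true_and, Finset.mem_insert]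
    constructor
    · rintro ⟨h1, h2⟩
      rcases key m' h1 h2 with h3 | h3
      · exact Or.inl h3
      · exact Or.inr ⟨h3, h2⟩
    · rintro (rfl | ⟨h1, h2⟩)
      · exact hm.2
      · exact ⟨hm.2.1.trans h1, h2⟩
  rw [queue, hS, Finset.sum_insert]
  · rfl
  · simp [Ahead.irrefl]

theorem Ahead.rel {i m : Fin n} (h : C.Ahead i m) : C.Same i m ∧ (0 : ℝ) < C.off i m + 0 :=
  ⟨h.1, by linarith [h.off_pos]⟩

variable {p : Fin n → ℝ}

/-- The vehicles have not overtaken each other. -/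
abbrev InOrder (C : Crossing n) (p : Fin n → ℝ) : Prop :=
  ∀ i k, C.Ahead i k → p i ≤ C.off i k + p k - C.len k

/-- Vehicles that have not overtaken each other leave room for the vehicles between them. -/
theorem queue_le (h0 : C.Apart) (hp : C.InOrder p) {i k : Fin n} (h : i = k ∨ C.Ahead i k) :
    p i ≤ C.off i k + p k - C.queue i k := by
  induction i using (wellFounded_ahead C 0).induction with
  | _ i ih =>
    rcases h with rfl | h
    · rw [queue_self, C.off_self]; linarith
    · obtain ⟨m, h1, h2, h3, -⟩ := exists_next h0 h
      have h4 := ih m h1.rel (h2.imp id id)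
      have h5 := hp i m h1
      rw [h3, h1.1.off_add (k := k)]
      linarith

/-- A vehicle stands still if it is in a queue without gaps behind a vehicle that stands still. -/
theorem stop_of_queue (h0 : C.Apart) (hp : C.InOrder p) {t : ℝ} {i k : Fin n}
    (h : i = k ∨ C.Ahead i k) (hk : C.Stop P t p k) (he : p i = C.off i k + p k - C.queue i k) :
    C.Stop P t p i := by
  induction i using (wellFounded_ahead C 0).induction with
  | _ i ih =>
    rcases h with rfl | h
    · exact hk
    · obtain ⟨m, h1, h2, h3, -⟩ := exists_next h0 h
      have h4 := queue_le h0 hp (h2.imp id id)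
      have h5 := hp i m h1
      rw [h3, h1.1.off_add (k := k)] at he
      exact .behind h1.1 (by linarith) (ih m h1.rel (h2.imp id id) (by linarith))

/-- A vehicle that stands still is in a queue without gaps behind a vehicle with a reason of its
own to stand still. -/
theorem Stop.exists_root (h0 : C.Apart) (hp : C.InOrder p) {t : ℝ} {i : Fin n}
    (h : C.Stop P t p i) : ∃ k, C.Root P t p k ∧ (i = k ∨ C.Ahead i k) ∧
      p i = C.off i k + p k - C.queue i k := by
  induction h with
  | @root i hr => exact ⟨i, hr, Or.inl rfl, by rw [queue_self, C.off_self]; ring⟩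
  | @behind i k hs he hk ih =>
    obtain ⟨l, hr, hl, hq⟩ := ih
    have hik : C.Ahead i k := by
      rcases ahead_trichotomy h0 hs with rfl | h1 | h1
      · rw [C.off_self] at he
        linarith [C.len_pos i]
      · exact h1
      · have := hp k i h1
        rw [hs.off_symm] at this
        linarith [C.len_pos i, C.len_pos k]
    have hil : C.Ahead i l := by
      rcases hl with rfl | hl
      · exact hik
      · exact hik.trans hl
    obtain ⟨m, h1, h2, h3, h4⟩ := exists_next h0 hil
    -- As `i` touches `k`, there is no vehicle between them.
    have hm : k = m := by
      rcases h4 k hik (hl.imp id id) with h5 | h5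
      · exact h5
      · have h6 := hp i m h1
        have h7 := hp m k h5
        rw [h1.1.off_add (k := k)] at he
        linarith [C.len_pos m]
    subst hm
    refine ⟨l, hr, Or.inr hil, ?_⟩
    rw [h3, hs.off_add (k := l), he]
    linarith

/-! ### The course of the full-speed profiles between two events -/

/-- `B i` is the point that vehicle `i` can reach while all vehicles with a reason of their own to
stand still at time `t` remain where they are. -/
def IsReach (C : Crossing n) (P : Priorities n) (t : ℝ) (p B : Fin n → ℝ) : Prop :=
  ∀ i, B i ≤ C.dist i ∧
    (∀ k, C.Root P t p k → (i = k ∨ C.Ahead i k) → B i ≤ C.off i k + p k - C.queue i k) ∧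
    (B i = C.dist i ∨ ∃ k, C.Root P t p k ∧ (i = k ∨ C.Ahead i k) ∧
      B i = C.off i k + p k - C.queue i k)

/-- The points at which the progress of vehicle `i` is an event: its goal, and for each of its
intersections the points at which it arrives there and has passed. -/
def IsTarget (C : Crossing n) (i : Fin n) (q : ℝ) : Prop :=
  q = C.dist i ∨ ∃ k, C.Cross i k ∧ (q = C.off i k ∨ q = C.off i k + C.len i)

/-- No start time comes, and no vehicle can reach a target, within less than the time `d`. -/
structure NoEvent (C : Crossing n) (t : ℝ) (p B : Fin n → ℝ) (d : ℝ) : Prop where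
  start : ∀ i, t < (C.vehicle i).startTime → t + d ≤ (C.vehicle i).startTime
  target : ∀ i q, C.IsTarget i q → p i < q → q ≤ B i → C.maxSpeed * d ≤ q - p i

theorem SolvesAll.inOrder (hF : C.SolvesAll P F) {t : ℝ} (ht : 0 ≤ t) : C.InOrder (pos F t) :=
  fun _ _ h => hF.order h.1 h.2 ht

theorem IsReach.le (h0 : C.Apart) {t : ℝ} {p B : Fin n → ℝ} (hp : C.InOrder p)
    (hd : ∀ i, p i ≤ C.dist i) (hB : C.IsReach P t p B) (i : Fin n) : p i ≤ B i := by
  rcases (hB i).2.2 with h | ⟨k, -, h, e⟩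
  · rw [h]; exact hd i
  · rw [e]; exact queue_le h0 hp h

/-- A step before the next event: the vehicles that stand still at an intermediate time are exactly
those that have reached the point that they can reach. -/
theorem stop_iff_of_noEvent (h0 : C.Apart) {t s d : ℝ} {p r B : Fin n → ℝ} (hr : C.InOrder r)
    (hle : ∀ i, p i ≤ B i) (hB : C.IsReach P t p B) (hE : C.NoEvent t p B d) (hs : 0 ≤ s)
    (hsd : s < d) (hv : 0 < C.maxSpeed)
    (he : ∀ i, r i = min (p i + C.maxSpeed * s) (B i)) (i : Fin n) :
    C.Stop P (t + s) r i ↔ r i = B i := by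
  have hvs : C.maxSpeed * s < C.maxSpeed * d := mul_lt_mul_of_pos_left hsd hv
  have hvs0 : 0 ≤ C.maxSpeed * s := mul_nonneg hv.le hs
  have hrB : ∀ i, r i ≤ B i := fun i => (he i).trans_le (min_le_right _ _)
  have hrp : ∀ i, r i ≤ p i + C.maxSpeed * s := fun i => (he i).trans_le (min_le_left _ _)
  have hpr : ∀ i, p i ≤ r i := fun i => by
    rw [he i]; exact le_min (by linarith) (hle i)
  -- A target that is reached during the step was reached at its beginning.
  have htar : ∀ k q, C.IsTarget k q → r k = q → p k = q := by
    intro k q hq h1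
    by_contra h2
    have h3 : p k < q := lt_of_le_of_ne (h1 ▸ hpr k) h2
    have h4 := hE.target k q hq h3 (h1 ▸ hrB k)
    linarith [hrp k]
  have hroot : ∀ k, C.Root P t p k → r k = p k := by
    intro k hk
    have h1 := (hB k).2.1 k hk (Or.inl rfl)
    rw [queue_self, C.off_self] at h1
    linarith [hrB k, hpr k]
  -- The reasons for standing still are the same throughout the step.
  have hroot_iff : ∀ k, C.Root P (t + s) r k ↔ C.Root P t p k := by
    intro k
    constructor
    · rintro (h1 | h1 | ⟨m, hc, h1, hb, h2⟩)
      · exact Or.inl (by linarith)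
      · exact Or.inr (Or.inl (htar k _ (Or.inl rfl) h1))
      · exact Or.inr (Or.inr ⟨m, hc, htar k _ (Or.inr ⟨m, hc, Or.inl rfl⟩) h1, hb,
          (hpr m).trans_lt h2⟩)
    · intro hk
      have h3 := hroot k hk
      rcases hk with h1 | h1 | ⟨m, hc, h1, hb, h2⟩
      · exact Or.inl (by linarith [hE.start k h1])
      · exact Or.inr (Or.inl (h3.trans h1))
      · refine Or.inr (Or.inr ⟨m, hc, h3.trans h1, hb, ?_⟩)
        -- The vehicle `m` with priority does not pass the intersection during the step: this would
        -- be an event.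
        rcases le_or_gt (C.off m k + C.len m) (B m) with h4 | h4
        · have := hE.target m _ (Or.inr ⟨k, hc.symm, Or.inr rfl⟩) h2 h4
          linarith [hrp m]
        · exact (hrB m).trans_lt h4
  constructor
  · intro h
    obtain ⟨k, hk, hik, e⟩ := h.exists_root h0 hr
    rw [hroot_iff] at hk
    refine le_antisymm (hrB i) ?_
    rw [e, hroot k hk]
    exact (hB i).2.1 k hk hik
  · intro h
    rcases (hB i).2.2 with h1 | ⟨k, hk, hik, e⟩
    · exact .root (Or.inr (Or.inl (h.trans h1)))
    · exact stop_of_queue h0 hr hik (.root ((hroot_iff k).2 hk)) (by rw [h, e, hroot k hk])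

/-- Until the next event, every vehicle moves at full speed up to the point that it can reach. -/
theorem SolvesAll.pos_add (h0 : C.Apart) (hv : 0 < C.maxSpeed) (hF : C.SolvesAll P F) {t d : ℝ}
    (ht : 0 ≤ t) {B : Fin n → ℝ} (hB : C.IsReach P t (pos F t) B)
    (hE : C.NoEvent t (pos F t) B d) {s : ℝ} (hs : 0 ≤ s) (hsd : s ≤ d) (i : Fin n) :
    pos F (t + s) i = min (pos F t i + C.maxSpeed * s) (B i) := by
  have hle := hB.le h0 (hF.inOrder ht) (fun i => hF.pos_le i t)
  have hcl : IsClosed {s | ∀ i, pos F (t + s) i = min (pos F t i + C.maxSpeed * s) (B i)} := by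
    rw [Set.ofPred_forall]
    refine isClosed_iInter fun i => isClosed_eq ?_ (by fun_prop)
    exact (hF.continuous i).comp (continuous_const.add continuous_id)
  refine (hcl.inter isClosed_Icc).Icc_subset_of_forall_mem_nhdsWithin ?_ ?_ ⟨hs, hsd⟩ i
  · intro i
    rw [add_zero, mul_zero, add_zero, min_eq_left (hle i)]
  · rintro s ⟨he, hs, hsd⟩
    have hiff := stop_iff_of_noEvent h0 (hF.inOrder (add_nonneg ht hs)) hle hB hE hs hsd hv he
    have htend : Tendsto (fun r => t + r) (𝓝[>] s) (𝓝[>] (t + s)) := by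
      refine tendsto_nhdsWithin_iff.2 ⟨?_, ?_⟩
      · exact ((continuous_const.add continuous_id).tendsto s).mono_left nhdsWithin_le_nhds
      · filter_upwards [self_mem_nhdsWithin] with r hr
        exact add_lt_add_right hr t
    refine eventually_all.2 fun i => ?_
    -- A vehicle that stands still has reached `B i` and remains there; any other one moves at full
    -- speed.
    by_cases hi : C.Stop P (t + s) (pos F (t + s)) i
    · filter_upwards [htend.eventually (hF.eventually_halt hi), self_mem_nhdsWithin] with r h1 h2
      have h3 := (hiff i).1 hi
      have h4 := he i
      rw [h1, h3, min_eq_right]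
      rw [h3] at h4
      have : B i ≤ pos F t i + C.maxSpeed * s := h4.trans_le (min_le_left _ _)
      have : C.maxSpeed * s ≤ C.maxSpeed * r := mul_le_mul_of_nonneg_left (le_of_lt h2) hv.le
      linarith
    · have h3 : pos F (t + s) i ≠ B i := fun h => hi ((hiff i).2 h)
      have h4 : pos F (t + s) i = pos F t i + C.maxSpeed * s := by
        rcases min_choice (pos F t i + C.maxSpeed * s) (B i) with h5 | h5
        · rw [he i, h5]
        · exact absurd ((he i).trans h5) h3
      have h5 : pos F t i + C.maxSpeed * s < B i :=
        lt_of_le_of_ne (h4 ▸ (he i).trans_le (min_le_right _ _)) (h4 ▸ h3)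
      have h6 : ∀ᶠ r in 𝓝[>] s, pos F t i + C.maxSpeed * r < B i := by
        have hc : Continuous fun r => pos F t i + C.maxSpeed * r := by fun_prop
        exact (hc.continuousAt.eventually_lt continuousAt_const h5).filter_mono nhdsWithin_le_nhds
      filter_upwards [htend.eventually (hF.eventually_move hi), h6] with r h1 h2
      rw [h1, h4, min_eq_left h2.le]
      ring

/-! ### Event times -/

section Events

variable {t d : ℝ} {B : Fin n → ℝ}

/-- At the beginning of a step, vehicle `i` has entered the point `q` of its lane if it is at `q` or
beyond and is not kept there. -/
theorem SolvesAll.entry_le_iff (h0 : C.Apart) (hv : 0 < C.maxSpeed) (hF : C.SolvesAll P F)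
    (ht : 0 ≤ t) (hB : C.IsReach P t (pos F t) B) (hE : C.NoEvent t (pos F t) B d) (hd : 0 < d)
    (i : Fin n) (q : ℝ) :
    firstTime (fun t => q < pos F t i) ≤ t ↔ q ≤ pos F t i ∧ q < B i := by
  constructor
  · intro h
    have h1 : ∀ s, 0 < s → q < pos F (t + s) i := by
      intro s hs
      obtain ⟨r, h2, h3⟩ := firstTime_lt (lt_of_le_of_lt h
        (EReal.coe_lt_coe_iff.2 (lt_add_of_pos_right t hs)))
      exact h2.trans_le ((hF.isSpeed i).mono (EReal.coe_lt_coe_iff.1 h3).le)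
    constructor
    · by_contra h2
      rw [not_le] at h2
      have h3 : ∀ᶠ s in 𝓝[>] t, pos F s i < q :=
        ((hF.continuous i).continuousAt.eventually_lt continuousAt_const h2).filter_mono
          nhdsWithin_le_nhds
      obtain ⟨s, h4, h5⟩ := (h3.and self_mem_nhdsWithin).exists
      have := h1 (s - t) (sub_pos.2 h5)
      rw [add_sub_cancel] at this
      exact lt_asymm this h4
    · have := h1 d hd
      rw [hF.pos_add h0 hv ht hB hE hd.le le_rfl] at this
      exact this.trans_le (min_le_right _ _)
  · rintro ⟨h1, h2⟩
    by_contra h3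
    rw [not_le] at h3
    obtain ⟨r, h4, h5⟩ := EReal.lt_iff_exists_real_btwn.1 h3
    rw [EReal.coe_lt_coe_iff] at h4
    set s := min (r - t) d with hs
    have hs0 : 0 < s := lt_min (sub_pos.2 h4) hd
    have h6 : q < pos F (t + s) i := by
      rw [hF.pos_add h0 hv ht hB hE hs0.le (min_le_right _ _)]
      exact lt_min (h1.trans_lt (lt_add_of_pos_right _ (mul_pos hv hs0))) h2
    have h7 := firstTime_le (p := fun t => q < pos F t i) h6
    have h8 : t + s ≤ r := by linarith [min_le_left (r - t) d]
    exact (not_le.2 h5) (h7.trans (EReal.coe_le_coe_iff.2 h8))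

/-- A point is entered only at an event. -/
theorem SolvesAll.entry_ge (h0 : C.Apart) (hv : 0 < C.maxSpeed) (hF : C.SolvesAll P F)
    (ht : 0 ≤ t) (hB : C.IsReach P t (pos F t) B) (hE : C.NoEvent t (pos F t) B d) (hd : 0 < d)
    {i : Fin n} {q : ℝ} (hq : C.IsTarget i q) (h : t < firstTime (fun t => q < pos F t i)) :
    ((t + d : ℝ) : EReal) ≤ firstTime (fun t => q < pos F t i) := by
  refine le_sInf ?_
  rintro _ ⟨r, hr, rfl⟩
  rw [EReal.coe_le_coe_iff]
  by_contra h1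
  rw [not_le] at h1
  have h2 : t < r := EReal.coe_lt_coe_iff.1 (h.trans_le (firstTime_le hr))
  have h3 := hF.pos_add h0 hv ht hB hE (s := r - t) (by linarith) (by linarith) i
  rw [add_sub_cancel] at h3
  have h4 : q < pos F r i := hr
  rw [h3, lt_min_iff] at h4
  have h5 := (hF.entry_le_iff h0 hv ht hB hE hd i q).not.1 (not_le.2 h)
  have h6 : pos F t i < q := by
    by_contra h7
    exact h5 ⟨not_lt.1 h7, h4.2⟩
  have h7 := hE.target i q hq h6 h4.2.le
  have h8 : C.maxSpeed * (r - t) < C.maxSpeed * d := mul_lt_mul_of_pos_left (by linarith) hv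
  linarith [h4.1]

theorem SolvesAll.reach_le_iff (hF : C.SolvesAll P F) (i : Fin n) (q : ℝ) :
    firstTime (fun t => q ≤ pos F t i) ≤ t ↔ q ≤ pos F t i := by
  constructor
  · intro h
    by_contra h2
    rw [not_le] at h2
    have h3 : ∀ᶠ s in 𝓝[>] t, pos F s i < q :=
      ((hF.continuous i).continuousAt.eventually_lt continuousAt_const h2).filter_mono
        nhdsWithin_le_nhds
    obtain ⟨s, h4, h5⟩ := (h3.and self_mem_nhdsWithin).exists
    obtain ⟨r, h6, h7⟩ := firstTime_lt (lt_of_le_of_lt h (EReal.coe_lt_coe_iff.2 h5))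
    have h8 : pos F r i ≤ pos F s i := (hF.isSpeed i).mono (EReal.coe_lt_coe_iff.1 h7).le
    exact (not_lt.2 (h6.trans h8)) h4
  · exact fun h => firstTime_le h

/-- A target is reached only at an event. -/
theorem SolvesAll.reach_ge (h0 : C.Apart) (hv : 0 < C.maxSpeed) (hF : C.SolvesAll P F)
    (ht : 0 ≤ t) (hB : C.IsReach P t (pos F t) B) (hE : C.NoEvent t (pos F t) B d)
    {i : Fin n} {q : ℝ} (hq : C.IsTarget i q) (h : t < firstTime (fun t => q ≤ pos F t i)) :
    ((t + d : ℝ) : EReal) ≤ firstTime (fun t => q ≤ pos F t i) := by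
  refine le_sInf ?_
  rintro _ ⟨r, hr, rfl⟩
  rw [EReal.coe_le_coe_iff]
  by_contra h1
  rw [not_le] at h1
  have h2 : t < r := EReal.coe_lt_coe_iff.1 (h.trans_le (firstTime_le hr))
  have h3 := hF.pos_add h0 hv ht hB hE (s := r - t) (by linarith) (by linarith) i
  rw [add_sub_cancel] at h3
  have h4 : q ≤ pos F r i := hr
  rw [h3, le_min_iff] at h4
  have h6 : pos F t i < q := not_le.1 ((hF.reach_le_iff i q).not.1 (not_le.2 h))
  have h7 := hE.target i q hq h6 h4.2
  have h8 : C.maxSpeed * (r - t) < C.maxSpeed * d := mul_lt_mul_of_pos_left (by linarith) hv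
  linarith [h4.1]

end Events

theorem CrossAt.entryTime_eq {i j : Fin n} {χ : Pt} (h : C.CrossAt i j χ) :
    C.entryTime F i χ = firstTime fun t => C.off i j < pos F t i := by
  rw [← h.offset_left]; rfl

theorem CrossAt.exitTime_eq {i j : Fin n} {χ : Pt} (h : C.CrossAt i j χ) :
    C.exitTime F i χ = firstTime fun t => C.off i j + C.len i ≤ pos F t i := by
  rw [← h.offset_left]; rfl

/-- A vehicle does not go beyond its goal, so that arrival means that it has covered the distance.
-/
theorem SolvesAll.arrivalTime_eq (hF : C.SolvesAll P F) (i : Fin n) :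
    C.arrivalTime F i = firstTime fun t => C.dist i ≤ pos F t i := by
  rw [arrivalTime]
  congr 1
  funext t
  rw [C.front_eq_goal, eq_iff_iff]
  exact ⟨fun h => h.ge, fun h => le_antisymm (hF.pos_le i t) h⟩

/-! ### Collisions in terms of event times -/

/-- Two vehicles do not collide at their intersection if and only if one of them leaves it before
the other one enters it. -/
theorem SolvesAll.no_collision_iff (hF : C.SolvesAll P F) {i j : Fin n} (hc : C.Cross i j) :
    (∀ t, 0 ≤ t → C.Clear i j (pos F t i) (pos F t j)) ↔
      firstTime (fun t => C.off i j + C.len i ≤ pos F t i) ≤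
          firstTime (fun t => C.off j i < pos F t j) ∨
        firstTime (fun t => C.off j i + C.len j ≤ pos F t j) ≤
          firstTime (fun t => C.off i j < pos F t i) := by
  have hent : ∀ k q (t : ℝ), firstTime (fun t => q < pos F t k) < t → q < pos F t k := by
    intro k q t h
    obtain ⟨s, h1, h2⟩ := firstTime_lt h
    exact h1.trans_le ((hF.isSpeed k).mono (EReal.coe_lt_coe_iff.1 h2).le)
  have hent' : ∀ k q (t : ℝ), q < pos F t k → firstTime (fun t => q < pos F t k) < t := by
    intro k q t h
    have h3 : ∀ᶠ s in 𝓝[<] t, q < pos F s k :=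
      (continuousAt_const.eventually_lt (hF.continuous k).continuousAt h).filter_mono
        nhdsWithin_le_nhds
    obtain ⟨s, h4, h5⟩ := (h3.and self_mem_nhdsWithin).exists
    exact (firstTime_le (p := fun t => q < pos F t k) h4).trans_lt (EReal.coe_lt_coe_iff.2 h5)
  -- A vehicle leaves an intersection strictly after it has entered, since it has a positive length.
  have hlt : ∀ k (q : ℝ), -C.len k < q →
      firstTime (fun t => q + C.len k ≤ pos F t k) ≠ ⊤ →
      firstTime (fun t => q < pos F t k) < firstTime (fun t => q + C.len k ≤ pos F t k) := by
    intro k q hq hne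
    have hr := fun t => hF.reach_le_iff (t := t) k (q + C.len k)
    generalize firstTime (fun t => q + C.len k ≤ pos F t k) = x at hne hr
    induction x with
    | top => exact absurd rfl hne
    | bot =>
      have := (hr 0).1 bot_le
      rw [pos_zero (hF.isSpeed k)] at this
      linarith
    | coe r => exact hent' k q r (by linarith [(hr r).1 le_rfl, C.len_pos k])
  constructor
  · intro h
    by_contra h1
    rw [not_or, not_le, not_le] at h1
    obtain ⟨h1, h2⟩ := h1
    -- If each vehicle enters before the other one leaves, then at some time both are at the
    -- intersection.
    have h3 : ∀ {k l : Fin n} {q q' : ℝ}, -C.len k < q →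
        firstTime (fun t => q < pos F t k) < firstTime (fun t => q' ≤ pos F t l) →
        firstTime (fun t => q < pos F t k) < firstTime (fun t => q + C.len k ≤ pos F t k) := by
      intro k l q q' hq hlt'
      rcases eq_or_ne (firstTime (fun t => q + C.len k ≤ pos F t k)) ⊤ with e | e
      · rw [e]; exact hlt'.trans_le le_top
      · exact hlt k q hq e
    have h4 := h3 hc.2.1 h2
    have h5 := h3 hc.2.2.2.1 h1
    obtain ⟨t, h6, h7⟩ := EReal.lt_iff_exists_real_btwn.1
      (max_lt (lt_min h4 h2) (lt_min h1 h5))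
    have ent_i := hent i _ t ((le_max_left _ _).trans_lt h6)
    have ent_j := hent j _ t ((le_max_right _ _).trans_lt h6)
    have ex_i := (hF.reach_le_iff i _).not.1 (not_le.2 (h7.trans_le (min_le_left _ _)))
    have ex_j := (hF.reach_le_iff j _).not.1 (not_le.2 (h7.trans_le (min_le_right _ _)))
    rw [not_le] at ex_i ex_j
    -- Before time 0 the vehicles are at their starts, as at time 0.
    rcases lt_or_ge t 0 with ht | ht
    · have e : ∀ k, pos F t k = pos F 0 k := fun k =>
        ((hF.isSpeed k).eq_zero ht.le).trans (pos_zero (hF.isSpeed k)).symm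
      rw [e] at ent_i ent_j ex_i ex_j
      exact (h 0 le_rfl).1 hc.1 ⟨by linarith, ent_i, by linarith, ent_j⟩
    · exact (h t ht).1 hc.1 ⟨by linarith, ent_i, by linarith, ent_j⟩
  · intro h t _
    refine ⟨fun _ h' => ?_, fun h' => ?_, fun h' => ?_⟩
    · obtain ⟨h1, h2, h3, h4⟩ := h'
      rcases h with h | h
      · have := (hF.reach_le_iff i _).1 (h.trans (hent' j _ t h4).le)
        linarith
      · have := (hF.reach_le_iff j _).1 (h.trans (hent' i _ t h2).le)
        linarith
    · have := C.inner_same h'.1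
      rw [hc.1] at this; norm_num at this
    · have := C.inner_opp h'.1
      rw [hc.1] at this; norm_num at this

/-- The full-speed profiles are valid if and only if all vehicles arrive in time and no two of them
collide, which can be seen from the event times and the goals. -/
theorem SolvesAll.valid_iff (h0 : C.Apart) (hF : C.SolvesAll P F) :
    C.Valid F ↔
      (∀ i, firstTime (fun t => C.dist i ≤ pos F t i) ≤ ((C.vehicle i).deadline : EReal)) ∧
      (∀ i j, C.Opp i j → 0 ≤ C.off i j → C.dist i + C.dist j ≤ C.off i j) ∧
      ∀ i j, C.Cross i j →
        firstTime (fun t => C.off i j + C.len i ≤ pos F t i) ≤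
            firstTime (fun t => C.off j i < pos F t j) ∨
          firstTime (fun t => C.off j i + C.len j ≤ pos F t j) ≤
            firstTime (fun t => C.off i j < pos F t i) := by
  constructor
  · intro h
    refine ⟨fun i => firstTime_le (h.pos_deadline i).ge, fun i j => h.opp_dist_le, fun i j hc => ?_⟩
    exact (hF.no_collision_iff hc).1 fun t _ => h.clear hc.ne t
  · rintro ⟨h1, h2, h3⟩
    refine hF.valid (fun i => le_antisymm (hF.pos_le i _) ((hF.reach_le_iff i _).1 (h1 i))) ?_
    intro t ht i j hij
    by_cases ho : inner ℝ (C.vehicle i).dir (C.vehicle j).dir = 0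
    · by_cases hc : C.Cross i j
      · exact (hF.no_collision_iff hc).2 (h3 i j hc) t ht
      · refine ⟨fun _ h' => hc ?_, fun h' => ?_, fun h' => ?_⟩
        · obtain ⟨h4, h5, h6, h7⟩ := h'
          have pi : 0 ≤ pos F t i := (hF.isSpeed i).nonneg t
          have pj : 0 ≤ pos F t j := (hF.isSpeed j).nonneg t
          exact ⟨ho, by linarith, h5.trans_le (hF.pos_le i t), by linarith,
            h7.trans_le (hF.pos_le j t)⟩
        · have := C.inner_same h'.1
          rw [ho] at this; norm_num at this
        · have := C.inner_opp h'.1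
          rw [ho] at this; norm_num at this
    · exact hF.clear_of_lane (h0 i j hij) ho (h2 i j) ht

end Crossing
end Traffic

namespace Traffic

/-! ### Terms and commands for the random access machine -/

/-- The lesser positive one of two integers, where nonpositive integers count as absent. -/
def leastPos (a c : ℤ) : ℤ := if 0 < c then (if 0 < a then min a c else c) else a

/-- Iteration of `f 0`, …, `f (N - 1)`. -/
def iter {α : Type*} (f : ℕ → α → α) : ℕ → α → α
  | 0, a => a
  | N + 1, a => f N (iter f N a)

/-- Terms over the registers and the memory banks. In `sum k i e` and `least k i e`, register `k`
ranges over the numbers below the content of register 2, and the values of `e` are added to the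
value of `i`, or the least positive value is taken. -/
inductive Term where
  | const (c : ℤ)
  | var (x : ℕ)
  | add (a b : Term)
  | sub (a b : Term)
  | mul (a b : Term)
  | load (a : ℕ) (e : Term)
  | ite (c a b : Term)
  | sum (k : ℕ) (i e : Term)
  | least (k : ℕ) (i e : Term)

/-- The range of all bounded loops: the content of register 2. -/
def State.count (s : State) : ℕ := (s.reg 2).toNat

namespace Term

/-- The value of a term in a machine state. Like the machine, terms treat positive numbers as true,
and negative addresses as 0. -/
def eval : Term → State → ℤ
  | const c, _ => c
  | var x, s => s.reg x
  | add a b, s => a.eval s + b.eval s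
  | sub a b, s => a.eval s - b.eval s
  | mul a b, s => a.eval s * b.eval s
  | load a e, s => s.bank a (e.eval s).toNat
  | ite c a b, s => if 0 < c.eval s then a.eval s else b.eval s
  | sum k i e, s => iter (fun j z => z + e.eval (s.setReg k j)) s.count (i.eval s)
  | least k i e, s => iter (fun j z => leastPos z (e.eval (s.setReg k j))) s.count (i.eval s)

end Term

namespace Prog

/-- `x := y`, for `x ≠ y`. -/
def move (x y : ℕ) : Prog := seq (const x 0) (add x y x)

/-- A loop in which register `k` runs through the numbers below the content of register 2, with
auxiliary registers `c` and `c + 1`. -/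
def forLoop (k c : ℕ) (p : Prog) : Prog :=
  seq (const k 0) (seq (sub c 2 k)
    (loop c (seq p (seq (const (c + 1) 1) (seq (add k k (c + 1)) (sub c 2 k))))))

/-- `x := leastPos x y`, with auxiliary register `y + 1`. -/
def leastCode (x y : ℕ) : Prog :=
  branch y (branch x (seq (sub (y + 1) x y) (branch (y + 1) (move x y) (const (y + 1) 0)))
    (move x y)) (const (y + 1) 0)

end Prog

open Prog in

/-- The code that leaves the value of a term in register `r`, where the registers from `r` on are
free. -/
def Term.code : Term → ℕ → Prog
  | const c, r => .const r c
  | var x, r => move r x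
  | add a b, r => seq (a.code r) (seq (b.code (r + 1)) (.add r r (r + 1)))
  | sub a b, r => seq (a.code r) (seq (b.code (r + 1)) (.sub r r (r + 1)))
  | mul a b, r => seq (a.code r) (seq (b.code (r + 1)) (.mul r r (r + 1)))
  | load a e, r => seq (e.code r) (.load r a r)
  | ite c a b, r => seq (c.code r) (branch r (a.code r) (b.code r))
  | sum k i e, r => seq (i.code r) (seq (move (r + 1) k) (seq
      (forLoop k (r + 2) (seq (e.code (r + 3)) (.add r r (r + 3)))) (move k (r + 1))))
  | least k i e, r => seq (i.code r) (seq (move (r + 1) k) (seq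
      (forLoop k (r + 2) (seq (e.code (r + 3)) (leastCode r (r + 3)))) (move k (r + 1))))

@[simp] theorem State.setReg_reg (s : State) (x y : ℕ) (z : ℤ) :
    (s.setReg x z).reg y = if y = x then z else s.reg y := by
  simp [State.setReg, Function.update_apply]

@[simp] theorem State.setReg_bank (s : State) (x : ℕ) (z : ℤ) : (s.setReg x z).bank = s.bank := rfl

theorem bitLen_pos (z : ℤ) : 1 ≤ bitLen z := by simp [bitLen]

theorem bitLen_le {z : ℤ} {m : ℕ} (h : z.natAbs < 2 ^ m) : bitLen z ≤ m + 1 :=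
  Nat.succ_le_succ (Nat.size_le.2 h)

theorem bitLen_mono {y z : ℤ} (h : y.natAbs ≤ z.natAbs) : bitLen y ≤ bitLen z :=
  Nat.succ_le_succ (Nat.size_le_size h)

theorem bitLen_two_mul {z : ℤ} {m d : ℕ} (hm : 1 ≤ m) (hd : 1 ≤ d) (h : z.natAbs < 2 ^ (m * d)) :
    bitLen z ≤ 2 * (m * d) := by
  have := bitLen_le h
  have := Nat.mul_le_mul hm hd
  omega

theorem run_move (s : State) {x y : ℕ} (h : x ≠ y) :
    (Prog.move x y).Run s (s.setReg x (s.reg y)) (2 + bitLen (s.reg y)) := by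
  have h1 := Prog.Run.seq (Prog.Run.const s x 0) (Prog.Run.add (s.setReg x 0) x y x)
  have e : (s.setReg x 0).setReg x ((s.setReg x 0).reg y + (s.setReg x 0).reg x)
      = s.setReg x (s.reg y) := by
    simp [State.setReg, h.symm]
  rw [e] at h1
  convert! h1 using 1
  simp [h.symm, bitLen]
  omega

/-- Correctness and cost of a bounded loop, for an invariant `Inv` that does not depend on the
auxiliary registers. -/
theorem run_forLoop {k c N m B : ℕ} {p : Prog} (hk : k ≠ 2) (hc : c ≠ 2) (hc' : c + 1 ≠ 2)
    (hkc : k ≠ c) (hkc' : k ≠ c + 1) (hN : bitLen N ≤ m) (Inv : ℕ → State → Prop)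
    (hst : ∀ j s z, Inv j s → Inv j (s.setReg c z)) (hst' : ∀ j s z, Inv j s → Inv j (s.setReg (c + 1) z))
    (hstep : ∀ j s, j < N → Inv j s → s.reg k = j → s.reg 2 = N → ∃ s' d, p.Run s s' d ∧ d ≤ B ∧
      s'.reg k = j ∧ s'.reg 2 = N ∧ Inv (j + 1) (s'.setReg k ((j + 1 : ℕ) : ℤ)))
    (s : State) (hs : s.reg 2 = N) (h0 : Inv 0 (s.setReg k ((0 : ℕ) : ℤ))) :
    ∃ s' d, (Prog.forLoop k c p).Run s s' d ∧ d ≤ N * (B + 8 * m) + 8 * m ∧ Inv N s' ∧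
      s'.reg 2 = N := by
  have hm : 1 ≤ m := (bitLen_pos _).trans hN
  have hb : ∀ z : ℤ, z.natAbs ≤ N → bitLen z ≤ m := fun z hz => (bitLen_mono (by simpa using hz)).trans hN
  -- Here `i` is the number of iterations that remain, and `j` the content of the counter.
  have main : ∀ i j s, i + j = N → Inv j s → s.reg k = j → s.reg 2 = N → s.reg c = (N : ℤ) - j →
      ∃ s' d, (Prog.loop c (Prog.seq p (Prog.seq (Prog.const (c + 1) 1) (Prog.seq
        (Prog.add k k (c + 1)) (Prog.sub c 2 k))))).Run s s' d ∧ d ≤ i * (B + 8 * m) + m ∧ Inv N s' ∧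
        s'.reg 2 = N := by
    intro i
    induction i with
    | zero =>
      intro j s hj hI h1 h2 h3
      obtain rfl : j = N := by omega
      rw [sub_self] at h3
      refine ⟨s, _, Prog.Run.loop_done (by rw [h3]; exact lt_irrefl _), ?_, hI, h2⟩
      rw [h3, zero_mul, zero_add]
      exact hb 0 (by simp)
    | succ i ih =>
      intro j s hj hI h1 h2 h3
      obtain ⟨s1, d1, r1, l1, e1, e2, I1⟩ := hstep j s (by omega) hI h1 h2
      set s2 := s1.setReg (c + 1) 1 with hs2
      set s3 := s2.setReg k (s2.reg k + s2.reg (c + 1)) with hs3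
      set s4 := s3.setReg c (s3.reg 2 - s3.reg k) with hs4
      have ek2 : s2.reg k = j := by rw [hs2, State.setReg_reg, if_neg hkc', e1]
      have ec2 : s2.reg (c + 1) = 1 := by rw [hs2, State.setReg_reg, if_pos rfl]
      have ek3 : s3.reg k = ((j + 1 : ℕ) : ℤ) := by
        rw [hs3, State.setReg_reg, if_pos rfl, ek2, ec2]; push_cast; ring
      have e23 : s3.reg 2 = N := by
        rw [hs3, State.setReg_reg, if_neg hk.symm, hs2, State.setReg_reg, if_neg hc'.symm, e2]
      have e3 : s3 = (s1.setReg k ((j + 1 : ℕ) : ℤ)).setReg (c + 1) 1 := by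
        rw [hs3, ek2, ec2, hs2]
        simp only [State.setReg]
        rw [Function.update_comm hkc']
        push_cast
        rfl
      have I4 : Inv (j + 1) s4 := by
        rw [hs4]; exact hst _ _ _ (by rw [e3]; exact hst' _ _ _ I1)
      have ek4 : s4.reg k = ((j + 1 : ℕ) : ℤ) := by rw [hs4, State.setReg_reg, if_neg hkc, ek3]
      have e24 : s4.reg 2 = N := by rw [hs4, State.setReg_reg, if_neg hc.symm, e23]
      have ec4 : s4.reg c = (N : ℤ) - ((j + 1 : ℕ) : ℤ) := by
        rw [hs4, State.setReg_reg, if_pos rfl, e23, ek3]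
      obtain ⟨s', d, r, l, hI', h2'⟩ := ih (j + 1) s4 (by omega) I4 ek4 e24 ec4
      refine ⟨s', _, Prog.Run.loop_step (by rw [h3]; omega) (Prog.Run.seq r1 (Prog.Run.seq
        (Prog.Run.const s1 (c + 1) 1) (Prog.Run.seq (Prog.Run.add s2 k k (c + 1))
          (Prog.Run.sub s3 c 2 k)))) r, ?_, hI', h2'⟩
      rw [h3, ek2, ec2, e23, ek3]
      have b1 := hb ((N : ℤ) - j) (by omega)
      have b2 := hb (j : ℤ) (by omega)
      have b3 := hb ((j + 1 : ℕ) : ℤ) (by omega)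
      have b4 : bitLen 1 = 2 := by simp [bitLen]
      rw [add_mul, one_mul]
      rw [b4]
      omega
  set s1 := s.setReg k ((0 : ℕ) : ℤ) with hs1
  set s2 := s1.setReg c (s1.reg 2 - s1.reg k) with hs2
  have ek1 : s1.reg k = ((0 : ℕ) : ℤ) := by rw [hs1, State.setReg_reg, if_pos rfl]
  have e21 : s1.reg 2 = N := by rw [hs1, State.setReg_reg, if_neg hk.symm, hs]
  obtain ⟨s', d, r, l, hI, h2⟩ := main N 0 s2 (by omega) (hst _ _ _ h0)
    (by rw [hs2, State.setReg_reg, if_neg hkc, ek1]) (by rw [hs2, State.setReg_reg, if_neg hc.symm, e21])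
    (by rw [hs2, State.setReg_reg, if_pos rfl, e21, ek1])
  refine ⟨s', _, Prog.Run.seq (Prog.Run.const s k 0) (Prog.Run.seq (Prog.Run.sub s1 c 2 k) r), ?_,
    hI, h2⟩
  rw [e21, ek1]
  have b1 : bitLen 0 = 1 := by simp [bitLen]
  have b2 := hb ((0 : ℕ) : ℤ) (by simp)
  rw [b1]
  omega

/-! ### Values and costs of terms -/

/-- The number of registers that are available for variables; the registers from here on hold
intermediate results. -/
def numVars : ℕ := 16

/-- The variables and the memory of the machine state `s` are as in `env`. -/
def Sim (env s : State) : Prop := (∀ x < numVars, s.reg x = env.reg x) ∧ s.bank = env.bank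

/-- The intermediate results below register `r` are the same in `s` and `s'`. -/
def Frame (r : ℕ) (s s' : State) : Prop := ∀ x, numVars ≤ x → x < r → s'.reg x = s.reg x

/-- All variables and memory cells have at most `m` bits. -/
def Bdd (m : ℕ) (env : State) : Prop :=
  (∀ x < numVars, (env.reg x).natAbs < 2 ^ m) ∧ ∀ a k, (env.bank a k).natAbs < 2 ^ m

namespace Term

/-- Variables are in range, and loops do not change register 2. -/
def ok : Term → Bool
  | const _ => true
  | var x => decide (x < numVars)
  | add a b | sub a b | mul a b => a.ok && b.ok
  | load _ e => e.ok
  | ite c a b => c.ok && (a.ok && b.ok)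
  | sum k i e | least k i e => decide (k < numVars) && (decide (k ≠ 2) && (i.ok && e.ok))

/-- The term does not depend on the memory bank `d`. -/
def avoids (d : ℕ) : Term → Bool
  | const _ => true
  | var _ => true
  | add a b | sub a b | mul a b => a.avoids d && b.avoids d
  | load a e => decide (a ≠ d) && e.avoids d
  | ite c a b => c.avoids d && (a.avoids d && b.avoids d)
  | sum _ i e | least _ i e => i.avoids d && e.avoids d

/-- The value of a term has at most `deg` times as many bits as the variables and the memory. -/
def deg : Term → ℕ
  | const c => bitLen c
  | var _ => 1
  | add a b | sub a b | mul a b => a.deg + b.deg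
  | load _ _ => 1
  | ite _ a b => a.deg + b.deg
  | sum _ i e | least _ i e => i.deg + e.deg + 1

/-- A bound for the cost of the evaluation of a term, per bit of the variables and the memory, where
`n` is the range of loops. -/
def cost (n : ℕ) : Term → ℕ
  | const c => bitLen c
  | var _ => 4
  | add a b | sub a b | mul a b => a.cost n + b.cost n + 2 * (a.deg + b.deg)
  | load _ e => e.cost n + 2 * (e.deg + 1)
  | ite c a b => c.cost n + 2 * c.deg + a.cost n + b.cost n
  | sum _ i e | least _ i e =>
    i.cost n + n * (e.cost n + 20 * (i.deg + e.deg + 1) + 16) + 24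

/-- The nesting depth of loops. -/
def depth : Term → ℕ
  | const _ => 0
  | var _ => 0
  | add a b | sub a b | mul a b => max a.depth b.depth
  | load _ e => e.depth
  | ite c a b => max c.depth (max a.depth b.depth)
  | sum _ i e | least _ i e => max i.depth e.depth + 1

theorem deg_pos (e : Term) : 1 ≤ e.deg := by
  induction e with
  | const c => exact bitLen_pos c
  | _ => simp only [deg] at *; omega

end Term

theorem Bdd.setReg {m : ℕ} {env : State} (h : Bdd m env) (k : ℕ) {z : ℤ} (hz : z.natAbs < 2 ^ m) :
    Bdd m (env.setReg k z) := by
  refine ⟨fun x hx => ?_, h.2⟩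
  rw [State.setReg_reg]
  split_ifs
  exacts [hz, h.1 x hx]

theorem Bdd.mono {m m' : ℕ} {env : State} (h : Bdd m env) (hm : m ≤ m') : Bdd m' env := by
  have := Nat.pow_le_pow_right (n := 2) (by norm_num) hm
  exact ⟨fun x hx => (h.1 x hx).trans_le this, fun a k => (h.2 a k).trans_le this⟩

theorem natAbs_leastPos_le (a c : ℤ) : (leastPos a c).natAbs ≤ a.natAbs + c.natAbs := by
  rw [leastPos]; split_ifs <;> omega

theorem iter_bound {f : ℕ → ℤ → ℤ} {v : ℕ → ℤ} {M N : ℕ} {z : ℤ}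
    (hf : ∀ j z, (f j z).natAbs ≤ z.natAbs + (v j).natAbs) (hv : ∀ j < N, (v j).natAbs ≤ M) :
    (iter f N z).natAbs ≤ z.natAbs + N * M := by
  induction N with
  | zero => simp [iter]
  | succ N ih =>
    have h1 := ih fun j hj => hv j (by omega)
    have h2 := hf N (iter f N z)
    have h3 := hv N (by omega)
    rw [iter, add_mul, one_mul]
    omega

theorem pow_add_pow_le {m d e : ℕ} (hm : 1 ≤ m) (hd : 1 ≤ d) (he : 1 ≤ e) :
    2 ^ (m * d) + 2 ^ (m * e) ≤ 2 ^ (m * (d + e)) := by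
  have h1 : 2 ≤ 2 ^ (m * d) := Nat.le_self_pow (Nat.mul_pos hm hd).ne' 2
  have h2 : 2 ≤ 2 ^ (m * e) := Nat.le_self_pow (Nat.mul_pos hm he).ne' 2
  rw [mul_add, pow_add]
  nlinarith

theorem iter_bound_pow {f : ℕ → ℤ → ℤ} {v : ℕ → ℤ} {m d e n N : ℕ} {z : ℤ} (hm : 1 ≤ m) (hd : 1 ≤ d)
    (hn : n < 2 ^ m) (hN : N ≤ n)
    (hf : ∀ j z, (f j z).natAbs ≤ z.natAbs + (v j).natAbs) (hv : ∀ j < n, (v j).natAbs < 2 ^ (m * e))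
    (hz : z.natAbs < 2 ^ (m * d)) : (iter f N z).natAbs < 2 ^ (m * (d + e + 1)) := by
  have h1 := iter_bound (z := z) (N := N) hf fun j hj => (hv j (hj.trans_le hN)).le
  have h2 := pow_add_pow_le hm hd (e := e + 1) (by omega)
  have h3 : N * 2 ^ (m * e) ≤ 2 ^ (m * (e + 1)) := by
    rw [mul_add, mul_one, pow_add, mul_comm]
    exact Nat.mul_le_mul_left _ (by omega)
  rw [add_assoc]
  omega

theorem State.count_setReg {s : State} {k : ℕ} (hk : k ≠ 2) (z : ℤ) :
    (s.setReg k z).count = s.count := by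
  simp [State.count, hk.symm]

theorem Bdd.count_lt {m : ℕ} {env : State} (h : Bdd m env) : env.count < 2 ^ m := by
  have := h.1 2 (by decide)
  simp only [State.count]
  omega

/-- The values of terms are bounded as stated by `Term.deg`. This uses that the range of loops is
itself less than `2 ^ m`, so that a sum adds at most `m` bits to its summands. -/
theorem Term.natAbs_eval_lt (e : Term) (he : e.ok = true) {m : ℕ} (hm : 1 ≤ m) {env : State}
    (h : Bdd m env) : (e.eval env).natAbs < 2 ^ (m * e.deg) := by
  induction e generalizing env with
  | const c =>
    have h1 : c.natAbs < 2 ^ c.natAbs.size := Nat.lt_size_self _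
    refine h1.trans_le (Nat.pow_le_pow_right (by norm_num) ?_)
    simp only [deg, bitLen]
    nlinarith
  | var x =>
    simp only [ok, decide_eq_true_eq] at he
    simpa [deg, eval] using h.1 x he
  | add a b iha ihb =>
    simp only [ok, Bool.and_eq_true] at he
    have h1 := iha he.1 h
    have h2 := ihb he.2 h
    have h3 := pow_add_pow_le hm a.deg_pos b.deg_pos
    simp only [eval, deg]
    omega
  | sub a b iha ihb =>
    simp only [ok, Bool.and_eq_true] at he
    have h1 := iha he.1 h
    have h2 := ihb he.2 h
    have h3 := pow_add_pow_le hm a.deg_pos b.deg_pos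
    simp only [eval, deg]
    omega
  | mul a b iha ihb =>
    simp only [ok, Bool.and_eq_true] at he
    have h1 := iha he.1 h
    have h2 := ihb he.2 h
    simp only [eval, deg, Int.natAbs_mul, mul_add, pow_add]
    exact Nat.mul_lt_mul'' h1 h2
  | load a e _ => simpa [deg, eval] using h.2 a _
  | ite c a b _ iha ihb =>
    simp only [ok, Bool.and_eq_true] at he
    have h1 := iha he.2.1 h
    have h2 := ihb he.2.2 h
    have h3 := pow_add_pow_le hm a.deg_pos b.deg_pos
    simp only [eval, deg]
    split_ifs <;> omega
  | sum k i e ihi ihe =>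
    simp only [ok, Bool.and_eq_true, decide_eq_true_eq] at he
    refine iter_bound_pow (v := fun j => e.eval (env.setReg k j)) hm i.deg_pos h.count_lt le_rfl
      (fun j z => Int.natAbs_add_le _ _) (fun j hj => ihe he.2.2.2 (h.setReg k ?_)) (ihi he.2.2.1 h)
    rw [Int.natAbs_natCast]; exact hj.trans h.count_lt
  | least k i e ihi ihe =>
    simp only [ok, Bool.and_eq_true, decide_eq_true_eq] at he
    refine iter_bound_pow (v := fun j => e.eval (env.setReg k j)) hm i.deg_pos h.count_lt le_rfl
      (fun j z => natAbs_leastPos_le _ _) (fun j hj => ihe he.2.2.2 (h.setReg k ?_)) (ihi he.2.2.1 h)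
    rw [Int.natAbs_natCast]; exact hj.trans h.count_lt

/-- The value of a term does not depend on a memory bank that the term avoids. -/
theorem Term.eval_congr (e : Term) {d : ℕ} (he : e.avoids d = true) {s s' : State}
    (hr : s.reg = s'.reg) (hb : ∀ a, a ≠ d → s.bank a = s'.bank a) : e.eval s = e.eval s' := by
  induction e generalizing s s' with
  | const c => rfl
  | var x => simp [eval, hr]
  | add a b iha ihb =>
    simp only [avoids, Bool.and_eq_true] at he
    simp only [eval, iha he.1 hr hb, ihb he.2 hr hb]
  | sub a b iha ihb =>
    simp only [avoids, Bool.and_eq_true] at he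
    simp only [eval, iha he.1 hr hb, ihb he.2 hr hb]
  | mul a b iha ihb =>
    simp only [avoids, Bool.and_eq_true] at he
    simp only [eval, iha he.1 hr hb, ihb he.2 hr hb]
  | load a e ih =>
    simp only [avoids, Bool.and_eq_true, decide_eq_true_eq] at he
    simp only [eval, ih he.2 hr hb, hb a he.1]
  | ite c a b ihc iha ihb =>
    simp only [avoids, Bool.and_eq_true] at he
    simp only [eval, ihc he.1 hr hb, iha he.2.1 hr hb, ihb he.2.2 hr hb]
  | sum k i e ihi ihe =>
    simp only [avoids, Bool.and_eq_true] at he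
    have h1 : ∀ j : ℕ, e.eval (s.setReg k j) = e.eval (s'.setReg k j) := fun j =>
      ihe he.2 (by simp [State.setReg, hr]) hb
    have h2 : s.count = s'.count := by simp [State.count, hr]
    simp only [eval, ihi he.1 hr hb, h1, h2]
  | least k i e ihi ihe =>
    simp only [avoids, Bool.and_eq_true] at he
    have h1 : ∀ j : ℕ, e.eval (s.setReg k j) = e.eval (s'.setReg k j) := fun j =>
      ihe he.2 (by simp [State.setReg, hr]) hb
    have h2 : s.count = s'.count := by simp [State.count, hr]
    simp only [eval, ihi he.1 hr hb, h1, h2]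

end Traffic

namespace Traffic

/-! ### Code for terms -/

theorem Sim.refl (s : State) : Sim s s := ⟨fun _ _ => rfl, rfl⟩

theorem Sim.temp {env s : State} (h : Sim env s) {x : ℕ} (hx : numVars ≤ x) (z : ℤ) :
    Sim env (s.setReg x z) := by
  refine ⟨fun y hy => ?_, h.2⟩
  rw [State.setReg_reg, if_neg (by omega)]
  exact h.1 y hy

theorem Sim.setReg {env s : State} (h : Sim env s) (x : ℕ) (z : ℤ) :
    Sim (env.setReg x z) (s.setReg x z) := by
  refine ⟨fun y hy => ?_, h.2⟩
  simp only [State.setReg_reg, h.1 y hy]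

theorem Frame.refl (r : ℕ) (s : State) : Frame r s s := fun _ _ _ => rfl

theorem Frame.trans {r : ℕ} {s s' s'' : State} (h : Frame r s s') (h' : Frame r s' s'') :
    Frame r s s'' := fun x h1 h2 => (h' x h1 h2).trans (h x h1 h2)

theorem Frame.mono {r r' : ℕ} {s s' : State} (h : Frame r' s s') (hr : r ≤ r') : Frame r s s' :=
  fun x h1 h2 => h x h1 (h2.trans_le hr)

theorem Frame.setReg {r : ℕ} {s s' : State} (h : Frame r s s') {x : ℕ}
    (hx : x < numVars ∨ r ≤ x) (z : ℤ) : Frame r s (s'.setReg x z) := by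
  intro y h1 h2
  rw [State.setReg_reg, if_neg (by omega)]
  exact h y h1 h2

/-- The program `q` combines the registers `r` and `r + 3` by the operation `op`. -/
def Combines (q : Prog) (r : ℕ) (op : ℤ → ℤ → ℤ) : Prop :=
  ∀ (s : State) (m D : ℕ), 1 ≤ m → 1 ≤ D → (s.reg r).natAbs < 2 ^ (m * D) →
    (s.reg (r + 3)).natAbs < 2 ^ (m * D) →
    ∃ s' d, q.Run s s' d ∧ s'.reg r = op (s.reg r) (s.reg (r + 3)) ∧
      (∀ x, x ≠ r → x ≠ r + 3 → x ≠ r + 4 → s'.reg x = s.reg x) ∧ s'.bank = s.bank ∧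
      d ≤ 20 * (m * D)

theorem combines_add (r : ℕ) : Combines (.add r r (r + 3)) r (· + ·) := by
  intro s m D hm hD h1 h2
  refine ⟨_, _, Prog.Run.add s r r (r + 3), by simp, fun x hx _ _ => by simp [hx], rfl, ?_⟩
  have := bitLen_two_mul hm hD h1
  have := bitLen_two_mul hm hD h2
  omega

theorem combines_least (r : ℕ) : Combines (Prog.leastCode r (r + 3)) r leastPos := by
  intro s m D hm hD h1 h2
  have b1 := bitLen_two_mul hm hD h1
  have b2 := bitLen_two_mul hm hD h2
  have hmD := Nat.mul_le_mul hm hD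
  have b0 : bitLen 0 = 1 := by simp [bitLen]
  by_cases hv : 0 < s.reg (r + 3)
  · by_cases ha : 0 < s.reg r
    · set s1 := s.setReg (r + 4) (s.reg r - s.reg (r + 3)) with hs1
      have e1 : s1.reg (r + 4) = s.reg r - s.reg (r + 3) := by simp [hs1]
      have b3 : bitLen (s.reg r - s.reg (r + 3)) ≤ m * D + 2 := by
        refine (bitLen_le (m := m * D + 1) ?_)
        rw [pow_succ]; omega
      by_cases hd : 0 < s1.reg (r + 4)
      · refine ⟨_, _, Prog.Run.branch_pos hv (Prog.Run.branch_pos ha (Prog.Run.seq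
          (Prog.Run.sub s (r + 4) r (r + 3)) (Prog.Run.branch_pos hd (run_move s1 (by omega))))), ?_,
          ?_, rfl, ?_⟩
        · rw [e1] at hd
          simp only [hs1, State.setReg_reg, if_true, leastPos, if_pos hv, if_pos ha]
          rw [if_neg (by omega), min_eq_right (by omega)]
        · intro x h3 h4 h5
          simp [hs1, h3, h5]
        · rw [e1]
          have : s1.reg (r + 3) = s.reg (r + 3) := by simp [hs1]
          rw [this]
          omega
      · refine ⟨_, _, Prog.Run.branch_pos hv (Prog.Run.branch_pos ha (Prog.Run.seq
          (Prog.Run.sub s (r + 4) r (r + 3)) (Prog.Run.branch_neg hd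
            (Prog.Run.const s1 (r + 4) 0)))), ?_, ?_, rfl, ?_⟩
        · rw [e1] at hd
          simp only [hs1, State.setReg_reg, leastPos, if_pos hv, if_pos ha]
          rw [if_neg (by omega), if_neg (by omega), min_eq_left (by omega)]
        · intro x h3 h4 h5
          simp [hs1, h5]
        · rw [e1, b0]
          omega
    · refine ⟨_, _, Prog.Run.branch_pos hv (Prog.Run.branch_neg ha (run_move s (by omega))), ?_,
        ?_, rfl, ?_⟩
      · simp [leastPos, hv, ha]
      · intro x h3 h4 h5
        simp [h3]
      · omega
  · refine ⟨_, _, Prog.Run.branch_neg hv (Prog.Run.const s (r + 4) 0), ?_, ?_, rfl, ?_⟩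
    · simp [leastPos, hv]
    · intro x h3 h4 h5
      simp [h5]
    · rw [b0]
      omega

/-- Evaluation of `e` in register `r`, at a cost of at most `B`. -/
def Evaluates (p : Prog) (env : State) (r : ℕ) (z : ℤ) (B : ℕ) : Prop :=
  ∀ s, Sim env s → ∃ s' d, p.Run s s' d ∧ Sim env s' ∧ Frame r s s' ∧ s'.reg r = z ∧ d ≤ B

/-- The code of a loop that combines the values of a term by the operation `op`. -/
theorem evaluates_reduce {q : Prog} {r : ℕ} {op : ℤ → ℤ → ℤ} (hq : Combines q r op)
    (hop : ∀ a c, (op a c).natAbs ≤ a.natAbs + c.natAbs) {pi pe : Prog} {env : State}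
    {k m Bi Be di de : ℕ} {zi : ℤ} {v : ℕ → ℤ} (hr : numVars ≤ r) (hk : k < numVars) (hk2 : k ≠ 2)
    (hm : 1 ≤ m) (hdi : 1 ≤ di) (hb : Bdd m env) (hi : Evaluates pi env r zi Bi)
    (hzi : zi.natAbs < 2 ^ (m * di))
    (he : ∀ j < env.count, Evaluates pe (env.setReg k j) (r + 3) (v j) Be)
    (hv : ∀ j < env.count, (v j).natAbs < 2 ^ (m * de)) :
    Evaluates (pi.seq ((Prog.move (r + 1) k).seq ((Prog.forLoop k (r + 2) (pe.seq q)).seq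
        (Prog.move k (r + 1))))) env r (iter (fun j z => op z (v j)) env.count zi)
      (Bi + env.count * (Be + 20 * (m * (di + de + 1)) + 16 * m) + 24 * m) := by
  intro s0 hs0
  have hn : numVars = 16 := rfl
  obtain ⟨s1, d1, r1, sim1, f1, e1, l1⟩ := hi s0 hs0
  set s2 := s1.setReg (r + 1) (s1.reg k) with hs2
  have r2 := run_move s1 (x := r + 1) (y := k) (by omega)
  set N := env.count with hN
  have hreg2 : ∀ (j : ℕ) s, Sim (env.setReg k j) s → s.reg 2 = env.reg 2 := by
    intro j s h
    rw [h.1 2 (by decide), State.setReg_reg, if_neg hk2.symm]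
  have h2N : ∀ {j : ℕ}, j < N → env.reg 2 = N := by
    intro j hj
    rw [hN, State.count] at hj ⊢
    omega
  -- After `j` iterations, register `r` contains the result for the first `j` values, and register
  -- `r + 1` saves the variable `k`.
  let Inv : ℕ → State → Prop := fun j s => Sim (env.setReg k j) s ∧ Frame r s0 s ∧
    s.reg r = iter (fun j z => op z (v j)) j zi ∧ s.reg (r + 1) = env.reg k
  have hbk : bitLen (env.reg k) ≤ m + 1 := bitLen_le (hb.1 k hk)
  have hbN : bitLen N ≤ 2 * m := by
    have := bitLen_le (z := (N : ℤ)) (m := m) (by rw [Int.natAbs_natCast]; exact hb.count_lt)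
    omega
  have esk : s1.reg k = env.reg k := sim1.1 k hk
  have hsim0 : Sim (env.setReg k ((0 : ℕ) : ℤ)) (s2.setReg k ((0 : ℕ) : ℤ)) :=
    (sim1.temp (by omega) _).setReg k _
  have hframe0 : Frame r s0 (s2.setReg k ((0 : ℕ) : ℤ)) :=
    (f1.setReg (Or.inr (by omega)) _).setReg (Or.inl hk) _
  have hI0 : Inv 0 (s2.setReg k ((0 : ℕ) : ℤ)) := by
    refine ⟨hsim0, hframe0, ?_, ?_⟩
    · rw [State.setReg_reg, if_neg (by omega), hs2, State.setReg_reg, if_neg (by omega), e1]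
      rfl
    · rw [State.setReg_reg, if_neg (by omega), hs2, State.setReg_reg, if_pos rfl, esk]
  have hloop : ∃ s3 d3, (Prog.forLoop k (r + 2) (pe.seq q)).Run s2 s3 d3 ∧
      d3 ≤ N * (Be + 20 * (m * (di + de + 1)) + 16 * m) + 16 * m ∧ Inv N s3 := by
    by_cases hpos : 0 ≤ env.reg 2
    · have e2N : env.reg 2 = N := by
        rw [hN, State.count]; omega
      have hstep : ∀ j s, j < N → Inv j s → s.reg k = j → s.reg 2 = N → ∃ s' d,
          (pe.seq q).Run s s' d ∧ d ≤ Be + 20 * (m * (di + de + 1)) ∧ s'.reg k = j ∧ s'.reg 2 = N ∧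
          Inv (j + 1) (s'.setReg k ((j + 1 : ℕ) : ℤ)) := by
        rintro j s hj ⟨i1, i2, i3, i4⟩ hsk hs2
        obtain ⟨t1, d1, q1, si1, fr1, ev1, c1⟩ := he j hj s i1
        have er : t1.reg r = s.reg r := fr1 r hr (by omega)
        have er1 : t1.reg (r + 1) = s.reg (r + 1) := fr1 (r + 1) (by omega) (by omega)
        obtain ⟨t2, d2, q2, ev2, fr2, bk2, c2⟩ := hq t1 m (di + de + 1) hm (by omega)
          (by
            rw [er, i3]
            exact iter_bound_pow hm hdi hb.count_lt hj.le (fun j z => hop _ _) hv hzi)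
          (by
            rw [ev1]
            exact (hv j hj).trans_le (Nat.pow_le_pow_right (by norm_num)
              (Nat.mul_le_mul_left _ (by omega))))
        have simt2 : Sim (env.setReg k j) t2 := by
          refine ⟨fun x hx => ?_, bk2.trans si1.2⟩
          rw [fr2 x (by omega) (by omega) (by omega)]
          exact si1.1 x hx
        refine ⟨t2, _, Prog.Run.seq q1 q2, by omega, ?_, ?_, ?_, ?_, ?_, ?_⟩
        · rw [simt2.1 k hk, State.setReg_reg, if_pos rfl]
        · rw [hreg2 j t2 simt2, e2N]
        · have := simt2.setReg k ((j + 1 : ℕ) : ℤ)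
          simpa [State.setReg] using this
        · refine Frame.setReg ?_ (Or.inl hk) _
          intro x h1 h2
          rw [fr2 x (by omega) (by omega) (by omega), fr1 x h1 (by omega)]
          exact i2 x h1 h2
        · rw [State.setReg_reg, if_neg (by omega), ev2, er, ev1, i3]
          rfl
        · rw [State.setReg_reg, if_neg (by omega), fr2 _ (by omega) (by omega) (by omega), er1, i4]
      have e22 : s2.reg 2 = N := by
        rw [hs2, State.setReg_reg, if_neg (by omega), sim1.1 2 (by decide), e2N]
      obtain ⟨s3, d3, r3, l3, I3, -⟩ := run_forLoop (p := pe.seq q) (k := k) (c := r + 2) (N := N)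
        (m := 2 * m) (B := Be + 20 * (m * (di + de + 1))) hk2 (by omega) (by omega) (by omega)
        (by omega) hbN Inv
        (fun j s z h => ⟨h.1.temp (by omega) z, h.2.1.setReg (Or.inr (by omega)) z,
          by rw [State.setReg_reg, if_neg (by omega)]; exact h.2.2.1,
          by rw [State.setReg_reg, if_neg (by omega)]; exact h.2.2.2⟩)
        (fun j s z h => ⟨h.1.temp (by omega) z, h.2.1.setReg (Or.inr (by omega)) z,
          by rw [State.setReg_reg, if_neg (by omega)]; exact h.2.2.1,
          by rw [State.setReg_reg, if_neg (by omega)]; exact h.2.2.2⟩)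
        hstep s2 e22 hI0
      exact ⟨s3, d3, r3, l3.trans_eq (by ring), I3⟩
    · -- A negative content of register 2 makes the range of the loop empty.
      have hN0 : N = 0 := by
        rw [hN, State.count]; omega
      have e22 : s2.reg 2 = env.reg 2 := by
        rw [hs2, State.setReg_reg, if_neg (by omega), sim1.1 2 (by decide)]
      set s3 := s2.setReg k ((0 : ℕ) : ℤ) with hs3
      have e32 : s3.reg 2 = env.reg 2 := by
        rw [hs3, State.setReg_reg, if_neg hk2.symm, e22]
      have e3k : s3.reg k = 0 := by
        rw [hs3, State.setReg_reg, if_pos rfl]; rfl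
      refine ⟨_, _, Prog.Run.seq (Prog.Run.const s2 k 0) (Prog.Run.seq
        (Prog.Run.sub s3 (r + 2) 2 k) (Prog.Run.loop_done ?_)), ?_, ?_⟩
      · rw [State.setReg_reg, if_pos rfl, e32, e3k]
        omega
      · have b0 : bitLen 0 = 1 := by simp [bitLen]
        have := bitLen_le (hb.1 2 (by decide))
        have hc : (s3.setReg (r + 2) (s3.reg 2 - s3.reg k)).reg (r + 2) = env.reg 2 := by
          rw [e32, e3k]; simp
        rw [hc, e32, e3k, b0]
        omega
      · rw [hN0]
        exact ⟨hI0.1.temp (by omega) _, hI0.2.1.setReg (Or.inr (by omega)) _,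
          by rw [State.setReg_reg, if_neg (by omega)]; exact hI0.2.2.1,
          by rw [State.setReg_reg, if_neg (by omega)]; exact hI0.2.2.2⟩
  obtain ⟨s3, d3, r3, l3, i1, i2, i3, i4⟩ := hloop
  have r4 := run_move s3 (x := k) (y := r + 1) (by omega)
  refine ⟨_, _, Prog.Run.seq r1 (Prog.Run.seq r2 (Prog.Run.seq r3 r4)), ?_, ?_, ?_, ?_⟩
  · have h5 := i1.setReg k (env.reg k)
    have h6 : (env.setReg k N).setReg k (env.reg k) = env := by
      simp [State.setReg]
    rw [h6] at h5
    rw [i4]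
    exact h5
  · exact i2.setReg (Or.inl hk) _
  · rw [State.setReg_reg, if_neg (by omega), i3]
  · rw [esk, i4]
    omega

/-- Evaluation of a binary operation on the values in registers `r` and `r + 1`. -/
theorem Evaluates.seq_setReg {p q : Prog} {env : State} {r : ℕ} {y z w : ℤ} {B B' b : ℕ}
    (hr : numVars ≤ r) (hp : Evaluates p env r y B) (hq : Evaluates q env (r + 1) z B')
    {f : Prog} (hf : ∀ s, s.reg r = y → s.reg (r + 1) = z → ∃ d, f.Run s (s.setReg r w) d ∧ d ≤ b) :
    Evaluates (p.seq (q.seq f)) env r w (B + B' + b) := by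
  intro s hs
  obtain ⟨s1, d1, r1, sim1, f1, e1, l1⟩ := hp s hs
  obtain ⟨s2, d2, r2, sim2, f2, e2, l2⟩ := hq s1 sim1
  obtain ⟨d3, r3, l3⟩ := hf s2 ((f2 r hr (by omega)).trans e1) e2
  refine ⟨_, _, Prog.Run.seq r1 (Prog.Run.seq r2 r3), sim2.temp hr _, ?_, by simp, by omega⟩
  exact (f1.trans (f2.mono (by omega))).setReg (Or.inr le_rfl) _

/-- The code of a term computes its value at the stated cost. -/
theorem Term.evaluates (e : Term) (he : e.ok = true) {m : ℕ} (hm : 1 ≤ m) {env : State}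
    (hb : Bdd m env) {r : ℕ} (hr : numVars ≤ r) :
    Evaluates (e.code r) env r (e.eval env) (e.cost env.count * m) := by
  have hn : numVars = 16 := rfl
  induction e generalizing env r with
  | const c =>
    intro s hs
    refine ⟨_, _, Prog.Run.const s r c, hs.temp hr _, (Frame.refl r s).setReg (Or.inr le_rfl) _,
      by simp [eval], ?_⟩
    simp only [cost]
    nlinarith
  | var x =>
    simp only [ok, decide_eq_true_eq] at he
    intro s hs
    refine ⟨_, _, run_move s (x := r) (y := x) (by omega), hs.temp hr _,
      (Frame.refl r s).setReg (Or.inr le_rfl) _, by simp [eval, hs.1 x he], ?_⟩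
    rw [hs.1 x he]
    have := bitLen_le (hb.1 x he)
    simp only [cost]
    omega
  | add a b iha ihb =>
    simp only [ok, Bool.and_eq_true] at he
    have h := (iha he.1 hb hr).seq_setReg (w := a.eval env + b.eval env)
      (b := 2 * (m * a.deg) + 2 * (m * b.deg)) hr (ihb he.2 hb (r := r + 1) (by omega))
      (f := .add r r (r + 1)) (fun s h1 h2 => ⟨_, by
        have := Prog.Run.add s r r (r + 1)
        rwa [h1, h2] at this, Nat.add_le_add
          (bitLen_two_mul hm a.deg_pos (a.natAbs_eval_lt he.1 hm hb))
          (bitLen_two_mul hm b.deg_pos (b.natAbs_eval_lt he.2 hm hb))⟩)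
    convert! h using 1
    simp only [cost]; ring
  | sub a b iha ihb =>
    simp only [ok, Bool.and_eq_true] at he
    have h := (iha he.1 hb hr).seq_setReg (w := a.eval env - b.eval env)
      (b := 2 * (m * a.deg) + 2 * (m * b.deg)) hr (ihb he.2 hb (r := r + 1) (by omega))
      (f := .sub r r (r + 1)) (fun s h1 h2 => ⟨_, by
        have := Prog.Run.sub s r r (r + 1)
        rwa [h1, h2] at this, Nat.add_le_add
          (bitLen_two_mul hm a.deg_pos (a.natAbs_eval_lt he.1 hm hb))
          (bitLen_two_mul hm b.deg_pos (b.natAbs_eval_lt he.2 hm hb))⟩)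
    convert! h using 1
    simp only [cost]; ring
  | mul a b iha ihb =>
    simp only [ok, Bool.and_eq_true] at he
    have h := (iha he.1 hb hr).seq_setReg (w := a.eval env * b.eval env)
      (b := 2 * (m * a.deg) + 2 * (m * b.deg)) hr (ihb he.2 hb (r := r + 1) (by omega))
      (f := .mul r r (r + 1)) (fun s h1 h2 => ⟨_, by
        have := Prog.Run.mul s r r (r + 1)
        rwa [h1, h2] at this, Nat.add_le_add
          (bitLen_two_mul hm a.deg_pos (a.natAbs_eval_lt he.1 hm hb))
          (bitLen_two_mul hm b.deg_pos (b.natAbs_eval_lt he.2 hm hb))⟩)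
    convert! h using 1
    simp only [cost]; ring
  | load a e ih =>
    simp only [ok] at he
    intro s hs
    obtain ⟨s1, d1, r1, sim1, f1, e1, l1⟩ := ih he hb hr s hs
    refine ⟨_, _, Prog.Run.seq r1 (Prog.Run.load s1 r a r), sim1.temp hr _,
      f1.setReg (Or.inr le_rfl) _, ?_, ?_⟩
    · rw [State.setReg_reg, if_pos rfl, e1, sim1.2]; rfl
    · rw [e1, sim1.2]
      have h1 := bitLen_two_mul hm e.deg_pos (e.natAbs_eval_lt he hm hb)
      have h2 := bitLen_le (hb.2 a (e.eval env).toNat)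
      have h3 : (cost env.count (load a e)) * m
        = e.cost env.count * m + 2 * (m * e.deg) + 2 * m := by simp only [cost]; ring
      rw [h3]
      omega
  | ite c a b ihc iha ihb =>
    simp only [ok, Bool.and_eq_true] at he
    intro s hs
    obtain ⟨s1, d1, r1, sim1, f1, e1, l1⟩ := ihc he.1 hb hr s hs
    have h1 := bitLen_two_mul hm c.deg_pos (c.natAbs_eval_lt he.1 hm hb)
    have h3 : (cost env.count (ite c a b)) * m = c.cost env.count * m + 2 * (m * c.deg)
      + a.cost env.count * m + b.cost env.count * m := by simp only [cost]; ring
    rw [h3]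
    by_cases hc : 0 < c.eval env
    · obtain ⟨s2, d2, r2, sim2, f2, e2, l2⟩ := iha he.2.1 hb hr s1 sim1
      refine ⟨_, _, Prog.Run.seq r1 (Prog.Run.branch_pos (by rw [e1]; exact hc) r2), sim2,
        f1.trans f2, ?_, ?_⟩
      · rw [e2, eval, if_pos hc]
      · rw [e1]; omega
    · obtain ⟨s2, d2, r2, sim2, f2, e2, l2⟩ := ihb he.2.2 hb hr s1 sim1
      refine ⟨_, _, Prog.Run.seq r1 (Prog.Run.branch_neg (by rw [e1]; exact hc) r2), sim2,
        f1.trans f2, ?_, ?_⟩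
      · rw [e2, eval, if_neg hc]
      · rw [e1]; omega
  | sum k i e ihi ihe =>
    simp only [ok, Bool.and_eq_true, decide_eq_true_eq] at he
    obtain ⟨hk, hk2, hi, he⟩ := he
    have hbj : ∀ j < env.count, Bdd m (env.setReg k j) := fun j hj =>
      hb.setReg k (by rw [Int.natAbs_natCast]; exact hj.trans hb.count_lt)
    have h := evaluates_reduce (combines_add r) Int.natAbs_add_le hr hk hk2 hm i.deg_pos hb
      (ihi hi hb hr) (i.natAbs_eval_lt hi hm hb) (v := fun j => e.eval (env.setReg k j))
      (Be := e.cost env.count * m)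
      (fun j hj => by
        have := ihe he (hbj j hj) (r := r + 3) (by omega)
        rwa [State.count_setReg hk2] at this)
      (fun j hj => e.natAbs_eval_lt he hm (hbj j hj))
    convert! h using 1
    simp only [cost]; ring
  | least k i e ihi ihe =>
    simp only [ok, Bool.and_eq_true, decide_eq_true_eq] at he
    obtain ⟨hk, hk2, hi, he⟩ := he
    have hbj : ∀ j < env.count, Bdd m (env.setReg k j) := fun j hj =>
      hb.setReg k (by rw [Int.natAbs_natCast]; exact hj.trans hb.count_lt)
    have h := evaluates_reduce (combines_least r) natAbs_leastPos_le hr hk hk2 hm i.deg_pos hb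
      (ihi hi hb hr) (i.natAbs_eval_lt hi hm hb) (v := fun j => e.eval (env.setReg k j))
      (Be := e.cost env.count * m)
      (fun j hj => by
        have := ihe he (hbj j hj) (r := r + 3) (by omega)
        rwa [State.count_setReg hk2] at this)
      (fun j hj => e.natAbs_eval_lt he hm (hbj j hj))
    convert! h using 1
    simp only [cost]; ring

/-- The cost of a term is polynomial in the range of the loops. -/
theorem Term.cost_le (e : Term) : ∃ K, ∀ n ν : ℕ, n ≤ ν → 1 ≤ ν → e.cost n ≤ K * ν ^ e.depth := by
  have hpow : ∀ {ν a b K : ℕ}, 1 ≤ ν → a ≤ b → K * ν ^ a ≤ K * ν ^ b := fun h1 h2 =>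
    Nat.mul_le_mul_left _ (Nat.pow_le_pow_right h1 h2)
  have hone : ∀ {ν a K : ℕ}, 1 ≤ ν → K ≤ K * ν ^ a := fun h1 =>
    Nat.le_mul_of_pos_right _ (Nat.pow_pos h1)
  induction e with
  | const c => exact ⟨bitLen c, fun n ν _ h => hone h⟩
  | var x => exact ⟨4, fun n ν _ h => hone h⟩
  | add a b iha ihb | sub a b iha ihb | mul a b iha ihb =>
    obtain ⟨Ka, ha⟩ := iha
    obtain ⟨Kb, hb⟩ := ihb
    refine ⟨Ka + Kb + 2 * (a.deg + b.deg), fun n ν h1 h2 => ?_⟩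
    simp only [cost, depth, add_mul Ka, add_mul (Ka + Kb)]
    exact Nat.add_le_add (Nat.add_le_add ((ha n ν h1 h2).trans (hpow h2 (le_max_left _ _)))
      ((hb n ν h1 h2).trans (hpow h2 (le_max_right _ _)))) (hone h2)
  | load a e ih =>
    obtain ⟨K, h⟩ := ih
    refine ⟨K + 2 * (e.deg + 1), fun n ν h1 h2 => ?_⟩
    simp only [cost, depth, add_mul K]
    exact Nat.add_le_add (h n ν h1 h2) (hone h2)
  | ite c a b ihc iha ihb =>
    obtain ⟨Kc, hc⟩ := ihc
    obtain ⟨Ka, ha⟩ := iha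
    obtain ⟨Kb, hb⟩ := ihb
    refine ⟨Kc + 2 * c.deg + Ka + Kb, fun n ν h1 h2 => ?_⟩
    simp only [cost, depth, add_mul Kc, add_mul (Kc + 2 * c.deg), add_mul (Kc + 2 * c.deg + Ka)]
    refine Nat.add_le_add (Nat.add_le_add (Nat.add_le_add ((hc n ν h1 h2).trans
      (hpow h2 (le_max_left _ _))) (hone h2)) ((ha n ν h1 h2).trans (hpow h2 ?_)))
      ((hb n ν h1 h2).trans (hpow h2 ?_))
    · exact (le_max_left _ _).trans (le_max_right _ _)
    · exact (le_max_right _ _).trans (le_max_right _ _)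
  | sum k i e ihi ihe | least k i e ihi ihe =>
    obtain ⟨Ki, hi⟩ := ihi
    obtain ⟨Ke, he⟩ := ihe
    refine ⟨Ki + (Ke + 20 * (i.deg + e.deg + 1) + 16) + 24, fun n ν h1 h2 => ?_⟩
    simp only [cost, depth, add_mul Ki, add_mul (Ki + _) 24]
    refine Nat.add_le_add (Nat.add_le_add ((hi n ν h1 h2).trans
      (hpow h2 ((le_max_left _ _).trans (Nat.le_succ _)))) ?_) (hone h2)
    rw [pow_succ', mul_left_comm]
    refine Nat.mul_le_mul h1 ?_
    rw [add_assoc (e.cost n), add_assoc Ke, add_mul Ke]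
    exact Nat.add_le_add ((he n ν h1 h2).trans (hpow h2 (le_max_right _ _))) (hone h2)

end Traffic

namespace Traffic

/-! ### Commands -/

/-- Replace the contents of a memory bank. -/
def State.setBank (s : State) (a : ℕ) (f : ℕ → ℤ) : State :=
  { s with bank := Function.update s.bank a f }

@[simp] theorem State.setBank_reg (s : State) (a : ℕ) (f : ℕ → ℤ) : (s.setBank a f).reg = s.reg :=
  rfl

@[simp] theorem State.setBank_bank (s : State) (a b : ℕ) (f : ℕ → ℤ) :
    (s.setBank a f).bank b = if b = a then f else s.bank b := by
  simp [State.setBank, Function.update_apply]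

/-- Commands: `fill a k e` stores the values of `e` for `k` below the content `n` of register 2 in
bank `a`, and `fill2 a i j e` stores the values of `e` for `i` and `j` below `n` as a square matrix,
row by row. The command `rep p` repeats `p` for `n` times. -/
inductive Cmd where
  | set (x : ℕ) (e : Term)
  | fill (a k : ℕ) (e : Term)
  | fill2 (a i j : ℕ) (e : Term)
  | seq (p q : Cmd)
  | ite (c : Term) (p q : Cmd)
  | rep (p : Cmd)

namespace Cmd

/-- The effect of a command on the variables and the memory. -/
def exec : Cmd → State → State
  | set x e, s => s.setReg x (e.eval s)
  | fill a k e, s => s.setBank a fun c =>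
      if c < s.count then e.eval (s.setReg k c) else s.bank a c
  | fill2 a i j e, s => s.setBank a fun c => if c < s.count * s.count then
      e.eval ((s.setReg i (c / s.count : ℕ)).setReg j (c % s.count : ℕ)) else s.bank a c
  | seq p q, s => q.exec (p.exec s)
  | ite c p q, s => if 0 < c.eval s then p.exec s else q.exec s
  | rep p, s => iter (fun _ => p.exec) s.count s

open Prog in

/-- The code of a command, where the registers from `r` on are free. -/
def code : Cmd → ℕ → Prog
  | set x e, r => .seq (e.code r) (move x r)
  | fill a k e, r => .seq (move r k) (.seq
      (forLoop k (r + 1) (.seq (e.code (r + 3)) (.store a k (r + 3)))) (move k r))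
  | fill2 a i j e, r => .seq (move r i) (.seq (move (r + 1) j) (.seq (.const (r + 2) 0) (.seq
      (forLoop i (r + 3) (forLoop j (r + 5) (.seq (e.code (r + 7)) (.seq (.store a (r + 2) (r + 7))
        (.seq (.const (r + 7) 1) (.add (r + 2) (r + 2) (r + 7)))))))
      (.seq (move i r) (move j (r + 1))))))
  | seq p q, r => .seq (p.code r) (q.code r)
  | ite c p q, r => .seq (c.code r) (.branch r (p.code r) (q.code r))
  | rep p, r => forLoop r (r + 1) (p.code (r + 3))

/-- The code of `p` performs `p` at a cost of at most `B`. -/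
def Runs (p : Cmd) (env : State) (B : ℕ) : Prop :=
  ∀ r s, numVars ≤ r → Sim env s → ∃ s' d, (p.code r).Run s s' d ∧ Sim (p.exec env) s' ∧
    Frame r s s' ∧ d ≤ B

theorem Runs.mono {p : Cmd} {env : State} {B B' : ℕ} (h : p.Runs env B) (hB : B ≤ B') :
    p.Runs env B' := fun r s hr hs => by
  obtain ⟨s', d, h1, h2, h3, h4⟩ := h r s hr hs
  exact ⟨s', d, h1, h2, h3, h4.trans hB⟩

theorem Runs.seq {p q : Cmd} {env : State} {B B' : ℕ} (hp : p.Runs env B)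
    (hq : q.Runs (p.exec env) B') : (p.seq q).Runs env (B + B') := fun r s hr hs => by
  obtain ⟨s1, d1, r1, sim1, f1, l1⟩ := hp r s hr hs
  obtain ⟨s2, d2, r2, sim2, f2, l2⟩ := hq r s1 hr sim1
  exact ⟨s2, _, Prog.Run.seq r1 r2, sim2, f1.trans f2, Nat.add_le_add l1 l2⟩

theorem Runs.ite {c : Term} {p q : Cmd} {env : State} {m B B' : ℕ} (hc : c.ok = true) (hm : 1 ≤ m)
    (hb : Bdd m env) (hp : 0 < c.eval env → p.Runs env B) (hq : ¬ 0 < c.eval env → q.Runs env B') :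
    (Cmd.ite c p q).Runs env ((c.cost env.count + 2 * c.deg) * m + B + B') := fun r s hr hs => by
  obtain ⟨s1, d1, r1, sim1, f1, e1, l1⟩ := c.evaluates hc hm hb hr s hs
  have h1 := bitLen_two_mul hm c.deg_pos (c.natAbs_eval_lt hc hm hb)
  have h2 : (c.cost env.count + 2 * c.deg) * m = c.cost env.count * m + 2 * (m * c.deg) := by ring
  rw [h2]
  by_cases h : 0 < c.eval env
  · obtain ⟨s2, d2, r2, sim2, f2, l2⟩ := hp h r s1 hr sim1
    refine ⟨s2, _, Prog.Run.seq r1 (Prog.Run.branch_pos (by rw [e1]; exact h) r2), ?_, f1.trans f2,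
      by rw [e1]; omega⟩
    rwa [exec, if_pos h]
  · obtain ⟨s2, d2, r2, sim2, f2, l2⟩ := hq h r s1 hr sim1
    refine ⟨s2, _, Prog.Run.seq r1 (Prog.Run.branch_neg (by rw [e1]; exact h) r2), ?_, f1.trans f2,
      by rw [e1]; omega⟩
    rwa [exec, if_neg h]

theorem runs_set {x : ℕ} {e : Term} {env : State} {m : ℕ} (hx : x < numVars) (he : e.ok = true)
    (hm : 1 ≤ m) (hb : Bdd m env) :
    (Cmd.set x e).Runs env ((e.cost env.count + 2 * e.deg + 2) * m) := fun r s hr hs => by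
  obtain ⟨s1, d1, r1, sim1, f1, e1, l1⟩ := e.evaluates he hm hb hr s hs
  have h1 := bitLen_two_mul hm e.deg_pos (e.natAbs_eval_lt he hm hb)
  refine ⟨_, _, Prog.Run.seq r1 (run_move s1 (by omega)), ?_, f1.setReg (Or.inl hx) _, ?_⟩
  · rw [e1]; exact sim1.setReg x _
  · rw [e1]
    have h2 : (e.cost env.count + 2 * e.deg + 2) * m
      = e.cost env.count * m + 2 * (m * e.deg) + 2 * m := by ring
    rw [h2]
    omega

/-- The environment in which the first `N` cells of bank `a` have been replaced. -/
def partialFill (env : State) (a : ℕ) (v : ℕ → ℤ) (N : ℕ) : State :=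
  env.setBank a fun c => if c < N then v c else env.bank a c

theorem partialFill_zero (env : State) (a : ℕ) (v : ℕ → ℤ) : partialFill env a v 0 = env := by
  simp [partialFill, State.setBank]

theorem bdd_partialFill {env : State} {m m' a N : ℕ} {v : ℕ → ℤ} (hb : Bdd m env) (hm : m ≤ m')
    (hv : ∀ c < N, (v c).natAbs < 2 ^ m') : Bdd m' (partialFill env a v N) := by
  have hb' := hb.mono hm
  refine ⟨hb'.1, fun d k => ?_⟩
  simp only [partialFill, State.setBank_bank]
  by_cases hd : d = a
  · rw [if_pos hd]
    split_ifs with h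
    · exact hv k h
    · exact hb'.2 a k
  · rw [if_neg hd]
    exact hb'.2 d k

theorem partialFill_setCell (env s : State) (a : ℕ) (v : ℕ → ℤ) (N : ℕ)
    (h : s.bank = (partialFill env a v N).bank) :
    (s.setCell a N (v N)).bank = (partialFill env a v (N + 1)).bank := by
  funext d k
  simp only [State.setCell, h, partialFill, Function.update_apply, State.setBank_bank]
  by_cases hd : d = a
  · simp only [hd, if_true]
    by_cases hk : k = N
    · simp [hk]
    · have : k < N + 1 ↔ k < N := by omega
      simp [hk, this]
  · simp [hd]

/-- While a bank is being filled with the values of a term that avoids this bank, these values do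
not change. -/
theorem eval_partialFill {e : Term} {a : ℕ} (he : e.avoids a = true) (env s : State) (v : ℕ → ℤ)
    (N : ℕ) (hr : s.reg = env.reg) (hb : s.bank = (partialFill env a v N).bank) :
    e.eval s = e.eval env := by
  refine e.eval_congr he hr fun d hd => ?_
  rw [hb]
  simp [partialFill, hd]

theorem count_eq {env : State} (h : 0 ≤ env.reg 2) : env.reg 2 = env.count := by
  simp only [State.count]; omega

theorem bitLen_natCast_le {N m : ℕ} (h : N < 2 ^ m) : bitLen N ≤ m + 1 :=
  bitLen_le (by rwa [Int.natAbs_natCast])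

/-- Correctness and cost of the code for `fill`: a loop with the invariant that the first `j` cells
of the bank have been replaced. -/
theorem runs_fill {a k : ℕ} {e : Term} {env : State} {m : ℕ} (hk : k < numVars) (hk2 : k ≠ 2)
    (he : e.ok = true) (ha : e.avoids a = true) (hm : 1 ≤ m) (hb : Bdd m env)
    (hn : 0 ≤ env.reg 2) :
    (Cmd.fill a k e).Runs env
      ((env.count * (e.cost env.count * e.deg + 2 * e.deg + 18) + 24) * m) := fun r s0 hr hs0 => by
  have hn16 : numVars = 16 := rfl
  set N := env.count with hN
  have e2N : env.reg 2 = N := count_eq hn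
  let v : ℕ → ℤ := fun j => e.eval (env.setReg k j)
  have hvb : ∀ j < N, (v j).natAbs < 2 ^ (m * e.deg) := fun j hj =>
    e.natAbs_eval_lt he hm (hb.setReg k (by rw [Int.natAbs_natCast]; exact hj.trans hb.count_lt))
  have hmd : m ≤ m * e.deg := Nat.le_mul_of_pos_right _ e.deg_pos
  have hbk := bitLen_le (hb.1 k hk)
  have hbN : bitLen N ≤ 2 * m := (bitLen_natCast_le hb.count_lt).trans (by omega)
  have r1 := run_move s0 (x := r) (y := k) (by omega)
  set s1 := s0.setReg r (s0.reg k) with hs1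
  have esk : s0.reg k = env.reg k := hs0.1 k hk
  -- After `j` iterations, the first `j` cells have been replaced, and register `r` saves the
  -- variable `k`.
  let Inv : ℕ → State → Prop := fun j s =>
    Sim ((partialFill env a v j).setReg k j) s ∧ Frame r s0 s ∧ s.reg r = env.reg k
  have hstep : ∀ j s, j < N → Inv j s → s.reg k = j → s.reg 2 = N → ∃ s' d,
      ((e.code (r + 3)).seq (.store a k (r + 3))).Run s s' d ∧
      d ≤ (e.cost N * e.deg + 2 * e.deg + 2) * m ∧ s'.reg k = j ∧ s'.reg 2 = N ∧
      Inv (j + 1) (s'.setReg k ((j + 1 : ℕ) : ℤ)) := by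
    rintro j s hj ⟨i1, i2, i3⟩ - -
    -- The bank that is being filled may contain longer numbers than `env`.
    have hbp : Bdd (m * e.deg) ((partialFill env a v j).setReg k j) :=
      (bdd_partialFill hb hmd fun c hc => hvb c (hc.trans hj)).setReg k (by
        rw [Int.natAbs_natCast]
        exact (hj.trans hb.count_lt).trans_le (Nat.pow_le_pow_right (by norm_num) hmd))
    obtain ⟨t, d, q1, si, fr, ev, c1⟩ := e.evaluates he (hm.trans hmd) hbp (r := r + 3) (by omega)
      s i1
    have hev : e.eval ((partialFill env a v j).setReg k j) = v j :=
      eval_partialFill ha (env.setReg k j) _ v j rfl rfl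
    rw [hev] at ev
    have hcount : ((partialFill env a v j).setReg k j).count = N := by
      rw [State.count_setReg hk2]; rfl
    rw [hcount] at c1
    have etk : t.reg k = j := by rw [si.1 k hk, State.setReg_reg, if_pos rfl]
    have q2 := Prog.Run.store t a k (r + 3)
    rw [etk, ev, Int.toNat_natCast] at q2
    refine ⟨_, _, Prog.Run.seq q1 q2, ?_, etk, ?_, ⟨?_, ?_⟩, ?_, ?_⟩
    · have h1 := bitLen_natCast_le (hj.trans hb.count_lt)
      have h2 := bitLen_two_mul hm e.deg_pos (hvb j hj)
      have h3 : (e.cost N * e.deg + 2 * e.deg + 2) * m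
        = e.cost N * (m * e.deg) + 2 * (m * e.deg) + 2 * m := by ring
      rw [h3]
      omega
    · change t.reg 2 = N
      rw [si.1 2 (by decide), State.setReg_reg, if_neg hk2.symm]
      exact e2N
    · intro x hx
      have := si.1 x hx
      simp only [State.setReg_reg] at this ⊢
      split_ifs with h
      · rfl
      · rw [if_neg h] at this
        exact this
    · exact partialFill_setCell env t a v j si.2
    · refine Frame.setReg ?_ (Or.inl hk) _
      intro x h1 h2
      exact (fr x h1 (by omega)).trans (i2 x h1 h2)
    · rw [State.setReg_reg, if_neg (by omega)]
      exact (fr r hr (by omega)).trans i3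
  have hI0 : Inv 0 (s1.setReg k ((0 : ℕ) : ℤ)) := by
    refine ⟨?_, ?_, ?_⟩
    · rw [partialFill_zero]
      exact (hs0.temp hr _).setReg k _
    · exact ((Frame.refl r s0).setReg (Or.inr le_rfl) _).setReg (Or.inl hk) _
    · rw [State.setReg_reg, if_neg (by omega), hs1, State.setReg_reg, if_pos rfl, esk]
  obtain ⟨s2, d2, r2, l2, ⟨i1, i2, i3⟩, -⟩ := run_forLoop (k := k) (c := r + 1) (N := N) (m := 2 * m)
    (B := (e.cost N * e.deg + 2 * e.deg + 2) * m) hk2 (by omega) (by omega) (by omega)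
    (by omega) hbN Inv
    (fun j s z h => ⟨h.1.temp (by omega) z, h.2.1.setReg (Or.inr (by omega)) z,
      by rw [State.setReg_reg, if_neg (by omega)]; exact h.2.2⟩)
    (fun j s z h => ⟨h.1.temp (by omega) z, h.2.1.setReg (Or.inr (by omega)) z,
      by rw [State.setReg_reg, if_neg (by omega)]; exact h.2.2⟩)
    hstep s1 (by rw [hs1, State.setReg_reg, if_neg (by omega), hs0.1 2 (by decide), e2N]) hI0
  have r3 := run_move s2 (x := k) (y := r) (by omega)
  refine ⟨_, _, Prog.Run.seq r1 (Prog.Run.seq r2 r3), ⟨?_, i1.2⟩, i2.setReg (Or.inl hk) _, ?_⟩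
  · intro x hx
    change _ = env.reg x
    rw [State.setReg_reg]
    split_ifs with h
    · rw [i3, h]
    · rw [i1.1 x hx, State.setReg_reg, if_neg h]; rfl
  · rw [esk, i3]
    have h3 : (N * (e.cost N * e.deg + 2 * e.deg + 18) + 24) * m
      = N * ((e.cost N * e.deg + 2 * e.deg + 2) * m + 8 * (2 * m)) + 24 * m := by ring
    rw [h3]
    omega

/-- Correctness and cost of the code for `fill2`: two nested loops, where the address of the next
cell is incremented in register `r + 2`. -/
theorem runs_fill2 {a i j : ℕ} {e : Term} {env : State} {m : ℕ} (hi : i < numVars) (hi2 : i ≠ 2)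
    (hj : j < numVars) (hj2 : j ≠ 2) (hij : i ≠ j) (he : e.ok = true) (ha : e.avoids a = true)
    (hm : 1 ≤ m) (hb : Bdd m env) (hn : 0 ≤ env.reg 2) :
    (Cmd.fill2 a i j e).Runs env
      ((env.count * (env.count * (e.cost env.count * e.deg + 2 * e.deg + 26) + 32) + 40) * m) :=
    fun r s0 hr hs0 => by
  have hn16 : numVars = 16 := rfl
  set N := env.count with hN
  have e2N : env.reg 2 = N := count_eq hn
  let v : ℕ → ℤ := fun c => e.eval ((env.setReg i (c / N : ℕ)).setReg j (c % N : ℕ))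
  have hNlt := hb.count_lt
  have hbij : ∀ x y, x < N → y < N → Bdd m ((env.setReg i (x : ℕ)).setReg j (y : ℕ)) :=
    fun x y hx hy => (hb.setReg i (by rw [Int.natAbs_natCast]; omega)).setReg j
      (by rw [Int.natAbs_natCast]; omega)
  have hvb : ∀ c < N * N, (v c).natAbs < 2 ^ (m * e.deg) := fun c hc =>
    e.natAbs_eval_lt he hm (hbij _ _ (Nat.div_lt_of_lt_mul hc)
      (Nat.mod_lt _ (Nat.pos_of_mul_pos_left (Nat.zero_lt_of_lt hc))))
  have hmd : m ≤ m * e.deg := Nat.le_mul_of_pos_right _ e.deg_pos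
  have hbki := bitLen_le (hb.1 i hi)
  have hbkj := bitLen_le (hb.1 j hj)
  have hbN : bitLen N ≤ 2 * m := (bitLen_natCast_le hb.count_lt).trans (by omega)
  have hcell : ∀ {x y}, x < N → y < N → x * N + y < N * N := fun {x y} hx hy => by
    have := Nat.mul_le_mul_right N (Nat.succ_le_of_lt hx)
    rw [Nat.succ_mul] at this
    omega
  have r1 := run_move s0 (x := r) (y := i) (by omega)
  set s1 := s0.setReg r (s0.reg i) with hs1
  have r2 := run_move s1 (x := r + 1) (y := j) (by omega)
  set s2 := s1.setReg (r + 1) (s1.reg j) with hs2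
  have r3 := Prog.Run.const s2 (r + 2) 0
  set s3 := s2.setReg (r + 2) 0 with hs3
  have esi : s0.reg i = env.reg i := hs0.1 i hi
  have esj : s1.reg j = env.reg j := by rw [hs1, State.setReg_reg, if_neg (by omega), hs0.1 j hj]
  -- Registers `r` and `r + 1` save the variables `i` and `j`, and register `r + 2` counts the
  -- cells.
  let Keep : ℕ → State → Prop := fun c s => Frame r s0 s ∧ s.reg r = env.reg i ∧
    s.reg (r + 1) = env.reg j ∧ s.reg (r + 2) = (c : ℤ)
  have keep_set : ∀ {c s x}, Keep c s → (x < numVars ∨ r + 3 ≤ x) → ∀ z, Keep c (s.setReg x z) := by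
    rintro c s x ⟨h1, h2, h3, h4⟩ hx z
    refine ⟨h1.setReg (by omega) z, ?_, ?_, ?_⟩ <;> rw [State.setReg_reg, if_neg (by omega)] <;>
      assumption
  let Inn : ℕ → ℕ → State → Prop := fun x y s =>
    Sim (((partialFill env a v (x * N + y)).setReg i x).setReg j y) s ∧ Keep (x * N + y) s
  let Out : ℕ → State → Prop := fun x s =>
    (∃ z : ℤ, Sim (((partialFill env a v (x * N)).setReg i x).setReg j z) s) ∧ Keep (x * N) s
  have hstep : ∀ x < N, ∀ y s, y < N → Inn x y s → s.reg j = y → s.reg 2 = N → ∃ s' d,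
      ((e.code (r + 7)).seq ((Prog.store a (r + 2) (r + 7)).seq ((Prog.const (r + 7) 1).seq
        (.add (r + 2) (r + 2) (r + 7))))).Run s s' d ∧
      d ≤ (e.cost N * e.deg + 2 * e.deg + 10) * m ∧ s'.reg j = y ∧ s'.reg 2 = N ∧
      Inn x (y + 1) (s'.setReg j ((y + 1 : ℕ) : ℤ)) := by
    rintro x hx y s hy ⟨i1, k1, k2, k3, k4⟩ - -
    have hc := hcell hx hy
    have hbp : Bdd (m * e.deg) (((partialFill env a v (x * N + y)).setReg i x).setReg j y) := by
      have hpow := Nat.pow_le_pow_right (n := 2) (by norm_num) hmd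
      refine ((bdd_partialFill hb hmd fun c hc' => hvb c (hc'.trans hc)).setReg i ?_).setReg j ?_ <;>
        · rw [Int.natAbs_natCast]; omega
    obtain ⟨t, d, q1, si, fr, ev, c1⟩ := e.evaluates he (hm.trans hmd) hbp (r := r + 7) (by omega)
      s i1
    have hev : e.eval (((partialFill env a v (x * N + y)).setReg i x).setReg j y)
        = v (x * N + y) := by
      have hNpos : 0 < N := by omega
      have h1 : (x * N + y) / N = x := by
        rw [mul_comm, Nat.mul_add_div hNpos, Nat.div_eq_of_lt hy, add_zero]
      have h2 : (x * N + y) % N = y := by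
        rw [mul_comm, Nat.mul_add_mod, Nat.mod_eq_of_lt hy]
      simp only [v, h1, h2]
      exact eval_partialFill ha ((env.setReg i x).setReg j y) _ v (x * N + y) rfl rfl
    rw [hev] at ev
    have hcount : (((partialFill env a v (x * N + y)).setReg i x).setReg j y).count = N := by
      rw [State.count_setReg hj2, State.count_setReg hi2]; rfl
    rw [hcount] at c1
    have et2 : t.reg (r + 2) = ((x * N + y : ℕ) : ℤ) := by
      rw [fr (r + 2) (by omega) (by omega), k4]
    have q2 := Prog.Run.store t a (r + 2) (r + 7)
    rw [et2, ev, Int.toNat_natCast] at q2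
    set t2 := t.setCell a (x * N + y) (v (x * N + y)) with ht2
    have q3 := Prog.Run.const t2 (r + 7) 1
    set t3 := t2.setReg (r + 7) 1 with ht3
    have q4 := Prog.Run.add t3 (r + 2) (r + 2) (r + 7)
    have e32 : t3.reg (r + 2) = ((x * N + y : ℕ) : ℤ) := by
      rw [ht3, State.setReg_reg, if_neg (by omega)]; exact et2
    have e37 : t3.reg (r + 7) = 1 := by rw [ht3, State.setReg_reg, if_pos rfl]
    rw [e32, e37] at q4
    set t4 := t3.setReg (r + 2) (((x * N + y : ℕ) : ℤ) + 1) with ht4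
    have e4 : ∀ z, z ≠ r + 2 → z ≠ r + 7 → t4.reg z = t.reg z := by
      intro z h1 h2
      rw [ht4, State.setReg_reg, if_neg h1, ht3, State.setReg_reg, if_neg h2]; rfl
    refine ⟨t4, _, Prog.Run.seq q1 (Prog.Run.seq q2 (Prog.Run.seq q3 q4)), ?_, ?_, ?_, ?_, ?_, ?_,
      ?_, ?_⟩
    · have h1 : bitLen ((x * N + y : ℕ) : ℤ) ≤ 3 * m := by
        refine (bitLen_natCast_le (m := m + m) ?_).trans (by omega)
        rw [pow_add]
        exact hc.trans (Nat.mul_lt_mul'' hNlt hNlt)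
      have h2 := bitLen_two_mul hm e.deg_pos (hvb _ hc)
      have h3 : (e.cost N * e.deg + 2 * e.deg + 10) * m
        = e.cost N * (m * e.deg) + 2 * (m * e.deg) + 10 * m := by ring
      have h4 : bitLen 1 = 2 := by simp [bitLen]
      rw [h3, h4]
      omega
    · rw [e4 j (by omega) (by omega), si.1 j hj, State.setReg_reg, if_pos rfl]
    · rw [e4 2 (by omega) (by omega), si.1 2 (by decide), State.setReg_reg, if_neg hj2.symm,
        State.setReg_reg, if_neg hi2.symm]
      exact e2N
    · refine ⟨fun z hz => ?_, ?_⟩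
      · have h5 := si.1 z hz
        have h6 := e4 z (by omega) (by omega)
        rw [State.setReg_reg] at h5
        refine (State.setReg_reg _ _ _ _).trans (Eq.trans ?_ (State.setReg_reg _ _ _ _).symm)
        split_ifs at h5 ⊢ with h
        · rfl
        · exact h6.trans h5
      · exact partialFill_setCell env t a v (x * N + y) si.2
    · refine Frame.setReg ?_ (Or.inl hj) _
      intro z h1 h2
      rw [e4 z (by omega) (by omega)]
      exact (fr z h1 (by omega)).trans (k1 z h1 h2)
    · rw [State.setReg_reg, if_neg (by omega), e4 _ (by omega) (by omega)]
      exact (fr r hr (by omega)).trans k2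
    · rw [State.setReg_reg, if_neg (by omega), e4 _ (by omega) (by omega)]
      exact (fr (r + 1) (by omega) (by omega)).trans k3
    · rw [State.setReg_reg, if_neg (by omega), ht4, State.setReg_reg, if_pos rfl]
      push_cast; ring
  have hrow : ∀ x s, x < N → Out x s → s.reg i = x → s.reg 2 = N → ∃ s' d,
      (Prog.forLoop j (r + 5) ((e.code (r + 7)).seq ((Prog.store a (r + 2) (r + 7)).seq
        ((Prog.const (r + 7) 1).seq (.add (r + 2) (r + 2) (r + 7)))))).Run s s' d ∧
      d ≤ N * ((e.cost N * e.deg + 2 * e.deg + 10) * m + 8 * (2 * m)) + 8 * (2 * m) ∧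
      s'.reg i = x ∧ s'.reg 2 = N ∧ Out (x + 1) (s'.setReg i ((x + 1 : ℕ) : ℤ)) := by
    rintro x s hx ⟨⟨z, i1⟩, i2⟩ - h2
    have hI0 : Inn x 0 (s.setReg j ((0 : ℕ) : ℤ)) := by
      refine ⟨?_, keep_set i2 (Or.inl hj) _⟩
      have := i1.setReg j ((0 : ℕ) : ℤ)
      simpa [State.setReg] using this
    obtain ⟨s', d, q, l, ⟨j1, j2⟩, h2'⟩ := run_forLoop (k := j) (c := r + 5) (N := N)
      (m := 2 * m) (B := (e.cost N * e.deg + 2 * e.deg + 10) * m) hj2 (by omega) (by omega) (by omega)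
      (by omega) hbN (Inn x)
      (fun y s z h => ⟨h.1.temp (by omega) z, keep_set h.2 (Or.inr (by omega)) z⟩)
      (fun y s z h => ⟨h.1.temp (by omega) z, keep_set h.2 (Or.inr (by omega)) z⟩)
      (hstep x hx) s h2 hI0
    have e1 : x * N + N = (x + 1) * N := by ring
    rw [e1] at j1 j2
    refine ⟨s', d, q, l, ?_, h2', ⟨N, ?_⟩, keep_set j2 (Or.inl hi) _⟩
    · rw [j1.1 i hi, State.setReg_reg, if_neg hij, State.setReg_reg, if_pos rfl]
    · have := j1.setReg i ((x + 1 : ℕ) : ℤ)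
      simp only [State.setReg] at this ⊢
      rwa [Function.update_comm hij.symm, Function.update_idem] at this
  have hs3sim : Sim env s3 := ((hs0.temp hr _).temp (by omega) _).temp (by omega) _
  have hkeep : Keep 0 s3 := by
    refine ⟨?_, ?_, ?_, ?_⟩
    · exact (((Frame.refl r s0).setReg (Or.inr le_rfl) _).setReg (Or.inr (by omega)) _).setReg
        (Or.inr (by omega)) _
    · rw [hs3, State.setReg_reg, if_neg (by omega), hs2, State.setReg_reg, if_neg (by omega), hs1,
        State.setReg_reg, if_pos rfl, esi]
    · rw [hs3, State.setReg_reg, if_neg (by omega), hs2, State.setReg_reg, if_pos rfl, esj]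
    · rw [hs3, State.setReg_reg, if_pos rfl]; rfl
  have hO0 : Out 0 (s3.setReg i ((0 : ℕ) : ℤ)) := by
    refine ⟨⟨env.reg j, ?_⟩, ?_⟩
    · rw [zero_mul, partialFill_zero]
      have := hs3sim.setReg i ((0 : ℕ) : ℤ)
      have e : (env.setReg i ((0 : ℕ) : ℤ)).setReg j (env.reg j) = env.setReg i ((0 : ℕ) : ℤ) := by
        simp only [State.setReg]
        rw [Function.update_comm hij, Function.update_eq_self]
      rwa [e]
    · rw [zero_mul]; exact keep_set hkeep (Or.inl hi) _
  obtain ⟨s4, d4, r4, l4, ⟨⟨z, i1⟩, i2, i3, i4, -⟩, -⟩ := run_forLoop (k := i) (c := r + 3) (N := N)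
    (m := 2 * m) (B := N * ((e.cost N * e.deg + 2 * e.deg + 10) * m + 8 * (2 * m)) + 8 * (2 * m)) hi2 (by omega) (by omega)
    (by omega) (by omega) hbN Out
    (fun y s z h => ⟨⟨h.1.choose, h.1.choose_spec.temp (by omega) z⟩,
      keep_set h.2 (Or.inr (by omega)) z⟩)
    (fun y s z h => ⟨⟨h.1.choose, h.1.choose_spec.temp (by omega) z⟩,
      keep_set h.2 (Or.inr (by omega)) z⟩)
    hrow s3 (by rw [hs3sim.1 2 (by decide), e2N]) hO0
  have r5 := run_move s4 (x := i) (y := r) (by omega)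
  set s5 := s4.setReg i (s4.reg r) with hs5
  have r6 := run_move s5 (x := j) (y := r + 1) (by omega)
  have e5 : s5.reg (r + 1) = env.reg j := by
    rw [hs5, State.setReg_reg, if_neg (by omega), i4]
  refine ⟨_, _, Prog.Run.seq r1 (Prog.Run.seq r2 (Prog.Run.seq r3 (Prog.Run.seq r4
    (Prog.Run.seq r5 r6)))), ⟨?_, i1.2⟩, (i2.setReg (Or.inl hi) _).setReg (Or.inl hj) _, ?_⟩
  · intro x hx
    change _ = env.reg x
    rw [State.setReg_reg, e5]
    split_ifs with h
    · rw [h]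
    · rw [hs5, State.setReg_reg]
      split_ifs with h'
      · rw [i3, h']
      · rw [i1.1 x hx, State.setReg_reg, if_neg h, State.setReg_reg, if_neg h']; rfl
  · rw [esi, esj, e5, i3]
    have h3 : (N * (N * (e.cost N * e.deg + 2 * e.deg + 26) + 32) + 40) * m
      = N * (N * ((e.cost N * e.deg + 2 * e.deg + 10) * m + 8 * (2 * m)) + 8 * (2 * m)
        + 8 * (2 * m)) + 40 * m := by ring
    have h4 : bitLen 0 = 1 := by simp [bitLen]
    rw [h3, h4]
    omega

/-- The code for `rep` counts in register `r`, outside the variables, so that the command that is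
repeated may change all variables except register 2. -/
theorem runs_rep {p : Cmd} {env : State} {m B : ℕ} (hm : 1 ≤ m) (hb : env.count < 2 ^ m)
    (hn : 0 ≤ env.reg 2) (h2 : ∀ j ≤ env.count, (iter (fun _ => p.exec) j env).reg 2 = env.reg 2)
    (hp : ∀ j < env.count, p.Runs (iter (fun _ => p.exec) j env) B) :
    (Cmd.rep p).Runs env (env.count * (B + 16 * m) + 16 * m) := fun r s0 hr hs0 => by
  have hn16 : numVars = 16 := rfl
  set N := env.count with hN
  have e2N : env.reg 2 = N := count_eq hn
  have hbN : bitLen N ≤ 2 * m := (bitLen_natCast_le hb).trans (by omega)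
  let Inv : ℕ → State → Prop := fun j s =>
    j ≤ N ∧ Sim (iter (fun _ => p.exec) j env) s ∧ Frame r s0 s
  have hstep : ∀ j s, j < N → Inv j s → s.reg r = j → s.reg 2 = N → ∃ s' d,
      (p.code (r + 3)).Run s s' d ∧ d ≤ B ∧ s'.reg r = j ∧ s'.reg 2 = N ∧
      Inv (j + 1) (s'.setReg r ((j + 1 : ℕ) : ℤ)) := by
    rintro j s hj ⟨i0, i1, i2⟩ hr' -
    obtain ⟨t, d, q, si, fr, l⟩ := hp j hj (r + 3) s (by omega) i1
    refine ⟨t, d, q, l, (fr r hr (by omega)).trans hr', ?_, hj, si.temp hr _, ?_⟩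
    · rw [si.1 2 (by decide), ← e2N]
      exact h2 (j + 1) hj
    · exact (i2.trans (fr.mono (by omega))).setReg (Or.inr le_rfl) _
  obtain ⟨s1, d1, r1, l1, ⟨-, i1, i2⟩, -⟩ := run_forLoop (k := r) (c := r + 1) (N := N) (m := 2 * m) (B := B) (by omega) (by omega)
    (by omega) (by omega) (by omega) hbN Inv
    (fun j s z h => ⟨h.1, h.2.1.temp (by omega) z, h.2.2.setReg (Or.inr (by omega)) z⟩)
    (fun j s z h => ⟨h.1, h.2.1.temp (by omega) z, h.2.2.setReg (Or.inr (by omega)) z⟩)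
    hstep s0 (by rw [hs0.1 2 (by decide), e2N])
    ⟨Nat.zero_le _, hs0.temp hr _, (Frame.refl r s0).setReg (Or.inr le_rfl) _⟩
  exact ⟨s1, d1, r1, i1, i2, l1.trans_eq (by ring)⟩

/-- Commands without repetitions that do not change register 2. -/
def ok : Cmd → Bool
  | set x e => decide (x < numVars) && (decide (x ≠ 2) && e.ok)
  | fill a k e => decide (k < numVars) && (decide (k ≠ 2) && (e.ok && e.avoids a))
  | fill2 a i j e => (decide (i < numVars) && decide (i ≠ 2)) &&
      ((decide (j < numVars) && (decide (j ≠ 2) && decide (i ≠ j))) && (e.ok && e.avoids a))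
  | seq p q => p.ok && q.ok
  | ite c p q => c.ok && (p.ok && q.ok)
  | rep _ => false

/-- The nesting depth of loops. -/
def depth : Cmd → ℕ
  | set _ e => e.depth
  | fill _ _ e => e.depth + 1
  | fill2 _ _ _ e => e.depth + 2
  | seq p q => max p.depth q.depth
  | ite c p q => max c.depth (max p.depth q.depth)
  | rep p => p.depth + 1

theorem exec_reg_two {p : Cmd} (hp : p.ok = true) (env : State) :
    (p.exec env).reg 2 = env.reg 2 := by
  induction p generalizing env with
  | set x e =>
    simp only [ok, Bool.and_eq_true, decide_eq_true_eq] at hp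
    rw [exec, State.setReg_reg, if_neg hp.2.1.symm]
  | fill a k e => rfl
  | fill2 a i j e => rfl
  | seq p q ihp ihq =>
    simp only [ok, Bool.and_eq_true] at hp
    rw [exec, ihq hp.2, ihp hp.1]
  | ite c p q ihp ihq =>
    simp only [ok, Bool.and_eq_true] at hp
    rw [exec]
    split_ifs
    exacts [ihp hp.2.1 env, ihq hp.2.2 env]
  | rep p => simp [ok] at hp

/-- The cost and the growth of numbers for commands without repetitions. -/
theorem exists_runs {p : Cmd} (hp : p.ok = true) : ∃ K G : ℕ, 1 ≤ G ∧
    ∀ (m ν : ℕ) (env : State), 1 ≤ m → Bdd m env → 0 ≤ env.reg 2 → env.count ≤ ν → 1 ≤ ν →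
      p.Runs env (K * (ν ^ p.depth * m)) ∧ Bdd (G * m) (p.exec env) := by
  have hpow : ∀ {ν a b K : ℕ}, 1 ≤ ν → a ≤ b → K * ν ^ a ≤ K * ν ^ b := fun h1 h2 =>
    Nat.mul_le_mul_left _ (Nat.pow_le_pow_right h1 h2)
  have hone : ∀ {ν a K : ℕ}, 1 ≤ ν → K ≤ K * ν ^ a := fun h1 =>
    Nat.le_mul_of_pos_right _ (Nat.pow_pos h1)
  induction p with
  | set x e =>
    simp only [ok, Bool.and_eq_true, decide_eq_true_eq] at hp
    obtain ⟨K, hK⟩ := e.cost_le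
    refine ⟨K + 2 * e.deg + 2, e.deg, e.deg_pos, fun m ν env hm hb _ hν h1 => ⟨?_, ?_⟩⟩
    · refine (runs_set hp.1 hp.2.2 hm hb).mono ?_
      rw [← mul_assoc, depth, add_assoc K, add_mul K, add_assoc]
      exact Nat.mul_le_mul_right _ (Nat.add_le_add (hK _ _ hν h1) (hone h1))
    · exact (hb.mono (Nat.le_mul_of_pos_left _ e.deg_pos)).setReg x
        (by rw [mul_comm]; exact e.natAbs_eval_lt hp.2.2 hm hb)
  | fill a k e =>
    simp only [ok, Bool.and_eq_true, decide_eq_true_eq] at hp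
    obtain ⟨hk, hk2, he, ha⟩ := hp
    obtain ⟨K, hK⟩ := e.cost_le
    refine ⟨K * e.deg + (2 * e.deg + 18) + 24, e.deg, e.deg_pos,
      fun m ν env hm hb hn hν h1 => ⟨?_, ?_⟩⟩
    · refine (runs_fill hk hk2 he ha hm hb hn).mono ?_
      rw [← mul_assoc]
      refine Nat.mul_le_mul_right _ ?_
      rw [add_mul _ 24]
      refine Nat.add_le_add ?_ (hone h1)
      rw [depth, pow_succ', mul_left_comm]
      refine Nat.mul_le_mul hν ?_
      rw [add_mul (K * e.deg), add_assoc, mul_right_comm]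
      exact Nat.add_le_add (Nat.mul_le_mul_right _ (hK _ _ hν h1)) (hone h1)
    · refine bdd_partialFill hb (Nat.le_mul_of_pos_left _ e.deg_pos) fun c hc => ?_
      rw [mul_comm]
      refine e.natAbs_eval_lt he hm (hb.setReg k ?_)
      rw [Int.natAbs_natCast]
      exact hc.trans hb.count_lt
  | fill2 a i j e =>
    simp only [ok, Bool.and_eq_true, decide_eq_true_eq] at hp
    obtain ⟨⟨hi, hi2⟩, ⟨hj, hj2, hij⟩, he, ha⟩ := hp
    obtain ⟨K, hK⟩ := e.cost_le
    refine ⟨K * e.deg + (2 * e.deg + 26) + 32 + 40, e.deg, e.deg_pos,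
      fun m ν env hm hb hn hν h1 => ⟨?_, ?_⟩⟩
    · refine (runs_fill2 hi hi2 hj hj2 hij he ha hm hb hn).mono ?_
      rw [← mul_assoc]
      refine Nat.mul_le_mul_right _ ?_
      rw [add_mul _ 40]
      refine Nat.add_le_add ?_ (hone h1)
      rw [depth, pow_succ' ν (e.depth + 1), mul_left_comm]
      refine Nat.mul_le_mul hν ?_
      rw [add_mul _ 32]
      refine Nat.add_le_add ?_ (hone h1)
      rw [pow_succ', mul_left_comm]
      refine Nat.mul_le_mul hν ?_
      rw [add_mul (K * e.deg), add_assoc, mul_right_comm]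
      exact Nat.add_le_add (Nat.mul_le_mul_right _ (hK _ _ hν h1)) (hone h1)
    · refine bdd_partialFill hb (Nat.le_mul_of_pos_left _ e.deg_pos) fun c hc => ?_
      rw [mul_comm]
      have hlt := hb.count_lt
      have h1 : c / env.count < env.count := Nat.div_lt_of_lt_mul hc
      have h2 : c % env.count < env.count := Nat.mod_lt _ (Nat.zero_lt_of_lt h1)
      refine e.natAbs_eval_lt he hm ((hb.setReg i ?_).setReg j ?_) <;>
        · rw [Int.natAbs_natCast]; omega
  | seq p q ihp ihq =>
    simp only [ok, Bool.and_eq_true] at hp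
    obtain ⟨K, G, hG, h⟩ := ihp hp.1
    obtain ⟨K', G', hG', h'⟩ := ihq hp.2
    refine ⟨K + K' * G, G' * G, Nat.mul_pos hG' hG, fun m ν env hm hb hn hν h1 => ?_⟩
    obtain ⟨r1, b1⟩ := h m ν env hm hb hn hν h1
    have e2 := exec_reg_two hp.1 env
    obtain ⟨r2, b2⟩ := h' (G * m) ν (p.exec env) (Nat.mul_pos hG hm) b1 (by rw [e2]; exact hn)
      (by rw [State.count, e2]; exact hν) h1
    refine ⟨(r1.seq r2).mono ?_, by rw [mul_assoc]; exact b2⟩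
    have e3 : K' * (ν ^ q.depth * (G * m)) = (K' * G) * ν ^ q.depth * m := by ring
    rw [e3, ← mul_assoc, ← mul_assoc, ← add_mul, add_mul K]
    exact Nat.mul_le_mul_right _ (Nat.add_le_add (hpow h1 (le_max_left _ _))
      (hpow h1 (le_max_right _ _)))
  | ite c p q ihp ihq =>
    simp only [ok, Bool.and_eq_true] at hp
    obtain ⟨K, G, hG, h⟩ := ihp hp.2.1
    obtain ⟨K', G', hG', h'⟩ := ihq hp.2.2
    obtain ⟨Kc, hKc⟩ := c.cost_le
    refine ⟨Kc + 2 * c.deg + K + K', G + G', by omega, fun m ν env hm hb hn hν h1 => ?_⟩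
    obtain ⟨r1, b1⟩ := h m ν env hm hb hn hν h1
    obtain ⟨r2, b2⟩ := h' m ν env hm hb hn hν h1
    refine ⟨(Runs.ite hp.1 hm hb (fun _ => r1) fun _ => r2).mono ?_, ?_⟩
    · simp only [← mul_assoc, ← add_mul]
      refine Nat.mul_le_mul_right _ ?_
      rw [add_mul _ K', add_mul _ K, add_mul Kc, depth]
      refine Nat.add_le_add (Nat.add_le_add (Nat.add_le_add ((hKc _ _ hν h1).trans
        (hpow h1 (le_max_left _ _))) (hone h1)) (hpow h1 ?_)) (hpow h1 ?_)
      · exact (le_max_left _ _).trans (le_max_right _ _)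
      · exact (le_max_right _ _).trans (le_max_right _ _)
    · rw [exec, add_mul]
      split_ifs
      exacts [b1.mono (Nat.le_add_right _ _), b2.mono (Nat.le_add_left _ _)]
  | rep p => simp [ok] at hp

end Cmd
end Traffic

namespace Traffic

/-! ### Integer data of an instance -/

namespace Instance

open Crossing

variable {n : ℕ} (I : Instance n)

/-- First coordinate of the direction of a vehicle. -/
def dx (i : Fin n) : ℤ := Int.sign ((I.vehicle i).goalX - (I.vehicle i).startX)

/-- Second coordinate of the direction of a vehicle. -/
def dy (i : Fin n) : ℤ := Int.sign ((I.vehicle i).goalY - (I.vehicle i).startY)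

/-- Inner product of directions. -/
def dotZ (i j : Fin n) : ℤ := I.dx i * I.dx j + I.dy i * I.dy j

/-- Lateral displacement of the start of `j` relative to the lane of `i`. -/
def latZ (i j : Fin n) : ℤ := I.dx i * ((I.vehicle j).startY - (I.vehicle i).startY) -
  I.dy i * ((I.vehicle j).startX - (I.vehicle i).startX)

/-- Distance from start to goal, like all integer distances in units of `1 / den ^ 2`. This is the
distance covered at full speed in one time unit `1 / (den * maxSpeed)`. -/
def distZ (i : Fin n) : ℤ := I.den * (I.dx i * ((I.vehicle i).goalX - (I.vehicle i).startX) +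
  I.dy i * ((I.vehicle i).goalY - (I.vehicle i).startY))

/-- The displacement `Crossing.off`. -/
def offZ (i j : Fin n) : ℤ := I.den * (I.dx i * ((I.vehicle j).startX - (I.vehicle i).startX) +
  I.dy i * ((I.vehicle j).startY - (I.vehicle i).startY))

/-- The length of a vehicle. -/
def lenZ (i : Fin n) : ℤ := I.den * (I.vehicle i).length

/-- Start time, like all integer times in units of `1 / (den * maxSpeed)`. -/
def startZ (i : Fin n) : ℤ := (I.vehicle i).startTime * I.maxSpeed

/-- The deadline of a vehicle. -/
def deadlineZ (i : Fin n) : ℤ := (I.vehicle i).deadline * I.maxSpeed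

/-- The number of distance units in the unit distance. -/
def fine : ℝ := (I.den : ℝ) ^ 2

/-- The number of time units in the unit time. -/
def rate : ℝ := I.den * I.maxSpeed

theorem den_pos' : (0 : ℝ) < I.den := Nat.cast_pos.2 I.den_pos

theorem fine_pos : 0 < I.fine := pow_pos I.den_pos' 2

variable {I}

theorem lt_iff {a b : ℤ} : (a : ℝ) / I.fine < b / I.fine ↔ a < b := by
  rw [div_lt_div_iff_of_pos_right I.fine_pos, Int.cast_lt]

theorem le_iff {a b : ℤ} : (a : ℝ) / I.fine ≤ b / I.fine ↔ a ≤ b := by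
  rw [div_le_div_iff_of_pos_right I.fine_pos, Int.cast_le]

theorem eq_iff {a b : ℤ} : (a : ℝ) / I.fine = b / I.fine ↔ a = b := by
  rw [div_left_inj' I.fine_pos.ne', Int.cast_inj]

theorem dx_dy (i : Fin n) : (I.dx i = 0 ∧ (I.dy i = 1 ∨ I.dy i = -1)) ∨
    (I.dy i = 0 ∧ (I.dx i = 1 ∨ I.dx i = -1)) := by
  have h1 := (I.vehicle i).start_ne_goal
  rcases (I.vehicle i).axis_parallel with h | h
  · left
    refine ⟨by simp [dx, h], ?_⟩
    have h2 : (I.vehicle i).goalY - (I.vehicle i).startY ≠ 0 := fun h3 => h1 ⟨h, by omega⟩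
    rcases lt_or_gt_of_ne h2 with h3 | h3
    · exact Or.inr (Int.sign_eq_neg_one_of_neg h3)
    · exact Or.inl (Int.sign_eq_one_of_pos h3)
  · right
    refine ⟨by simp [dy, h], ?_⟩
    have h2 : (I.vehicle i).goalX - (I.vehicle i).startX ≠ 0 := fun h3 => h1 ⟨by omega, h⟩
    rcases lt_or_gt_of_ne h2 with h3 | h3
    · exact Or.inr (Int.sign_eq_neg_one_of_neg h3)
    · exact Or.inl (Int.sign_eq_one_of_pos h3)

theorem start_apply (i : Fin n) : (I.toCrossing.vehicle i).start 0 = (I.vehicle i).startX / I.den ∧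
    (I.toCrossing.vehicle i).start 1 = (I.vehicle i).startY / I.den := ⟨rfl, rfl⟩

theorem goal_apply (i : Fin n) : (I.toCrossing.vehicle i).goal 0 = (I.vehicle i).goalX / I.den ∧
    (I.toCrossing.vehicle i).goal 1 = (I.vehicle i).goalY / I.den := ⟨rfl, rfl⟩

theorem goal_sub_start (i : Fin n) : (I.toCrossing.vehicle i).goal - (I.toCrossing.vehicle i).start =
    ((I.distZ i : ℝ) / I.fine) • !₂[(I.dx i : ℝ), (I.dy i : ℝ)] := by
  have hq := I.den_pos'
  have hx : I.dx i * ((I.vehicle i).goalX - (I.vehicle i).startX) * I.dx i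
      = (I.vehicle i).goalX - (I.vehicle i).startX := by
    rcases dx_dy (I := I) i with ⟨h, -⟩ | ⟨-, h | h⟩
    · have := Int.sign_eq_zero_iff_zero.1 h
      rw [this]; ring
    · rw [h]; ring
    · rw [h]; ring
  have hy : I.dy i * ((I.vehicle i).goalY - (I.vehicle i).startY) * I.dy i
      = (I.vehicle i).goalY - (I.vehicle i).startY := by
    rcases dx_dy (I := I) i with ⟨-, h | h⟩ | ⟨h, -⟩
    · rw [h]; ring
    · rw [h]; ring
    · have := Int.sign_eq_zero_iff_zero.1 h
      rw [this]; ring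
  have hxy : I.dx i * I.dy i = 0 := by
    rcases dx_dy (I := I) i with ⟨h, -⟩ | ⟨h, -⟩ <;> simp [h]
  have hx' : (I.dx i * (I.distZ i) : ℤ) = I.den * ((I.vehicle i).goalX - (I.vehicle i).startX) := by
    rw [distZ]
    linear_combination (I.den : ℤ) * hx +
      I.den * ((I.vehicle i).goalY - (I.vehicle i).startY) * hxy
  have hy' : (I.dy i * (I.distZ i) : ℤ) = I.den * ((I.vehicle i).goalY - (I.vehicle i).startY) := by
    rw [distZ]
    linear_combination (I.den : ℤ) * hy +
      I.den * ((I.vehicle i).goalX - (I.vehicle i).startX) * hxy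
  have hx2 : (I.dx i : ℝ) * I.distZ i = I.den * ((I.vehicle i).goalX - (I.vehicle i).startX) := by
    exact_mod_cast hx'
  have hy2 : (I.dy i : ℝ) * I.distZ i = I.den * ((I.vehicle i).goalY - (I.vehicle i).startY) := by
    exact_mod_cast hy'
  apply Pt.ext'
  · simp only [PiLp.sub_apply, PiLp.smul_apply, goal_apply, start_apply, smul_eq_mul]
    change _ = (I.distZ i : ℝ) / I.fine * I.dx i
    rw [fine]
    field_simp
    linear_combination -hx2
  · simp only [PiLp.sub_apply, PiLp.smul_apply, goal_apply, start_apply, smul_eq_mul]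
    change _ = (I.distZ i : ℝ) / I.fine * I.dy i
    rw [fine]
    field_simp
    linear_combination -hy2

theorem norm_unit (i : Fin n) : ‖(!₂[(I.dx i : ℝ), (I.dy i : ℝ)] : Pt)‖ = 1 := by
  rw [EuclideanSpace.norm_eq, Fin.sum_univ_two, Real.sqrt_eq_one]
  change ‖(I.dx i : ℝ)‖ ^ 2 + ‖(I.dy i : ℝ)‖ ^ 2 = 1
  rcases dx_dy (I := I) i with ⟨h, h' | h'⟩ | ⟨h, h' | h'⟩ <;> simp [h, h']

theorem dist_eq (i : Fin n) : I.toCrossing.dist i = I.distZ i / I.fine := by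
  have h0 : (0 : ℤ) ≤ I.distZ i := by
    rw [distZ]
    refine mul_nonneg (by positivity) (add_nonneg ?_ ?_)
    · rw [dx, mul_comm, Int.mul_sign_self]; positivity
    · rw [dy, mul_comm, Int.mul_sign_self]; positivity
  have h0' : (0 : ℝ) ≤ I.distZ i := by exact_mod_cast h0
  have := I.fine_pos
  rw [Crossing.dist, goal_sub_start, norm_smul, norm_unit, mul_one, Real.norm_of_nonneg (by positivity)]

theorem distZ_pos (i : Fin n) : 0 < I.distZ i := by
  rw [← lt_iff (I := I), ← dist_eq, Int.cast_zero, zero_div]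
  exact (I.toCrossing.vehicle i).dist_pos

theorem dir_eq (i : Fin n) : (I.toCrossing.vehicle i).dir = !₂[(I.dx i : ℝ), (I.dy i : ℝ)] := by
  have h := (I.toCrossing.vehicle i).dist_pos
  have e : ‖(I.toCrossing.vehicle i).goal - (I.toCrossing.vehicle i).start‖ = I.distZ i / I.fine :=
    dist_eq i
  rw [e] at h
  rw [Vehicle.dir, e, goal_sub_start, smul_smul, inv_mul_cancel₀ h.ne', one_smul]

theorem dir_apply (i : Fin n) : (I.toCrossing.vehicle i).dir 0 = I.dx i ∧
    (I.toCrossing.vehicle i).dir 1 = I.dy i := by rw [dir_eq]; exact ⟨rfl, rfl⟩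

theorem inner_dir_eq (i j : Fin n) :
    inner ℝ (I.toCrossing.vehicle i).dir (I.toCrossing.vehicle j).dir = (I.dotZ i j : ℝ) := by
  rw [Pt.inner_eq, (dir_apply i).1, (dir_apply i).2, (dir_apply j).1, (dir_apply j).2, dotZ]
  push_cast; ring

theorem off_eq (i j : Fin n) : I.toCrossing.off i j = I.offZ i j / I.fine := by
  have hq := I.den_pos'
  rw [Crossing.off, Pt.inner_eq, PiLp.sub_apply, PiLp.sub_apply, (dir_apply i).1, (dir_apply i).2,
    (start_apply i).1, (start_apply i).2, (start_apply j).1, (start_apply j).2, offZ, fine]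
  push_cast
  field_simp

theorem len_eq (i : Fin n) : I.toCrossing.len i = I.lenZ i / I.fine := by
  have hq := I.den_pos'
  change ((I.vehicle i).length : ℝ) / I.den = _
  rw [lenZ, fine]
  push_cast
  field_simp

theorem startTime_eq (hv : 0 < I.maxSpeed) (i : Fin n) :
    (I.toCrossing.vehicle i).startTime = I.startZ i / I.rate := by
  have hq := I.den_pos'
  have hv : (0 : ℝ) < I.maxSpeed := Nat.cast_pos.2 hv
  change ((I.vehicle i).startTime : ℝ) / I.den = _
  rw [startZ, rate]
  push_cast
  field_simp

theorem deadline_eq (hv : 0 < I.maxSpeed) (i : Fin n) :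
    (I.toCrossing.vehicle i).deadline = I.deadlineZ i / I.rate := by
  have hq := I.den_pos'
  have hv : (0 : ℝ) < I.maxSpeed := Nat.cast_pos.2 hv
  change ((I.vehicle i).deadline : ℝ) / I.den = _
  rw [deadlineZ, rate]
  push_cast
  field_simp

theorem lane_iff (i j : Fin n) : I.toCrossing.Lane i j ↔ I.latZ i j = 0 := by
  have hq := I.den_pos'
  have e0 : ((I.toCrossing.vehicle j).start - (I.toCrossing.vehicle i).start) 0 =
      (((I.vehicle j).startX - (I.vehicle i).startX : ℤ) : ℝ) / I.den := by
    rw [PiLp.sub_apply, (start_apply i).1, (start_apply j).1]; push_cast; ring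
  have e1 : ((I.toCrossing.vehicle j).start - (I.toCrossing.vehicle i).start) 1 =
      (((I.vehicle j).startY - (I.vehicle i).startY : ℤ) : ℝ) / I.den := by
    rw [PiLp.sub_apply, (start_apply i).2, (start_apply j).2]; push_cast; ring
  have h : I.toCrossing.Lane i j ↔
      (((I.vehicle j).startX - (I.vehicle i).startX : ℤ) : ℝ) / I.den = I.offZ i j / I.fine * I.dx i ∧
      (((I.vehicle j).startY - (I.vehicle i).startY : ℤ) : ℝ) / I.den = I.offZ i j / I.fine * I.dy i := by
    rw [Lane, off_eq]
    constructor
    · intro h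
      refine ⟨?_, ?_⟩
      · rw [← e0, h, PiLp.smul_apply, (dir_apply i).1, smul_eq_mul]
      · rw [← e1, h, PiLp.smul_apply, (dir_apply i).2, smul_eq_mul]
    · rintro ⟨h1, h2⟩
      apply Pt.ext'
      · rw [e0, h1, PiLp.smul_apply, (dir_apply i).1, smul_eq_mul]
      · rw [e1, h2, PiLp.smul_apply, (dir_apply i).2, smul_eq_mul]
  have hz : ∀ a b : ℤ, (a : ℝ) / I.den = ((I.den * b : ℤ) : ℝ) / I.fine ↔ a = b := by
    intro a b
    rw [fine]
    push_cast
    rw [pow_two, mul_div_mul_left _ _ hq.ne', div_left_inj' hq.ne', Int.cast_inj]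
  have hd : ∀ d : ℤ, (I.offZ i j : ℝ) / I.fine * d = ((I.den * ((I.dx i * ((I.vehicle j).startX -
      (I.vehicle i).startX) + I.dy i * ((I.vehicle j).startY - (I.vehicle i).startY)) * d) : ℤ) : ℝ)
      / I.fine := by
    intro d
    rw [offZ]; push_cast; ring
  rw [h, hd, hd, hz, hz, latZ]
  rcases dx_dy (I := I) i with ⟨h, h' | h'⟩ | ⟨h, h' | h'⟩ <;> rw [h, h'] <;> constructor <;>
    intros <;> omega

theorem same_iff (i j : Fin n) : I.toCrossing.Same i j ↔ I.dotZ i j = 1 ∧ I.latZ i j = 0 := by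
  rw [Same, lane_iff]
  refine and_congr_left fun _ => ⟨fun h => ?_, fun h => ?_⟩
  · have := I.toCrossing.inner_same h
    rw [inner_dir_eq] at this
    exact_mod_cast this
  · rcases (I.toCrossing.vehicle i).dir_rel (I.toCrossing.vehicle j) with h' | h' | h'
    · rw [inner_dir_eq, h] at h'; norm_num at h'
    · exact h'
    · have := I.toCrossing.inner_opp h'
      rw [inner_dir_eq, h] at this; norm_num at this

theorem opp_iff (i j : Fin n) : I.toCrossing.Opp i j ↔ I.dotZ i j = -1 ∧ I.latZ i j = 0 := by
  rw [Opp, lane_iff]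
  refine and_congr_left fun _ => ⟨fun h => ?_, fun h => ?_⟩
  · have := I.toCrossing.inner_opp h
    rw [inner_dir_eq] at this
    exact_mod_cast this
  · rcases (I.toCrossing.vehicle i).dir_rel (I.toCrossing.vehicle j) with h' | h' | h'
    · rw [inner_dir_eq, h] at h'; norm_num at h'
    · have := I.toCrossing.inner_same h'
      rw [inner_dir_eq, h] at this; norm_num at this
    · exact h'

theorem cross_iff (i j : Fin n) : I.toCrossing.Cross i j ↔ I.dotZ i j = 0 ∧ -I.lenZ i < I.offZ i j ∧
    I.offZ i j < I.distZ i ∧ -I.lenZ j < I.offZ j i ∧ I.offZ j i < I.distZ j := by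
  have hneg : ∀ a b : ℤ, -((a : ℝ) / I.fine) < b / I.fine ↔ -a < b := fun a b => by
    rw [← lt_iff (I := I), Int.cast_neg, neg_div]
  rw [Cross, inner_dir_eq]
  simp only [off_eq, len_eq, dist_eq, lt_iff, hneg, Int.cast_eq_zero]

theorem ahead_iff (i j : Fin n) : I.toCrossing.Ahead i j ↔
    (I.dotZ i j = 1 ∧ I.latZ i j = 0) ∧ I.lenZ j ≤ I.offZ i j := by
  rw [Ahead, same_iff, off_eq, len_eq, le_iff]

open Classical in
/-- The distance `Crossing.queue`. -/
def queueZ (I : Instance n) (i k : Fin n) : ℤ :=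
  ∑ m with I.toCrossing.Ahead i m ∧ (m = k ∨ I.toCrossing.Ahead m k), I.lenZ m

theorem queue_eq (i k : Fin n) : I.toCrossing.queue i k = I.queueZ i k / I.fine := by
  rw [queue, queueZ, Int.cast_sum, Finset.sum_div]
  exact Finset.sum_congr rfl fun m _ => len_eq m

theorem clear_zero_iff (i j : Fin n) : I.toCrossing.Clear i j 0 0 ↔
    (I.dotZ i j = 0 → ¬ (-I.lenZ i < I.offZ i j ∧ I.offZ i j < 0 ∧ -I.lenZ j < I.offZ j i ∧
      I.offZ j i < 0)) ∧
    (I.dotZ i j = 1 ∧ I.latZ i j = 0 → I.offZ i j ≤ -I.lenZ i ∨ I.lenZ j ≤ I.offZ i j) ∧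
    (I.dotZ i j = -1 ∧ I.latZ i j = 0 → 0 ≤ I.offZ i j ∨ I.offZ i j + I.lenZ j ≤ -I.lenZ i) := by
  have h0 : ((0 : ℤ) : ℝ) / I.fine = 0 := by simp
  have e1 : ∀ a b : ℤ, -((a : ℝ) / I.fine) < b / I.fine ↔ -a < b := fun a b => by
    rw [← lt_iff (I := I), Int.cast_neg, neg_div]
  have e2 : ∀ a : ℤ, (a : ℝ) / I.fine < 0 ↔ a < 0 := fun a => by rw [← h0, lt_iff]
  have e3 : ∀ a b : ℤ, (a : ℝ) / I.fine ≤ -(b / I.fine) ↔ a ≤ -b := fun a b => by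
    rw [← le_iff (I := I), Int.cast_neg, neg_div]
  have e4 : ∀ a b : ℤ, 0 ≤ (a : ℝ) / I.fine - b / I.fine ↔ b ≤ a := fun a b => by
    rw [sub_nonneg, le_iff]
  have e5 : ∀ a b c : ℤ, (a : ℝ) / I.fine + b / I.fine ≤ -(c / I.fine) ↔ a + b ≤ -c :=
    fun a b c => by rw [← e3, Int.cast_add, add_div]
  have e6 : ∀ a : ℤ, 0 ≤ (a : ℝ) / I.fine ↔ 0 ≤ a := fun a => by rw [← h0, le_iff]
  rw [Clear, same_iff, opp_iff, inner_dir_eq]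
  simp only [off_eq, len_eq, zero_sub, add_zero, sub_zero, e1, e2, e3, e4, e5, e6, Int.cast_eq_zero]

end Instance
end Traffic

namespace Traffic

/-! ### Terms for the data of an instance -/

/-- The entries of a concatenation of lists of equal length. -/
theorem getD_flatMap_finRange {α : Type*} {n d : ℕ} (f : Fin n → List α) (hf : ∀ i, (f i).length = d)
    (z : α) (i : Fin n) {c : ℕ} (hc : c < d) :
    ((List.finRange n).flatMap f).getD (i * d + c) z = (f i).getD c z := by
  induction n with
  | zero => exact i.elim0
  | succ n ih =>
    rw [List.finRange_succ, List.flatMap_cons, List.flatMap_map]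
    refine Fin.cases ?_ (fun j => ?_) i
    · rw [Fin.val_zero, zero_mul, zero_add, List.getD_append _ _ _ _ (by rw [hf]; exact hc)]
    · have h1 := ih (fun j => f j.succ) (fun j => hf _) j
      rw [List.getD_append_right _ _ _ _ (by rw [hf, Fin.val_succ]; nlinarith), hf, Fin.val_succ,
        ← h1]
      congr 1
      rw [add_mul, one_mul]; omega

/-- The entries of a word, continued by zeros. -/
def entry (w : List ℤ) (k : ℕ) : ℤ := w.getD k 0

namespace Instance

variable {n : ℕ} (I : Instance n)

/-- The numbers of vehicle `i`, in the order of the encoding. -/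
def fields (i : Fin n) : List ℤ :=
  [((I.vehicle i).length : ℤ), (I.vehicle i).startX, (I.vehicle i).startY, (I.vehicle i).goalX,
    (I.vehicle i).goalY, ((I.vehicle i).startTime : ℤ), (I.vehicle i).deadline]

theorem encode_eq : I.encode = (n : ℤ) :: (I.den : ℤ) :: (I.maxSpeed : ℤ) ::
    (List.finRange n).flatMap I.fields := rfl

/-- The three numbers `n`, `den` and `maxSpeed` precede the numbers of the vehicles. -/
theorem entry_field (i : Fin n) {c : ℕ} (hc : c < 7) :
    entry I.encode (3 + c + 7 * i) = (I.fields i).getD c 0 := by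
  have h := getD_flatMap_finRange (d := 7) I.fields (fun _ => rfl) 0 i hc
  rw [← h, entry, encode_eq]
  have : 3 + c + 7 * (i : ℕ) = ((i : ℕ) * 7 + c) + 1 + 1 + 1 := by ring
  rw [this, List.getD_cons_succ, List.getD_cons_succ, List.getD_cons_succ]

theorem length_flatMap_fields : ((List.finRange n).flatMap I.fields).length = 7 * n := by
  rw [List.length_flatMap]
  simp [fields, mul_comm]

theorem length_encode : I.encode.length = 7 * n + 3 := by
  rw [encode_eq]
  simp only [List.length_cons, I.length_flatMap_fields]

end Instance

/-- The certificate that a machine reads from a word. -/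
def prioritiesOf (n : ℕ) (u : List ℤ) : Priorities n := fun i j => decide (0 < entry u (i * n + j))

/-- The certificate is recovered from its encoding. -/
theorem prioritiesOf_encode {n : ℕ} (P : Priorities n) : prioritiesOf n P.encode = P := by
  funext i j
  have h := getD_flatMap_finRange (d := n)
    (fun i => (List.finRange n).map fun j => if P i j then (1 : ℤ) else 0) (fun _ => by simp) 0 i j.2
  have h2 : entry P.encode (i * n + j) = if P i j then 1 else 0 := by
    rw [entry, Priorities.encode, h, List.getD_eq_getElem _ _ (by simp)]
    simp
  rw [prioritiesOf, h2]
  cases P i j <;> simp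

namespace Term

/-! ### Conditions as terms

A condition is a term which holds if its value is positive. -/

/-- The condition `a < b`. -/
def lt (a b : Term) : Term := sub b a

/-- The condition `a ≤ b`; the values are integers. -/
def le (a b : Term) : Term := sub (add b (const 1)) a

/-- Conjunction of conditions. -/
def and (a b : Term) : Term := ite a b (const 0)

/-- Disjunction of conditions. -/
def or (a b : Term) : Term := ite a (const 1) b

/-- Negation of a condition. -/
def not (a : Term) : Term := sub (const 1) a

/-- The condition `a = b`. -/
def eq (a b : Term) : Term := and (le a b) (le b a)

/-- The condition `e` holds for some value of register `k` below the content of register 2. -/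
def any (k : ℕ) (e : Term) : Term := sum k (const 0) (ite e (const 1) (const 0))

variable {a b e : Term} {s : State}

theorem pos_lt : 0 < (lt a b).eval s ↔ a.eval s < b.eval s := by simp [lt, eval]

theorem pos_le : 0 < (le a b).eval s ↔ a.eval s ≤ b.eval s := by simp only [le, eval]; omega

theorem pos_and : 0 < (and a b).eval s ↔ 0 < a.eval s ∧ 0 < b.eval s := by
  simp only [and, eval]; split_ifs with h <;> simp [h]

theorem pos_or : 0 < (or a b).eval s ↔ 0 < a.eval s ∨ 0 < b.eval s := by
  simp only [or, eval]; split_ifs with h <;> simp [h]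

theorem pos_not : 0 < (not a).eval s ↔ ¬ 0 < a.eval s := by simp only [not, eval]; omega

theorem pos_eq : 0 < (eq a b).eval s ↔ a.eval s = b.eval s := by
  rw [eq, pos_and, pos_le, pos_le, le_antisymm_iff]

end Term

theorem iter_add (v : ℕ → ℤ) (N : ℕ) (z : ℤ) :
    iter (fun j z => z + v j) N z = z + ∑ j : Fin N, v j := by
  induction N with
  | zero => simp [iter]
  | succ N ih => rw [iter, ih, Fin.sum_univ_castSucc, add_assoc]; rfl

/-- The outcome of repeated application of `leastPos`. -/
theorem iter_leastPos (v : ℕ → ℤ) (N : ℕ) (z : ℤ) :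
    (0 < z → 0 < iter (fun j z => leastPos z (v j)) N z ∧
      iter (fun j z => leastPos z (v j)) N z ≤ z) ∧
    (∀ j : Fin N, 0 < v j → 0 < iter (fun j z => leastPos z (v j)) N z ∧
      iter (fun j z => leastPos z (v j)) N z ≤ v j) ∧
    (0 < iter (fun j z => leastPos z (v j)) N z → iter (fun j z => leastPos z (v j)) N z = z ∨
      ∃ j : Fin N, iter (fun j z => leastPos z (v j)) N z = v j) := by
  induction N with
  | zero => exact ⟨fun h => ⟨h, le_rfl⟩, fun j => j.elim0, fun _ => Or.inl rfl⟩
  | succ N ih =>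
    obtain ⟨h1, h2, h3⟩ := ih
    simp only [iter]
    set y := iter (fun j z => leastPos z (v j)) N z
    have k1 : 0 < y → 0 < leastPos y (v N) ∧ leastPos y (v N) ≤ y := by
      intro h; rw [leastPos]; split_ifs <;> omega
    have k2 : 0 < v N → 0 < leastPos y (v N) ∧ leastPos y (v N) ≤ v N := by
      intro h; rw [leastPos]; split_ifs <;> omega
    have k3 : 0 < leastPos y (v N) → leastPos y (v N) = y ∨ leastPos y (v N) = v N := by
      rw [leastPos]; split_ifs <;> omega
    refine ⟨fun h => ?_, fun j => ?_, fun h => ?_⟩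
    · have := h1 h
      have := k1 this.1
      omega
    · refine Fin.lastCases ?_ (fun j => ?_) j
      · exact k2
      · intro h
        have h4 := h2 j h
        have := k1 h4.1
        exact ⟨this.1, this.2.trans h4.2⟩
    · rcases k3 h with e | e
      · rw [e] at h ⊢
        rcases h3 h with e' | ⟨j, e'⟩
        · exact Or.inl e'
        · exact Or.inr ⟨j.castSucc, e'⟩
      · exact Or.inr ⟨Fin.last N, e⟩

namespace Term

variable {n : ℕ} {s : State}

theorem eval_sum (hs : s.reg 2 = n) (k : ℕ) (i e : Term) :
    (sum k i e).eval s = i.eval s + ∑ j : Fin n, e.eval (s.setReg k (j : ℕ)) := by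
  have : s.count = n := by rw [State.count, hs, Int.toNat_natCast]
  rw [eval, this, iter_add (fun j => e.eval (s.setReg k j))]

theorem pos_any (hs : s.reg 2 = n) (k : ℕ) (e : Term) :
    0 < (any k e).eval s ↔ ∃ j : Fin n, 0 < e.eval (s.setReg k (j : ℕ)) := by
  rw [any, eval_sum hs]
  simp only [eval, zero_add]
  have h0 : ∀ j : Fin n, 0 ≤ (if 0 < e.eval (s.setReg k (j : ℕ)) then (1 : ℤ) else 0) := fun j => by
    split_ifs <;> norm_num
  constructor
  · intro h
    by_contra! hc
    rw [Finset.sum_eq_zero fun j _ => if_neg (hc j).not_gt] at h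
    exact lt_irrefl _ h
  · rintro ⟨j, hj⟩
    refine Finset.sum_pos' (fun j _ => h0 j) ⟨j, Finset.mem_univ _, ?_⟩
    rw [if_pos hj]
    norm_num

/-- The index of the cell in row `a` and column `b` of a matrix. -/
def idx (a b : ℕ) : Term := add (mul (var a) (var 2)) (var b)

/-- Number `c` in the list `Instance.fields` of the vehicle whose index is in register `a`. -/
def field (c a : ℕ) : Term := load 0 (add (const (3 + c : ℕ)) (mul (const 7) (var a)))

/-- The sign of the value of `e`. -/
def sign (e : Term) : Term := ite e (const 1) (ite (lt e (const 0)) (const (-1)) (const 0))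

/-- The integer `Instance.dx` for the vehicle whose index is in register `a`. The following terms
refer to the vehicles in registers `a` and `b` in the same way. -/
def dx (a : ℕ) : Term := sign (sub (field 3 a) (field 1 a))

/-- The integer `Instance.dy`. -/
def dy (a : ℕ) : Term := sign (sub (field 4 a) (field 2 a))

/-- The denominator of the instance. -/
def den : Term := load 0 (const 1)

/-- The speed limit of the instance. -/
def maxSpeed : Term := load 0 (const 2)

/-- The inner product `Instance.dotZ`. -/
def dot (a b : ℕ) : Term := add (mul (dx a) (dx b)) (mul (dy a) (dy b))

/-- The lateral displacement `Instance.latZ`. -/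
def lat (a b : ℕ) : Term := sub (mul (dx a) (sub (field 2 b) (field 2 a)))
  (mul (dy a) (sub (field 1 b) (field 1 a)))

/-- The distance `Instance.distZ`. -/
def dist (a : ℕ) : Term := mul den (add (mul (dx a) (sub (field 3 a) (field 1 a)))
  (mul (dy a) (sub (field 4 a) (field 2 a))))

/-- The displacement `Instance.offZ`. -/
def off (a b : ℕ) : Term := mul den (add (mul (dx a) (sub (field 1 b) (field 1 a)))
  (mul (dy a) (sub (field 2 b) (field 2 a))))

/-- The length `Instance.lenZ`. -/
def len (a : ℕ) : Term := mul den (field 0 a)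

/-- The start time `Instance.startZ`. -/
def start (a : ℕ) : Term := mul (field 5 a) maxSpeed

/-- The deadline `Instance.deadlineZ`. -/
def deadline (a : ℕ) : Term := mul (field 6 a) maxSpeed

/-- The condition `Crossing.Cross`. -/
def cross (a b : ℕ) : Term := and (eq (dot a b) (const 0)) (and (lt (sub (const 0) (len a)) (off a b))
  (and (lt (off a b) (dist a)) (and (lt (sub (const 0) (len b)) (off b a)) (lt (off b a) (dist b)))))

/-- The condition `Crossing.Same`. -/
def same (a b : ℕ) : Term := and (eq (dot a b) (const 1)) (eq (lat a b) (const 0))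

/-- The condition `Crossing.Opp`. -/
def opp (a b : ℕ) : Term := and (eq (dot a b) (const (-1))) (eq (lat a b) (const 0))

/-- The condition `Crossing.Ahead`. -/
def ahead (a b : ℕ) : Term := and (same a b) (le (len b) (off a b))

/-- The condition `Before`, according to the certificate in bank 1. -/
def before (a b : ℕ) : Term := or (and (lt (var a) (var b)) (load 1 (idx a b)))
  (and (lt (var b) (var a)) (not (load 1 (idx b a))))

/-- Vehicle `b` is vehicle `a` or ahead of it. -/
def within (a b : ℕ) : Term := or (eq (var a) (var b)) (ahead a b)

end Term

/-- The input of the machine is the instance `I` with the certificate `u`. -/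
structure Instance.Input {n : ℕ} (I : Instance n) (u : List ℤ) (s : State) : Prop where
  word : s.bank 0 = entry I.encode
  cert : s.bank 1 = entry u
  count : s.reg 2 = n

namespace Instance.Input

open Crossing

variable {n : ℕ} {I : Instance n} {u : List ℤ} {s : State}

theorem setReg (h : I.Input u s) {k : ℕ} (hk : 2 ≠ k) (z : ℤ) : I.Input u (s.setReg k z) :=
  ⟨h.word, h.cert, by rw [State.setReg_reg, if_neg hk, h.count]⟩

variable {a b : ℕ} {i j : Fin n}

theorem field (h : I.Input u s) (ha : s.reg a = (i : ℕ)) {c : ℕ} (hc : c < 7) :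
    (Term.field c a).eval s = (I.fields i).getD c 0 := by
  simp only [Term.field, Term.eval, h.word, ha]
  rw [← I.entry_field i hc]
  congr 1

theorem den (h : I.Input u s) : Term.den.eval s = I.den := by
  simp only [Term.den, Term.eval, h.word]
  rfl

theorem maxSpeed (h : I.Input u s) : Term.maxSpeed.eval s = I.maxSpeed := by
  simp only [Term.maxSpeed, Term.eval, h.word]
  rfl

theorem _root_.Traffic.Term.eval_sign (e : Term) (s : State) : (Term.sign e).eval s = Int.sign (e.eval s) := by
  simp only [Term.sign, Term.eval, Term.pos_lt]
  split_ifs with h1 h2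
  · exact (Int.sign_eq_one_of_pos h1).symm
  · exact (Int.sign_eq_neg_one_of_neg h2).symm
  · rw [show e.eval s = 0 by omega]; rfl

theorem dx (h : I.Input u s) (ha : s.reg a = (i : ℕ)) : (Term.dx a).eval s = I.dx i := by
  rw [Term.dx, Term.eval_sign, Term.eval, h.field ha (by norm_num), h.field ha (by norm_num)]
  rfl

theorem dy (h : I.Input u s) (ha : s.reg a = (i : ℕ)) : (Term.dy a).eval s = I.dy i := by
  rw [Term.dy, Term.eval_sign, Term.eval, h.field ha (by norm_num), h.field ha (by norm_num)]
  rfl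

theorem dist (h : I.Input u s) (ha : s.reg a = (i : ℕ)) : (Term.dist a).eval s = I.distZ i := by
  simp only [Term.dist, Term.eval, h.den, h.dx ha, h.dy ha, h.field ha (by norm_num : 1 < 7),
    h.field ha (by norm_num : 2 < 7), h.field ha (by norm_num : 3 < 7),
    h.field ha (by norm_num : 4 < 7)]
  rfl

theorem len (h : I.Input u s) (ha : s.reg a = (i : ℕ)) : (Term.len a).eval s = I.lenZ i := by
  simp only [Term.len, Term.eval, h.den, h.field ha (by norm_num : 0 < 7)]
  rfl

theorem start (h : I.Input u s) (ha : s.reg a = (i : ℕ)) : (Term.start a).eval s = I.startZ i := by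
  simp only [Term.start, Term.eval, h.maxSpeed, h.field ha (by norm_num : 5 < 7)]
  rfl

theorem deadline (h : I.Input u s) (ha : s.reg a = (i : ℕ)) :
    (Term.deadline a).eval s = I.deadlineZ i := by
  simp only [Term.deadline, Term.eval, h.maxSpeed, h.field ha (by norm_num : 6 < 7)]
  rfl

theorem dot (h : I.Input u s) (ha : s.reg a = (i : ℕ)) (hb : s.reg b = (j : ℕ)) :
    (Term.dot a b).eval s = I.dotZ i j := by
  simp only [Term.dot, Term.eval, h.dx ha, h.dy ha, h.dx hb, h.dy hb]
  rfl

theorem lat (h : I.Input u s) (ha : s.reg a = (i : ℕ)) (hb : s.reg b = (j : ℕ)) :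
    (Term.lat a b).eval s = I.latZ i j := by
  simp only [Term.lat, Term.eval, h.dx ha, h.dy ha, h.field ha (by norm_num : 1 < 7),
    h.field ha (by norm_num : 2 < 7), h.field hb (by norm_num : 1 < 7),
    h.field hb (by norm_num : 2 < 7)]
  rfl

theorem off (h : I.Input u s) (ha : s.reg a = (i : ℕ)) (hb : s.reg b = (j : ℕ)) :
    (Term.off a b).eval s = I.offZ i j := by
  simp only [Term.off, Term.eval, h.den, h.dx ha, h.dy ha, h.field ha (by norm_num : 1 < 7),
    h.field ha (by norm_num : 2 < 7), h.field hb (by norm_num : 1 < 7),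
    h.field hb (by norm_num : 2 < 7)]
  rfl

theorem cross (h : I.Input u s) (ha : s.reg a = (i : ℕ)) (hb : s.reg b = (j : ℕ)) :
    0 < (Term.cross a b).eval s ↔ I.toCrossing.Cross i j := by
  simp only [Term.cross, Term.pos_and, Term.pos_eq, Term.pos_lt, h.dot ha hb, h.off ha hb,
    h.off hb ha, h.dist ha, h.dist hb, Term.eval, h.len ha, h.len hb, cross_iff, zero_sub]

theorem same (h : I.Input u s) (ha : s.reg a = (i : ℕ)) (hb : s.reg b = (j : ℕ)) :
    0 < (Term.same a b).eval s ↔ I.dotZ i j = 1 ∧ I.latZ i j = 0 := by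
  simp only [Term.same, Term.pos_and, Term.pos_eq, h.dot ha hb, h.lat ha hb, Term.eval]

theorem opp (h : I.Input u s) (ha : s.reg a = (i : ℕ)) (hb : s.reg b = (j : ℕ)) :
    0 < (Term.opp a b).eval s ↔ I.dotZ i j = -1 ∧ I.latZ i j = 0 := by
  simp only [Term.opp, Term.pos_and, Term.pos_eq, h.dot ha hb, h.lat ha hb, Term.eval]

theorem ahead (h : I.Input u s) (ha : s.reg a = (i : ℕ)) (hb : s.reg b = (j : ℕ)) :
    0 < (Term.ahead a b).eval s ↔ I.toCrossing.Ahead i j := by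
  simp only [Term.ahead, Term.pos_and, Term.pos_le, h.same ha hb, h.len hb, h.off ha hb, ahead_iff]

theorem within (h : I.Input u s) (ha : s.reg a = (i : ℕ)) (hb : s.reg b = (j : ℕ)) :
    0 < (Term.within a b).eval s ↔ i = j ∨ I.toCrossing.Ahead i j := by
  simp only [Term.within, Term.pos_or, Term.pos_eq, Term.eval, h.ahead ha hb, ha, hb, Nat.cast_inj,
    Fin.val_inj]

theorem idx (h : I.Input u s) (ha : s.reg a = (i : ℕ)) (hb : s.reg b = (j : ℕ)) :
    ((Term.idx a b).eval s).toNat = i * n + j := by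
  simp only [Term.idx, Term.eval, ha, hb, h.count]
  exact_mod_cast Int.toNat_natCast (i * n + j)

theorem before (h : I.Input u s) (ha : s.reg a = (i : ℕ)) (hb : s.reg b = (j : ℕ)) :
    0 < (Term.before a b).eval s ↔ Before (prioritiesOf n u) i j := by
  simp only [Term.before, Term.pos_or, Term.pos_and, Term.pos_lt, Term.pos_not, h.idx ha hb,
    h.idx hb ha, h.cert, Before, prioritiesOf, Term.eval, ha, hb, Nat.cast_lt, Fin.val_fin_lt,
    decide_eq_true_eq, decide_eq_false_iff_not]

end Instance.Input

end Traffic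

namespace Traffic

/-! ### The simulation program

Register 2 contains the number of vehicles, register 3 the time, and register 4 the delay until
the next event; registers 5 to 8 are used for indices of vehicles. Bank 0 contains the word and
bank 1 the certificate. Banks 2, 3 and 4 record the times at which vehicles enter and leave
intersections and arrive, where `-2` means that the event has not yet occurred. Bank 5 contains
the distances `Instance.queueZ`, bank 6 the positions of the vehicles, bank 7 the vehicles with a
reason of their own to stand still, and bank 8 the distances that the vehicles can reach,
increased by 1: in this way they are positive and can be computed by `Term.least`. Bank 9 is a
temporary store. -/

/-- The cells of bank `a` at the addresses `addr` contain the family `x`. -/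
def Holds {ι : Type*} (addr : ι → ℕ) (s : State) (a : ℕ) (x : ι → ℤ) : Prop :=
  ∀ i, s.bank a (addr i) = x i

/-- The addresses of the entries of a vector. -/
def row {n : ℕ} (i : Fin n) : ℕ := i

/-- The addresses of the entries of a matrix. -/
def cell {n : ℕ} (p : Fin n × Fin n) : ℕ := p.1 * n + p.2

/-- The effect of a command that stores the family `x` in bank `a`, with bank 9 as a temporary
store. -/
structure Stores {ι : Type*} (addr : ι → ℕ) (a : ℕ) (x : ι → ℤ) (s s' : State) : Prop where
  reg : s'.reg = s.reg
  bank : ∀ b, b ≠ a → b ≠ 9 → s'.bank b = s.bank b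
  holds : Holds addr s' a x
  bdd : ∀ m, Bdd m s → (∀ i, (x i).natAbs < 2 ^ m) → Bdd m s'

variable {n : ℕ} {s : State}

theorem stores_fill (hn : s.reg 2 = n) {a k : ℕ} {e : Term} {x : Fin n → ℤ}
    (hx : ∀ i : Fin n, e.eval (s.setReg k (i : ℕ)) = x i) :
    Stores row a x s ((Cmd.fill a k e).exec s) := by
  have hc : s.count = n := by rw [State.count, hn, Int.toNat_natCast]
  refine ⟨rfl, fun b hb _ => ?_, fun i => ?_, fun m hb hm => ⟨hb.1, fun b c => ?_⟩⟩
  · simp [Cmd.exec, hb]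
  · simp [Cmd.exec, hc, row, hx]
  · simp only [Cmd.exec, State.setBank_bank, hc]
    by_cases h : b = a
    · rw [if_pos h]
      split_ifs with h'
      · have := hx ⟨c, h'⟩
        rw [this]
        exact hm _
      · exact hb.2 _ _
    · rw [if_neg h]
      exact hb.2 _ _

theorem stores_fill2 (hn : s.reg 2 = n) {a i j : ℕ} {e : Term} {x : Fin n × Fin n → ℤ}
    (hx : ∀ k l : Fin n, e.eval ((s.setReg i (k : ℕ)).setReg j (l : ℕ)) = x (k, l)) :
    Stores cell a x s ((Cmd.fill2 a i j e).exec s) := by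
  have hc : s.count = n := by rw [State.count, hn, Int.toNat_natCast]
  refine ⟨rfl, fun b hb _ => ?_, fun p => ?_, fun m hb hm => ⟨hb.1, fun b c => ?_⟩⟩
  · simp [Cmd.exec, hb]
  · have hp : 0 < n := Fin.pos p.1
    have h1 : (p.1 * n + p.2 : ℕ) / n = p.1 := by
      rw [mul_comm, Nat.mul_add_div hp, Nat.div_eq_of_lt p.2.2, add_zero]
    have h2 : (p.1 * n + p.2 : ℕ) % n = p.2 := by
      rw [mul_comm, Nat.mul_add_mod, Nat.mod_eq_of_lt p.2.2]
    have h3 : (p.1 * n + p.2 : ℕ) < n * n := by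
      have := Nat.mul_le_mul_right n (Nat.succ_le_of_lt p.1.2)
      rw [Nat.succ_mul] at this
      have := p.2.2
      omega
    simp only [Cmd.exec, State.setBank_bank, hc, cell, if_true, if_pos h3, h1, h2, hx]
  · simp only [Cmd.exec, State.setBank_bank, hc]
    by_cases h : b = a
    · rw [if_pos h]
      split_ifs with h'
      · have h1 : c / n < n := Nat.div_lt_of_lt_mul h'
        have := hx ⟨c / n, h1⟩ ⟨c % n, Nat.mod_lt _ (Nat.zero_lt_of_lt h1)⟩
        simp only at this
        rw [this]
        exact hm _
      · exact hb.2 _ _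
    · rw [if_neg h]
      exact hb.2 _ _

namespace Cmd

/-- Store the values of `e` for register 5 in bank `a`, where `e` may depend on this bank. -/
def update (a : ℕ) (e : Term) : Cmd := (fill 9 5 e).seq (fill a 5 (.load 9 (.var 5)))

/-- Store the values of `e` for registers 5 and 6 in bank `a`, where `e` may depend on this bank. -/
def update2 (a : ℕ) (e : Term) : Cmd := (fill2 9 5 6 e).seq (fill2 a 5 6 (.load 9 (.idx 5 6)))

end Cmd

theorem Stores.trans {ι : Type*} {addr : ι → ℕ} {a : ℕ} {x : ι → ℤ} {s s' s'' : State}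
    (h : Stores addr 9 x s s') (h' : Stores addr a x s' s'') : Stores addr a x s s'' :=
  ⟨h'.reg.trans h.reg, fun b hb hb' => (h'.bank b hb hb').trans (h.bank b hb' hb'), h'.holds,
    fun m hb hm => h'.bdd m (h.bdd m hb hm) hm⟩

theorem stores_update (hn : s.reg 2 = n) {a : ℕ} {e : Term} {x : Fin n → ℤ}
    (hx : ∀ i : Fin n, e.eval (s.setReg 5 (i : ℕ)) = x i) :
    Stores row a x s ((Cmd.update a e).exec s) := by
  have h1 := stores_fill (a := 9) hn hx
  refine h1.trans (stores_fill (by rw [h1.reg, hn]) fun i => ?_)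
  have := h1.holds i
  simpa [Term.eval, row] using this

theorem stores_update2 (hn : s.reg 2 = n) {a : ℕ} {e : Term} {x : Fin n × Fin n → ℤ}
    (hx : ∀ k l : Fin n, e.eval ((s.setReg 5 (k : ℕ)).setReg 6 (l : ℕ)) = x (k, l)) :
    Stores cell a x s ((Cmd.update2 a e).exec s) := by
  have h1 := stores_fill2 (a := 9) hn hx
  refine h1.trans (stores_fill2 (by rw [h1.reg, hn]) fun k l => ?_)
  have := h1.holds (k, l)
  simp only [Term.eval, Term.idx, State.setReg_reg, State.setReg_bank]
  simp only [if_true, h1.reg, hn, show ¬ (5 : ℕ) = 6 by decide, show ¬ (2 : ℕ) = 6 by decide,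
    show ¬ (2 : ℕ) = 5 by decide, if_false]
  rw [← this, cell]
  congr 1

theorem Term.least_spec (hs : s.reg 2 = n) (k : ℕ) (i e : Term) :
    (0 < i.eval s → 0 < (least k i e).eval s ∧ (least k i e).eval s ≤ i.eval s) ∧
    (∀ j : Fin n, 0 < e.eval (s.setReg k (j : ℕ)) →
      0 < (least k i e).eval s ∧ (least k i e).eval s ≤ e.eval (s.setReg k (j : ℕ))) ∧
    (0 < (least k i e).eval s → (least k i e).eval s = i.eval s ∨
      ∃ j : Fin n, (least k i e).eval s = e.eval (s.setReg k (j : ℕ))) := by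
  have : s.count = n := by rw [State.count, hs, Int.toNat_natCast]
  simp only [eval, this]
  exact iter_leastPos (fun j => e.eval (s.setReg k j)) n (i.eval s)

namespace Term

/-- The distance that vehicle `a` has covered. -/
def pos (a : ℕ) : Term := load 6 (var a)

/-- The condition `Crossing.Root` for vehicle `a`. -/
def root (a : ℕ) : Term := or (lt (var 3) (start a)) (or (eq (pos a) (dist a))
  (any 8 (and (cross a 8) (and (eq (pos a) (off a 8)) (and (before 8 a)
    (lt (pos 8) (add (off 8 a) (len 8))))))))

/-- The distance that vehicle `a` can reach before the next event. -/
def reach (a : ℕ) : Term := sub (load 8 (var a)) (const 1)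

/-- The value of `z`, or the current time if `z` is `-2` and the condition `c` holds. -/
def record (z c : Term) : Term := ite (and (eq z (const (-2))) c) (var 3) z

end Term

namespace Cmd

open Term

/-- Determine the distances that the vehicles can reach. -/
def setReach : Cmd :=
  (fill 7 5 (.ite (root 5) (const 1) (const 0))).seq
    (fill 8 5 (least 6 (add (dist 5) (const 1)) (.ite (and (load 7 (var 6)) (within 5 6))
      (add (sub (add (off 5 6) (pos 6)) (load 5 (idx 5 6))) (const 1)) (const 0))))

/-- Determine the time until the next event, or 0 if there is none. -/
def setDelay : Cmd :=
  (set 4 (least 5 (const 0) (sub (start 5) (var 3)))).seq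
  ((set 4 (least 5 (var 4) (.ite (le (dist 5) (reach 5)) (sub (dist 5) (pos 5)) (const 0)))).seq
  ((set 4 (least 5 (var 4) (least 6 (const 0) (.ite (and (cross 5 6) (le (off 5 6) (reach 5)))
    (sub (off 5 6) (pos 5)) (const 0))))).seq
  (set 4 (least 5 (var 4) (least 6 (const 0) (.ite (and (cross 5 6)
    (le (add (off 5 6) (len 5)) (reach 5))) (sub (add (off 5 6) (len 5)) (pos 5)) (const 0)))))))

/-- Record the events that have occurred, and proceed to the time of the next event. -/
def advance : Cmd :=
  (update2 2 (record (load 2 (idx 5 6)) (and (le (off 5 6) (pos 5)) (lt (off 5 6) (reach 5))))).seq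
  ((update2 3 (record (load 3 (idx 5 6)) (le (add (off 5 6) (len 5)) (pos 5)))).seq
  ((update 4 (record (load 4 (var 5)) (le (dist 5) (pos 5)))).seq
  ((update 6 (.ite (lt (reach 5) (add (pos 5) (var 4))) (reach 5) (add (pos 5) (var 4)))).seq
  (set 3 (add (var 3) (var 4))))))

/-- One step of the simulation. -/
def step : Cmd := setReach.seq (setDelay.seq advance)

/-- The queues, and the state of the simulation at time 0. -/
def prepare : Cmd :=
  (fill2 5 5 6 (sum 7 (const 0) (.ite (and (ahead 5 7) (or (eq (var 7) (var 6)) (ahead 7 6))) (len 7)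
    (const 0)))).seq
  ((fill2 2 5 6 (.ite (lt (off 5 6) (const 0)) (const (-1)) (const (-2)))).seq
  ((fill2 3 5 6 (const (-2))).seq
  ((fill 4 5 (const (-2))).seq
  ((fill 6 5 (const 0)).seq
  (set 3 (const 0))))))

end Cmd

theorem ok_step : Cmd.step.ok = true := by decide

theorem ok_prepare : Cmd.prepare.ok = true := by decide

theorem depth_step : Cmd.step.depth = 2 := by decide

theorem depth_prepare : Cmd.prepare.depth = 3 := by decide

end Traffic

namespace Traffic

/-! ### One step of the simulation -/

open Crossing

variable {n : ℕ} {I : Instance n} {u : List ℤ} {s : State} {τ : ℤ} {x : Fin n → ℤ}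

namespace Instance

/-- Positions, in the distance units of the instance. -/
def posOf (I : Instance n) (x : Fin n → ℤ) (i : Fin n) : ℝ := x i / I.fine

/-- A time, in the time units of the instance. -/
def timeOf (I : Instance n) (τ : ℤ) : ℝ := τ / I.rate

theorem rate_pos (hv : 0 < I.maxSpeed) : 0 < I.rate :=
  mul_pos I.den_pos' (Nat.cast_pos.2 hv)

theorem timeOf_lt (hv : 0 < I.maxSpeed) {a b : ℤ} : I.timeOf a < I.timeOf b ↔ a < b := by
  rw [timeOf, timeOf, div_lt_div_iff_of_pos_right (rate_pos hv), Int.cast_lt]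

theorem timeOf_le (hv : 0 < I.maxSpeed) {a b : ℤ} : I.timeOf a ≤ I.timeOf b ↔ a ≤ b := by
  rw [timeOf, timeOf, div_le_div_iff_of_pos_right (rate_pos hv), Int.cast_le]

theorem startTime_eq_timeOf (hv : 0 < I.maxSpeed) (i : Fin n) :
    (I.toCrossing.vehicle i).startTime = I.timeOf (I.startZ i) := startTime_eq hv i

theorem add_fine (a b : ℤ) : (a : ℝ) / I.fine + b / I.fine = ((a + b : ℤ) : ℝ) / I.fine := by
  push_cast; ring

theorem sub_fine (a b : ℤ) : (a : ℝ) / I.fine - b / I.fine = ((a - b : ℤ) : ℝ) / I.fine := by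
  push_cast; ring

theorem root_iff (hv : 0 < I.maxSpeed) (P : Priorities n) (i : Fin n) :
    I.toCrossing.Root P (I.timeOf τ) (I.posOf x) i ↔ τ < I.startZ i ∨ x i = I.distZ i ∨
      ∃ k, I.toCrossing.Cross i k ∧ x i = I.offZ i k ∧ Before P k i ∧
        x k < I.offZ k i + I.lenZ k := by
  simp only [Root, startTime_eq_timeOf hv, timeOf_lt hv, posOf, dist_eq, off_eq, len_eq, add_fine,
    lt_iff, eq_iff]

theorem isReach_iff (P : Priorities n) {t : ℝ} {B : Fin n → ℤ} :
    I.toCrossing.IsReach P t (I.posOf x) (I.posOf B) ↔ ∀ i, B i ≤ I.distZ i ∧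
      (∀ k, I.toCrossing.Root P t (I.posOf x) k → (i = k ∨ I.toCrossing.Ahead i k) →
        B i ≤ I.offZ i k + x k - I.queueZ i k) ∧
      (B i = I.distZ i ∨ ∃ k, I.toCrossing.Root P t (I.posOf x) k ∧
        (i = k ∨ I.toCrossing.Ahead i k) ∧ B i = I.offZ i k + x k - I.queueZ i k) := by
  simp only [IsReach, dist_eq, off_eq, queue_eq]
  simp only [show ∀ (y : Fin n → ℤ) i, I.posOf y i = (y i : ℝ) / I.fine from fun _ _ => rfl,
    add_fine, sub_fine, le_iff, eq_iff]

end Instance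

namespace Instance.Input

variable {a b : ℕ} {i j : Fin n}

theorem vector {c : ℕ} {y : Fin n → ℤ} (hy : Holds row s c y) (ha : s.reg a = (i : ℕ)) :
    (Term.load c (.var a)).eval s = y i := by
  rw [← hy i]; simp [Term.eval, ha, row]

theorem matrix (h : I.Input u s) {c : ℕ} {y : Fin n × Fin n → ℤ} (hy : Holds cell s c y)
    (ha : s.reg a = (i : ℕ)) (hb : s.reg b = (j : ℕ)) :
    (Term.load c (.idx a b)).eval s = y (i, j) := by
  rw [← hy (i, j), Term.eval, h.idx ha hb, cell]

theorem root (h : I.Input u s) (hv : 0 < I.maxSpeed) (ht : s.reg 3 = τ) (hx : Holds row s 6 x)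
    (ha : s.reg a = (i : ℕ)) (ha8 : a ≠ 8) :
    0 < (Term.root a).eval s ↔
      I.toCrossing.Root (prioritiesOf n u) (I.timeOf τ) (I.posOf x) i := by
  rw [root_iff hv]
  have h8 : ∀ k : Fin n, I.Input u (s.setReg 8 (k : ℕ)) := fun k => h.setReg (by decide) _
  have ha' : ∀ k : Fin n, (s.setReg 8 (k : ℕ)).reg a = (i : ℕ) := fun k => by simp [ha8, ha]
  have hk : ∀ k : Fin n, (s.setReg 8 (k : ℕ)).reg 8 = (k : ℕ) := fun k => by simp
  have hx8 : ∀ k : Fin n, Holds row (s.setReg 8 (k : ℕ)) 6 x := fun k => hx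
  simp only [Term.root, Term.pos_or, Term.pos_lt, Term.pos_eq, Term.pos_any h.count, Term.pos_and,
    Term.pos, h.start ha, h.dist ha, vector hx ha]
  refine or_congr ?_ (or_congr Iff.rfl (exists_congr fun k => ?_))
  · simp [Term.eval, ht]
  · rw [(h8 k).cross (ha' k) (hk k), (h8 k).off (ha' k) (hk k), (h8 k).before (hk k) (ha' k),
      vector (hx8 k) (ha' k), vector (hx8 k) (hk k), Term.eval, (h8 k).off (hk k) (ha' k),
      (h8 k).len (hk k)]

end Instance.Input

/-- The command `setReach` computes the distances that the vehicles can reach. The assumption `hx0`,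
that these are nonnegative, ensures that `least` does not ignore any of them. -/
theorem setReach_spec (h : I.Input u s) (hv : 0 < I.maxSpeed) (ht : s.reg 3 = τ)
    (hW : Holds cell s 5 fun p => I.queueZ p.1 p.2) (hx : Holds row s 6 x)
    (hx0 : ∀ i k, (i = k ∨ I.toCrossing.Ahead i k) → 0 ≤ I.offZ i k + x k - I.queueZ i k) :
    ∃ B : Fin n → ℤ,
      I.toCrossing.IsReach (prioritiesOf n u) (I.timeOf τ) (I.posOf x) (I.posOf B) ∧
      (∀ i, 0 ≤ B i) ∧ (Cmd.setReach.exec s).reg = s.reg ∧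
      (∀ b, b ≠ 7 → b ≠ 8 → b ≠ 9 → (Cmd.setReach.exec s).bank b = s.bank b) ∧
      Holds row (Cmd.setReach.exec s) 8 (fun i => B i + 1) ∧
      ∀ m, 1 ≤ m → Bdd m s → (∀ i, (I.distZ i + 1).natAbs < 2 ^ m) →
        Bdd m (Cmd.setReach.exec s) := by
  classical
  set P := prioritiesOf n u with hP
  set e := Term.least 6 (.add (.dist 5) (.const 1)) (.ite (.and (.load 7 (.var 6)) (.within 5 6))
      (.add (.sub (.add (.off 5 6) (.pos 6)) (.load 5 (.idx 5 6))) (.const 1)) (.const 0)) with he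
  -- The contents of bank 7.
  let y : Fin n → ℤ := fun i => if I.toCrossing.Root P (I.timeOf τ) (I.posOf x) i then 1 else 0
  have h1 : Stores row 7 y s
      ((Cmd.fill 7 5 (.ite (.root 5) (.const 1) (.const 0))).exec s) := by
    refine stores_fill h.count fun i => ?_
    rw [Term.eval]
    simp only [(h.setReg (k := 5) (by decide) (i : ℕ)).root hv (τ := τ) (x := x) (a := 5) (i := i)
      (by simp [ht]) hx (by simp) (by decide)]
    rfl
  set s1 := (Cmd.fill 7 5 (.ite (.root 5) (.const 1) (.const 0))).exec s with hs1
  have hI1 : I.Input u s1 := ⟨by rw [h1.bank 0 (by decide) (by decide), h.word],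
    by rw [h1.bank 1 (by decide) (by decide), h.cert], by rw [h1.reg, h.count]⟩
  have hW1 : Holds cell s1 5 fun p => I.queueZ p.1 p.2 := fun p => by
    rw [h1.bank 5 (by decide) (by decide)]; exact hW p
  have hx1 : Holds row s1 6 x := fun p => by
    rw [h1.bank 6 (by decide) (by decide)]; exact hx p
  have hI5 : ∀ i : Fin n, I.Input u (s1.setReg 5 (i : ℕ)) := fun i => hI1.setReg (by decide) _
  -- The contents of bank 8.
  let z : Fin n → ℤ := fun i => e.eval (s1.setReg 5 (i : ℕ))
  have hbody : ∀ i k : Fin n, (Term.ite (.and (.load 7 (.var 6)) (.within 5 6))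
      (.add (.sub (.add (.off 5 6) (.pos 6)) (.load 5 (.idx 5 6))) (.const 1)) (.const 0)).eval
        ((s1.setReg 5 (i : ℕ)).setReg 6 (k : ℕ)) =
      if I.toCrossing.Root P (I.timeOf τ) (I.posOf x) k ∧ (i = k ∨ I.toCrossing.Ahead i k) then
        I.offZ i k + x k - I.queueZ i k + 1 else 0 := by
    intro i k
    have h6 := (hI5 i).setReg (k := 6) (by decide) (k : ℕ)
    set t := (s1.setReg 5 (i : ℕ)).setReg 6 (k : ℕ) with ht6
    have r5 : t.reg 5 = (i : ℕ) := by simp [ht6]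
    have r6 : t.reg 6 = (k : ℕ) := by simp [ht6]
    have hy : Holds row t 7 y := h1.holds
    have hyk : 0 < y k ↔ I.toCrossing.Root P (I.timeOf τ) (I.posOf x) k := by
      simp only [y]; split_ifs with h <;> simp [h]
    rw [Term.eval]
    simp only [Term.pos_and, Instance.Input.vector hy r6, hyk, h6.within r5 r6]
    simp only [Term.eval]
    have e1 : Term.eval (.pos 6) t = x k := Instance.Input.vector (c := 6) hx1 r6
    have e2 : t.bank 5 ((Term.idx 5 6).eval t).toNat = I.queueZ i k :=
      h6.matrix (c := 5) hW1 r5 r6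
    rw [h6.off r5 r6, e1, e2]
  have hinit : ∀ i : Fin n, (Term.add (.dist 5) (.const 1)).eval (s1.setReg 5 (i : ℕ))
      = I.distZ i + 1 := fun i => by
    rw [Term.eval, (hI5 i).dist (i := i) (by simp)]; rfl
  have hz : ∀ i, (0 < z i ∧ z i ≤ I.distZ i + 1) ∧
      (∀ k, I.toCrossing.Root P (I.timeOf τ) (I.posOf x) k → (i = k ∨ I.toCrossing.Ahead i k) →
        z i ≤ I.offZ i k + x k - I.queueZ i k + 1) ∧
      (z i = I.distZ i + 1 ∨ ∃ k, I.toCrossing.Root P (I.timeOf τ) (I.posOf x) k ∧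
        (i = k ∨ I.toCrossing.Ahead i k) ∧ z i = I.offZ i k + x k - I.queueZ i k + 1) := by
    intro i
    obtain ⟨a1, a2, a3⟩ := Term.least_spec (hI5 i).count 6 (.add (.dist 5) (.const 1))
      (.ite (.and (.load 7 (.var 6)) (.within 5 6))
      (.add (.sub (.add (.off 5 6) (.pos 6)) (.load 5 (.idx 5 6))) (.const 1)) (.const 0))
    simp only [hinit, hbody] at a1 a2 a3
    have hd := I.distZ_pos i
    have b1 := a1 (by omega)
    refine ⟨b1, fun k hk hik => ?_, ?_⟩
    · have := a2 k
      rw [if_pos ⟨hk, hik⟩] at this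
      have h0 := hx0 i k hik
      exact (this (by omega)).2
    · rcases a3 b1.1 with h2 | ⟨k, h2⟩
      · exact Or.inl h2
      · right
        by_cases hc : I.toCrossing.Root P (I.timeOf τ) (I.posOf x) k ∧
            (i = k ∨ I.toCrossing.Ahead i k)
        · rw [if_pos hc] at h2
          exact ⟨k, hc.1, hc.2, h2⟩
        · rw [if_neg hc] at h2
          rw [h2] at b1
          exact absurd b1.1 (lt_irrefl _)
  have h2 : Stores row 8 z s1 (Cmd.setReach.exec s) := stores_fill hI1.count fun i => rfl
  refine ⟨fun i => z i - 1, ?_, fun i => ?_, h2.reg.trans h1.reg, fun b b7 b8 b9 => ?_, fun i => ?_,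
    fun m hm hb hd => ?_⟩
  · rw [Instance.isReach_iff]
    intro i
    obtain ⟨a1, a2, a3⟩ := hz i
    refine ⟨by omega, fun k hk hik => by have := a2 k hk hik; omega, ?_⟩
    rcases a3 with h | ⟨k, hk, hik, h⟩
    · left; omega
    · right; exact ⟨k, hk, hik, by omega⟩
  · have := (hz i).1; simp only; omega
  · rw [h2.bank b b8 b9, h1.bank b b7 b9]
  · rw [h2.holds i]; ring
  · refine h2.bdd m (h1.bdd m hb fun i => ?_) fun i => ?_
    · have : 2 ^ 1 ≤ 2 ^ m := Nat.pow_le_pow_right (by norm_num) hm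
      simp only [y]
      split_ifs
      · rw [Int.natAbs_one]; omega
      · rw [Int.natAbs_zero]; omega
    · have := (hz i).1
      have := hd i
      omega

/-- The number `d` is the least positive element of `S`, if there is one, and otherwise it is not
positive. -/
def IsLeastPos (S : Set ℤ) (d : ℤ) : Prop := (∀ c ∈ S, 0 < c → 0 < d ∧ d ≤ c) ∧ (0 < d → d ∈ S)

theorem isLeastPos_zero : IsLeastPos ∅ 0 := ⟨fun _ h => h.elim, fun h => absurd h (lt_irrefl _)⟩

theorem isLeastPos_single (v : ℤ) : IsLeastPos {v} v := by
  refine ⟨?_, fun _ => rfl⟩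
  rintro c rfl hc
  exact ⟨hc, le_rfl⟩

theorem isLeastPos_ite (p : Prop) [Decidable p] (v : ℤ) :
    IsLeastPos {c | p ∧ c = v} (if p then v else 0) := by
  constructor
  · rintro c ⟨hp, rfl⟩ hc
    rw [if_pos hp]
    exact ⟨hc, le_rfl⟩
  · split_ifs with hp
    · exact fun _ => ⟨hp, rfl⟩
    · exact fun h => absurd h (lt_irrefl _)

/-- A minimum over vehicles is a least positive element of a union. -/
theorem isLeastPos_least (hs : s.reg 2 = n) {k : ℕ} {i e : Term} {S : Set ℤ} {T : Fin n → Set ℤ}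
    (hS : IsLeastPos S (i.eval s)) (hT : ∀ j : Fin n, IsLeastPos (T j) (e.eval (s.setReg k (j : ℕ)))) :
    IsLeastPos (S ∪ ⋃ j, T j) ((Term.least k i e).eval s) := by
  obtain ⟨h1, h2, h3⟩ := Term.least_spec hs k i e
  constructor
  · rintro c (hc | hc) h0
    · have a1 := hS.1 c hc h0
      have a2 := h1 a1.1
      exact ⟨a2.1, a2.2.trans a1.2⟩
    · obtain ⟨j, hj⟩ := Set.mem_iUnion.1 hc
      have a1 := (hT j).1 c hj h0
      have a2 := h2 j a1.1
      exact ⟨a2.1, a2.2.trans a1.2⟩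
  · intro h0
    rcases h3 h0 with e | ⟨j, e⟩
    · left
      rw [e] at h0 ⊢
      exact hS.2 h0
    · right
      rw [e] at h0 ⊢
      exact Set.mem_iUnion.2 ⟨j, (hT j).2 h0⟩

theorem Term.eval_sub (a b : Term) (s : State) : (sub a b).eval s = a.eval s - b.eval s := rfl

theorem Term.least_nonneg {k : ℕ} {i e : Term} (h : 0 ≤ i.eval s) : 0 ≤ (Term.least k i e).eval s := by
  have key : ∀ N, 0 ≤ iter (fun j z => leastPos z (e.eval (s.setReg k (j : ℕ)))) N (i.eval s) := by
    intro N
    induction N with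
    | zero => exact h
    | succ N ih => rw [iter, leastPos]; split_ifs <;> omega
  exact key _

namespace Instance

/-- The points at which the progress of vehicle `i` is an event. -/
def IsTargetZ (I : Instance n) (i : Fin n) (q : ℤ) : Prop :=
  q = I.distZ i ∨ ∃ j, I.toCrossing.Cross i j ∧ (q = I.offZ i j ∨ q = I.offZ i j + I.lenZ i)

/-- The number `d` is the time until the next event, or 0 if there is none. -/
structure IsDelay (I : Instance n) (τ : ℤ) (x B : Fin n → ℤ) (d : ℤ) : Prop where
  nonneg : 0 ≤ d
  start : ∀ i, τ < I.startZ i → 0 < d ∧ d ≤ I.startZ i - τ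
  target : ∀ i q, I.IsTargetZ i q → x i < q → q ≤ B i → 0 < d ∧ d ≤ q - x i
  event : 0 < d → (∃ i, d = I.startZ i - τ) ∨ ∃ i q, I.IsTargetZ i q ∧ q ≤ B i ∧ d = q - x i

end Instance

theorem State.setReg_setReg (s : State) (k : ℕ) (y z : ℤ) :
    (s.setReg k y).setReg k z = s.setReg k z := by simp [State.setReg]

/-- The command `setDelay` computes the time until the next event. In the units of the instance, a
distance is also the time in which it is covered at full speed. -/
theorem setDelay_spec (h : I.Input u s) (ht : s.reg 3 = τ) (hx : Holds row s 6 x) {B : Fin n → ℤ}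
    (hB : Holds row s 8 fun i => B i + 1) :
    ∃ d, Cmd.setDelay.exec s = s.setReg 4 d ∧ I.IsDelay τ x B d := by
  have hI : ∀ z, I.Input u (s.setReg 4 z) := fun z => h.setReg (by decide) z
  have hI5 : ∀ z (i : Fin n), I.Input u ((s.setReg 4 z).setReg 5 (i : ℕ)) := fun z i =>
    (hI z).setReg (by decide) _
  have hI6 : ∀ z (i j : Fin n), I.Input u (((s.setReg 4 z).setReg 5 (i : ℕ)).setReg 6 (j : ℕ)) :=
    fun z i j => (hI5 z i).setReg (by decide) _
  have hr : ∀ {t : State} {a : ℕ} {i : Fin n}, t.bank = s.bank → t.reg a = (i : ℕ) →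
      (Term.reach a).eval t = B i := fun {t a i} hb ha => by
    have hB' : Holds row t 8 fun i => B i + 1 := by rw [Holds, hb]; exact hB
    rw [Term.reach, Term.eval, Instance.Input.vector hB' ha, Term.eval]; ring
  have hp : ∀ {t : State} {a : ℕ} {i : Fin n}, t.bank = s.bank → t.reg a = (i : ℕ) →
      (Term.pos a).eval t = x i := fun {t a i} hb ha => by
    have hx' : Holds row t 6 x := by rw [Holds, hb]; exact hx
    exact Instance.Input.vector hx' ha
  -- The four assignments of `setDelay`, each of which takes further events into account: start
  -- times, goals, arrivals at intersections, and passed intersections.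
  set e1 := Term.least 5 (.const 0) (.sub (.start 5) (.var 3)) with he1
  set e2 := Term.least 5 (.var 4) (.ite (.le (.dist 5) (.reach 5)) (.sub (.dist 5) (.pos 5))
    (.const 0)) with he2
  set e3 := Term.least 5 (.var 4) (.least 6 (.const 0) (.ite (.and (.cross 5 6)
    (.le (.off 5 6) (.reach 5))) (.sub (.off 5 6) (.pos 5)) (.const 0))) with he3
  set e4 := Term.least 5 (.var 4) (.least 6 (.const 0) (.ite (.and (.cross 5 6)
    (.le (.add (.off 5 6) (.len 5)) (.reach 5))) (.sub (.add (.off 5 6) (.len 5)) (.pos 5))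
    (.const 0))) with he4
  set d1 := e1.eval s with hd1
  set d2 := e2.eval (s.setReg 4 d1) with hd2
  set d3 := e3.eval (s.setReg 4 d2) with hd3
  set d4 := e4.eval (s.setReg 4 d3) with hd4
  have hexec : Cmd.setDelay.exec s = s.setReg 4 d4 := by
    simp only [Cmd.setDelay, Cmd.exec, ← he1, ← he2, ← he3, ← he4, State.setReg_setReg, ← hd1, ← hd2,
      ← hd3, ← hd4]
  classical
  have l1 := isLeastPos_least (k := 5) (i := .const 0) (e := .sub (.start 5) (.var 3))
    (T := fun i : Fin n => {I.startZ i - τ}) h.count isLeastPos_zero fun i => by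
      rw [Term.eval, (h.setReg (k := 5) (by decide) _).start (i := i) (by simp), Term.eval,
        State.setReg_reg, if_neg (by decide), ht]
      exact isLeastPos_single _
  have l2 := isLeastPos_least (s := s.setReg 4 d1) (k := 5) (i := .var 4)
    (T := fun i : Fin n => {c | I.distZ i ≤ B i ∧ c = I.distZ i - x i})
    (e := .ite (.le (.dist 5) (.reach 5)) (.sub (.dist 5) (.pos 5)) (.const 0)) (hI _).count
    (by rw [Term.eval, State.setReg_reg, if_pos rfl]; exact l1) fun i => by
      have r5 : ((s.setReg 4 d1).setReg 5 (i : ℕ)).reg 5 = (i : ℕ) := by simp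
      have hb : ((s.setReg 4 d1).setReg 5 (i : ℕ)).bank = s.bank := rfl
      rw [Term.eval]
      simp only [Term.pos_le, (hI5 _ i).dist r5, hr hb r5, Term.eval_sub, hp hb r5]
      exact isLeastPos_ite _ _
  have l3 := isLeastPos_least (s := s.setReg 4 d2) (k := 5) (i := .var 4)
    (T := fun i : Fin n => ∅ ∪ ⋃ j, {c | (I.toCrossing.Cross i j ∧ I.offZ i j ≤ B i) ∧
      c = I.offZ i j - x i})
    (e := .least 6 (.const 0) (.ite (.and (.cross 5 6)
    (.le (.off 5 6) (.reach 5))) (.sub (.off 5 6) (.pos 5)) (.const 0))) (hI _).count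
    (by rw [Term.eval, State.setReg_reg, if_pos rfl]; exact l2) fun i =>
      isLeastPos_least (hI5 _ i).count isLeastPos_zero fun j => by
        set t := ((s.setReg 4 d2).setReg 5 (i : ℕ)).setReg 6 (j : ℕ) with ht
        have r5 : t.reg 5 = (i : ℕ) := by simp [ht]
        have r6 : t.reg 6 = (j : ℕ) := by simp [ht]
        have hb : t.bank = s.bank := rfl
        have hIt : I.Input u t := hI6 _ i j
        rw [Term.eval]
        simp only [Term.pos_and, Term.pos_le, hIt.cross r5 r6, hIt.off r5 r6, hr hb r5, Term.eval_sub,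
          hp hb r5]
        exact isLeastPos_ite _ _
  have l4 := isLeastPos_least (s := s.setReg 4 d3) (k := 5) (i := .var 4)
    (T := fun i : Fin n => ∅ ∪ ⋃ j, {c | (I.toCrossing.Cross i j ∧ I.offZ i j + I.lenZ i ≤ B i) ∧
      c = I.offZ i j + I.lenZ i - x i})
    (e := .least 6 (.const 0) (.ite (.and (.cross 5 6)
    (.le (.add (.off 5 6) (.len 5)) (.reach 5))) (.sub (.add (.off 5 6) (.len 5)) (.pos 5))
    (.const 0))) (hI _).count
    (by rw [Term.eval, State.setReg_reg, if_pos rfl]; exact l3) fun i =>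
      isLeastPos_least (hI5 _ i).count isLeastPos_zero fun j => by
        set t := ((s.setReg 4 d3).setReg 5 (i : ℕ)).setReg 6 (j : ℕ) with ht
        have r5 : t.reg 5 = (i : ℕ) := by simp [ht]
        have r6 : t.reg 6 = (j : ℕ) := by simp [ht]
        have hb : t.bank = s.bank := rfl
        have hIt : I.Input u t := hI6 _ i j
        have hs : (Term.add (.off 5 6) (.len 5)).eval t = I.offZ i j + I.lenZ i := by
          rw [Term.eval, hIt.off r5 r6, hIt.len r5]
        rw [Term.eval]
        simp only [Term.pos_and, Term.pos_le, hIt.cross r5 r6, hs, hr hb r5, Term.eval_sub, hp hb r5]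
        exact isLeastPos_ite _ _
  have n1 : 0 ≤ d1 := Term.least_nonneg le_rfl
  have n2 : 0 ≤ d2 := Term.least_nonneg (by rw [Term.eval, State.setReg_reg, if_pos rfl]; exact n1)
  have n3 : 0 ≤ d3 := Term.least_nonneg (by rw [Term.eval, State.setReg_reg, if_pos rfl]; exact n2)
  have n4 : 0 ≤ d4 := Term.least_nonneg (by rw [Term.eval, State.setReg_reg, if_pos rfl]; exact n3)
  refine ⟨d4, hexec, n4, fun i hi => ?_, fun i q hq hxq hqB => ?_, fun hd => ?_⟩
  · refine l4.1 _ (Or.inl (Or.inl (Or.inl (Or.inr ?_)))) (by omega)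
    exact Set.mem_iUnion.2 ⟨i, rfl⟩
  · rcases hq with rfl | ⟨j, hj, rfl | rfl⟩
    · refine l4.1 _ (Or.inl (Or.inl (Or.inr ?_))) (by omega)
      exact Set.mem_iUnion.2 ⟨i, hqB, rfl⟩
    · refine l4.1 _ (Or.inl (Or.inr ?_)) (by omega)
      exact Set.mem_iUnion.2 ⟨i, Or.inr (Set.mem_iUnion.2 ⟨j, ⟨hj, hqB⟩, rfl⟩)⟩
    · refine l4.1 _ (Or.inr ?_) (by omega)
      exact Set.mem_iUnion.2 ⟨i, Or.inr (Set.mem_iUnion.2 ⟨j, ⟨hj, hqB⟩, rfl⟩)⟩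
  · rcases l4.2 hd with (((h | h) | h) | h) | h
    · exact h.elim
    · obtain ⟨i, hi⟩ := Set.mem_iUnion.1 h
      exact Or.inl ⟨i, hi⟩
    · obtain ⟨i, hi, e⟩ := Set.mem_iUnion.1 h
      exact Or.inr ⟨i, _, Or.inl rfl, hi, e⟩
    · obtain ⟨i, hi | hi⟩ := Set.mem_iUnion.1 h
      · exact hi.elim
      · obtain ⟨j, ⟨hj, hB⟩, e⟩ := Set.mem_iUnion.1 hi
        exact Or.inr ⟨i, _, Or.inr ⟨j, hj, Or.inl rfl⟩, hB, e⟩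
    · obtain ⟨i, hi | hi⟩ := Set.mem_iUnion.1 h
      · exact hi.elim
      · obtain ⟨j, ⟨hj, hB⟩, e⟩ := Set.mem_iUnion.1 hi
        exact Or.inr ⟨i, _, Or.inr ⟨j, hj, Or.inr rfl⟩, hB, e⟩

end Traffic

namespace Traffic

open Crossing

variable {n : ℕ} {I : Instance n} {u : List ℤ} {s : State} {τ : ℤ} {x : Fin n → ℤ}

/-- The state of the simulation at time `τ`: the positions `x` of the vehicles, and the records
`en`, `ex` and `ar` of the times at which vehicles enter and leave intersections, and arrive. -/
structure Instance.Conf (I : Instance n) (u : List ℤ) (s : State) (τ : ℤ) (x : Fin n → ℤ)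
    (en ex : Fin n × Fin n → ℤ) (ar : Fin n → ℤ) : Prop extends I.Input u s where
  time : s.reg 3 = τ
  queue : Holds cell s 5 fun p => I.queueZ p.1 p.2
  pos : Holds row s 6 x
  enter : Holds cell s 2 en
  exit : Holds cell s 3 ex
  arrive : Holds row s 4 ar

open Classical in
/-- The record `z` of an event, updated at time `τ` if the event has occurred. -/
def stamp (τ : ℤ) (p : Prop) (z : ℤ) : ℤ := if z = -2 ∧ p then τ else z

theorem natAbs_stamp_lt {m : ℕ} {p : Prop} {z : ℤ} (h : τ.natAbs < 2 ^ m) (hz : z.natAbs < 2 ^ m) :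
    (stamp τ p z).natAbs < 2 ^ m := by
  rw [stamp]; split_ifs <;> assumption

theorem Term.eval_record (z c : Term) (s : State) :
    (Term.record z c).eval s = stamp (s.reg 3) (0 < c.eval s) (z.eval s) := by
  rw [record, eval, stamp]
  simp only [pos_and, pos_eq, eval]
  congr

namespace Stores

variable {ι : Type*} {addr : ι → ℕ} {a : ℕ} {y : ι → ℤ} {s' : State}

theorem input (h : Stores addr a y s s') (h0 : 0 ≠ a) (h1 : 1 ≠ a) (hI : I.Input u s) :
    I.Input u s' :=
  ⟨(h.bank 0 h0 (by decide)).trans hI.word, (h.bank 1 h1 (by decide)).trans hI.cert,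
    by rw [h.reg, hI.count]⟩

theorem keep {κ : Type*} {addr' : κ → ℕ} {b : ℕ} {z : κ → ℤ} (h : Stores addr a y s s')
    (hb : b ≠ a) (hb9 : b ≠ 9) (hz : Holds addr' s b z) : Holds addr' s' b z := fun p => by
  rw [h.bank b hb hb9]; exact hz p

end Stores

theorem Instance.Input.reach {a : ℕ} {i : Fin n} {B : Fin n → ℤ} (hB : Holds row s 8 fun i => B i + 1)
    (ha : s.reg a = (i : ℕ)) : (Term.reach a).eval s = B i := by
  rw [Term.reach, Term.eval, Instance.Input.vector hB ha, Term.eval]; ring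

/-- The command `advance` stamps the events that have occurred, and moves each vehicle at full speed
up to the point that it can reach. -/
theorem advance_spec {en ex : Fin n × Fin n → ℤ} {ar B : Fin n → ℤ} {d : ℤ}
    (h : I.Conf u s τ x en ex ar) (hd : s.reg 4 = d) (hB : Holds row s 8 fun i => B i + 1) :
    I.Conf u (Cmd.advance.exec s) (τ + d) (fun i => min (x i + d) (B i))
      (fun p => stamp τ (I.offZ p.1 p.2 ≤ x p.1 ∧ I.offZ p.1 p.2 < B p.1) (en p))
      (fun p => stamp τ (I.offZ p.1 p.2 + I.lenZ p.1 ≤ x p.1) (ex p))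
      (fun i => stamp τ (I.distZ i ≤ x i) (ar i)) ∧
    ∀ m, Bdd m s → (τ + d).natAbs < 2 ^ m → (∀ i, (min (x i + d) (B i)).natAbs < 2 ^ m) →
      Bdd m (Cmd.advance.exec s) := by
  have h1 : Stores cell 2 (fun p : Fin n × Fin n =>
      stamp τ (I.offZ p.1 p.2 ≤ x p.1 ∧ I.offZ p.1 p.2 < B p.1) (en p)) s _ :=
    stores_update2 (e := .record (.load 2 (.idx 5 6)) (.and (.le (.off 5 6) (.pos 5))
      (.lt (.off 5 6) (.reach 5)))) h.count fun i j => by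
    set t := (s.setReg 5 (i : ℕ)).setReg 6 (j : ℕ) with ht
    have r5 : t.reg 5 = (i : ℕ) := by simp [ht]
    have r6 : t.reg 6 = (j : ℕ) := by simp [ht]
    have hIt : I.Input u t := (h.toInput.setReg (by decide) _).setReg (by decide) _
    have hx : (Term.pos 5).eval t = x i := Instance.Input.vector (c := 6) h.pos r5
    have hz : (Term.load 2 (.idx 5 6)).eval t = en (i, j) := hIt.matrix (c := 2) h.enter r5 r6
    have hb : (Term.reach 5).eval t = B i := Instance.Input.reach hB r5
    rw [Term.eval_record, hz]
    simp only [Term.pos_and, Term.pos_le, Term.pos_lt, hIt.off r5 r6, hx, hb]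
    rw [show t.reg 3 = τ by simp [ht, h.time]]
  set s1 := (Cmd.update2 2 (.record (.load 2 (.idx 5 6)) (.and (.le (.off 5 6) (.pos 5))
      (.lt (.off 5 6) (.reach 5))))).exec s with hs1
  have i1 := h1.input (by decide) (by decide) h.toInput
  have h2 : Stores cell 3 (fun p : Fin n × Fin n =>
      stamp τ (I.offZ p.1 p.2 + I.lenZ p.1 ≤ x p.1) (ex p)) s1 _ :=
    stores_update2 (e := .record (.load 3 (.idx 5 6)) (.le (.add (.off 5 6) (.len 5)) (.pos 5)))
    i1.count fun i j => by
    set t := (s1.setReg 5 (i : ℕ)).setReg 6 (j : ℕ) with ht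
    have r5 : t.reg 5 = (i : ℕ) := by simp [ht]
    have r6 : t.reg 6 = (j : ℕ) := by simp [ht]
    have hIt : I.Input u t := (i1.setReg (by decide) _).setReg (by decide) _
    have hx : (Term.pos 5).eval t = x i :=
      Instance.Input.vector (c := 6) (h1.keep (by decide) (by decide) h.pos) r5
    have hz : (Term.load 3 (.idx 5 6)).eval t = ex (i, j) :=
      hIt.matrix (c := 3) (h1.keep (by decide) (by decide) h.exit) r5 r6
    have hs : (Term.add (.off 5 6) (.len 5)).eval t = I.offZ i j + I.lenZ i := by
      rw [Term.eval, hIt.off r5 r6, hIt.len r5]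
    rw [Term.eval_record, hz]
    simp only [Term.pos_le, hs, hx]
    rw [show t.reg 3 = τ by simp [ht, h1.reg, h.time]]
  set s2 := (Cmd.update2 3 (.record (.load 3 (.idx 5 6))
    (.le (.add (.off 5 6) (.len 5)) (.pos 5)))).exec s1 with hs2
  have i2 := h2.input (by decide) (by decide) i1
  have x2 := h2.keep (by decide) (by decide) (h1.keep (by decide) (by decide) h.pos)
  have h3 : Stores row 4 (fun i => stamp τ (I.distZ i ≤ x i) (ar i)) s2 _ :=
    stores_update (e := .record (.load 4 (.var 5)) (.le (.dist 5) (.pos 5))) i2.count fun i => by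
    set t := s2.setReg 5 (i : ℕ) with ht
    have r5 : t.reg 5 = (i : ℕ) := by simp [ht]
    have hIt : I.Input u t := i2.setReg (by decide) _
    have hx : (Term.pos 5).eval t = x i := Instance.Input.vector (c := 6) x2 r5
    have hz : (Term.load 4 (.var 5)).eval t = ar i := Instance.Input.vector (c := 4)
      (h2.keep (by decide) (by decide) (h1.keep (by decide) (by decide) h.arrive)) r5
    rw [Term.eval_record, hz]
    simp only [Term.pos_le, hIt.dist r5, hx]
    rw [show t.reg 3 = τ by simp [ht, h2.reg, h1.reg, h.time]]
  set s3 := (Cmd.update 4 (.record (.load 4 (.var 5)) (.le (.dist 5) (.pos 5)))).exec s2 with hs3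
  have i3 := h3.input (by decide) (by decide) i2
  have b3 := h3.keep (by decide) (by decide) (h2.keep (by decide) (by decide)
    (h1.keep (by decide) (by decide) hB))
  have e3 : s3.reg = s.reg := by rw [h3.reg, h2.reg, h1.reg]
  have h4 : Stores row 6 (fun i => min (x i + d) (B i)) s3 _ :=
    stores_update (e := .ite (.lt (.reach 5) (.add (.pos 5) (.var 4))) (.reach 5)
      (.add (.pos 5) (.var 4))) i3.count fun i => by
    set t := s3.setReg 5 (i : ℕ) with ht
    have r5 : t.reg 5 = (i : ℕ) := by simp [ht]
    have hb : (Term.reach 5).eval t = B i := Instance.Input.reach b3 r5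
    have hx : (Term.add (.pos 5) (.var 4)).eval t = x i + d := by
      have h5 : (Term.pos 5).eval t = x i :=
        Instance.Input.vector (c := 6) (h3.keep (by decide) (by decide) x2) r5
      have h6 : t.reg 4 = d := by simp [ht, e3, hd]
      rw [Term.eval, h5, Term.eval, h6]
    rw [Term.eval]
    simp only [Term.pos_lt, hb, hx]
    split_ifs with hlt
    · rw [min_eq_right hlt.le]
    · rw [min_eq_left (not_lt.1 hlt)]
  set s4 := (Cmd.update 6 (.ite (.lt (.reach 5) (.add (.pos 5) (.var 4))) (.reach 5)
      (.add (.pos 5) (.var 4)))).exec s3 with hs4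
  have i4 := h4.input (by decide) (by decide) i3
  have hexec : Cmd.advance.exec s = s4.setReg 3 (τ + d) := by
    have : (Term.add (.var 3) (.var 4)).eval s4 = τ + d := by
      rw [Term.eval, Term.eval, Term.eval, h4.reg, e3, h.time, hd]
    rw [← this]
    rfl
  rw [hexec]
  refine ⟨⟨i4.setReg (by decide) _, ?_, ?_, h4.holds, ?_, ?_, ?_⟩, fun m hb hτ hx => ?_⟩
  · simp
  · exact h4.keep (by decide) (by decide) (h3.keep (by decide) (by decide)
      (h2.keep (by decide) (by decide) (h1.keep (by decide) (by decide) h.queue)))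
  · exact h4.keep (by decide) (by decide) (h3.keep (by decide) (by decide)
      (h2.keep (by decide) (by decide) h1.holds))
  · exact h4.keep (by decide) (by decide) (h3.keep (by decide) (by decide) h2.holds)
  · exact h4.keep (by decide) (by decide) h3.holds
  · have ht : τ.natAbs < 2 ^ m := by rw [← h.time]; exact hb.1 3 (by decide)
    refine Bdd.setReg ?_ _ hτ
    refine h4.bdd m (h3.bdd m (h2.bdd m (h1.bdd m hb fun p => ?_) fun p => ?_) fun i => ?_) hx
    · exact natAbs_stamp_lt ht (by rw [← h.enter p]; exact hb.2 _ _)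
    · exact natAbs_stamp_lt ht (by rw [← h.exit p]; exact hb.2 _ _)
    · exact natAbs_stamp_lt ht (by rw [← h.arrive i]; exact hb.2 _ _)

/-- The effect of one step of the simulation on its state. -/
theorem step_spec {en ex : Fin n × Fin n → ℤ} {ar : Fin n → ℤ} (hv : 0 < I.maxSpeed)
    (h : I.Conf u s τ x en ex ar) (hτ : 0 ≤ τ) (hx : ∀ i, 0 ≤ x i)
    (hx0 : ∀ i k, (i = k ∨ I.toCrossing.Ahead i k) → 0 ≤ I.offZ i k + x k - I.queueZ i k) :
    ∃ (B : Fin n → ℤ) (d : ℤ),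
      I.toCrossing.IsReach (prioritiesOf n u) (I.timeOf τ) (I.posOf x) (I.posOf B) ∧
      I.IsDelay τ x B d ∧
      I.Conf u (Cmd.step.exec s) (τ + d) (fun i => min (x i + d) (B i))
        (fun p => stamp τ (I.offZ p.1 p.2 ≤ x p.1 ∧ I.offZ p.1 p.2 < B p.1) (en p))
        (fun p => stamp τ (I.offZ p.1 p.2 + I.lenZ p.1 ≤ x p.1) (ex p))
        (fun i => stamp τ (I.distZ i ≤ x i) (ar i)) ∧
      ∀ m, 1 ≤ m → Bdd m s → (τ + d).natAbs < 2 ^ m → (∀ i, (I.distZ i + 1).natAbs < 2 ^ m) →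
        Bdd m (Cmd.step.exec s) := by
  obtain ⟨B, hB, hB0, hreg, hbank, hB8, hbd⟩ :=
    setReach_spec h.toInput hv h.time h.queue h.pos hx0
  set s1 := Cmd.setReach.exec s with hs1
  have keep : ∀ {κ : Type} {addr : κ → ℕ} {b : ℕ} {z : κ → ℤ}, b ≠ 7 → b ≠ 8 → b ≠ 9 →
      Holds addr s b z → Holds addr s1 b z := fun h7 h8 h9 hz p => by
    rw [hbank _ h7 h8 h9]; exact hz p
  have i1 : I.Input u s1 := ⟨by rw [hbank 0 (by decide) (by decide) (by decide), h.word],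
    by rw [hbank 1 (by decide) (by decide) (by decide), h.cert], by rw [hreg, h.count]⟩
  obtain ⟨d, hd, hD⟩ := setDelay_spec i1 (by rw [hreg, h.time])
    (keep (by decide) (by decide) (by decide) h.pos) hB8
  have h2 : I.Conf u (s1.setReg 4 d) τ x en ex ar :=
    ⟨i1.setReg (by decide) _, by simp [hreg, h.time],
      keep (by decide) (by decide) (by decide) h.queue,
      keep (by decide) (by decide) (by decide) h.pos,
      keep (by decide) (by decide) (by decide) h.enter,
      keep (by decide) (by decide) (by decide) h.exit,
      keep (by decide) (by decide) (by decide) h.arrive⟩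
  obtain ⟨h3, hb3⟩ := advance_spec h2 (d := d) (by simp) hB8
  have hexec : Cmd.step.exec s = Cmd.advance.exec (s1.setReg 4 d) := by
    rw [← hd]; rfl
  rw [hexec]
  have hd0 := hD.nonneg
  refine ⟨B, d, hB, hD, h3, fun m hm hb ht hdist => hb3 m ((hbd m hm hb hdist).setReg 4 (by omega)) ht
    fun i => ?_⟩
  have h1 := ((Instance.isReach_iff _).1 hB i).1
  have := hdist i
  have := hB0 i
  have := hx i
  omega

end Traffic

namespace Traffic

/-! ### Correctness of the simulation -/

open Crossing

variable {n : ℕ} {I : Instance n} {u : List ℤ} {s : State} {τ d : ℤ} {x B : Fin n → ℤ}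

namespace Instance

/-- The integer `z` stands for the extended real number `e`. -/
def Denotes (I : Instance n) (z : ℤ) (e : EReal) : Prop :=
  (z = -1 ∧ e = ⊥) ∨ (z = -2 ∧ e = ⊤) ∨ (0 < I.maxSpeed ∧ 0 ≤ z ∧ e = (I.timeOf z : EReal))

/-- At the beginning of the step that starts at time `τ`, the integer `z` is an admissible record of
an event at time `e`: an event at time `τ` may have been recorded or not. -/
def Recorded (I : Instance n) (τ z : ℤ) (e : EReal) : Prop :=
  (I.Denotes z e ∧ e ≤ I.timeOf τ) ∨ (z = -2 ∧ I.timeOf τ ≤ e)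

theorem Denotes.decodeTime {z : ℤ} {e : EReal} (h : I.Denotes z e) : I.decodeTime z = e := by
  rcases h with ⟨rfl, rfl⟩ | ⟨rfl, rfl⟩ | ⟨-, hz, rfl⟩
  · rfl
  · rfl
  · rw [Instance.decodeTime, if_neg (by omega), if_neg (by omega)]; rfl

theorem Denotes.eq_top {e : EReal} (h : I.Denotes (-2) e) : e = ⊤ := by
  rcases h with ⟨h, -⟩ | ⟨-, h⟩ | ⟨-, h, -⟩
  · norm_num at h
  · exact h
  · norm_num at h

theorem Denotes.ne_of_le {z : ℤ} {e : EReal} (h : I.Denotes z e) {t : ℝ} (he : e ≤ t) : z ≠ -2 := by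
  rintro rfl
  rw [h.eq_top] at he
  exact absurd he (EReal.coe_lt_top t).not_ge

theorem Denotes.stamp {z : ℤ} {e : EReal} {p : Prop} (h : I.Denotes z e)
    (hp : p ↔ e ≤ I.timeOf τ) : I.Denotes (stamp τ p z) e := by
  rw [Traffic.stamp]
  split_ifs with hc
  · exact absurd hc.1 (h.ne_of_le (hp.1 hc.2))
  · exact h

theorem Recorded.stamp (hv : 0 < I.maxSpeed) {z : ℤ} {e : EReal} {p : Prop} (h : I.Recorded τ z e)
    (hτ : 0 ≤ τ) (hp : p ↔ e ≤ I.timeOf τ) :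
    (I.Denotes (stamp τ p z) e ∧ e ≤ I.timeOf τ) ∨ (Traffic.stamp τ p z = -2 ∧ I.timeOf τ < e) := by
  rcases h with ⟨h, he⟩ | ⟨rfl, he⟩
  · exact Or.inl ⟨h.stamp hp, he⟩
  · by_cases h : p
    · have he' := hp.1 h
      rw [Traffic.stamp, if_pos ⟨rfl, h⟩]
      exact Or.inl ⟨Or.inr (Or.inr ⟨hv, hτ, le_antisymm he' he⟩), he'⟩
    · rw [Traffic.stamp, if_neg fun hc => h hc.2]
      exact Or.inr ⟨rfl, lt_of_not_ge fun hc => h (hp.2 hc)⟩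

/-- Records remain admissible if there is no event until time `τ + d`. -/
theorem Recorded.advance (hv : 0 < I.maxSpeed) {z : ℤ} {e : EReal} {p : Prop}
    (h : I.Recorded τ z e) (hτ : 0 ≤ τ) (hp : p ↔ e ≤ I.timeOf τ) (hd : 0 ≤ d)
    (hn : I.timeOf τ < e → I.timeOf (τ + d) ≤ e) :
    I.Recorded (τ + d) (Traffic.stamp τ p z) e := by
  rcases h.stamp hv hτ hp with ⟨h1, h2⟩ | ⟨h1, h2⟩
  · refine Or.inl ⟨h1, h2.trans ?_⟩
    rw [EReal.coe_le_coe_iff, timeOf_le hv]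
    omega
  · exact Or.inr ⟨h1, hn h2⟩

/-- Records are final if no event is left. -/
theorem Recorded.denotes (hv : 0 < I.maxSpeed) {z : ℤ} {e : EReal} {p : Prop}
    (h : I.Recorded τ z e) (hτ : 0 ≤ τ) (hp : p ↔ e ≤ I.timeOf τ)
    (hn : I.timeOf τ < e → e = ⊤) : I.Denotes (Traffic.stamp τ p z) e := by
  rcases h.stamp hv hτ hp with ⟨h1, -⟩ | ⟨h1, h2⟩
  · exact h1
  · rw [h1, hn h2]
    exact Or.inr (Or.inl ⟨rfl, rfl⟩)

theorem isTarget_iff (i : Fin n) (q : ℝ) :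
    I.toCrossing.IsTarget i q ↔ ∃ z, I.IsTargetZ i z ∧ q = z / I.fine := by
  simp only [IsTarget, IsTargetZ, dist_eq, off_eq, len_eq, add_fine]
  constructor
  · rintro (rfl | ⟨k, hk, rfl | rfl⟩)
    · exact ⟨_, Or.inl rfl, rfl⟩
    · exact ⟨_, Or.inr ⟨k, hk, Or.inl rfl⟩, rfl⟩
    · exact ⟨_, Or.inr ⟨k, hk, Or.inr rfl⟩, rfl⟩
  · rintro ⟨z, rfl | ⟨k, hk, rfl | rfl⟩, rfl⟩
    · exact Or.inl rfl
    · exact Or.inr ⟨k, hk, Or.inl rfl⟩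
    · exact Or.inr ⟨k, hk, Or.inr rfl⟩

theorem maxSpeed_mul_timeOf (hv : 0 < I.maxSpeed) (d : ℤ) :
    I.toCrossing.maxSpeed * I.timeOf d = d / I.fine := by
  have hq := I.den_pos'
  have hv' : (0 : ℝ) < I.maxSpeed := Nat.cast_pos.2 hv
  change (I.maxSpeed : ℝ) / I.den * _ = _
  rw [timeOf, rate, fine]
  field_simp

theorem maxSpeed_pos (hv : 0 < I.maxSpeed) : 0 < I.toCrossing.maxSpeed :=
  div_pos (Nat.cast_pos.2 hv) I.den_pos'

theorem timeOf_add (a b : ℤ) : I.timeOf (a + b) = I.timeOf a + I.timeOf b := by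
  rw [timeOf, timeOf, timeOf]; push_cast; ring

/-- There is no event before the next one; if there is none at all, then this holds for any
length of time. -/
theorem IsDelay.noEvent (hv : 0 < I.maxSpeed) (h : I.IsDelay τ x B d) {δ : ℝ}
    (hδ : 0 < d → δ ≤ I.timeOf d) :
    I.toCrossing.NoEvent (I.timeOf τ) (I.posOf x) (I.posOf B) δ := by
  constructor
  · intro i hi
    rw [startTime_eq_timeOf hv] at hi ⊢
    obtain ⟨h1, h2⟩ := h.start i ((timeOf_lt hv).1 hi)
    have h3 := hδ h1
    have h4 : I.timeOf (τ + d) ≤ I.timeOf (I.startZ i) := (timeOf_le hv).2 (by omega)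
    rw [timeOf_add] at h4
    linarith
  · intro i q hq h1 h2
    obtain ⟨z, hz, rfl⟩ := (isTarget_iff i q).1 hq
    obtain ⟨h3, h4⟩ := h.target i z hz (lt_iff.1 h1) (le_iff.1 h2)
    have h5 := mul_le_mul_of_nonneg_left (hδ h3) I.toCrossing.maxSpeed_nonneg
    rw [maxSpeed_mul_timeOf hv] at h5
    refine h5.trans ?_
    rw [posOf, sub_fine, le_iff]
    exact h4

/-- The events at which the simulation pauses: the start times, and for each vehicle the points of
its lane which are its goal (`none`), the intersection with another vehicle (`false`), or the point
at which it has passed this intersection (`true`). -/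
abbrev Item (n : ℕ) := Fin n ⊕ (Fin n × Option (Fin n × Bool))

/-- The event has not occurred at time `τ` when the vehicles are at the positions `x`. -/
def Pending (I : Instance n) (τ : ℤ) (x : Fin n → ℤ) : Item n → Prop
  | .inl i => τ < I.startZ i
  | .inr (i, none) => x i < I.distZ i
  | .inr (i, some (j, false)) => x i < I.offZ i j
  | .inr (i, some (j, true)) => x i < I.offZ i j + I.lenZ i

open Classical in
/-- The number of events that have not yet occurred. -/
def pending (I : Instance n) (τ : ℤ) (x : Fin n → ℤ) : ℕ :=
  (Finset.univ.filter (I.Pending τ x)).card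

theorem pending_le (τ : ℤ) (x : Fin n → ℤ) : I.pending τ x ≤ 2 * n ^ 2 + 2 * n := by
  classical
  refine (Finset.card_le_univ _).trans_eq ?_
  simp only [Fintype.card_sum, Fintype.card_prod, Fintype.card_option, Fintype.card_fin,
    Fintype.card_bool]
  ring

theorem Pending.of_le {τ' : ℤ} {x' : Fin n → ℤ} (hτ : τ ≤ τ') (hx : ∀ i, x i ≤ x' i) {p : Item n}
    (h : I.Pending τ' x' p) : I.Pending τ x p := by
  rcases p with i | ⟨i, _ | ⟨j, _ | _⟩⟩
  · exact hτ.trans_lt h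
  all_goals exact (hx i).trans_lt h

theorem pending_mono {τ' : ℤ} {x' : Fin n → ℤ} (hτ : τ ≤ τ') (hx : ∀ i, x i ≤ x' i) :
    I.pending τ' x' ≤ I.pending τ x := by
  classical
  exact Finset.card_le_card fun p hp => by
    rw [Finset.mem_filter] at hp ⊢
    exact ⟨hp.1, hp.2.of_le hτ hx⟩

/-- The event at the end of a step is no longer pending after the step. -/
theorem IsDelay.pending_lt (h : I.IsDelay τ x B d) (hd : 0 < d) (hB : ∀ i, x i ≤ B i) :
    I.pending (τ + d) (fun i => min (x i + d) (B i)) < I.pending τ x := by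
  classical
  have hle : ∀ i, x i ≤ min (x i + d) (B i) := fun i => le_min (by omega) (hB i)
  have hp : ∃ p, I.Pending τ x p ∧ ¬ I.Pending (τ + d) (fun i => min (x i + d) (B i)) p := by
    rcases h.event hd with ⟨i, e⟩ | ⟨i, q, hq, hqB, e⟩
    · exact ⟨.inl i, by simp only [Pending]; omega, by simp only [Pending]; omega⟩
    · rcases hq with rfl | ⟨j, -, rfl | rfl⟩
      · exact ⟨.inr (i, none), by simp only [Pending]; omega, by simp only [Pending]; omega⟩
      · exact ⟨.inr (i, some (j, false)), by simp only [Pending]; omega,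
          by simp only [Pending]; omega⟩
      · exact ⟨.inr (i, some (j, true)), by simp only [Pending]; omega,
          by simp only [Pending]; omega⟩
  obtain ⟨p, h1, h2⟩ := hp
  refine Finset.card_lt_card ⟨fun r hr => ?_, fun hs => ?_⟩
  · rw [Finset.mem_filter] at hr ⊢
    exact ⟨hr.1, hr.2.of_le (by omega) hle⟩
  · have := hs (Finset.mem_filter.2 ⟨Finset.mem_univ p, h1⟩)
    exact h2 (Finset.mem_filter.1 this).2

end Instance

variable {F : Profile n}

/-- The time at which vehicle `i` enters its intersection with `j`. -/
def enterTime (C : Crossing n) (F : Profile n) (p : Fin n × Fin n) : EReal :=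
  firstTime fun t => C.off p.1 p.2 < pos F t p.1

/-- The time at which vehicle `i` leaves its intersection with `j`. -/
def leaveTime (C : Crossing n) (F : Profile n) (p : Fin n × Fin n) : EReal :=
  firstTime fun t => C.off p.1 p.2 + C.len p.1 ≤ pos F t p.1

/-- The time at which vehicle `i` arrives at its goal. -/
def reachTime (C : Crossing n) (F : Profile n) (i : Fin n) : EReal :=
  firstTime fun t => C.dist i ≤ pos F t i

/-- All events have been recorded. -/
structure Instance.Complete (I : Instance n) (F : Profile n) (en ex : Fin n × Fin n → ℤ)
    (ar : Fin n → ℤ) : Prop where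
  enter : ∀ p : Fin n × Fin n, I.toCrossing.Cross p.1 p.2 →
    I.Denotes (en p) (enterTime I.toCrossing F p)
  exit : ∀ p : Fin n × Fin n, I.toCrossing.Cross p.1 p.2 →
    I.Denotes (ex p) (leaveTime I.toCrossing F p)
  arrive : ∀ i, I.Denotes (ar i) (reachTime I.toCrossing F i)

/-- The state of the simulation reflects the state of the crossing at time `τ`. -/
structure Instance.Track (I : Instance n) (u : List ℤ) (F : Profile n) (s : State) (τ : ℤ)
    (x : Fin n → ℤ) (en ex : Fin n × Fin n → ℤ) (ar : Fin n → ℤ) : Prop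
    extends I.Conf u s τ x en ex ar where
  nonneg : 0 ≤ τ
  pos_eq : Crossing.pos F (I.timeOf τ) = I.posOf x
  entered : ∀ p : Fin n × Fin n, I.toCrossing.Cross p.1 p.2 →
    I.Recorded τ (en p) (enterTime I.toCrossing F p)
  left : ∀ p : Fin n × Fin n, I.toCrossing.Cross p.1 p.2 →
    I.Recorded τ (ex p) (leaveTime I.toCrossing F p)
  arrived : ∀ i, I.Recorded τ (ar i) (reachTime I.toCrossing F i)

theorem eq_top_of_forall_le {e : EReal} {t : ℝ} (h : ∀ d : ℝ, 0 < d → ((t + d : ℝ) : EReal) ≤ e) :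
    e = ⊤ := by
  rw [EReal.eq_top_iff_forall_lt]
  intro y
  refine lt_of_lt_of_le ?_ (h (|y - t| + 1) (by positivity))
  rw [EReal.coe_lt_coe_iff]
  linarith [le_abs_self (y - t)]

/-- A step of the simulation makes the number of pending events smaller, or else all events have
been recorded. Each step takes at most the time `M`, which bounds the time on the clock throughout.
-/
theorem Instance.Track.step {en ex : Fin n × Fin n → ℤ} {ar : Fin n → ℤ} {M : ℤ}
    (hv : 0 < I.maxSpeed) (h0 : I.toCrossing.Apart)
    (hF : I.toCrossing.SolvesAll (prioritiesOf n u) F) (h : I.Track u F s τ x en ex ar)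
    (hM : ∀ i, I.startZ i ≤ M) (hM' : ∀ i q, I.IsTargetZ i q → q ≤ M) (hM0 : 0 ≤ M) :
    ∃ τ' x' en' ex' ar', I.Track u F (Cmd.step.exec s) τ' x' en' ex' ar' ∧
      (I.Complete F en ex ar → I.Complete F en' ex' ar') ∧
      (I.Complete F en' ex' ar' ∨ I.pending τ' x' < I.pending τ x) ∧
      τ' + M * I.pending τ' x' ≤ τ + M * I.pending τ x ∧
      ∀ m, 1 ≤ m → Bdd m s → τ'.natAbs < 2 ^ m → (∀ i, (I.distZ i + 1).natAbs < 2 ^ m) →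
        Bdd m (Cmd.step.exec s) := by
  have hvC := Instance.maxSpeed_pos hv
  have ht0 : 0 ≤ I.timeOf τ := div_nonneg (Int.cast_nonneg h.nonneg) (Instance.rate_pos hv).le
  have hord : I.toCrossing.InOrder (I.posOf x) := h.pos_eq ▸ hF.inOrder ht0
  have hx : ∀ i, 0 ≤ x i := fun i => by
    have h1 : 0 ≤ pos F (I.timeOf τ) i := (hF.isSpeed i).nonneg _
    rw [h.pos_eq, Instance.posOf] at h1
    rw [← Instance.le_iff (I := I), Int.cast_zero, zero_div]
    exact h1
  have hx0 : ∀ i k, (i = k ∨ I.toCrossing.Ahead i k) → x i ≤ I.offZ i k + x k - I.queueZ i k := by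
    intro i k hik
    have := queue_le h0 hord hik
    rw [Instance.off_eq, Instance.queue_eq, Instance.posOf, Instance.posOf, Instance.add_fine,
      Instance.sub_fine, Instance.le_iff] at this
    exact this
  obtain ⟨B, d, hB, hD, hC, hbd⟩ := step_spec hv h.toConf h.nonneg hx
    fun i k hik => (hx i).trans (hx0 i k hik)
  have hle : ∀ i, x i ≤ B i := fun i =>
    Instance.le_iff.1 (hB.le h0 hord (fun i => by rw [← h.pos_eq]; exact hF.pos_le i _) i)
  rw [← h.pos_eq] at hB
  -- There are no events for some positive time.
  obtain ⟨δ, hδ0, hδ⟩ : ∃ δ : ℝ, 0 < δ ∧ (0 < d → δ ≤ I.timeOf d) := by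
    by_cases hd : 0 < d
    · exact ⟨I.timeOf d, div_pos (Int.cast_pos.2 hd) (Instance.rate_pos hv), fun _ => le_rfl⟩
    · exact ⟨1, one_pos, fun h => absurd h hd⟩
  have hE : ∀ δ' : ℝ, (0 < d → δ' ≤ I.timeOf d) →
      I.toCrossing.NoEvent (I.timeOf τ) (pos F (I.timeOf τ)) (I.posOf B) δ' := fun δ' h' => by
    rw [h.pos_eq]; exact hD.noEvent hv h'
  -- The machine recognizes whether an event has occurred.
  have p1 : ∀ p : Fin n × Fin n, (I.offZ p.1 p.2 ≤ x p.1 ∧ I.offZ p.1 p.2 < B p.1) ↔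
      enterTime I.toCrossing F p ≤ I.timeOf τ := fun p => by
    rw [enterTime, hF.entry_le_iff h0 hvC ht0 hB (hE δ hδ) hδ0, h.pos_eq, Instance.off_eq,
      Instance.posOf, Instance.posOf, Instance.le_iff, Instance.lt_iff]
  have p2 : ∀ p : Fin n × Fin n, (I.offZ p.1 p.2 + I.lenZ p.1 ≤ x p.1) ↔
      leaveTime I.toCrossing F p ≤ I.timeOf τ := fun p => by
    rw [leaveTime, hF.reach_le_iff, h.pos_eq, Instance.off_eq, Instance.len_eq,
      Instance.posOf, Instance.add_fine, Instance.le_iff]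
  have p3 : ∀ i, I.distZ i ≤ x i ↔ reachTime I.toCrossing F i ≤ I.timeOf τ := fun i => by
    rw [reachTime, hF.reach_le_iff, h.pos_eq, Instance.dist_eq, Instance.posOf, Instance.le_iff]
  -- An event that has not occurred does not occur before the end of the step.
  have q1 : ∀ p : Fin n × Fin n, I.toCrossing.Cross p.1 p.2 → ∀ δ' : ℝ, 0 < δ' →
      (0 < d → δ' ≤ I.timeOf d) → I.timeOf τ < enterTime I.toCrossing F p →
      ((I.timeOf τ + δ' : ℝ) : EReal) ≤ enterTime I.toCrossing F p := fun p hp δ' h1 h2 h3 =>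
    hF.entry_ge h0 hvC ht0 hB (hE δ' h2) h1 (Or.inr ⟨p.2, hp, Or.inl rfl⟩) h3
  have q2 : ∀ p : Fin n × Fin n, I.toCrossing.Cross p.1 p.2 → ∀ δ' : ℝ, 0 < δ' →
      (0 < d → δ' ≤ I.timeOf d) → I.timeOf τ < leaveTime I.toCrossing F p →
      ((I.timeOf τ + δ' : ℝ) : EReal) ≤ leaveTime I.toCrossing F p := fun p hp δ' h1 h2 h3 =>
    hF.reach_ge h0 hvC ht0 hB (hE δ' h2) (Or.inr ⟨p.2, hp, Or.inr rfl⟩) h3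
  have q3 : ∀ i, ∀ δ' : ℝ, 0 < δ' →
      (0 < d → δ' ≤ I.timeOf d) → I.timeOf τ < reachTime I.toCrossing F i →
      ((I.timeOf τ + δ' : ℝ) : EReal) ≤ reachTime I.toCrossing F i := fun i δ' h1 h2 h3 =>
    hF.reach_ge h0 hvC ht0 hB (hE δ' h2) (Or.inl rfl) h3
  have next : ∀ e : EReal, (∀ δ' : ℝ, 0 < δ' → (0 < d → δ' ≤ I.timeOf d) → I.timeOf τ < e →
      ((I.timeOf τ + δ' : ℝ) : EReal) ≤ e) → I.timeOf τ < e → I.timeOf (τ + d) ≤ e := by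
    intro e he h3
    rcases hD.nonneg.eq_or_lt with hd | hd
    · rw [← hd, add_zero]; exact h3.le
    · rw [Instance.timeOf_add]
      exact he _ (div_pos (Int.cast_pos.2 hd) (Instance.rate_pos hv)) (fun _ => le_rfl) h3
  -- If there is no next event, then an event that has not occurred never occurs.
  have top : ¬ 0 < d → ∀ e : EReal, (∀ δ' : ℝ, 0 < δ' → (0 < d → δ' ≤ I.timeOf d) →
      I.timeOf τ < e → ((I.timeOf τ + δ' : ℝ) : EReal) ≤ e) → I.timeOf τ < e → e = ⊤ := by
    intro hd e he h3
    exact eq_top_of_forall_le fun δ' h' => he δ' h' (fun h => absurd h hd) h3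
  refine ⟨_, _, _, _, _, ⟨hC, add_nonneg h.nonneg hD.nonneg, ?_, fun p hp => ?_, fun p hp => ?_,
    fun i => ?_⟩, fun hc => ⟨fun p hp => ?_, fun p hp => ?_, fun i => ?_⟩, ?_, ?_, hbd⟩
  · funext i
    have e1 := hF.pos_add (s := I.timeOf d) h0 hvC ht0 hB (hE (I.timeOf d) fun _ => le_rfl)
      (div_nonneg (Int.cast_nonneg hD.nonneg) (Instance.rate_pos hv).le) le_rfl i
    rw [Instance.timeOf_add]
    refine e1.trans ?_
    rw [h.pos_eq, Instance.maxSpeed_mul_timeOf hv, Instance.posOf, Instance.posOf, Instance.posOf,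
      Instance.add_fine, min_div_div_right I.fine_pos.le, Int.cast_min]
  · exact (h.entered p hp).advance hv h.nonneg (p1 p) hD.nonneg (next _ (q1 p hp))
  · exact (h.left p hp).advance hv h.nonneg (p2 p) hD.nonneg (next _ (q2 p hp))
  · exact (h.arrived i).advance hv h.nonneg (p3 i) hD.nonneg (next _ (q3 i))
  · exact (hc.enter p hp).stamp (p1 p)
  · exact (hc.exit p hp).stamp (p2 p)
  · exact (hc.arrive i).stamp (p3 i)
  · by_cases hd : 0 < d
    · exact Or.inr (hD.pending_lt hd hle)
    · left
      refine ⟨fun p hp => ?_, fun p hp => ?_, fun i => ?_⟩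
      · exact (h.entered p hp).denotes hv h.nonneg (p1 p) (top hd _ (q1 p hp))
      · exact (h.left p hp).denotes hv h.nonneg (p2 p) (top hd _ (q2 p hp))
      · exact (h.arrived i).denotes hv h.nonneg (p3 i) (top hd _ (q3 i))
  · rcases hD.nonneg.eq_or_lt with hd | hd
    · rw [← hd, add_zero]
      have : I.pending τ (fun i => min (x i + 0) (B i)) ≤ I.pending τ x :=
        Instance.pending_mono le_rfl fun i => le_min (by omega) (hle i)
      have := mul_le_mul_of_nonneg_left (Nat.cast_le (α := ℤ).2 this) hM0
      linarith
    · have h1 := hD.pending_lt hd hle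
      have h2 : d ≤ M := by
        rcases hD.event hd with ⟨i, e⟩ | ⟨i, q, hq, -, e⟩
        · have := hM i
          have := h.nonneg
          omega
        · have := hM' i q hq
          have := hx i
          omega
      have h3 : ((I.pending (τ + d) fun i => min (x i + d) (B i)) : ℤ) + 1 ≤ I.pending τ x := by
        exact_mod_cast h1
      have := mul_le_mul_of_nonneg_left h3 hM0
      linarith

end Traffic

namespace Traffic

/-! ### The beginning and the end of the simulation -/

open Crossing

variable {n : ℕ} {I : Instance n} {u : List ℤ} {s : State} {F : Profile n}

theorem firstTime_eq_bot {p : ℝ → Prop} (h : ∀ t, p t) : firstTime p = ⊥ := by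
  rw [EReal.eq_bot_iff_forall_lt]
  intro y
  refine (firstTime_le (h (y - 1))).trans_lt ?_
  rw [EReal.coe_lt_coe_iff]
  linarith

theorem firstTime_eq_top {p : ℝ → Prop} (h : ∀ t, ¬ p t) : firstTime p = ⊤ := by
  rw [firstTime, Set.eq_empty_of_forall_notMem (s := {t | p t}) h, Set.image_empty, sInf_empty]

namespace Crossing.SolvesAll

variable {C : Crossing n} {P : Priorities n}

theorem firstTime_nonneg (hF : C.SolvesAll P F) {i : Fin n} {p : ℝ → Prop}
    (hp : ∀ t, p t → 0 < pos F t i) : 0 ≤ firstTime p := by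
  refine le_sInf ?_
  rintro _ ⟨t, ht, rfl⟩
  by_contra hlt
  have h1 : t < 0 := by
    rw [not_le] at hlt
    exact EReal.coe_lt_coe_iff.1 hlt
  have h2 := hp t ht
  have h3 : pos F t i = 0 := (hF.isSpeed i).eq_zero h1.le
  rw [h3] at h2
  exact lt_irrefl _ h2

end Crossing.SolvesAll

namespace Instance

theorem off_neg_iff (i j : Fin n) : I.toCrossing.off i j < 0 ↔ I.offZ i j < 0 := by
  rw [off_eq, ← lt_iff (I := I), Int.cast_zero, zero_div]

theorem enterTime_eq_bot {P : Priorities n} (hF : I.toCrossing.SolvesAll P F) {p : Fin n × Fin n}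
    (h : I.offZ p.1 p.2 < 0) : enterTime I.toCrossing F p = ⊥ :=
  firstTime_eq_bot fun t => ((off_neg_iff _ _).2 h).trans_le ((hF.isSpeed p.1).nonneg t)

theorem enterTime_nonneg {P : Priorities n} (hF : I.toCrossing.SolvesAll P F) {p : Fin n × Fin n}
    (h : ¬ I.offZ p.1 p.2 < 0) : 0 ≤ enterTime I.toCrossing F p := by
  rw [← off_neg_iff, not_lt] at h
  exact hF.firstTime_nonneg fun t ht => h.trans_lt ht

theorem leaveTime_nonneg {P : Priorities n} (hF : I.toCrossing.SolvesAll P F) {p : Fin n × Fin n}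
    (h : I.toCrossing.Cross p.1 p.2) : 0 ≤ leaveTime I.toCrossing F p :=
  hF.firstTime_nonneg fun _ ht => lt_of_lt_of_le (by linarith [h.2.1]) ht

theorem reachTime_nonneg {P : Priorities n} (hF : I.toCrossing.SolvesAll P F) (i : Fin n) :
    0 ≤ reachTime I.toCrossing F i :=
  hF.firstTime_nonneg fun _ ht => lt_of_lt_of_le (I.toCrossing.vehicle i).dist_pos ht

/-- The records of entries at time 0: a vehicle that starts beyond an intersection has always been
there. -/
def enterStart (I : Instance n) (p : Fin n × Fin n) : ℤ := if I.offZ p.1 p.2 < 0 then -1 else -2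

/-- The state of the simulation at time 0. -/
theorem prepare_spec (h : I.Input u s) :
    I.Conf u (Cmd.prepare.exec s) 0 (fun _ => 0) I.enterStart (fun _ => -2) fun _ => -2 := by
  have h1 : Stores cell 5 (fun p : Fin n × Fin n => I.queueZ p.1 p.2) s _ :=
    stores_fill2 (i := 5) (j := 6) (e := .sum 7 (.const 0) (.ite (.and (.ahead 5 7)
      (.or (.eq (.var 7) (.var 6)) (.ahead 7 6))) (.len 7) (.const 0))) h.count fun i j => by
    classical
    set t := (s.setReg 5 (i : ℕ)).setReg 6 (j : ℕ) with ht
    have hIt : I.Input u t := (h.setReg (by decide) _).setReg (by decide) _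
    rw [Term.eval_sum hIt.count, Instance.queueZ, Finset.sum_filter, Term.eval, zero_add]
    refine Finset.sum_congr rfl fun m _ => ?_
    have r5 : (t.setReg 7 (m : ℕ)).reg 5 = (i : ℕ) := by simp [ht]
    have r6 : (t.setReg 7 (m : ℕ)).reg 6 = (j : ℕ) := by simp [ht]
    have r7 : (t.setReg 7 (m : ℕ)).reg 7 = (m : ℕ) := by simp
    have hI7 : I.Input u (t.setReg 7 (m : ℕ)) := hIt.setReg (by decide) _
    have e1 : (Term.var 7).eval (t.setReg 7 (m : ℕ)) = (Term.var 6).eval (t.setReg 7 (m : ℕ)) ↔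
        m = j := by
      rw [Term.eval, Term.eval, r6, r7, Nat.cast_inj, Fin.val_inj]
    rw [Term.eval]
    simp only [Term.pos_and, Term.pos_or, Term.pos_eq, hI7.ahead r5 r7, hI7.ahead r7 r6, e1,
      hI7.len r7]
    rfl
  set s1 := (Cmd.fill2 5 5 6 (.sum 7 (.const 0) (.ite (.and (.ahead 5 7)
      (.or (.eq (.var 7) (.var 6)) (.ahead 7 6))) (.len 7) (.const 0)))).exec s with hs1
  have i1 := h1.input (by decide) (by decide) h
  have h2 : Stores cell 2 I.enterStart s1 _ :=
    stores_fill2 (i := 5) (j := 6) (e := .ite (.lt (.off 5 6) (.const 0)) (.const (-1))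
      (.const (-2))) i1.count fun i j => by
    set t := (s1.setReg 5 (i : ℕ)).setReg 6 (j : ℕ) with ht
    have hIt : I.Input u t := (i1.setReg (by decide) _).setReg (by decide) _
    have r5 : t.reg 5 = (i : ℕ) := by simp [ht]
    have r6 : t.reg 6 = (j : ℕ) := by simp [ht]
    rw [Term.eval, enterStart]
    simp only [Term.pos_lt, hIt.off r5 r6]
    rfl
  set s2 := (Cmd.fill2 2 5 6 (.ite (.lt (.off 5 6) (.const 0)) (.const (-1))
      (.const (-2)))).exec s1 with hs2
  have i2 := h2.input (by decide) (by decide) i1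
  have h3 : Stores cell 3 (fun _ : Fin n × Fin n => (-2 : ℤ)) s2 _ :=
    stores_fill2 (i := 5) (j := 6) (e := .const (-2)) i2.count fun i j => rfl
  set s3 := (Cmd.fill2 3 5 6 (.const (-2))).exec s2 with hs3
  have i3 := h3.input (by decide) (by decide) i2
  have h4 : Stores row 4 (fun _ : Fin n => (-2 : ℤ)) s3 _ :=
    stores_fill (k := 5) (e := .const (-2)) i3.count fun i => rfl
  set s4 := (Cmd.fill 4 5 (.const (-2))).exec s3 with hs4
  have i4 := h4.input (by decide) (by decide) i3
  have h5 : Stores row 6 (fun _ : Fin n => (0 : ℤ)) s4 _ :=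
    stores_fill (k := 5) (e := .const 0) i4.count fun i => rfl
  set s5 := (Cmd.fill 6 5 (.const 0)).exec s4 with hs5
  have i5 := h5.input (by decide) (by decide) i4
  have hexec : Cmd.prepare.exec s = s5.setReg 3 0 := rfl
  rw [hexec]
  refine ⟨i5.setReg (by decide) _, by simp, ?_, h5.holds, ?_, ?_, ?_⟩
  · exact h5.keep (by decide) (by decide) (h4.keep (by decide) (by decide)
      (h3.keep (by decide) (by decide) (h2.keep (by decide) (by decide) h1.holds)))
  · exact h5.keep (by decide) (by decide) (h4.keep (by decide) (by decide)
      (h3.keep (by decide) (by decide) h2.holds))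
  · exact h5.keep (by decide) (by decide) (h4.keep (by decide) (by decide) h3.holds)
  · exact h5.keep (by decide) (by decide) h4.holds

theorem timeOf_zero : I.timeOf 0 = 0 := by rw [timeOf, Int.cast_zero, zero_div]

/-- The simulation reflects the state of the crossing at time 0. -/
theorem Conf.track {P : Priorities n} (hF : I.toCrossing.SolvesAll P F)
    (h : I.Conf u s 0 (fun _ => 0) I.enterStart (fun _ => -2) fun _ => -2) :
    I.Track u F s 0 (fun _ => 0) I.enterStart (fun _ => -2) fun _ => -2 := by
  refine ⟨h, le_rfl, ?_, fun p hp => ?_, fun p hp => Or.inr ⟨rfl, ?_⟩, fun i => Or.inr ⟨rfl, ?_⟩⟩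
  · funext i
    rw [timeOf_zero, posOf, Int.cast_zero, zero_div]
    exact (hF.isSpeed i).eq_zero le_rfl
  · rw [enterStart]
    split_ifs with h1
    · left
      rw [enterTime_eq_bot hF h1]
      exact ⟨Or.inl ⟨rfl, rfl⟩, bot_le⟩
    · right
      rw [timeOf_zero]
      exact ⟨rfl, enterTime_nonneg hF h1⟩
  · rw [timeOf_zero]; exact leaveTime_nonneg hF hp
  · rw [timeOf_zero]; exact reachTime_nonneg hF i

/-- When the speed limit is 0, there is nothing to simulate. -/
theorem complete_zero (hF : F = 0) :
    I.Complete F I.enterStart (fun _ => -2) fun _ => -2 := by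
  have hp : ∀ t (i : Fin n), pos F t i = 0 := fun t i => by
    rw [hF]; simp [pos, travelled]
  refine ⟨fun p hc => ?_, fun p hc => Or.inr (Or.inl ⟨rfl, firstTime_eq_top fun t => ?_⟩),
    fun i => Or.inr (Or.inl ⟨rfl, firstTime_eq_top fun t => ?_⟩)⟩
  · rw [enterStart]
    split_ifs with h1
    · refine Or.inl ⟨rfl, firstTime_eq_bot fun t => ?_⟩
      rw [hp]; exact (off_neg_iff _ _).2 h1
    · refine Or.inr (Or.inl ⟨rfl, firstTime_eq_top fun t => ?_⟩)
      rw [hp, off_neg_iff]; exact h1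
  · rw [hp]; linarith [hc.2.1]
  · rw [hp, not_le]; exact (I.toCrossing.vehicle i).dist_pos

end Instance

namespace Term

/-- All vehicles arrive in time, and the vehicles do not collide. A vehicle that arrives has entered
its intersections, but it need not leave them; an exit or arrival that does not take place is
recorded as `-2`, which fails the comparison with 0. -/
def valid : Term :=
  and (not (any 5 (not (and (le (const 0) (load 4 (var 5))) (le (load 4 (var 5)) (deadline 5))))))
  (and (not (any 5 (any 6 (and (opp 5 6) (and (le (const 0) (off 5 6))
    (lt (off 5 6) (add (dist 5) (dist 6))))))))
  (not (any 5 (any 6 (and (cross 5 6) (not (or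
    (and (le (const 0) (load 3 (idx 5 6))) (le (load 3 (idx 5 6)) (load 2 (idx 6 5))))
    (and (le (const 0) (load 3 (idx 6 5))) (le (load 3 (idx 6 5)) (load 2 (idx 5 6)))))))))))

/-- The bodies of the vehicles `a` and `b` overlap initially. -/
def overlap (a b : ℕ) : Term :=
  or (and (eq (dot a b) (const 0)) (and (lt (sub (const 0) (len a)) (off a b))
    (and (lt (off a b) (const 0)) (and (lt (sub (const 0) (len b)) (off b a))
      (lt (off b a) (const 0))))))
  (or (and (same a b) (and (lt (sub (const 0) (len a)) (off a b)) (lt (off a b) (len b))))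
    (and (opp a b) (and (lt (off a b) (const 0)) (lt (sub (const 0) (len a))
      (add (off a b) (len b))))))

/-- The vehicles do not overlap initially. -/
def apart : Term := not (any 5 (any 6 (and (not (eq (var 5) (var 6))) (overlap 5 6))))

end Term

namespace Instance.Input

theorem forall_pair (h : I.Input u s) {e : Term} {p : Fin n → Fin n → Prop}
    (hp : ∀ i j : Fin n, 0 < e.eval ((s.setReg 5 (i : ℕ)).setReg 6 (j : ℕ)) ↔ ¬ p i j) :
    0 < (Term.not (.any 5 (.any 6 e))).eval s ↔ ∀ i j, p i j := by
  rw [Term.pos_not, Term.pos_any h.count]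
  simp only [Term.pos_any ((h.setReg (k := 5) (by decide) _).count), hp]
  push Not
  rfl

theorem apart (h : I.Input u s) : 0 < Term.apart.eval s ↔ I.toCrossing.Apart := by
  rw [Term.apart, h.forall_pair (p := fun i j => i ≠ j → I.toCrossing.Clear i j 0 0)]
  intro i j
  set t := (s.setReg 5 (i : ℕ)).setReg 6 (j : ℕ) with ht
  have hIt : I.Input u t := (h.setReg (by decide) _).setReg (by decide) _
  have r5 : t.reg 5 = (i : ℕ) := by simp [ht]
  have r6 : t.reg 6 = (j : ℕ) := by simp [ht]
  simp only [Term.overlap, Term.pos_and, Term.pos_or, Term.pos_not, Term.pos_eq, Term.pos_lt, r5, r6,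
    hIt.dot r5 r6, hIt.off r5 r6, hIt.off r6 r5, hIt.same r5 r6, hIt.opp r5 r6, hIt.len r6,
    Term.eval, hIt.len r5, clear_zero_iff, zero_sub, Nat.cast_inj, Fin.val_inj, Classical.not_imp]
  refine and_congr_right fun _ => ?_
  constructor <;> intro h <;> omega

theorem valid {P : Priorities n} (h : I.Input u s) (h0 : I.toCrossing.Apart)
    (hF : I.toCrossing.SolvesAll P F) {en ex : Fin n × Fin n → ℤ} {ar : Fin n → ℤ}
    (hen : Holds cell s 2 en) (hex : Holds cell s 3 ex) (har : Holds row s 4 ar)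
    (hc : I.Complete F en ex ar) : 0 < Term.valid.eval s ↔ I.toCrossing.Valid F := by
  have hI : ∀ i j : Fin n, I.Input u ((s.setReg 5 (i : ℕ)).setReg 6 (j : ℕ)) := fun i j =>
    (h.setReg (by decide) _).setReg (by decide) _
  have r5 : ∀ i j : Fin n, ((s.setReg 5 (i : ℕ)).setReg 6 (j : ℕ)).reg 5 = (i : ℕ) := by simp
  have r6 : ∀ i j : Fin n, ((s.setReg 5 (i : ℕ)).setReg 6 (j : ℕ)).reg 6 = (j : ℕ) := by simp
  have t1 : 0 < (Term.not (.any 5 (.not (.and (.le (.const 0) (.load 4 (.var 5)))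
      (.le (.load 4 (.var 5)) (.deadline 5)))))).eval s ↔
      ∀ i, 0 ≤ ar i ∧ ar i ≤ I.deadlineZ i := by
    rw [Term.pos_not, Term.pos_any h.count, not_exists]
    refine forall_congr' fun i => ?_
    have hIi : I.Input u (s.setReg 5 (i : ℕ)) := h.setReg (by decide) _
    have ri : (s.setReg 5 (i : ℕ)).reg 5 = (i : ℕ) := by simp
    have e : (Term.load 4 (.var 5)).eval (s.setReg 5 (i : ℕ)) = ar i := vector (c := 4) har ri
    rw [Term.pos_not, not_not, Term.pos_and, Term.pos_le, Term.pos_le, e, hIi.deadline ri]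
    rfl
  have t2 := h.forall_pair (e := .and (.opp 5 6) (.and (.le (.const 0) (.off 5 6))
    (.lt (.off 5 6) (.add (.dist 5) (.dist 6)))))
    (p := fun i j => I.toCrossing.Opp i j → 0 ≤ I.offZ i j →
      I.distZ i + I.distZ j ≤ I.offZ i j) fun i j => by
    simp only [Term.pos_and, Term.pos_le, Term.pos_lt, (hI i j).opp (r5 i j) (r6 i j),
      (hI i j).off (r5 i j) (r6 i j), Term.eval, (hI i j).dist (r5 i j), (hI i j).dist (r6 i j),
      opp_iff, Classical.not_imp, not_le]
  have t3 := h.forall_pair (e := .and (.cross 5 6) (.not (.or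
    (.and (.le (.const 0) (.load 3 (.idx 5 6))) (.le (.load 3 (.idx 5 6)) (.load 2 (.idx 6 5))))
    (.and (.le (.const 0) (.load 3 (.idx 6 5))) (.le (.load 3 (.idx 6 5)) (.load 2 (.idx 5 6)))))))
    (p := fun i j => I.toCrossing.Cross i j → (0 ≤ ex (i, j) ∧ ex (i, j) ≤ en (j, i)) ∨
      (0 ≤ ex (j, i) ∧ ex (j, i) ≤ en (i, j))) fun i j => by
    rw [Term.pos_and, Term.pos_not, Term.pos_or, Term.pos_and, Term.pos_and, Term.pos_le,
      Term.pos_le, Term.pos_le, Term.pos_le, (hI i j).cross (r5 i j) (r6 i j),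
      (hI i j).matrix (c := 3) hex (r5 i j) (r6 i j), (hI i j).matrix (c := 3) hex (r6 i j) (r5 i j),
      (hI i j).matrix (c := 2) hen (r5 i j) (r6 i j), (hI i j).matrix (c := 2) hen (r6 i j) (r5 i j),
      Classical.not_imp]
    rfl
  rw [Term.valid, Term.pos_and, Term.pos_and, t1, t2, t3, hF.valid_iff h0]
  -- Only vehicles that move can arrive.
  have harr : ∀ i, (0 ≤ ar i ∧ ar i ≤ I.deadlineZ i) ↔
      reachTime I.toCrossing F i ≤ ((I.toCrossing.vehicle i).deadline : EReal) := by
    intro i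
    rcases hc.arrive i with ⟨-, e⟩ | ⟨h1, e⟩ | ⟨hv, h1, e⟩
    · have := reachTime_nonneg hF i
      rw [e] at this
      exact absurd this (EReal.bot_lt_coe 0).not_ge
    · rw [h1, e]
      exact iff_of_false (by norm_num) (EReal.coe_lt_top _).not_ge
    · rw [e, deadline_eq hv, EReal.coe_le_coe_iff]
      exact (and_iff_right h1).trans (timeOf_le hv).symm
  have hopp : (∀ i j, I.toCrossing.Opp i j → 0 ≤ I.offZ i j → I.distZ i + I.distZ j ≤ I.offZ i j) ↔
      ∀ i j, I.toCrossing.Opp i j → 0 ≤ I.toCrossing.off i j →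
        I.toCrossing.dist i + I.toCrossing.dist j ≤ I.toCrossing.off i j := by
    refine forall_congr' fun i => forall_congr' fun j => imp_congr_right fun _ => ?_
    rw [← not_lt, ← off_neg_iff, not_lt, dist_eq, dist_eq, off_eq, add_fine, le_iff]
  rw [forall_congr' harr, hopp]
  refine and_congr_right fun hA => and_congr_right fun _ => forall_congr' fun i =>
    forall_congr' fun j => imp_congr_right fun hij => ?_
  have key : ∀ i j, I.toCrossing.Cross i j → ((0 ≤ ex (i, j) ∧ ex (i, j) ≤ en (j, i)) ↔
      leaveTime I.toCrossing F (i, j) ≤ enterTime I.toCrossing F (j, i)) := by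
    intro i j hij
    have h1 : enterTime I.toCrossing F (j, i) ≤ reachTime I.toCrossing F j :=
      firstTime_mono fun t ht => lt_of_lt_of_le hij.2.2.2.2 ht
    have h2 : enterTime I.toCrossing F (j, i) < ⊤ := (h1.trans (hA j)).trans_lt (EReal.coe_lt_top _)
    have h3 := leaveTime_nonneg hF (p := (i, j)) hij
    rcases hc.enter (j, i) hij.symm with ⟨a1, a2⟩ | ⟨a1, a2⟩ | ⟨hv, a1, a2⟩
    · rw [a1, a2]
      refine iff_of_false (by omega) fun hb => ?_
      rw [le_bot_iff.1 hb] at h3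
      exact absurd h3 (EReal.bot_lt_coe 0).not_ge
    · rw [a2] at h2
      exact absurd h2 (lt_irrefl _)
    · rcases hc.exit (i, j) hij with ⟨b1, b2⟩ | ⟨b1, b2⟩ | ⟨-, b1, b2⟩
      · rw [b2] at h3
        exact absurd h3 (EReal.bot_lt_coe 0).not_ge
      · rw [b1, b2, a2]
        exact iff_of_false (by norm_num) (EReal.coe_lt_top _).not_ge
      · rw [b2, a2, EReal.coe_le_coe_iff, timeOf_le hv]
        exact and_iff_right b1
  exact or_congr (key i j hij) (key j i hij.symm)

end Instance.Input

end Traffic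

namespace Traffic

/-! ### Repetition of steps -/

namespace Cmd

/-- Each execution of `p` costs at most `B` and advances the invariant by `c`. -/
def Advances (Inv : ℕ → State → Prop) (p : Cmd) (c B : ℕ) : Prop :=
  ∀ k s, Inv k s → p.Runs s B ∧ Inv (k + c) (p.exec s)

variable {Inv : ℕ → State → Prop} {p q : Cmd} {c d B B' : ℕ}

theorem Advances.seq (hp : Advances Inv p c B) (hq : Advances Inv q d B') :
    Advances Inv (p.seq q) (c + d) (B + B') := fun k s h => by
  obtain ⟨r1, h1⟩ := hp k s h
  obtain ⟨r2, h2⟩ := hq _ _ h1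
  exact ⟨r1.seq r2, by rw [← add_assoc]; exact h2⟩

theorem Advances.rep (hp : Advances Inv p c B) {N m : ℕ} (hm : 1 ≤ m) (hN : N < 2 ^ m)
    (h2 : ∀ k s, Inv k s → s.reg 2 = N) :
    Advances Inv (Cmd.rep p) (N * c) (N * (B + 16 * m) + 16 * m) := fun k s h => by
  have hc : s.count = N := by rw [State.count, h2 k s h, Int.toNat_natCast]
  have hI : ∀ j, Inv (k + j * c) (iter (fun _ => p.exec) j s) := by
    intro j
    induction j with
    | zero => simpa [iter] using h
    | succ j ih =>
      rw [add_mul, one_mul, ← add_assoc]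
      exact (hp _ _ ih).2
  refine ⟨?_, ?_⟩
  · have := runs_rep (p := p) (env := s) (B := B) hm (hc ▸ hN) (by rw [h2 k s h]; positivity)
      (fun j _ => by rw [h2 _ _ (hI j), h2 k s h]) fun j _ => (hp _ _ (hI j)).1
    rwa [hc] at this
  · rw [exec, hc]; exact hI N

/-- The command `p` twice. -/
def twice (p : Cmd) : Cmd := p.seq p

/-- The simulation: `8 * n ^ 2` steps. By `pending_le` these are more than there are events, unless
`n = 0`. -/
def simulate : Cmd := rep (rep (twice (twice (twice step))))

end Cmd

namespace Instance

variable {n : ℕ} {I : Instance n} {u : List ℤ} {s : State} {F : Profile n}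

/-- The time on the clock remains bounded during the simulation. -/
theorem Track.bound {τ : ℤ} {x : Fin n → ℤ} {en ex : Fin n × Fin n → ℤ} {ar : Fin n → ℤ} {M : ℤ}
    {m : ℕ} (hM0 : 0 ≤ M) (h : I.Track u F s τ x en ex ar)
    (hτ : τ + M * I.pending τ x ≤ M * (2 * n ^ 2 + 2 * n : ℕ)) (hm : M * (2 * n ^ 2 + 2 * n : ℕ) < 2 ^ m) :
    τ.natAbs < 2 ^ m := by
  have h1 := h.nonneg
  have h2 : 0 ≤ M * I.pending τ x := mul_nonneg hM0 (Int.natCast_nonneg _)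
  have h3 : (τ.natAbs : ℤ) < ((2 ^ m : ℕ) : ℤ) := by
    rw [Int.natAbs_of_nonneg h1]; push_cast; linarith
  exact_mod_cast h3

open Crossing in

/-- The simulation comes to an end, since each step makes the number of pending events smaller. -/
theorem exists_simulate : ∃ K : ℕ, ∀ {n : ℕ} {I : Instance n} {u : List ℤ} {F : Profile n} {s : State}
    {M : ℤ} {m : ℕ}, 0 < I.maxSpeed → I.toCrossing.Apart →
    I.toCrossing.SolvesAll (prioritiesOf n u) F →
    I.Track u F s 0 (fun _ => 0) I.enterStart (fun _ => -2) (fun _ => -2) → 1 ≤ m → n < 2 ^ m →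
    (∀ i, I.startZ i ≤ M) → (∀ i q, I.IsTargetZ i q → q ≤ M) → 0 ≤ M →
    M * (2 * n ^ 2 + 2 * n : ℕ) < 2 ^ m → (∀ i, (I.distZ i + 1).natAbs < 2 ^ m) → Bdd m s →
    Cmd.simulate.Runs s (K * (max n 1 ^ 4 * m)) ∧ Bdd m (Cmd.simulate.exec s) ∧
    ∃ τ x en ex ar, I.Conf u (Cmd.simulate.exec s) τ x en ex ar ∧ I.Complete F en ex ar := by
  obtain ⟨K, G, -, hK⟩ := Cmd.exists_runs ok_step
  refine ⟨8 * K + 64, fun {n I u F s M m} hv h0 hF hT hm hn hM hM' hM0 hMm hdist hb => ?_⟩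
  set N := 2 * n ^ 2 + 2 * n with hN
  let Inv : ℕ → State → Prop := fun k s => ∃ τ x en ex ar, I.Track u F s τ x en ex ar ∧
    τ + M * I.pending τ x ≤ M * N ∧ (I.Complete F en ex ar ∨ I.pending τ x + k ≤ N) ∧ Bdd m s
  have hcount : ∀ k s, Inv k s → s.reg 2 = n := by
    rintro k s ⟨_, _, _, _, _, h, -⟩
    exact h.count
  have h1 : Cmd.Advances Inv Cmd.step 1 (K * (max n 1 ^ 2 * m)) := by
    rintro k s ⟨τ, x, en, ex, ar, h, hτ, hc, hbs⟩
    obtain ⟨τ', x', en', ex', ar', h', hc', hp, hτ', hb'⟩ := h.step hv h0 hF hM hM' hM0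
    have hr := (hK m (max n 1) s hm hbs (by rw [h.count]; positivity)
      (by rw [State.count, h.count, Int.toNat_natCast]; exact le_max_left _ _) (le_max_right _ _)).1
    rw [depth_step] at hr
    refine ⟨hr, τ', x', en', ex', ar', h', hτ'.trans hτ, ?_,
      hb' m hm hbs (h'.bound hM0 (hτ'.trans hτ) hMm) hdist⟩
    rcases hc with hc | hc
    · exact Or.inl (hc' hc)
    · rcases hp with hp | hp
      · exact Or.inl hp
      · right; omega
  have h2 := h1.seq h1
  have h4 := h2.seq h2
  have h8 := h4.seq h4
  have hall := (h8.rep hm hn hcount).rep hm hn hcount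
  have hstart : Inv 0 s := by
    refine ⟨0, _, _, _, _, hT, ?_, Or.inr (I.pending_le _ _), hb⟩
    rw [zero_add]
    exact mul_le_mul_of_nonneg_left (Int.ofNat_le.2 (I.pending_le _ _)) hM0
  obtain ⟨hr, τ, x, en, ex, ar, h, -, hc, hb'⟩ := hall 0 s hstart
  refine ⟨hr.mono ?_, hb', τ, x, en, ex, ar, h.toConf, ?_⟩
  · have e1 : n ≤ max n 1 := le_max_left _ _
    have e2 : 1 ≤ max n 1 := le_max_right _ _
    generalize max n 1 = ν at e1 e2 ⊢
    have e4 : ν * m ≤ ν ^ 4 * m := Nat.mul_le_mul_right _ (Nat.le_self_pow (by norm_num) _)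
    have e5 : m ≤ ν ^ 4 * m := Nat.le_mul_of_pos_left _ (Nat.pow_pos e2)
    have e6 : ν ^ 2 * m ≤ ν ^ 4 * m :=
      Nat.mul_le_mul_right _ (Nat.pow_le_pow_right e2 (by norm_num))
    set B := K * (ν ^ 2 * m) with hB
    calc n * (n * (B + B + (B + B) + (B + B + (B + B)) + 16 * m) + 16 * m + 16 * m) + 16 * m
        ≤ ν * (ν * (8 * B + 16 * m) + 16 * m + 16 * m) + 16 * m := by
          refine Nat.add_le_add_right (Nat.mul_le_mul e1 (Nat.add_le_add_right
            (Nat.add_le_add_right (Nat.mul_le_mul e1 (by omega)) _) _)) _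
      _ = 8 * K * (ν ^ 4 * m) + 16 * (ν ^ 2 * m) + 32 * (ν * m) + 16 * m := by rw [hB]; ring
      _ ≤ (8 * K + 64) * (ν ^ 4 * m) := by
          rw [add_mul]
          omega
  · rcases hc with hc | hc
    · exact hc
    · rcases Nat.eq_zero_or_pos n with rfl | hn0
      · exact ⟨fun p => p.1.elim0, fun p => p.1.elim0, fun i => i.elim0⟩
      · exfalso
        have e1 : n ≤ n ^ 2 := Nat.le_self_pow (by norm_num) _
        have e2 : 0 + n * (n * (1 + 1 + (1 + 1) + (1 + 1 + (1 + 1)))) = 8 * n ^ 2 := by ring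
        rw [e2] at hc
        omega

end Instance

end Traffic

namespace Traffic

/-! ### Simulation of the full-speed profiles by a machine -/

open Crossing

/-- The full-speed profiles obey the full-speed policy for any speed limit, including 0. -/
theorem Crossing.IsFullSpeed.solvesAll {n : ℕ} {C : Crossing n} {P : Priorities n} {F : Profile n}
    (h : C.IsFullSpeed P F) : C.SolvesAll P F := by
  rcases C.maxSpeed_nonneg.eq_or_lt with hv | hv
  · obtain rfl := h.eq_zero hv.symm
    refine fun T => ⟨fun t _ i => ?_, fun _ _ => Or.inl rfl, fun _ _ _ => rfl,
      fun _ _ => Filter.Eventually.of_forall fun _ => rfl⟩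
    rw [speed, ← hv, ite_self]
    rfl
  · exact h.solves hv

variable {n : ℕ} {I : Instance n} {u : List ℤ} {s : State} {F : Profile n} {m : ℕ}

namespace Instance.Input

theorem natAbs_entry_lt (h : I.Input u s) (hb : Bdd m s) (k : ℕ) :
    (entry I.encode k).natAbs < 2 ^ m := by
  rw [← h.word]; exact hb.2 0 k

theorem natAbs_field_lt (h : I.Input u s) (hb : Bdd m s) (i : Fin n) {c : ℕ} (hc : c < 7) :
    ((I.fields i).getD c 0).natAbs < 2 ^ m := by
  rw [← I.entry_field i hc]; exact h.natAbs_entry_lt hb _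

/-- The sum of the displacements in both coordinates, weighted by a direction. -/
theorem natAbs_scaled_le {b d : ℕ} {p q x x' y y' : ℤ} (hd : d ≤ b) (hp : |p| ≤ 1) (hq : |q| ≤ 1)
    (hx : |x| ≤ b) (hx' : |x'| ≤ b) (hy : |y| ≤ b) (hy' : |y'| ≤ b) :
    |(d : ℤ) * (p * (x - x') + q * (y - y'))| ≤ 4 * (b : ℤ) ^ 2 := by
  have hb : (0 : ℤ) ≤ b := Int.natCast_nonneg _
  have h1 : |p * (x - x')| ≤ 1 * (2 * b) := by
    rw [abs_mul]
    exact mul_le_mul hp ((abs_sub _ _).trans (by linarith)) (abs_nonneg _) zero_le_one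
  have h2 : |q * (y - y')| ≤ 1 * (2 * b) := by
    rw [abs_mul]
    exact mul_le_mul hq ((abs_sub _ _).trans (by linarith)) (abs_nonneg _) zero_le_one
  have h3 : |p * (x - x') + q * (y - y')| ≤ 4 * b := (abs_add_le _ _).trans (by linarith)
  rw [abs_mul, Nat.abs_cast]
  calc (d : ℤ) * |p * (x - x') + q * (y - y')| ≤ b * (4 * b) :=
        mul_le_mul (Int.ofNat_le.2 hd) h3 (abs_nonneg _) hb
    _ = _ := by ring

/-- The numbers in the simulation, in terms of those in the input. -/
theorem bounds (h : I.Input u s) (hb : Bdd m s) :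
    (∀ i, I.startZ i ≤ 8 * (2 ^ m) ^ 2) ∧ (∀ i q, I.IsTargetZ i q → q ≤ 8 * (2 ^ m) ^ 2) ∧
      ∀ i, |I.distZ i| ≤ 4 * (2 ^ m) ^ 2 := by
  have hB : ((2 ^ m : ℕ) : ℤ) = 2 ^ m := by push_cast; rfl
  rw [← hB]
  generalize hbb : 2 ^ m = b
  have hd : I.den ≤ b := by
    rw [← hbb]
    exact (h.natAbs_entry_lt hb 1).le
  have hv : I.maxSpeed ≤ b := by
    rw [← hbb]
    exact (h.natAbs_entry_lt hb 2).le
  have hf : ∀ i {c : ℕ}, c < 7 → |(I.fields i).getD c 0| ≤ b := fun i c hc => by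
    have := h.natAbs_field_lt hb i hc
    rw [Int.abs_eq_natAbs, Int.ofNat_le, ← hbb]
    exact this.le
  have hx : ∀ i, |I.dx i| ≤ 1 ∧ |I.dy i| ≤ 1 := fun i => by
    rcases I.dx_dy i with ⟨h1, h2 | h2⟩ | ⟨h1, h2 | h2⟩ <;> simp [h1, h2]
  have h0 : (0 : ℤ) ≤ (b : ℤ) ^ 2 := by positivity
  have hdist : ∀ i, |I.distZ i| ≤ 4 * (b : ℤ) ^ 2 := fun i =>
    natAbs_scaled_le hd (hx i).1 (hx i).2 (hf i (c := 3) (by decide)) (hf i (c := 1) (by decide))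
      (hf i (c := 4) (by decide)) (hf i (c := 2) (by decide))
  have hoff : ∀ i j, |I.offZ i j| ≤ 4 * (b : ℤ) ^ 2 := fun i j =>
    natAbs_scaled_le hd (hx i).1 (hx i).2 (hf j (c := 1) (by decide)) (hf i (c := 1) (by decide))
      (hf j (c := 2) (by decide)) (hf i (c := 2) (by decide))
  have hlen : ∀ i, I.lenZ i ≤ (b : ℤ) ^ 2 := fun i => by
    rw [lenZ, sq]
    exact mul_le_mul (Int.ofNat_le.2 hd) ((le_abs_self _).trans (hf i (c := 0) (by decide)))
      (Int.natCast_nonneg _) (Int.natCast_nonneg _)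
  refine ⟨fun i => ?_, fun i q hq => ?_, hdist⟩
  · have : I.startZ i ≤ (b : ℤ) ^ 2 := by
      rw [startZ, sq]
      exact mul_le_mul ((le_abs_self _).trans (hf i (c := 5) (by decide))) (Int.ofNat_le.2 hv)
        (Int.natCast_nonneg _) (Int.natCast_nonneg _)
    linarith
  · rcases hq with rfl | ⟨j, -, rfl | rfl⟩
    · linarith [le_abs_self (I.distZ i), hdist i]
    · linarith [le_abs_self (I.offZ i j), hoff i j]
    · linarith [le_abs_self (I.offZ i j), hoff i j, hlen i]

end Instance.Input

namespace Cmd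

/-- The answer that the input is rejected. -/
def reject : Cmd := set 0 (.const 0)

/-- The simulation for an instance of the problem. -/
def solve : Cmd := ite .apart (prepare.seq ((ite .maxSpeed simulate (set 3 (.const 0))).seq
  (set 0 (.ite .valid (.const 1) (.const 0))))) reject

end Cmd

namespace Instance

theorem Conf.setReg {τ : ℤ} {x : Fin n → ℤ} {en ex : Fin n × Fin n → ℤ} {ar : Fin n → ℤ}
    (h : I.Conf u s τ x en ex ar) {k : ℕ} (h2 : 2 ≠ k) (h3 : 3 ≠ k) (z : ℤ) :
    I.Conf u (s.setReg k z) τ x en ex ar :=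
  ⟨h.toInput.setReg h2 z, by rw [State.setReg_reg, if_neg h3, h.time], h.queue, h.pos, h.enter,
    h.exit, h.arrive⟩

/-- When all events have been recorded, the memory contains the required output. -/
theorem Conf.reports {P : Priorities n} (hF : I.toCrossing.SolvesAll P F) {τ : ℤ} {x : Fin n → ℤ}
    {en ex : Fin n × Fin n → ℤ} {ar : Fin n → ℤ} (h : I.Conf u s τ x en ex ar)
    (hc : I.Complete F en ex ar) : Reports I F s := by
  refine ⟨fun i j χ hij => ?_, fun i => ?_⟩
  · have hX := ((I.toCrossing.crossAt_iff i j χ).1 hij).1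
    have h2 : s.bank 2 (i * n + j) = en (i, j) := h.enter (i, j)
    have h3 : s.bank 3 (i * n + j) = ex (i, j) := h.exit (i, j)
    rw [h2, h3, hij.entryTime_eq, hij.exitTime_eq]
    exact ⟨(hc.enter (i, j) hX).decodeTime, (hc.exit (i, j) hX).decodeTime⟩
  · have h4 : s.bank 4 i = ar i := h.arrive i
    rw [h4, hF.arrivalTime_eq]
    exact (hc.arrive i).decodeTime

/-- The numbers in the simulation have at most `9 * m` bits. -/
theorem pow_bounds (hm : 1 ≤ m) (hn : n < 2 ^ m) :
    8 * ((2 : ℤ) ^ m) ^ 2 * (2 * n ^ 2 + 2 * n : ℕ) < 2 ^ (9 * m) ∧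
      4 * ((2 : ℤ) ^ m) ^ 2 + 1 < 2 ^ (9 * m) := by
  have h2 : (2 : ℤ) ≤ 2 ^ m := le_self_pow₀ (by norm_num) (by omega)
  have hn' : (n : ℤ) + 1 ≤ 2 ^ m := by exact_mod_cast hn
  rw [mul_comm 9, pow_mul]
  generalize (2 : ℤ) ^ m = b at h2 hn' ⊢
  have h5 : (2 : ℤ) ^ 5 ≤ b ^ 5 := pow_le_pow_left₀ (by norm_num) h2 5
  have h4 : 0 < b ^ 4 := by positivity
  have h9 : b ^ 9 = b ^ 5 * b ^ 4 := by ring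
  have h6 : 32 * b ^ 4 ≤ b ^ 9 := by
    rw [h9]; exact mul_le_mul_of_nonneg_right (by linarith) h4.le
  have hn0 : (0 : ℤ) ≤ n := Int.natCast_nonneg _
  have h7 : (2 * (n : ℤ) ^ 2 + 2 * n) < 4 * b ^ 2 := by nlinarith
  have h8 : b ^ 4 = b ^ 2 * b ^ 2 := by ring
  have h10 : (2 : ℤ) ^ 2 ≤ b ^ 2 := pow_le_pow_left₀ (by norm_num) h2 2
  constructor
  · push_cast
    have := mul_lt_mul_of_pos_left h7 (show 0 < 8 * b ^ 2 by positivity)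
    nlinarith
  · nlinarith

/-- The costs of the parts of `Cmd.solve` add up to `O(ν ^ 4 * m)`; the simulation dominates. -/
theorem cost_solve {ν a d Ka Kp G Km Ks K3 Kv K0 m : ℕ} (hν : 1 ≤ ν) (ha : a ≤ Ka * ν ^ 2) :
    (a + 2 * d) * m + (Kp * (ν ^ 3 * m) + ((Km * (G * m) + Ks * (ν ^ 4 * (G * m)) +
      K3 * (ν ^ 0 * (G * m))) + Kv * (ν ^ 2 * (G * m)))) + K0 * (ν ^ 0 * m) ≤
    (Ka + 2 * d + Kp + G * (Km + Ks + K3 + Kv) + K0) * (ν ^ 4 * m) := by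
  have key : ∀ {K c : ℕ}, c ≤ 4 → K * ν ^ c ≤ K * ν ^ 4 := fun hc =>
    Nat.mul_le_mul_left _ (Nat.pow_le_pow_right hν hc)
  have h0 : ∀ K : ℕ, K ≤ K * ν ^ 4 := fun K => Nat.le_mul_of_pos_right _ (Nat.pow_pos hν)
  have h1 := ha.trans (key (c := 2) (by norm_num))
  have h2 := h0 (2 * d)
  have h3 := key (K := Kp) (c := 3) (by norm_num)
  have h4 := h0 (G * Km)
  have h5 := h0 (G * K3)
  have h6 := key (K := G * Kv) (c := 2) (by norm_num)
  have h7 := h0 K0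
  calc _ = (a + 2 * d + Kp * ν ^ 3 + (G * Km + G * Ks * ν ^ 4 + G * K3 + G * Kv * ν ^ 2) + K0) * m := by
        ring
    _ ≤ (Ka * ν ^ 4 + 2 * d * ν ^ 4 + Kp * ν ^ 4 + (G * Km * ν ^ 4 + G * Ks * ν ^ 4 + G * K3 * ν ^ 4 +
          G * Kv * ν ^ 4) + K0 * ν ^ 4) * m := by
        refine Nat.mul_le_mul_right _ ?_
        omega
    _ = _ := by ring

/-- The machine simulates the full-speed profiles and decides whether they are valid. -/
theorem exists_solve : ∃ K : ℕ, ∀ {n : ℕ} {I : Instance n} {u : List ℤ} {s : State} {m : ℕ},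
    I.Input u s → 1 ≤ m → Bdd m s → Cmd.solve.Runs s (K * (max n 1 ^ 4 * m)) ∧
    ∀ {F : Profile n}, I.toCrossing.IsFullSpeed (prioritiesOf n u) F →
      ((Cmd.solve.exec s).reg 0 = 1 ↔ I.toCrossing.Valid F) ∧
      (I.toCrossing.InitiallyDisjoint → Reports I F (Cmd.solve.exec s)) := by
  obtain ⟨Ka, hKa⟩ := Term.cost_le .apart
  obtain ⟨Kp, G, -, hKp⟩ := Cmd.exists_runs ok_prepare
  obtain ⟨Ks, hKs⟩ := exists_simulate
  obtain ⟨Kv, Gv, -, hKv⟩ :=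
    Cmd.exists_runs (p := .set 0 (.ite .valid (.const 1) (.const 0))) (by decide)
  obtain ⟨K3, G3, -, hK3⟩ := Cmd.exists_runs (p := .set 3 (.const 0)) (by decide)
  obtain ⟨K0, G0, -, hK0⟩ := Cmd.exists_runs (p := Cmd.reject) (by decide)
  set Km := Term.maxSpeed.cost 0 + 2 * Term.maxSpeed.deg with hKm
  refine ⟨Ka + 2 * Term.apart.deg + Kp + (G + 9) * (Km + Ks + K3 + Kv) + K0,
    fun {n I u s m} h hm hb => ?_⟩
  have hcnt : s.count = n := by rw [State.count, h.count, Int.toNat_natCast]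
  have hn : n < 2 ^ m := hcnt ▸ hb.count_lt
  have e1 : n ≤ max n 1 := le_max_left _ _
  have e2 : 1 ≤ max n 1 := le_max_right _ _
  have h2 : 0 ≤ s.reg 2 := by rw [h.count]; positivity
  obtain ⟨r1, b1⟩ := hKp m (max n 1) s hm hb h2 (hcnt ▸ e1) e2
  have c1 := prepare_spec h
  set s1 := Cmd.prepare.exec s with hs1
  set m1 := (G + 9) * m with hm1
  have hm1' : 1 ≤ m1 := Nat.mul_pos (by omega) hm
  have hb1 : Bdd m1 s1 := b1.mono (Nat.mul_le_mul_right _ (by omega))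
  have hn1 : n < 2 ^ m1 :=
    hn.trans_le (Nat.pow_le_pow_right (by norm_num) (Nat.le_mul_of_pos_left _ (by omega)))
  obtain ⟨F, hF, huniq⟩ := I.toCrossing.existsUnique_isFullSpeed (prioritiesOf n u)
  have hS := hF.solvesAll
  -- After the simulation, everything has been recorded.
  have mid : I.toCrossing.Apart → ((Cmd.ite .maxSpeed Cmd.simulate (.set 3 (.const 0))).Runs s1
      (Km * m1 + Ks * (max n 1 ^ 4 * m1) + K3 * (max n 1 ^ 0 * m1))) ∧
      Bdd m1 ((Cmd.ite .maxSpeed Cmd.simulate (.set 3 (.const 0))).exec s1) ∧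
      ∃ τ x en ex ar, I.Conf u ((Cmd.ite .maxSpeed Cmd.simulate (.set 3 (.const 0))).exec s1)
        τ x en ex ar ∧ I.Complete F en ex ar := by
    intro h0
    have hite := fun h1 h2 => Cmd.Runs.ite (c := .maxSpeed) (p := Cmd.simulate)
      (q := .set 3 (.const 0)) (B := Ks * (max n 1 ^ 4 * m1)) (B' := K3 * (max n 1 ^ 0 * m1))
      (by decide) hm1' hb1 h1 h2
    rw [c1.maxSpeed] at hite
    rw [Cmd.exec, c1.maxSpeed]
    by_cases hv : (0 : ℤ) < I.maxSpeed
    · rw [if_pos hv]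
      obtain ⟨t1, t2, t3⟩ := h.bounds hb
      obtain ⟨p1, p2⟩ := pow_bounds hm hn
      have hle : (2 : ℕ) ^ (9 * m) ≤ 2 ^ m1 :=
        Nat.pow_le_pow_right (by norm_num) (Nat.mul_le_mul_right _ (by omega))
      have hle' : (2 : ℤ) ^ (9 * m) ≤ 2 ^ m1 := by exact_mod_cast hle
      obtain ⟨q1, q2, q3⟩ := hKs (Int.natCast_pos.1 hv) h0 hS (c1.track hS) hm1' hn1 t1 t2
        (by positivity) (p1.trans_le hle') (fun i => by
          have h1 := t3 i
          have h2 : |I.distZ i + 1| < 2 ^ m1 :=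
            (abs_add_le _ _).trans_lt (by rw [abs_one]; linarith)
          rw [Int.abs_eq_natAbs] at h2
          exact_mod_cast h2) hb1
      exact ⟨hite (fun _ => q1) fun h => absurd hv h, q2, q3⟩
    -- For the speed limit 0, the records at time 0 are final.
    · rw [if_neg hv]
      obtain ⟨q1, q2⟩ := hK3 m1 (max n 1) s1 hm1' hb1 (by rw [c1.count]; positivity)
        (by rw [State.count, c1.count, Int.toNat_natCast]; exact e1) e2
      refine ⟨hite (fun h => absurd h hv) fun _ => q1, hb1.setReg 3 (by simp [Term.eval]), ?_⟩
      have hF0 : F = 0 := hF.eq_zero (by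
        have : I.maxSpeed = 0 := by omega
        simp [toCrossing, this])
      refine ⟨0, fun _ => 0, _, _, _, ?_, complete_zero hF0⟩
      have hs3 : (Cmd.set 3 (.const 0)).exec s1 = s1.setReg 3 0 := rfl
      rw [hs3]
      exact ⟨c1.toInput.setReg (by decide) _, by simp, c1.queue, c1.pos, c1.enter, c1.exit, c1.arrive⟩
  set s2 := (Cmd.ite .maxSpeed Cmd.simulate (.set 3 (.const 0))).exec s1 with hs2
  have hrej := (hK0 m (max n 1) s hm hb h2 (hcnt ▸ e1) e2).1
  have hite := fun h1 h2 => Cmd.Runs.ite (c := .apart) (q := Cmd.reject)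
    (p := Cmd.prepare.seq ((Cmd.ite .maxSpeed Cmd.simulate (.set 3 (.const 0))).seq
      (.set 0 (.ite .valid (.const 1) (.const 0)))))
    (B := Kp * (max n 1 ^ 3 * m) + ((Km * m1 + Ks * (max n 1 ^ 4 * m1) + K3 * (max n 1 ^ 0 * m1)) +
      Kv * (max n 1 ^ 2 * m1)))
    (B' := K0 * (max n 1 ^ 0 * m)) (by decide) hm hb h1 h2
  have hexec : Cmd.solve.exec s = if 0 < Term.apart.eval s then
      s2.setReg 0 ((Term.ite .valid (.const 1) (.const 0)).eval s2) else s.setReg 0 0 := rfl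
  rw [hexec]
  refine ⟨?_, fun {F'} hF' => ?_⟩
  · refine (hite (fun h0 => ?_) fun _ => hrej).mono ?_
    · rw [h.apart] at h0
      obtain ⟨q1, q2, τ, x, en, ex, ar, c2, -⟩ := mid h0
      have r3 := (hKv m1 (max n 1) s2 hm1' q2 (by rw [c2.count]; positivity)
        (by rw [State.count, c2.count, Int.toNat_natCast]; exact e1) e2).1
      rw [depth_prepare] at r1
      exact r1.seq (q1.seq r3)
    · rw [hcnt]
      exact cost_solve e2 (hKa n _ e1 e2)
  · obtain rfl := huniq F' hF'
    rcases Decidable.em (0 < Term.apart.eval s) with h0 | h0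
    · rw [if_pos h0]
      rw [h.apart] at h0
      obtain ⟨-, -, τ, x, en, ex, ar, c2, hc⟩ := mid h0
      refine ⟨?_, fun _ => (c2.setReg (by decide) (by decide) _).reports hS hc⟩
      rw [State.setReg_reg, if_pos rfl, ← c2.toInput.valid h0 hS c2.enter c2.exit c2.arrive hc,
        Term.eval]
      split_ifs with hval <;> simp [Term.eval, hval]
    · rw [if_neg h0]
      rw [h.apart] at h0
      refine ⟨iff_of_false (by simp) fun hV => h0 fun i j => clear_zero hV,
        fun hd => absurd (initiallyDisjoint_iff.1 hd) h0⟩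

end Instance
end Traffic

namespace Traffic

/-! ### Words that encode instances -/

/-- The numbers `f`, in the order of the encoding, are those of a vehicle. -/
structure ValidFields (f : ℕ → ℤ) : Prop where
  length_pos : 0 < f 0
  startTime_nonneg : 0 ≤ f 5
  start_ne_goal : ¬ (f 1 = f 3 ∧ f 2 = f 4)
  axis_parallel : f 1 = f 3 ∨ f 2 = f 4

/-- The word `w` has the length and the entries of an instance with `n` vehicles. -/
structure WellFormed (n : ℕ) (w : List ℤ) : Prop where
  count : entry w 0 = n
  length : w.length = 7 * n + 3
  den_pos : 0 < entry w 1
  maxSpeed_nonneg : 0 ≤ entry w 2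
  vehicle : ∀ i : Fin n, ValidFields fun c => entry w (3 + c + 7 * i)

variable {n : ℕ} {w u : List ℤ}

theorem Instance.wellFormed_encode (I : Instance n) : WellFormed n I.encode := by
  refine ⟨rfl, I.length_encode, Int.natCast_pos.2 I.den_pos, Int.natCast_nonneg _, fun i => ?_⟩
  refine ⟨?_, ?_, ?_, ?_⟩ <;> simp only [I.entry_field i, Nat.reduceLT]
  exacts [Int.natCast_pos.2 (I.vehicle i).length_pos, Int.natCast_nonneg _,
    (I.vehicle i).start_ne_goal, (I.vehicle i).axis_parallel]

/-- The instance that is encoded by a well-formed word. -/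
def WellFormed.toInstance (h : WellFormed n w) : Instance n where
  den := (entry w 1).toNat
  den_pos := by have := h.den_pos; omega
  maxSpeed := (entry w 2).toNat
  vehicle i :=
    { length := (entry w (3 + 0 + 7 * i)).toNat
      startX := entry w (3 + 1 + 7 * i)
      startY := entry w (3 + 2 + 7 * i)
      goalX := entry w (3 + 3 + 7 * i)
      goalY := entry w (3 + 4 + 7 * i)
      startTime := (entry w (3 + 5 + 7 * i)).toNat
      deadline := entry w (3 + 6 + 7 * i)
      length_pos := by have := (h.vehicle i).length_pos; omega
      start_ne_goal := (h.vehicle i).start_ne_goal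
      axis_parallel := (h.vehicle i).axis_parallel }

theorem WellFormed.encode_toInstance (h : WellFormed n w) : w = h.toInstance.encode := by
  have hlen : w.length = h.toInstance.encode.length := by rw [h.length, Instance.length_encode]
  have key : ∀ k < 7 * n + 3, entry w k = entry h.toInstance.encode k := by
    intro k hk
    rcases (by omega : k = 0 ∨ k = 1 ∨ k = 2 ∨ 3 ≤ k) with rfl | rfl | rfl | hk3
    · exact h.count
    · exact (Int.toNat_of_nonneg h.den_pos.le).symm
    · exact (Int.toNat_of_nonneg h.maxSpeed_nonneg).symm
    · obtain ⟨i, c, hc, rfl⟩ : ∃ (i : Fin n) (c : ℕ), c < 7 ∧ k = 3 + c + 7 * i :=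
        ⟨⟨(k - 3) / 7, by omega⟩, (k - 3) % 7, by omega, by simp only; omega⟩
      rw [h.toInstance.entry_field i hc]
      have h0 := Int.toNat_of_nonneg (h.vehicle i).length_pos.le
      have h5 := Int.toNat_of_nonneg (h.vehicle i).startTime_nonneg
      interval_cases c
      exacts [h0.symm, rfl, rfl, rfl, rfl, h5.symm, rfl]
  refine List.ext_getElem hlen fun k h1 h2 => ?_
  have := key k (h.length ▸ h1)
  rwa [entry, entry, List.getD_eq_getElem _ _ h1, List.getD_eq_getElem _ _ h2] at this

namespace Term

/-- The length of the word is that of an instance with as many vehicles as register 2 says. -/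
def lengthOk : Term :=
  and (le (const 0) (var 2)) (eq (var 0) (add (mul (const 7) (var 2)) (const 3)))

/-- The numbers of vehicle `a` are invalid. -/
def invalidFields (a : ℕ) : Term :=
  or (le (field 0 a) (const 0)) (or (lt (field 5 a) (const 0))
    (or (and (eq (field 1 a) (field 3 a)) (eq (field 2 a) (field 4 a)))
      (not (or (eq (field 1 a) (field 3 a)) (eq (field 2 a) (field 4 a))))))

/-- The entries of the word are those of an instance. -/
def valuesOk : Term :=
  and (lt (const 0) den) (and (le (const 0) maxSpeed) (not (any 5 (invalidFields 5))))

end Term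

/-- The verifier: it rejects words that do not encode an instance. -/
def Cmd.verify : Cmd :=
  (Cmd.set 2 (.load 0 (.const 0))).seq
    (.ite .lengthOk (.ite .valuesOk Cmd.solve Cmd.reject) Cmd.reject)

/-- The state of the verifier when it has read the number of vehicles. -/
def readState (w u : List ℤ) : State := (initState w u).setReg 2 (entry w 0)

theorem lengthOk_iff : 0 < Term.lengthOk.eval (readState w u) ↔
    ∃ n : ℕ, entry w 0 = n ∧ w.length = 7 * n + 3 := by
  have h0 : (readState w u).reg 0 = w.length := by simp [readState, initState]
  have h2 : (readState w u).reg 2 = entry w 0 := by simp [readState]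
  rw [Term.lengthOk, Term.pos_and, Term.pos_le, Term.pos_eq]
  simp only [Term.eval, h0, h2]
  constructor
  · rintro ⟨h3, h4⟩
    exact ⟨(entry w 0).toNat, by omega, by omega⟩
  · rintro ⟨n, h3, h4⟩
    omega

theorem readState_bank : (readState w u).bank 0 = entry w ∧ (readState w u).bank 1 = entry u :=
  ⟨rfl, rfl⟩

theorem valuesOk_iff (hc : entry w 0 = n) (hl : w.length = 7 * n + 3) :
    0 < Term.valuesOk.eval (readState w u) ↔ WellFormed n w := by
  have h2 : (readState w u).reg 2 = n := by simp [readState, hc]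
  have hf : ∀ (i : Fin n) (c : ℕ), (Term.field c 5).eval ((readState w u).setReg 5 (i : ℕ)) =
      entry w (3 + c + 7 * i) := fun i c => by
    simp only [Term.field, Term.eval, State.setReg_bank, readState_bank.1, State.setReg_reg,
      if_true]
    congr 1
  have hden : Term.den.eval (readState w u) = entry w 1 := rfl
  have hspeed : Term.maxSpeed.eval (readState w u) = entry w 2 := rfl
  have h0 : ∀ s, (Term.const 0).eval s = 0 := fun _ => rfl
  have hv : ∀ i : Fin n, ¬ 0 < (Term.invalidFields 5).eval ((readState w u).setReg 5 (i : ℕ)) ↔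
      ValidFields fun c => entry w (3 + c + 7 * i) := fun i => by
    simp only [Term.invalidFields, Term.pos_or, Term.pos_and, Term.pos_not, Term.pos_le,
      Term.pos_lt, Term.pos_eq, hf, h0]
    constructor
    · intro h
      exact ⟨by omega, by omega, by omega, by omega⟩
    · rintro ⟨a, b, c, d⟩
      omega
  rw [Term.valuesOk, Term.pos_and, Term.pos_and, Term.pos_lt, Term.pos_le, Term.pos_not,
    Term.pos_any h2, not_exists, hden, hspeed, h0]
  simp only [hv]
  exact ⟨fun h => ⟨hc, hl, h.1, h.2.1, h.2.2⟩, fun h => ⟨h.den_pos, h.maxSpeed_nonneg, h.vehicle⟩⟩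

theorem exec_verify_encode (I : Instance n) (u : List ℤ) :
    Cmd.verify.exec (initState I.encode u) = Cmd.solve.exec (readState I.encode u) := by
  have h := I.wellFormed_encode
  have h1 : 0 < Term.lengthOk.eval (readState I.encode u) := lengthOk_iff.2 ⟨n, h.count, h.length⟩
  have h2 : 0 < Term.valuesOk.eval (readState I.encode u) := (valuesOk_iff h.count h.length).2 h
  have hexec : Cmd.verify.exec (initState I.encode u) = if 0 < Term.lengthOk.eval (readState I.encode u)
      then if 0 < Term.valuesOk.eval (readState I.encode u) then Cmd.solve.exec (readState I.encode u)
        else (readState I.encode u).setReg 0 0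
      else (readState I.encode u).setReg 0 0 := rfl
  rw [hexec, if_pos h1, if_pos h2]

theorem exec_verify_of_ne (h : ∀ (n : ℕ) (I : Instance n), w ≠ I.encode) (u : List ℤ) :
    (Cmd.verify.exec (initState w u)).reg 0 = 0 := by
  have hexec : Cmd.verify.exec (initState w u) = if 0 < Term.lengthOk.eval (readState w u)
      then if 0 < Term.valuesOk.eval (readState w u) then Cmd.solve.exec (readState w u)
        else (readState w u).setReg 0 0
      else (readState w u).setReg 0 0 := rfl
  rw [hexec]
  split_ifs with h1 h2
  · obtain ⟨n, hc, hl⟩ := lengthOk_iff.1 h1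
    exact absurd ((valuesOk_iff hc hl).1 h2).encode_toInstance (h n _)
  all_goals simp

theorem Instance.input_readState (I : Instance n) (u : List ℤ) : I.Input u (readState I.encode u) :=
  ⟨rfl, rfl, by simp [readState, entry, Instance.encode]⟩

/-- The cost of the verifier, if there cannot be more than `ν` vehicles. -/
theorem exists_verify : ∃ K : ℕ, ∀ {w u : List ℤ} {m ν : ℕ}, 1 ≤ m → 1 ≤ ν →
    Bdd m (initState w u) → (∀ n, w.length = 7 * n + 3 → n ≤ ν) →
    Cmd.verify.Runs (initState w u) (K * (ν ^ 4 * m)) := by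
  obtain ⟨K, hK⟩ := Instance.exists_solve
  obtain ⟨Kv, hKv⟩ := Term.cost_le .valuesOk
  set c0 := (Term.load 0 (.const 0)).cost 0 + 2 * (Term.load 0 (.const 0)).deg + 2
  set c1 := Term.lengthOk.cost 0 + 2 * Term.lengthOk.deg
  set c2 := (Term.const 0).cost 0 + 2 * (Term.const 0).deg + 2
  set dv := 2 * Term.valuesOk.deg with hdv
  refine ⟨c0 + c1 + Kv + dv + K + 2 * c2, fun {w u m ν} hm hν hb hle => ?_⟩
  have r0 : (Cmd.set 2 (.load 0 (.const 0))).Runs (initState w u) (c0 * m) :=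
    Cmd.runs_set (by decide) (by decide) hm hb
  have hex : (Cmd.set 2 (.load 0 (.const 0))).exec (initState w u) = readState w u := rfl
  have hb1 : Bdd m (readState w u) := hb.setReg 2 (hb.2 0 0)
  have rrej : Cmd.reject.Runs (readState w u) (c2 * m) :=
    Cmd.runs_set (by decide) (by decide) hm hb1
  have hsum : c0 * m + (c1 * m + ((Kv * ν ^ 4 + dv) * m + K * (ν ^ 4 * m) + c2 * m)
      + c2 * m) ≤ (c0 + c1 + Kv + dv + K + 2 * c2) * (ν ^ 4 * m) := by
    have h1 : m ≤ ν ^ 4 * m := Nat.le_mul_of_pos_left _ (Nat.pow_pos hν)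
    have h2 := fun c : ℕ => Nat.mul_le_mul_left c h1
    have h3 := h2 c0
    have h4 := h2 c1
    have h5 := h2 c2
    have h6 := h2 dv
    calc _ = c0 * m + c1 * m + Kv * (ν ^ 4 * m) + dv * m + K * (ν ^ 4 * m) + 2 * (c2 * m) := by ring
      _ ≤ c0 * (ν ^ 4 * m) + c1 * (ν ^ 4 * m) + Kv * (ν ^ 4 * m) + dv * (ν ^ 4 * m) +
          K * (ν ^ 4 * m) + 2 * (c2 * (ν ^ 4 * m)) := by omega
      _ = _ := by ring
  refine Cmd.Runs.mono (r0.seq ?_) hsum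
  rw [hex]
  refine Cmd.Runs.ite (c := .lengthOk) (by decide) hm hb1 (fun h1 => ?_) fun _ => rrej
  obtain ⟨n, hc, hl⟩ := lengthOk_iff.1 h1
  have hn := hle n hl
  have hcount : (readState w u).count = n := by simp [State.count, readState, hc]
  refine (Cmd.Runs.ite (c := .valuesOk) (B := K * (ν ^ 4 * m)) (by decide) hm hb1 (fun h2 => ?_)
    fun _ => rrej).mono ?_
  · have hw := (valuesOk_iff hc hl).1 h2
    have hI := hw.toInstance.input_readState u
    rw [← hw.encode_toInstance] at hI
    refine (hK hI hm hb1).1.mono ?_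
    exact Nat.mul_le_mul_left _ (Nat.mul_le_mul_right _ (Nat.pow_le_pow_left (max_le hn hν) 4))
  · rw [hcount]
    refine Nat.add_le_add_right (Nat.add_le_add_right (Nat.mul_le_mul_right _
      (Nat.add_le_add_right ((hKv n ν hn hν).trans ?_) _)) _) _
    exact Nat.mul_le_mul_left _ (Nat.pow_le_pow_right hν (by decide))

end Traffic

namespace Traffic

/-! ### The verifier as a program -/

/-- The machine is deterministic, so that acceptance, which asks for some accepting run, can be
refuted by one run that does not accept. -/
theorem Prog.Run.deterministic {p : Prog} {s s₁ s₂ : State} {c₁ c₂ : ℕ} (h₁ : p.Run s s₁ c₁)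
    (h₂ : p.Run s s₂ c₂) : s₁ = s₂ := by
  induction h₁ generalizing s₂ c₂ with
  | const | add | sub | mul | load | store => cases h₂; rfl
  | seq _ _ ih ih' =>
    cases h₂ with
    | seq h h' =>
      obtain rfl := ih h
      exact ih' h'
  | branch_pos hx _ ih =>
    cases h₂ with
    | branch_pos _ h => exact ih h
    | branch_neg hx' _ => exact absurd hx hx'
  | branch_neg hx _ ih =>
    cases h₂ with
    | branch_pos hx' _ => exact absurd hx' hx
    | branch_neg _ h => exact ih h
  | loop_done hx =>
    cases h₂ with
    | loop_done _ => rfl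
    | loop_step hx' _ _ => exact absurd hx' hx
  | loop_step hx _ _ ih ih' =>
    cases h₂ with
    | loop_done hx' => exact absurd hx hx'
    | loop_step _ h h' =>
      obtain rfl := ih h
      exact ih' h'

/-- The code of the verifier. -/
def verifier : Prog := Cmd.verify.code numVars

/-- The program for a command. -/
theorem Cmd.Runs.run {p : Cmd} {env : State} {B : ℕ} (h : p.Runs env B) :
    ∃ s c, (p.code numVars).Run env s c ∧ c ≤ B ∧ s.reg 0 = (p.exec env).reg 0 ∧
      s.bank = (p.exec env).bank := by
  obtain ⟨s, c, hr, hs, -, hc⟩ := h numVars env le_rfl (Sim.refl env)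
  exact ⟨s, c, hr, hc, hs.1 0 (by decide), hs.2⟩

variable {n m : ℕ} {w u : List ℤ}

theorem bdd_initState (hw : ∀ z ∈ w, z.natAbs < 2 ^ m) (hu : ∀ z ∈ u, z.natAbs < 2 ^ m)
    (hwl : w.length < 2 ^ m) (hul : u.length < 2 ^ m) : Bdd m (initState w u) := by
  have hget : ∀ l : List ℤ, (∀ z ∈ l, z.natAbs < 2 ^ m) → ∀ k, (l.getD k 0).natAbs < 2 ^ m := by
    intro l hl k
    rcases lt_or_ge k l.length with hk | hk
    · rw [List.getD_eq_getElem _ _ hk]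
      exact hl _ (List.getElem_mem hk)
    · rw [List.getD_eq_default _ _ hk]
      simp
  refine ⟨fun x _ => ?_, fun a k => ?_⟩
  · simp only [initState]
    split_ifs
    exacts [by simpa using hwl, by simpa using hul, by simp]
  · simp only [initState]
    split_ifs
    exacts [hget w hw k, hget u hu k, by simp]

/-- The numbers in an encoded instance and in the memory of the machine at the beginning. -/
theorem Instance.bdd_initState {I : Instance n} {b : ℕ} (hI : I.HasBits b) (P : Priorities n) :
    Bdd (b + 2 * Nat.log 2 n + 5) (initState I.encode P.encode) := by
  have hn : n < 2 ^ (Nat.log 2 n + 1) := Nat.lt_pow_succ_log_self (by norm_num) n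
  generalize Nat.log 2 n = l at hn
  have mono : ∀ {a : ℕ}, a ≤ b + 2 * l + 5 → 2 ^ a ≤ 2 ^ (b + 2 * l + 5) := fun h =>
    Nat.pow_le_pow_right (by norm_num) h
  refine Traffic.bdd_initState (fun z hz => ?_) (fun z hz => ?_) ?_ ?_
  · rcases List.mem_cons.1 hz with rfl | hz
    · rw [Int.natAbs_natCast]
      exact hn.trans_le (mono (by omega))
    · exact (hI z hz).trans_le (mono (by omega))
  · have h1 : 2 ^ 1 ≤ 2 ^ (b + 2 * l + 5) := mono (by omega)
    rcases P.eq_of_mem_encode hz with rfl | rfl <;> simp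
  · rw [I.length_encode]
    refine lt_of_lt_of_le ?_ (mono (a := l + 1 + 4) (by omega))
    rw [pow_add]
    omega
  · rw [P.length_encode]
    refine lt_of_lt_of_le ?_ (mono (a := (l + 1) * 2) (by omega))
    rw [pow_mul]
    exact Nat.pow_lt_pow_left hn (by norm_num)

/-- The machine simulates the full-speed profiles in time `O(n^4 (b + log n))`. -/
theorem exists_simulation : ∃ K : ℕ, ∀ (n b : ℕ) (I : Instance n) (P : Priorities n) (F : Profile n),
    1 ≤ n → I.HasBits b → I.toCrossing.IsFullSpeed P F →
      ∃ (s : State) (c : ℕ), verifier.Run (initState I.encode P.encode) s c ∧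
        c ≤ K * (n ^ 4 * (b + Nat.log 2 n)) ∧ (s.reg 0 = 1 ↔ I.toCrossing.Valid F) ∧
        (I.toCrossing.InitiallyDisjoint → Reports I F s) := by
  obtain ⟨K, hK⟩ := exists_verify
  obtain ⟨_, hsolve⟩ := Instance.exists_solve
  refine ⟨K * 6, fun n b I P F hn hI hF => ?_⟩
  -- As the denominator is positive, the instance has at least one bit. This absorbs the additive
  -- constant in the number of bits.
  have hb : 1 ≤ b := by
    have h1 : I.den < 2 ^ b := hI I.den List.mem_cons_self
    have h2 := I.den_pos
    by_contra h
    obtain rfl : b = 0 := by omega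
    omega
  have hB := Instance.bdd_initState hI P
  obtain ⟨s, c, hr, hc, h0, hbank⟩ := (hK (ν := n) (by omega) hn hB fun k hk => by
    rw [I.length_encode] at hk; omega).run
  rw [exec_verify_encode] at h0 hbank
  have hin := I.input_readState P.encode
  obtain ⟨hv, hrep⟩ := (hsolve hin (m := b + 2 * Nat.log 2 n + 5) (by omega)
    (hB.setReg 2 (hB.2 0 0))).2 (by rwa [prioritiesOf_encode])
  refine ⟨s, c, hr, hc.trans ?_, by rw [h0]; exact hv, fun hd => ?_⟩
  · rw [mul_assoc, mul_left_comm 6]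
    exact Nat.mul_le_mul_left _ (Nat.mul_le_mul_left _ (by omega))
  · have := hrep hd
    simp only [Reports] at this ⊢
    rwa [hbank]

theorem natAbs_lt_wordSize {z : ℤ} (hz : z ∈ w) : z.natAbs < 2 ^ wordSize w := by
  have h1 : bitLen z ≤ wordSize w := List.single_le_sum (by simp) _ (List.mem_map_of_mem hz)
  exact (Nat.lt_size_self _).trans_le (Nat.pow_le_pow_right (by norm_num) (by rw [bitLen] at h1; omega))

theorem length_le_wordSize (w : List ℤ) : w.length ≤ wordSize w := by
  induction w with
  | nil => simp [wordSize]
  | cons a l ih =>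
    have := bitLen_pos a
    simp only [wordSize, List.map_cons, List.sum_cons, List.length_cons] at ih ⊢
    omega

theorem bdd_initState_wordSize (w u : List ℤ) :
    Bdd (wordSize w + wordSize u + 1) (initState w u) := by
  have mono : ∀ {a : ℕ}, a ≤ wordSize w + wordSize u → 2 ^ a ≤ 2 ^ (wordSize w + wordSize u + 1) :=
    fun h => Nat.pow_le_pow_right (by norm_num) (by omega)
  have hlt : ∀ l : List ℤ, l.length < 2 ^ wordSize l := fun l =>
    (length_le_wordSize l).trans_lt Nat.lt_two_pow_self
  exact bdd_initState (fun z hz => (natAbs_lt_wordSize hz).trans_le (mono (by omega)))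
    (fun z hz => (natAbs_lt_wordSize hz).trans_le (mono (by omega)))
    ((hlt w).trans_le (mono (by omega))) ((hlt u).trans_le (mono (by omega)))

/-- The verifier always halts at polynomial cost. -/
theorem exists_verifier_run : ∃ K : ℕ, ∀ w u : List ℤ, ∃ s c, verifier.Run (initState w u) s c ∧
    c ≤ K * (wordSize w + wordSize u + 1) ^ 5 ∧
    s.reg 0 = (Cmd.verify.exec (initState w u)).reg 0 := by
  obtain ⟨K, hK⟩ := exists_verify
  refine ⟨K, fun w u => ?_⟩
  have hl := length_le_wordSize w
  obtain ⟨s, c, hr, hc, h0, -⟩ := (hK (ν := wordSize w + wordSize u + 1) (Nat.le_add_left _ _)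
    (Nat.le_add_left _ _) (bdd_initState_wordSize w u) fun n hn => by omega).run
  exact ⟨s, c, hr, hc.trans_eq (by ring), h0⟩

/-- The certificates that the verifier accepts. -/
theorem accepts_iff : Accepts verifier w u ↔ ∃ (n : ℕ) (I : Instance n), w = I.encode ∧
    ∃ F, I.toCrossing.IsFullSpeed (prioritiesOf n u) F ∧ I.toCrossing.Valid F := by
  obtain ⟨K, hK⟩ := exists_verifier_run
  obtain ⟨_, hsolve⟩ := Instance.exists_solve
  obtain ⟨s, c, hr, -, h0⟩ := hK w u
  have hacc : Accepts verifier w u ↔ s.reg 0 = 1 := by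
    constructor
    · rintro ⟨s', c', hr', h1⟩
      rwa [hr.deterministic hr']
    · exact fun h => ⟨s, c, hr, h⟩
  rw [hacc, h0]
  have main : ∀ {n : ℕ} {I : Instance n} {F : Profile n},
      I.toCrossing.IsFullSpeed (prioritiesOf n u) F →
      ((Cmd.verify.exec (initState I.encode u)).reg 0 = 1 ↔ I.toCrossing.Valid F) := by
    intro n I F hF
    rw [exec_verify_encode]
    have hB := bdd_initState_wordSize I.encode u
    exact ((hsolve (I.input_readState u) (Nat.le_add_left _ _) (hB.setReg 2 (hB.2 0 0))).2 hF).1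
  constructor
  · intro h
    by_cases hw : ∃ (n : ℕ) (I : Instance n), w = I.encode
    · obtain ⟨n, I, rfl⟩ := hw
      obtain ⟨F, hF, -⟩ := I.toCrossing.existsUnique_isFullSpeed (prioritiesOf n u)
      exact ⟨n, I, rfl, F, hF, (main hF).1 h⟩
    · push Not at hw
      rw [exec_verify_of_ne hw] at h
      exact absurd h zero_ne_one
  · rintro ⟨n, I, rfl, F, hF, hV⟩
    exact (main hF).2 hV

/-- Solvable instances are those for which the full-speed profiles for some certificate are valid,
which the verifier checks. -/
theorem inNP_trafficCrossingProblem : InNP TrafficCrossingProblem := by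
  obtain ⟨K, hK⟩ := exists_verifier_run
  refine ⟨verifier, .C K * (.X + 1) ^ 5, 2 * .X ^ 2, fun w u => ?_, fun w => ?_⟩
  · obtain ⟨s, c, hr, hc, -⟩ := hK w u
    exact ⟨s, c, hr, by simpa using hc⟩
  · simp only [accepts_iff]
    constructor
    -- The length of the word bounds the number of vehicles, and thus the size of certificates.
    · rintro ⟨n, I, rfl, hI⟩
      obtain ⟨P, F, hF, hV⟩ := I.toCrossing.solvable_iff.1 hI
      refine ⟨P.encode, ?_, n, I, rfl, F, by rwa [prioritiesOf_encode], hV⟩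
      have h1 : n ≤ wordSize I.encode := by
        have := length_le_wordSize I.encode
        rw [I.length_encode] at this
        omega
      have h2 := (wordSize_encode_le n P).trans
        (Nat.mul_le_mul_left 2 (Nat.pow_le_pow_left h1 2))
      simpa using h2
    · rintro ⟨u, -, n, I, rfl, F, hF, hV⟩
      exact ⟨n, I, rfl, F, hV⟩

end Traffic

end

theorem mainTheorem2 :
    -- the full-speed profiles are well defined
    (∀ (n : ℕ) (C : Traffic.Crossing n) (P : Traffic.Priorities n), ∃! F, C.IsFullSpeed P F) ∧
    -- if there is a valid set of profiles, then the full-speed profiles for its priorities are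
    -- valid, and none of their events is later
    (∀ (n : ℕ) (C : Traffic.Crossing n) (D : Traffic.Profile n), C.Valid D →
      (∃ P : Traffic.Priorities n, C.Agrees P D) ∧
      ∀ (P : Traffic.Priorities n) (F : Traffic.Profile n),
        C.Agrees P D → C.IsFullSpeed P F →
          C.Valid F ∧
          (∀ i j χ, C.CrossAt i j χ →
            C.entryTime F i χ ≤ C.entryTime D i χ ∧ C.exitTime F i χ ≤ C.exitTime D i χ) ∧
          ∀ i, C.arrivalTime F i ≤ C.arrivalTime D i) ∧
    -- hence the priorities are a certificate, and its size is quadratic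
    (∀ (n : ℕ) (C : Traffic.Crossing n),
      C.Solvable ↔ ∃ (P : Traffic.Priorities n) (F : Traffic.Profile n),
        C.IsFullSpeed P F ∧ C.Valid F) ∧
    (∃ K : ℕ, ∀ (n : ℕ) (P : Traffic.Priorities n), Traffic.wordSize P.encode ≤ K * n ^ 2) ∧
    -- simulation of the full-speed profiles
    (∃ (V : Traffic.Prog) (K : ℕ),
      ∀ (n b : ℕ) (I : Traffic.Instance n) (P : Traffic.Priorities n) (F : Traffic.Profile n),
        1 ≤ n → I.HasBits b → I.toCrossing.IsFullSpeed P F →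
          ∃ (s : Traffic.State) (c : ℕ),
            V.Run (Traffic.initState I.encode P.encode) s c ∧
            c ≤ K * (n ^ 4 * (b + Nat.log 2 n)) ∧
            (s.reg 0 = 1 ↔ I.toCrossing.Valid F) ∧
            (I.toCrossing.InitiallyDisjoint → Traffic.Reports I F s)) ∧
    -- the problem is in NP
    Traffic.InNP Traffic.TrafficCrossingProblem := by
  exact ⟨fun n => Traffic.Crossing.existsUnique_isFullSpeed,
    fun n C D hD => ⟨hD.exists_agrees, fun P F hA hF => hD.full_speed hA hF⟩,
    fun n => Traffic.Crossing.solvable_iff, ⟨2, Traffic.wordSize_encode_le⟩,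
    ⟨Traffic.verifier, Traffic.exists_simulation⟩, Traffic.inNP_trafficCrossingProblem⟩
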